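/- Let $P$ be a simple polygon in the plane with $n\ge 3$ vertices $p_1,\dots,p_n$ in cyclic order. Vertices with a straight angle are allowed; $P$ need not have a vertex that sees all others. Write $p\leftrightarrow q$ if $pq$ is a boundary edge or a diagonal of $P$ (that is, the open segment lies in the interior of $P$). A triangulation $T$ of $P$ is the graph on the vertices formed by all boundary edges and a maximal set of pairwise non-crossing diagonals. Let $d_T$ be the link distance in $T$ (number of edges of a shortest path), $\mathcal W(T)=\sum_{x<y}d_T(p_x,p_y)$ ($\binom n2$ times the average distance), and for $\alpha\in\mathbb N$ let $\mathcal W_{\mathrm{EXT}}(T,\alpha)=\mathcal W(T)+\alpha\sum_{x}d_T(p_x,p_n)$. The special vertices $p_a,p_c,p_e,p_g$ of $T$ are the following, where $p_1p_dp_n$ is the triangle of $T$ on the edge $p_1p_n$. On the way from $p_1$ to $p_d$, $p_a$ is the last vertex strictly closer to $p_1$ than to $p_d$, and $p_c$ is the first one strictly closer to $p_d$ than to $p_1$. On the way from $p_d$ to $p_n$, $p_e$ is the last vertex strictly closer to $p_d$ than to $p_n$, and $p_g$ is the first one strictly closer to $p_n$ than to $p_d$. For $i<j$, procedure $\mathrm{EXT}((p_i,\dots,p_j),a,c,e,g,\alpha)$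 returns $1+\alpha$ if $j=i+1$; it returns $3+2\alpha$ if $a=i$, $c=e=i+1$ and $g=j=i+2$; otherwise it returns the minimum (with $\min\emptyset=+\infty$) of $$\mathrm{EXT}((p_i,\dots,p_d),a',a+1,c-1,g',\alpha+j-d)+\mathrm{EXT}((p_d,\dots,p_j),a'',e+1,g-1,g'',\alpha+d-i)+(\alpha+j-g+1)(d-a-1)+(e-d+1)(i-d)$$ over all $d,a',g',a'',g''$ such that the following three conditions hold: $i<d<j$ and $p_i\leftrightarrow p_d\leftrightarrow p_j$; $i\le a'\le a+1\le c-1\le g'\le d$ (if $d=i+1$, instead: $a=i$ and $c=d$); $d\le a''\le e+1\le g-1\le g''\le j$ (if $j=d+1$, instead: $e=d$ and $g=j$). **Theorem.** (1) Correctness. For all $\alpha\in\mathbb N$ and all indices $a,c,e,g$, $\mathrm{EXT}((p_1,\dots,p_n),a,c,e,g,\alpha)$ is the minimum of $\mathcal W_{\mathrm{EXT}}(T,\alpha)$ over all triangulations $T$ of $P$ with special vertices $p_a,p_c,p_e,p_g$ ($+\infty$ if there are none). The minimum of these values over all $a,c,e,g$ is finite and is the minimum of $\mathcal W_{\mathrm{EXT}}(T,\alpha)$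 over all triangulations $T$ of $P$; for $\alpha=0$ it is the minimum of $\mathcal W(T)$. (2) Running time. EXT can be carried out in $O(n^{11})$ time, including the output of an optimal triangulation: there is a real-RAM program (unit-cost arithmetic and comparisons on reals and on integers of $O(\log n)$ bits, indirect addressing, no division or rounding) that, given $n$ and the coordinates of the vertices of any simple polygon $P$, halts after $O(n^{11})$ steps and outputs the table of the values of $\mathrm{EXT}((p_i,\dots,p_j),a,c,e,g,\,n-(j-i+1))$ for all $i<j$ and all $a,c,e,g$, a triangulation $T$ of $P$ that minimizes $\mathcal W$ (hence the average link distance), and its cost $\mathcal W(T)$, which equals $\min_{a,c,e,g}\mathrm{EXT}((p_1,\dots,p_n),a,c,e,g,0)$. -/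

import Mathlib

/-! ### Simple polygons and their triangulations -/

section Polygons

variable {n : ℕ} [NeZero n]

/-- The `k`-th boundary edge of the closed polygonal chain `p 0, p 1, …, p (n-1), p 0`
(addition in `Fin n` is cyclic). -/
def polygonEdge (p : Fin n → ℝ × ℝ) (k : Fin n) : Set (ℝ × ℝ) :=
  segment ℝ (p k) (p (k + 1))

/-- The vertices are distinct, consecutive edges meet only in their common vertex, and any two other
edges are disjoint. Vertices with a straight angle are allowed, and so are both orientations. -/
structure IsSimplePolygon (p : Fin n → ℝ × ℝ) : Prop where
  three_le : 3 ≤ n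
  injective : Function.Injective p
  consecutive : ∀ k, polygonEdge p k ∩ polygonEdge p (k + 1) = {p (k + 1)}
  disjoint : ∀ k l, k ≠ l → l ≠ k + 1 → k ≠ l + 1 → Disjoint (polygonEdge p k) (polygonEdge p l)

def polygonBoundary (p : Fin n → ℝ × ℝ) : Set (ℝ × ℝ) := ⋃ k, polygonEdge p k

/-- The horizontal ray from `q` to the right crosses the `k`-th edge. Exactly one endpoint of the edge
has to lie strictly above the ray, so a vertex on the ray counts for the edges on one side only. -/
def RayCrosses (p : Fin n → ℝ × ℝ) (q : ℝ × ℝ) (k : Fin n) : Prop :=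
  Xor (q.2 < (p k).2) (q.2 < (p (k + 1)).2) ∧ ∃ x, q.1 < x ∧ (x, q.2) ∈ polygonEdge p k

/-- The open region bounded by the polygon, by the even-odd rule. -/
def polygonInterior (p : Fin n → ℝ × ℝ) : Set (ℝ × ℝ) :=
  {q | q ∉ polygonBoundary p ∧ Odd {k | RayCrosses p q k}.ncard}

def IsBoundaryEdge (k l : Fin n) : Prop := l = k + 1 ∨ k = l + 1

/-- The open segment between the two vertices lies in the interior of the polygon. As the interior
does not contain boundary points, the vertices are then distinct and not neighbours. -/
def IsDiagonal (p : Fin n → ℝ × ℝ) (k l : Fin n) : Prop :=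
  openSegment ℝ (p k) (p l) ⊆ polygonInterior p

/-- The segments `p k p l` and `p k' p l'` have no common point apart from endpoints. -/
def NonCrossing (p : Fin n → ℝ × ℝ) (k l k' l' : Fin n) : Prop :=
  Disjoint (openSegment ℝ (p k) (p l)) (openSegment ℝ (p k') (p l'))

/-- A triangulation of the interior of the polygon, as a graph on its vertices: all boundary edges and
a maximal set of pairwise non-crossing diagonals. -/
structure IsTriangulation (p : Fin n → ℝ × ℝ) (T : SimpleGraph (Fin n)) : Prop where
  boundary : ∀ k, T.Adj k (k + 1)
  inside : ∀ k l, T.Adj k l → IsBoundaryEdge k l ∨ IsDiagonal p k l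
  nonCrossing : ∀ k l k' l', T.Adj k l → T.Adj k' l' → s(k, l) ≠ s(k', l') →
    NonCrossing p k l k' l'
  maximal : ∀ k l, IsDiagonal p k l →
    (∀ k' l', T.Adj k' l' → s(k, l) ≠ s(k', l') → NonCrossing p k l k' l') → T.Adj k l

/-- The sum of the link distances over all unordered pairs of vertices. -/
noncomputable def totalDist (T : SimpleGraph (Fin n)) : ℕ :=
  ∑ x, ∑ y ∈ Finset.Ioi x, T.dist x y

/-- The extended cost: `α` times the distances to the last vertex are added. -/
noncomputable def extCost (T : SimpleGraph (Fin n)) (α : ℕ) : ℕ :=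
  totalDist T + α * ∑ x, T.dist x ⊤

/-- `a, c, e, g` are the special vertices of `T`: with `d` the third vertex of the triangle on the
edge between the first vertex `0` and the last vertex `⊤`, on the way from `0` to `d` the last vertex
that is closer to `0` than to `d` is `a`, and the first one that is closer to `d` than to `0` is `c`;
`e` and `g` are defined in the same way between `d` and `⊤`. -/
def HasSpecialVertices (T : SimpleGraph (Fin n)) (a c e g : Fin n) : Prop :=
  ∃ d : Fin n, 0 < d ∧ d < ⊤ ∧ T.Adj 0 d ∧ T.Adj d ⊤ ∧
    IsGreatest {k | k ≤ d ∧ T.dist k 0 < T.dist k d} a ∧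
    IsLeast {k | k ≤ d ∧ T.dist k d < T.dist k 0} c ∧
    IsGreatest {k | d ≤ k ∧ T.dist k d < T.dist k ⊤} e ∧
    IsLeast {k | d ≤ k ∧ T.dist k ⊤ < T.dist k d} g

/-- The vertices with indices `k` and `l` see each other within the polygon. -/
def Sees (p : Fin n → ℝ × ℝ) (k l : ℕ) : Prop :=
  ∃ (hk : k < n) (hl : l < n), IsBoundaryEdge (⟨k, hk⟩ : Fin n) ⟨l, hl⟩ ∨ IsDiagonal p ⟨k, hk⟩ ⟨l, hl⟩

end Polygons

/-! ### The procedure EXT -/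

open Classical in
/-- The procedure EXT on the subpolygon with vertices `i, …, j`, with guessed special vertices
`a, c, e, g` and with coefficient `α`; `V` is the visibility relation. A minimum over the empty set
is `⊤`. A side of the triangle `i d j` that is a boundary edge is a "polygon" with two vertices, of
cost `1 + α`; on such a side the special vertices are its endpoints. -/
noncomputable def ext (V : ℕ → ℕ → Prop) (i j a c e g α : ℕ) : WithTop ℤ :=
  if j = i + 1 then ((1 + α : ℤ) : WithTop ℤ)
  else if a = i ∧ c = i + 1 ∧ e = i + 1 ∧ g = i + 2 ∧ j = i + 2 then ((3 + 2 * α : ℤ) : WithTop ℤ)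
  else
    (Finset.Ioo i j).attach.inf fun d =>
    (Finset.Icc i d.1).inf fun a' => (Finset.Icc i d.1).inf fun g' =>
    (Finset.Icc d.1 j).inf fun a'' => (Finset.Icc d.1 j).inf fun g'' =>
      if V i d ∧ V d j ∧
          (if d = i + 1 then a = i ∧ c = d
            else i ≤ a' ∧ a' ≤ a + 1 ∧ a + 1 ≤ c - 1 ∧ c - 1 ≤ g' ∧ g' ≤ d) ∧
          (if j = d + 1 then e = d ∧ g = j
            else d ≤ a'' ∧ a'' ≤ e + 1 ∧ e + 1 ≤ g - 1 ∧ g - 1 ≤ g'' ∧ g'' ≤ j) then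
        ext V i d a' (a + 1) (c - 1) g' (α + (j - d)) +
          ext V d j a'' (e + 1) (g - 1) g'' (α + (d - i)) +
          (((α + j - g + 1) * (d - a - 1) + (e - d + 1) * (i - d) : ℤ) : WithTop ℤ)
      else ⊤
termination_by j - i
decreasing_by all_goals (have := Finset.mem_Ioo.1 d.2; omega)

/-- The value of EXT on the whole polygon: the minimum over all guesses of the special vertices. -/
noncomputable def extMin {n : ℕ} [NeZero n] (p : Fin n → ℝ × ℝ) (α : ℕ) : WithTop ℤ :=
  Finset.univ.inf fun q : Fin n × Fin n × Fin n × Fin n =>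
    ext (Sees p) 0 (n - 1) q.1 q.2.1 q.2.2.1 q.2.2.2 α

/-! ### The real RAM

A program works on finitely many integer arrays and finitely many real arrays, named by natural
numbers. Arithmetic, comparisons and (indirect) array accesses have unit cost; there is no division
and no rounding of reals. -/

/-- Integer expressions. -/
inductive IExp : Type
  | const (z : ℤ)
  | get (arr : ℕ) (idx : IExp)
  | add (x y : IExp)
  | sub (x y : IExp)
  | mul (x y : IExp)

/-- Real expressions. -/
inductive RExp : Type
  | const (z : ℤ)
  | get (arr : ℕ) (idx : IExp)
  | add (x y : RExp)
  | sub (x y : RExp)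
  | mul (x y : RExp)

/-- Comparisons. -/
inductive Cond : Type
  | ilt (x y : IExp)
  | rlt (x y : RExp)

/-- Programs. -/
inductive Prog : Type
  | skip
  | iset (arr : ℕ) (idx val : IExp)
  | rset (arr : ℕ) (idx : IExp) (val : RExp)
  | seq (P Q : Prog)
  | ite (b : Cond) (P Q : Prog)
  | loop (b : Cond) (P : Prog)

/-- The contents of the memory. -/
structure Memory where
  ints : ℕ → ℤ → ℤ
  reals : ℕ → ℤ → ℝ

namespace IExp

def eval (s : Memory) : IExp → ℤ
  | const z => z
  | get arr idx => s.ints arr (idx.eval s)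
  | add x y => x.eval s + y.eval s
  | sub x y => x.eval s - y.eval s
  | mul x y => x.eval s * y.eval s

/-- The number of operations. -/
def cost : IExp → ℕ
  | const _ => 1
  | get _ idx => idx.cost + 1
  | add x y => x.cost + y.cost + 1
  | sub x y => x.cost + y.cost + 1
  | mul x y => x.cost + y.cost + 1

end IExp

namespace RExp

def eval (s : Memory) : RExp → ℝ
  | const z => z
  | get arr idx => s.reals arr (idx.eval s)
  | add x y => x.eval s + y.eval s
  | sub x y => x.eval s - y.eval s
  | mul x y => x.eval s * y.eval s

/-- The number of operations. -/
def cost : RExp → ℕ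
  | const _ => 1
  | get _ idx => idx.cost + 1
  | add x y => x.cost + y.cost + 1
  | sub x y => x.cost + y.cost + 1
  | mul x y => x.cost + y.cost + 1

end RExp

namespace Cond

def Holds (s : Memory) : Cond → Prop
  | ilt x y => x.eval s < y.eval s
  | rlt x y => x.eval s < y.eval s

/-- The number of operations. -/
def cost : Cond → ℕ
  | ilt x y => x.cost + y.cost + 1
  | rlt x y => x.cost + y.cost + 1

end Cond

namespace Memory

def setInt (s : Memory) (arr : ℕ) (idx val : ℤ) : Memory :=
  { s with ints := Function.update s.ints arr (Function.update (s.ints arr) idx val) }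

def setReal (s : Memory) (arr : ℕ) (idx : ℤ) (val : ℝ) : Memory :=
  { s with reals := Function.update s.reals arr (Function.update (s.reals arr) idx val) }

end Memory

/-- `Runs B P s t s'`: started on `s`, the program `P` halts after exactly `t` steps with memory `s'`,
and all integers and addresses it writes are at most `B` in absolute value (with `B` polynomial in
the input size, integers are words of logarithmically many bits; intermediate values are bounded
by a polynomial in `B`, as expressions are of constant size). -/
inductive Runs (B : ℤ) : Prog → Memory → ℕ → Memory → Prop
  | skip (s : Memory) : Runs B .skip s 1 s
  | iset (s : Memory) (arr : ℕ) (idx val : IExp) (hi : |idx.eval s| ≤ B) (hv : |val.eval s| ≤ B) :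
      Runs B (.iset arr idx val) s (idx.cost + val.cost + 1)
        (s.setInt arr (idx.eval s) (val.eval s))
  | rset (s : Memory) (arr : ℕ) (idx : IExp) (val : RExp) (hi : |idx.eval s| ≤ B) :
      Runs B (.rset arr idx val) s (idx.cost + val.cost + 1)
        (s.setReal arr (idx.eval s) (val.eval s))
  | seq {P Q : Prog} {s s' s'' : Memory} {t t' : ℕ} (hP : Runs B P s t s') (hQ : Runs B Q s' t' s'') :
      Runs B (.seq P Q) s (t + t') s''
  | ite_true {b : Cond} {P Q : Prog} {s s' : Memory} {t : ℕ} (hb : b.Holds s) (h : Runs B P s t s') :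
      Runs B (.ite b P Q) s (b.cost + t + 1) s'
  | ite_false {b : Cond} {P Q : Prog} {s s' : Memory} {t : ℕ} (hb : ¬ b.Holds s)
      (h : Runs B Q s t s') : Runs B (.ite b P Q) s (b.cost + t + 1) s'
  | loop_true {b : Cond} {P : Prog} {s s' s'' : Memory} {t t' : ℕ} (hb : b.Holds s)
      (h : Runs B P s t s') (h' : Runs B (.loop b P) s' t' s'') :
      Runs B (.loop b P) s (b.cost + t + t' + 1) s''
  | loop_false {b : Cond} {P : Prog} {s : Memory} (hb : ¬ b.Holds s) :
      Runs B (.loop b P) s (b.cost + 1) s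

/-! ### Input and output -/

section InputOutput

variable {n : ℕ}

/-- The input: the number of vertices in cell `0` of integer array `0`, their coordinates in the real
arrays `0` and `1`; all other cells are `0`. -/
noncomputable def inputMemory (p : Fin n → ℝ × ℝ) : Memory where
  ints arr idx := if arr = 0 ∧ idx = 0 then n else 0
  reals arr idx :=
    if h : 0 ≤ idx ∧ idx.toNat < n then
      if arr = 0 then (p ⟨idx.toNat, h.2⟩).1 else if arr = 1 then (p ⟨idx.toNat, h.2⟩).2 else 0
    else 0

open Classical in
/-- Integer array `1` is the adjacency matrix of `T`. -/
def HoldsGraph (s : Memory) (T : SimpleGraph (Fin n)) : Prop :=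
  ∀ k l : Fin n, s.ints 1 ((k : ℤ) * n + l) = if T.Adj k l then 1 else 0

/-- Integer array `3` is the table of the values of EXT for all subpolygons `i, …, j` and all guesses
`a, c, e, g`, where `α` is `n` minus the number of vertices of the subpolygon. The value `⊤` is
stored as `-1`. -/
def HoldsExtTable [NeZero n] (s : Memory) (p : Fin n → ℝ × ℝ) : Prop :=
  ∀ i j a c e g : Fin n, i < j →
    s.ints 3 ((((((i : ℤ) * n + j) * n + a) * n + c) * n + e) * n + g) =
      (ext (Sees p) i j a c e g (n - (j - i + 1))).untopD (-1)

end InputOutput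

/-! ### Distances in triangulated intervals -/

section Distances

variable {V W : Type*} {G : SimpleGraph V} {H : SimpleGraph W}

/-! Combinatorics. Apart from the geometry, a triangulation of `i, …, j` is a recursive object
(`Tri`): the triangle `i d j` on the base edge, with a triangulation on each of the sides `i d` and
`d j`. Neither part offers shortcuts to the other, because it can be retracted onto a side of the
triangle, and a path from the left to the right part passes through `d` or along the edge `i j`
(`Tri.dist_across`). The distances of a vertex to the two ends of an edge differ by at most one. So
the route along `i j` beats the one through `d`, and then by exactly one, precisely for the pairs
`x, y` with `x` strictly closer to `i` than to `d` and `y` strictly closer to `j` than to `d`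
(`IsNode.dist_cross`). Such vertices form an initial segment `i, …, a` and a final segment `g, …, j`
(`Sides`), and the segments belonging to the base edge `i j` are determined by those of the two
sides: they end at `c - 1` and begin at `e + 1` (`IsNode.sides`). Hence the special vertices are all
that a part has to pass on, and prescribing `a, c` for the side `i d` means prescribing the two
middle special vertices `a + 1, c - 1` of the left part. Summing the distances gives the recursion
of the cost (`IsNode.triCost_eq`), and induction shows that EXT is the minimum over `Tri`
(`ext_le_triCost`, `exists_triCost_eq_ext`).

Geometry. It remains to identify maximal sets of non-crossing diagonals with `Tri`. The interior is
defined by a crossing parity, which is locally constant off the boundary and changes across every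
edge. A diagonal splits the polygon into two polygons whose parities add up to that of the whole.
The decisive fact, a fragment of the Jordan curve theorem, is that either boundary chain has parity
zero with respect to the part on the other side (`IsCut.parity_chain_eq_zero`): this parity is
constant along the chain, a comparison of the three directions at one end of the diagonal shows that
the two constants agree, and a vertex exposed on the convex hull makes one of them zero.
Consequently diagonals with both ends in one part are diagonals of that part, and two diagonals
cross exactly if their indices interleave. An exposed vertex also produces a diagonal if there are
at least four vertices (`IsCornerCoord.exists_diagonal`). So triangulations can be cut, and by
induction every boundary edge lies on a triangle (`IsTriangulation.exists_apex`). This gives both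
directions of the correspondence, `IsTriangulation.exists_tri` and `Tri.isTriangulation`.

Running time. Starting from coefficient 0 on the whole polygon, the recursion always keeps `α` equal
to `n` minus the number of vertices of the subpolygon. So a table indexed by the six numbers `i, j,
a, c, e, g` suffices, and an entry is found by a search over the five numbers `d, a', g', a'', g''`.
Visibility is decided by signs of polynomials (`IsSimplePolygon.sees_iff`), and merging the stored
adjacency matrices of two subtriangulations takes quadratic time; both are dominated by the search.
The program is written in a small language whose only loops run over `0, …, n - 1`; its time is at
most a constant times `n` to the nesting depth (`SProg.time_le`), which is 11. -/

theorem SimpleGraph.Reachable.le_add_dist_of_lipschitz (f : V → ℕ)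
    (hf : ∀ u v, G.Adj u v → f v ≤ f u + 1) {x y : V} (h : G.Reachable x y) :
    f y ≤ f x + G.dist x y := by
  obtain ⟨w, hw⟩ := h.exists_walk_length_eq_dist
  rw [← hw]
  clear hw h
  induction w with
  | nil => simp
  | cons h p ih =>
    have := hf _ _ h
    rw [SimpleGraph.Walk.length_cons]
    omega

/-- No reachability is needed: `u` and `v` lie in the same component, and if `x` does not, both
distances are 0 by convention. -/
theorem SimpleGraph.dist_le_dist_add_one {x u v : W} (h : H.Adj u v) :
    H.dist x v ≤ H.dist x u + 1 := by
  by_cases hr : H.Reachable x u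
  · obtain ⟨w, hw⟩ := hr.exists_walk_length_eq_dist
    rw [← hw]
    refine (SimpleGraph.dist_le (w.concat h)).trans ?_
    simp
  · rw [SimpleGraph.dist_eq_zero_of_not_reachable fun h' => hr (h'.trans h.symm.reachable)]
    omega

/-- A map that sends every edge to an edge or to a single vertex cannot increase distances. All
lower bounds on distances below come from such retractions or from a Lipschitz function. -/
theorem SimpleGraph.Reachable.dist_map_le (r : V → W)
    (hr : ∀ u v, G.Adj u v → r u = r v ∨ H.Adj (r u) (r v)) {x y : V} (h : G.Reachable x y) :
    H.dist (r x) (r y) ≤ G.dist x y := by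
  have := h.le_add_dist_of_lipschitz (fun v => H.dist (r x) (r v)) fun u v huv => by
    rcases hr u v huv with h' | h'
    · simp [h']
    · exact SimpleGraph.dist_le_dist_add_one h'
  simpa using this

end Distances

/-! ### Combinatorial triangulations and their distances -/

/-- `Tri V i j G`: the graph `G` is a triangulation of the convex polygon with vertices `i, …, j` all
of whose edges, except possibly the edge `i j`, satisfy `V`. -/
inductive Tri (V : ℕ → ℕ → Prop) : ℕ → ℕ → SimpleGraph ℕ → Prop
  | edge (i : ℕ) : Tri V i (i + 1) (SimpleGraph.edge i (i + 1))
  | node {i d j : ℕ} {G₁ G₂ : SimpleGraph ℕ} (h₁ : Tri V i d G₁) (h₂ : Tri V d j G₂)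
      (hid : V i d) (hdj : V d j) : Tri V i j (G₁ ⊔ G₂ ⊔ SimpleGraph.edge i j)

/-- The vertices of `i, …, j` that are closer to `i` than to `j` are `i, …, x`, and those closer to
`j` are `y, …, j`. -/
structure Sides (G : SimpleGraph ℕ) (i j x y : ℕ) : Prop where
  le_left : i ≤ x
  lt : x < y
  le_right : y ≤ j
  left_iff : ∀ k, i ≤ k → k ≤ j → (G.dist k i < G.dist k j ↔ k ≤ x)
  right_iff : ∀ k, i ≤ k → k ≤ j → (G.dist k j < G.dist k i ↔ y ≤ k)

/-- The counterpart of `HasSpecialVertices` on index intervals. For a triangulation the apex `d` is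
unique (`IsNode.apex_unique`), so at most one quadruple is special. -/
def Special (G : SimpleGraph ℕ) (i j a c e g : ℕ) : Prop :=
  ∃ d, i < d ∧ d < j ∧ G.Adj i d ∧ G.Adj d j ∧ Sides G i d a c ∧ Sides G d j e g

/-- The cost `W_EXT` of the triangulation `G` of `i, …, j`. -/
noncomputable def triCost (G : SimpleGraph ℕ) (i j α : ℕ) : ℤ :=
  ∑ x ∈ Finset.Icc i j, ∑ y ∈ Finset.Ioc x j, (G.dist x y : ℤ) +
    α * ∑ x ∈ Finset.Icc i j, (G.dist x j : ℤ)

theorem Sides.congr {G H : SimpleGraph ℕ} {i j x y : ℕ} (h : Sides G i j x y)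
    (hGH : ∀ u v, i ≤ u → u ≤ j → i ≤ v → v ≤ j → G.dist u v = H.dist u v) : Sides H i j x y := by
  have hij : i ≤ j := h.le_left.trans (h.lt.le.trans h.le_right)
  refine ⟨h.le_left, h.lt, h.le_right, fun k hk hk' => ?_, fun k hk hk' => ?_⟩
  · rw [← hGH k i hk hk' le_rfl hij, ← hGH k j hk hk' hij le_rfl, h.left_iff k hk hk']
  · rw [← hGH k i hk hk' le_rfl hij, ← hGH k j hk hk' hij le_rfl, h.right_iff k hk hk']

theorem Sides.unique {G : SimpleGraph ℕ} {i j x y x' y' : ℕ} (h : Sides G i j x y)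
    (h' : Sides G i j x' y') : x = x' ∧ y = y' := by
  have := h.le_left; have := h.lt; have := h.le_right
  have := h'.le_left; have := h'.lt; have := h'.le_right
  refine ⟨le_antisymm ?_ ?_, le_antisymm ?_ ?_⟩
  · rw [← h'.left_iff x (by omega) (by omega), h.left_iff x (by omega) (by omega)]
  · rw [← h.left_iff x' (by omega) (by omega), h'.left_iff x' (by omega) (by omega)]
  · rw [← h.right_iff y' (by omega) (by omega), h'.right_iff y' (by omega) (by omega)]
  · rw [← h'.right_iff y (by omega) (by omega), h.right_iff y (by omega) (by omega)]

namespace Tri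

variable {V : ℕ → ℕ → Prop} {i d j : ℕ} {G G₁ G₂ : SimpleGraph ℕ}

theorem lt (h : Tri V i j G) : i < j := by
  induction h with
  | edge => omega
  | node => omega

theorem adj_ends (h : Tri V i j G) : G.Adj i j := by
  cases h with
  | edge => simp [SimpleGraph.edge_adj]
  | node h₁ h₂ =>
    have := h₁.lt
    have := h₂.lt
    simp only [SimpleGraph.sup_adj, SimpleGraph.edge_adj]
    right
    constructor
    · simp
    · omega

theorem adj_range (h : Tri V i j G) {u v : ℕ} (huv : G.Adj u v) : i ≤ u ∧ u ≤ j := by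
  induction h with
  | edge i =>
    rw [SimpleGraph.edge_adj] at huv
    omega
  | node h₁ h₂ _ _ ih₁ ih₂ =>
    have := h₁.lt
    have := h₂.lt
    simp only [SimpleGraph.sup_adj, SimpleGraph.edge_adj] at huv
    rcases huv with (h | h) | h
    · have := ih₁ h
      omega
    · have := ih₂ h
      omega
    · omega

theorem reachable_left (h : Tri V i j G) {k : ℕ} (hk : i ≤ k) (hk' : k ≤ j) :
    G.Reachable i k := by
  induction h generalizing k with
  | edge i =>
    obtain rfl | rfl : k = i ∨ k = i + 1 := by omega
    · rfl
    · exact (adj_ends (.edge (V := V) i)).reachable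
  | @node i d j G₁ G₂ h₁ h₂ _ _ ih₁ ih₂ =>
    have l₁ : G₁ ≤ G₁ ⊔ G₂ ⊔ SimpleGraph.edge i j := le_sup_left.trans le_sup_left
    have l₂ : G₂ ≤ G₁ ⊔ G₂ ⊔ SimpleGraph.edge i j := le_sup_right.trans le_sup_left
    rcases le_total k d with hd | hd
    · exact (ih₁ hk hd).mono l₁
    · exact ((ih₁ h₁.lt.le le_rfl).mono l₁).trans ((ih₂ hd hk').mono l₂)

theorem reachable (h : Tri V i j G) {k l : ℕ} (hk : i ≤ k) (hk' : k ≤ j) (hl : i ≤ l)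
    (hl' : l ≤ j) : G.Reachable k l :=
  (h.reachable_left hk hk').symm.trans (h.reachable_left hl hl')

/-- The map `k ↦ min k d` retracts the whole graph onto the left part: the right part collapses to
`d`, and the edge `i j` becomes the edge `i d`. So no detour through the right part is shorter. -/
theorem dist_left (h₁ : Tri V i d G₁) (h₂ : Tri V d j G₂) {x y : ℕ} (hx : i ≤ x) (hx' : x ≤ d)
    (hy : i ≤ y) (hy' : y ≤ d) :
    (G₁ ⊔ G₂ ⊔ SimpleGraph.edge i j).dist x y = G₁.dist x y := by
  have l₁ : G₁ ≤ G₁ ⊔ G₂ ⊔ SimpleGraph.edge i j := le_sup_left.trans le_sup_left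
  have hr := h₁.reachable hx hx' hy hy'
  refine le_antisymm (hr.dist_anti l₁) ?_
  have := (hr.mono l₁).dist_map_le (H := G₁) (fun k => min k d) fun u v huv => by
    have := h₁.lt
    have := h₂.lt
    simp only [SimpleGraph.sup_adj, SimpleGraph.edge_adj] at huv
    rcases huv with (h | h) | h
    · right
      rw [min_eq_left (h₁.adj_range h).2, min_eq_left (h₁.adj_range h.symm).2]
      exact h
    · left
      rw [min_eq_right (h₂.adj_range h).1, min_eq_right (h₂.adj_range h.symm).1]
    · right
      rcases h.1 with ⟨rfl, rfl⟩ | ⟨rfl, rfl⟩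
      · rw [min_eq_left (by omega), min_eq_right (by omega)]
        exact h₁.adj_ends
      · rw [min_eq_left (a := v) (by omega), min_eq_right (by omega)]
        exact h₁.adj_ends.symm
  simpa only [min_eq_left hx', min_eq_left hy'] using this

theorem dist_right (h₁ : Tri V i d G₁) (h₂ : Tri V d j G₂) {x y : ℕ} (hx : d ≤ x) (hx' : x ≤ j)
    (hy : d ≤ y) (hy' : y ≤ j) :
    (G₁ ⊔ G₂ ⊔ SimpleGraph.edge i j).dist x y = G₂.dist x y := by
  have l₂ : G₂ ≤ G₁ ⊔ G₂ ⊔ SimpleGraph.edge i j := le_sup_right.trans le_sup_left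
  have hr := h₂.reachable hx hx' hy hy'
  refine le_antisymm (hr.dist_anti l₂) ?_
  have := (hr.mono l₂).dist_map_le (H := G₂) (fun k => max k d) fun u v huv => by
    have := h₁.lt
    have := h₂.lt
    simp only [SimpleGraph.sup_adj, SimpleGraph.edge_adj] at huv
    rcases huv with (h | h) | h
    · left
      rw [max_eq_right (h₁.adj_range h).2, max_eq_right (h₁.adj_range h.symm).2]
    · right
      rw [max_eq_left (h₂.adj_range h).1, max_eq_left (h₂.adj_range h.symm).1]
      exact h
    · right
      rcases h.1 with ⟨rfl, rfl⟩ | ⟨rfl, rfl⟩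
      · rw [max_eq_left (a := v) (by omega), max_eq_right (by omega)]
        exact h₂.adj_ends
      · rw [max_eq_left (by omega), max_eq_right (a := v) (by omega)]
        exact h₂.adj_ends.symm
  simpa only [max_eq_left hx, max_eq_left hy] using this

/-- The left part can be left only through `d` or along the edge `i j`. For the lower bound, the
function of `y` that is the distance from `x` on the left and the claimed minimum on the right is
shown to grow by at most one along every edge. -/
theorem dist_across (h₁ : Tri V i d G₁) (h₂ : Tri V d j G₂)
    (hG : G = G₁ ⊔ G₂ ⊔ SimpleGraph.edge i j) {x y : ℕ} (hx : i ≤ x) (hx' : x ≤ d)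
    (hy : d ≤ y) (hy' : y ≤ j) :
    G.dist x y = min (G.dist x d + G.dist d y) (G.dist x i + 1 + G.dist j y) := by
  have hid := h₁.lt
  have hdj := h₂.lt
  have l₁ : G₁ ≤ G := hG ▸ le_sup_left.trans le_sup_left
  have l₂ : G₂ ≤ G := hG ▸ le_sup_right.trans le_sup_left
  have aid : G.Adj i d := l₁ h₁.adj_ends
  have adj' : G.Adj d j := l₂ h₂.adj_ends
  have aij : G.Adj i j := by
    rw [hG, SimpleGraph.sup_adj, SimpleGraph.edge_adj]
    right
    constructor
    · simp
    · omega
  have hr : ∀ {u v}, i ≤ u → u ≤ j → i ≤ v → v ≤ j → G.Reachable u v := by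
    have : ∀ {u}, i ≤ u → u ≤ j → G.Reachable d u := by
      intro u hu hu'
      rcases le_total u d with h | h
      · exact (h₁.reachable hid.le le_rfl hu h).mono l₁
      · exact (h₂.reachable le_rfl hdj.le h hu').mono l₂
    exact fun {_ _} hu hu' hv hv' => (this hu hu').symm.trans (this hv hv')
  have tri : ∀ {u v w}, i ≤ u → u ≤ j → i ≤ v → v ≤ j → i ≤ w → w ≤ j →
      G.dist u w ≤ G.dist u v + G.dist v w := by
    intro u v w a b c d e f
    obtain ⟨p, hp⟩ := (hr a b c d).exists_walk_length_eq_dist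
    obtain ⟨q, hq⟩ := (hr c d e f).exists_walk_length_eq_dist
    rw [← hp, ← hq, ← SimpleGraph.Walk.length_append]
    exact SimpleGraph.dist_le _
  apply le_antisymm
  · apply le_min
    · exact tri (by omega) (by omega) (by omega) (by omega) (by omega) (by omega)
    · have t₁ := tri (u := x) (v := i) (w := y) (by omega) (by omega) (by omega) (by omega)
        (by omega) (by omega)
      have t₂ := tri (u := i) (v := j) (w := y) (by omega) (by omega) (by omega) (by omega)
        (by omega) (by omega)
      rw [SimpleGraph.dist_eq_one_iff_adj.2 aij] at t₂
      omega
  · have := (hr (u := x) (v := y) (by omega) (by omega) (by omega)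
        (by omega)).le_add_dist_of_lipschitz
      (fun v => if v ≤ d then G.dist x v
        else min (G.dist x d + G.dist d v) (G.dist x i + 1 + G.dist j v)) fun u v huv => by
      have e₁ : G.dist x v ≤ G.dist x u + 1 := SimpleGraph.dist_le_dist_add_one huv
      have e₂ : G.dist d v ≤ G.dist d u + 1 := SimpleGraph.dist_le_dist_add_one huv
      have e₃ : G.dist j v ≤ G.dist j u + 1 := SimpleGraph.dist_le_dist_add_one huv
      have e₄ : G.dist x i ≤ G.dist x d + 1 := SimpleGraph.dist_le_dist_add_one aid.symm
      have e₅ : G.dist x d ≤ G.dist x i + 1 := SimpleGraph.dist_le_dist_add_one aid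
      have e₆ : G.dist j d = 1 := SimpleGraph.dist_eq_one_iff_adj.2 adj'.symm
      have huv' := huv
      rw [hG] at huv'
      simp only [SimpleGraph.sup_adj, SimpleGraph.edge_adj] at huv'
      -- Only edges at `d` into the right part and the edge `i j` switch between the two formulas;
      -- there the claim holds because `i, d, j` are pairwise adjacent.
      rcases huv' with (h | h) | h
      · rw [if_pos (h₁.adj_range h).2, if_pos (h₁.adj_range h.symm).2]
        exact e₁
      · have hu := h₂.adj_range h
        have hv := h₂.adj_range h.symm
        rcases hu.1.eq_or_lt with rfl | hu
        · rw [if_pos le_rfl, if_neg (by have := huv.ne; omega)]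
          rw [SimpleGraph.dist_self] at e₂
          omega
        · rw [if_neg (not_le.2 hu)]
          rcases hv.1.eq_or_lt with rfl | hv
          · rw [if_pos le_rfl]
            rw [SimpleGraph.dist_self] at *
            omega
          · rw [if_neg (not_le.2 hv)]
            omega
      · rcases h.1 with ⟨rfl, rfl⟩ | ⟨rfl, rfl⟩
        · rw [if_neg (by omega), if_pos (by omega), SimpleGraph.dist_self]
          omega
        · rw [if_pos (by omega), if_neg (by omega), SimpleGraph.dist_self]
          omega
    simp only [if_pos hx', SimpleGraph.dist_self, zero_add] at this
    refine le_trans ?_ this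
    split_ifs with h
    · obtain rfl : y = d := by omega
      simp
    · exact le_rfl

end Tri

/-- The graph of a polygon that is cut along the sides of the triangle `i d j`. -/
structure IsNode (V : ℕ → ℕ → Prop) (i d j : ℕ) (G₁ G₂ G : SimpleGraph ℕ) : Prop where
  left : Tri V i d G₁
  right : Tri V d j G₂
  eq : G = G₁ ⊔ G₂ ⊔ SimpleGraph.edge i j

namespace IsNode

variable {V : ℕ → ℕ → Prop} {i d j a c e g : ℕ} {G G₁ G₂ : SimpleGraph ℕ}

theorem adj_iff (h : IsNode V i d j G₁ G₂ G) {u v : ℕ} :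
    G.Adj u v ↔ G₁.Adj u v ∨ G₂.Adj u v ∨ (u = i ∧ v = j ∨ u = j ∧ v = i) := by
  have := h.left.lt
  have := h.right.lt
  rw [h.eq, SimpleGraph.sup_adj, SimpleGraph.sup_adj, SimpleGraph.edge_adj, or_assoc]
  refine or_congr_right (or_congr_right ⟨fun h => h.1, fun h => ⟨h, ?_⟩⟩)
  omega

theorem adj_left (h : IsNode V i d j G₁ G₂ G) : G.Adj i d :=
  h.adj_iff.2 (.inl h.left.adj_ends)

theorem adj_right (h : IsNode V i d j G₁ G₂ G) : G.Adj d j :=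
  h.adj_iff.2 (.inr (.inl h.right.adj_ends))

theorem dist_left (h : IsNode V i d j G₁ G₂ G) (x y : ℕ) (hx : i ≤ x) (hx' : x ≤ d) (hy : i ≤ y)
    (hy' : y ≤ d) : G.dist x y = G₁.dist x y := by
  rw [h.eq]
  exact h.left.dist_left h.right hx hx' hy hy'

theorem dist_right (h : IsNode V i d j G₁ G₂ G) (x y : ℕ) (hx : d ≤ x) (hx' : x ≤ j) (hy : d ≤ y)
    (hy' : y ≤ j) : G.dist x y = G₂.dist x y := by
  rw [h.eq]
  exact h.left.dist_right h.right hx hx' hy hy'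

/-- Apart from each other, `i` has neighbours only in the left part and `j` only in the right part;
the parts share just `d`. -/
theorem apex_unique (h : IsNode V i d j G₁ G₂ G) {d' : ℕ} (hi : i < d') (hj : d' < j)
    (hid : G.Adj i d') (hdj : G.Adj d' j) : d' = d := by
  have := h.left.lt
  have := h.right.lt
  rw [h.adj_iff] at hid hdj
  have h₁ : d' ≤ d := by
    rcases hid with h' | h' | h'
    · exact (h.left.adj_range h'.symm).2
    · have := h.right.adj_range h'
      omega
    · omega
  have h₂ : d ≤ d' := by
    rcases hdj with h' | h' | h'
    · have := h.left.adj_range h'.symm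
      omega
    · exact (h.right.adj_range h').1
    · omega
  omega

theorem sides_left (h : IsNode V i d j G₁ G₂ G) {x y : ℕ} :
    Sides G i d x y ↔ Sides G₁ i d x y :=
  ⟨fun hs => hs.congr h.dist_left,
    fun hs => hs.congr fun u v a b c d => (h.dist_left u v a b c d).symm⟩

theorem sides_right (h : IsNode V i d j G₁ G₂ G) {x y : ℕ} :
    Sides G d j x y ↔ Sides G₂ d j x y :=
  ⟨fun hs => hs.congr h.dist_right,
    fun hs => hs.congr fun u v a b c d => (h.dist_right u v a b c d).symm⟩

theorem special_iff (h : IsNode V i d j G₁ G₂ G) :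
    Special G i j a c e g ↔ Sides G₁ i d a c ∧ Sides G₂ d j e g := by
  rw [← h.sides_left, ← h.sides_right]
  constructor
  · rintro ⟨d', hi, hj, hid, hdj, h₁, h₂⟩
    obtain rfl := h.apex_unique hi hj hid hdj
    exact ⟨h₁, h₂⟩
  · exact fun hs => ⟨d, h.left.lt, h.right.lt, h.adj_left, h.adj_right, hs⟩

theorem dist_last (h : IsNode V i d j G₁ G₂ G) {k : ℕ} (hk : i ≤ k) (hk' : k ≤ d) :
    G.dist k j = min (G.dist k d) (G.dist k i) + 1 := by
  rw [h.left.dist_across h.right h.eq hk hk' h.right.lt.le le_rfl, SimpleGraph.dist_self,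
    SimpleGraph.dist_eq_one_iff_adj.2 h.adj_right]
  omega

theorem dist_first (h : IsNode V i d j G₁ G₂ G) {k : ℕ} (hk : d ≤ k) (hk' : k ≤ j) :
    G.dist k i = min (G.dist k d) (G.dist k j) + 1 := by
  rw [SimpleGraph.dist_comm, h.left.dist_across h.right h.eq le_rfl h.left.lt.le hk hk',
    SimpleGraph.dist_self, SimpleGraph.dist_eq_one_iff_adj.2 h.adj_left,
    SimpleGraph.dist_comm (u := d), SimpleGraph.dist_comm (u := j)]
  omega

/-- A vertex on the left has distance `min (dist k d) (dist k i) + 1` to `j`, so it is closer to `i`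
than to `j` unless it is strictly closer to `d` than to `i`, that is, unless `c ≤ k`. A vertex on
the right is never closer to `i`. The other half is the mirror image. -/
theorem sides (h : IsNode V i d j G₁ G₂ G) (h₁ : Sides G₁ i d a c) (h₂ : Sides G₂ d j e g) :
    Sides G i j (c - 1) (e + 1) := by
  rw [← h.sides_left] at h₁
  rw [← h.sides_right] at h₂
  have := h₁.le_left; have := h₁.lt; have := h₁.le_right
  have := h₂.le_left; have := h₂.lt; have := h₂.le_right
  refine ⟨by omega, by omega, by omega, fun k hk hk' => ?_, fun k hk hk' => ?_⟩
  · rcases le_total k d with hd | hd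
    · have := h₁.right_iff k hk hd
      have := h.dist_last hk hd
      omega
    · have := h.dist_first hd hk'
      have : G.dist k j ≤ G.dist k d + 1 := SimpleGraph.dist_le_dist_add_one h.adj_right
      omega
  · rcases le_total k d with hd | hd
    · have := h.dist_last hk hd
      have : G.dist k i ≤ G.dist k d + 1 := SimpleGraph.dist_le_dist_add_one h.adj_left.symm
      omega
    · have := h₂.left_iff k hd hk'
      have := h.dist_first hd hk'
      omega

/-- The route along `i j` costs one edge and saves at most one at each end compared to the route
through `d`. So it is shorter only if it saves at both ends, and then by one. -/
theorem dist_cross (h : IsNode V i d j G₁ G₂ G) (h₁ : Sides G₁ i d a c) (h₂ : Sides G₂ d j e g)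
    {x y : ℕ} (hx : i ≤ x) (hx' : x ≤ d) (hy : d ≤ y) (hy' : y ≤ j) :
    (G.dist x y : ℤ) = G₁.dist x d + G₂.dist y d -
      (if x ≤ a then 1 else 0) * (if g ≤ y then 1 else 0) := by
  rw [← h.sides_left] at h₁
  rw [← h.sides_right] at h₂
  have l := h.left.lt
  have r := h.right.lt
  rw [h.left.dist_across h.right h.eq hx hx' hy hy', ← h.dist_left x d hx hx' l.le le_rfl,
    ← h.dist_right y d hy hy' le_rfl r.le, SimpleGraph.dist_comm (u := d),
    SimpleGraph.dist_comm (u := j)]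
  have e₁ : G.dist x d ≤ G.dist x i + 1 := SimpleGraph.dist_le_dist_add_one h.adj_left
  have e₂ : G.dist y d ≤ G.dist y j + 1 := SimpleGraph.dist_le_dist_add_one h.adj_right.symm
  have e₃ := h₁.left_iff x hx hx'
  have e₄ := h₂.right_iff y hy hy'
  split_ifs <;> push_cast <;> omega

end IsNode

/-- Serves to trade distances to the first vertex of the right part for distances to its last
vertex, which are the ones that the extended cost weights. -/
theorem Sides.dist_sub {V : ℕ → ℕ → Prop} {i j x y k : ℕ} {G : SimpleGraph ℕ} (h : Sides G i j x y)
    (hG : Tri V i j G) (hk : i ≤ k) (hk' : k ≤ j) :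
    (G.dist k i : ℤ) = G.dist k j + (if y ≤ k then 1 else 0) - (if k ≤ x then 1 else 0) := by
  have e₁ : G.dist k i ≤ G.dist k j + 1 := SimpleGraph.dist_le_dist_add_one hG.adj_ends.symm
  have e₂ : G.dist k j ≤ G.dist k i + 1 := SimpleGraph.dist_le_dist_add_one hG.adj_ends
  have e₃ := h.left_iff k hk hk'
  have e₄ := h.right_iff k hk hk'
  split_ifs <;> omega

/-! ### The recursion of the cost -/

theorem sum_Ico_ite_le {i d a : ℕ} (h : i ≤ a) (h' : a < d) :
    ∑ x ∈ Finset.Ico i d, (if x ≤ a then 1 else 0 : ℤ) = a - i + 1 := by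
  rw [← Finset.sum_filter, Finset.sum_const, nsmul_one]
  have : (Finset.Ico i d).filter (· ≤ a) = Finset.Icc i a := by
    ext k
    simp only [Finset.mem_filter, Finset.mem_Ico, Finset.mem_Icc]
    omega
  rw [this, Nat.card_Icc]
  omega

theorem sum_Ioc_ite_ge {d j g : ℕ} (h : d < g) (h' : g ≤ j) :
    ∑ y ∈ Finset.Ioc d j, (if g ≤ y then 1 else 0 : ℤ) = j - g + 1 := by
  rw [← Finset.sum_filter, Finset.sum_const, nsmul_one]
  have : (Finset.Ioc d j).filter (g ≤ ·) = Finset.Icc g j := by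
    ext k
    simp only [Finset.mem_filter, Finset.mem_Ioc, Finset.mem_Icc]
    omega
  rw [this, Nat.card_Icc]
  omega

theorem sum_Ioc_ite_le {d j e : ℕ} (h : d ≤ e) (h' : e ≤ j) :
    ∑ y ∈ Finset.Ioc d j, (if y ≤ e then 1 else 0 : ℤ) = e - d := by
  rw [← Finset.sum_filter, Finset.sum_const, nsmul_one]
  have : (Finset.Ioc d j).filter (· ≤ e) = Finset.Ioc d e := by
    ext k
    simp only [Finset.mem_filter, Finset.mem_Ioc]
    omega
  rw [this, Nat.card_Ioc]
  omega

theorem sum_Icc_eq_Ico_add {d j : ℕ} (h : d ≤ j) (f : ℕ → ℤ) :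
    ∑ x ∈ Finset.Icc d j, f x = ∑ x ∈ Finset.Ico d j, f x + f j := by
  rw [← Finset.Ico_insert_right h, Finset.sum_insert (by simp), add_comm]

theorem sum_Icc_eq_add_Ioc {d j : ℕ} (h : d ≤ j) (f : ℕ → ℤ) :
    ∑ x ∈ Finset.Icc d j, f x = f d + ∑ x ∈ Finset.Ioc d j, f x := by
  rw [← Finset.Ioc_insert_left h, Finset.sum_insert (by simp)]

theorem sum_Icc_split {i d j : ℕ} (h : i ≤ d) (h' : d ≤ j) (f : ℕ → ℤ) :
    ∑ x ∈ Finset.Icc i j, f x = ∑ x ∈ Finset.Ico i d, f x + ∑ x ∈ Finset.Icc d j, f x := by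
  rw [← Finset.sum_union]
  · congr 1
    ext k
    simp only [Finset.mem_union, Finset.mem_Ico, Finset.mem_Icc]
    omega
  · rw [Finset.disjoint_left]
    intro k
    simp only [Finset.mem_Ico, Finset.mem_Icc]
    omega

theorem sum_Ioc_split {i d j : ℕ} (h : i ≤ d) (h' : d ≤ j) (f : ℕ → ℤ) :
    ∑ x ∈ Finset.Ioc i j, f x = ∑ x ∈ Finset.Ioc i d, f x + ∑ x ∈ Finset.Ioc d j, f x := by
  rw [← Finset.sum_union]
  · congr 1
    ext k
    simp only [Finset.mem_union, Finset.mem_Ioc]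
    omega
  · rw [Finset.disjoint_left]
    intro k
    simp only [Finset.mem_Ioc]
    omega

/-- Pairs of vertices lie in the left part, in the right part, or on opposite sides of `d`. By
`dist_cross` the pairs of the third kind count each distance to `d` on the left `j - d` times and
each one on the right `d - i` times, whence the growth of the coefficients, less one for each of the
`(a - i + 1) * (j - g + 1)` pairs with a shortcut. -/
theorem IsNode.triCost_eq {V : ℕ → ℕ → Prop} {i d j a c e g : ℕ} {G G₁ G₂ : SimpleGraph ℕ}
    (h : IsNode V i d j G₁ G₂ G) (h₁ : Sides G₁ i d a c) (h₂ : Sides G₂ d j e g) (α : ℕ) :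
    triCost G i j α = triCost G₁ i d (α + (j - d)) + triCost G₂ d j (α + (d - i)) +
      ((α + j - g + 1) * (d - a - 1) + (e - d + 1) * (i - d)) := by
  have l := h.left.lt
  have r := h.right.lt
  have := h₁.le_left; have := h₁.lt; have := h₁.le_right
  have := h₂.le_left; have := h₂.lt; have := h₂.le_right
  have cross : ∑ x ∈ Finset.Ico i d, ∑ y ∈ Finset.Ioc d j, (G.dist x y : ℤ) =
      (j - d) * ∑ x ∈ Finset.Ico i d, (G₁.dist x d : ℤ) +
      (d - i) * ∑ y ∈ Finset.Ioc d j, (G₂.dist y d : ℤ) - (a - i + 1) * (j - g + 1) := by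
    calc _ = ∑ x ∈ Finset.Ico i d, ∑ y ∈ Finset.Ioc d j, ((G₁.dist x d : ℤ) + G₂.dist y d -
          (if x ≤ a then 1 else 0) * (if g ≤ y then 1 else 0)) := by
          refine Finset.sum_congr rfl fun x hx => Finset.sum_congr rfl fun y hy => ?_
          rw [Finset.mem_Ico] at hx
          rw [Finset.mem_Ioc] at hy
          exact h.dist_cross h₁ h₂ hx.1 hx.2.le hy.1.le hy.2
      _ = _ := by
          simp only [Finset.sum_sub_distrib, Finset.sum_add_distrib, Finset.sum_const,
            Nat.card_Ico, Nat.card_Ioc, nsmul_eq_mul, ← Finset.mul_sum, ← Finset.sum_mul]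
          rw [sum_Ico_ite_le (by omega) (by omega), sum_Ioc_ite_ge (by omega) (by omega)]
          push_cast [l.le, r.le]
          ring
  have right : ∑ y ∈ Finset.Ioc d j, (G₂.dist y d : ℤ) =
      ∑ y ∈ Finset.Icc d j, (G₂.dist y j : ℤ) + (j - g + 1) - (e - d + 1) := by
    -- The sum over the closed interval includes `d`, at distance 1 from `j`; this turns the count
    -- `e - d` into `e - d + 1`.
    rw [sum_Icc_eq_add_Ioc r.le, SimpleGraph.dist_eq_one_iff_adj.2 h.right.adj_ends]
    calc _ = ∑ y ∈ Finset.Ioc d j, ((G₂.dist y j : ℤ) + (if g ≤ y then 1 else 0) -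
          (if y ≤ e then 1 else 0)) := by
          refine Finset.sum_congr rfl fun y hy => ?_
          rw [Finset.mem_Ioc] at hy
          exact h₂.dist_sub h.right hy.1.le hy.2
      _ = _ := by
          rw [Finset.sum_sub_distrib, Finset.sum_add_distrib, sum_Ioc_ite_ge (by omega) (by omega),
            sum_Ioc_ite_le (by omega) (by omega)]
          push_cast
          ring
  have last : ∑ x ∈ Finset.Ico i d, (G.dist x j : ℤ) =
      ∑ x ∈ Finset.Ico i d, (G₁.dist x d : ℤ) + (d - i) - (a - i + 1) := by
    calc _ = ∑ x ∈ Finset.Ico i d, ((G₁.dist x d : ℤ) + 1 - (if x ≤ a then 1 else 0)) := by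
          refine Finset.sum_congr rfl fun x hx => ?_
          rw [Finset.mem_Ico] at hx
          rw [h.dist_cross h₁ h₂ hx.1 hx.2.le r.le le_rfl, if_pos h₂.le_right,
            SimpleGraph.dist_eq_one_iff_adj.2 h.right.adj_ends.symm]
          simp
      _ = _ := by
          rw [Finset.sum_sub_distrib, Finset.sum_add_distrib, sum_Ico_ite_le (by omega) (by omega),
            Finset.sum_const, Nat.card_Ico, nsmul_one]
          push_cast [l.le]
          ring
  have pairs : ∑ x ∈ Finset.Icc i j, ∑ y ∈ Finset.Ioc x j, (G.dist x y : ℤ) =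
      ∑ x ∈ Finset.Icc i d, ∑ y ∈ Finset.Ioc x d, (G₁.dist x y : ℤ) +
      ∑ x ∈ Finset.Ico i d, ∑ y ∈ Finset.Ioc d j, (G.dist x y : ℤ) +
      ∑ x ∈ Finset.Icc d j, ∑ y ∈ Finset.Ioc x j, (G₂.dist x y : ℤ) := by
    rw [sum_Icc_split l.le r.le, sum_Icc_eq_Ico_add l.le]
    simp only [Finset.Ioc_self, Finset.sum_empty, add_zero]
    rw [← Finset.sum_add_distrib]
    congr 1
    · refine Finset.sum_congr rfl fun x hx => ?_
      rw [Finset.mem_Ico] at hx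
      rw [sum_Ioc_split hx.2.le r.le]
      congr 1
      refine Finset.sum_congr rfl fun y hy => ?_
      rw [Finset.mem_Ioc] at hy
      rw [h.dist_left x y hx.1 hx.2.le (by omega) hy.2]
    · refine Finset.sum_congr rfl fun x hx => Finset.sum_congr rfl fun y hy => ?_
      rw [Finset.mem_Icc] at hx
      rw [Finset.mem_Ioc] at hy
      rw [h.dist_right x y hx.1 hx.2 (by omega) hy.2]
  have tail : ∑ x ∈ Finset.Icc d j, (G.dist x j : ℤ) = ∑ x ∈ Finset.Icc d j, (G₂.dist x j : ℤ) := by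
    refine Finset.sum_congr rfl fun x hx => ?_
    rw [Finset.mem_Icc] at hx
    rw [h.dist_right x j hx.1 hx.2 r.le le_rfl]
  unfold triCost
  rw [pairs, cross, sum_Icc_split l.le r.le, last, tail, right,
    sum_Icc_eq_Ico_add l.le (fun x => (G₁.dist x d : ℤ)),
    SimpleGraph.dist_self]
  push_cast [l.le, r.le]
  ring

namespace Tri

variable {V : ℕ → ℕ → Prop} {i d j a c e g : ℕ} {G : SimpleGraph ℕ}

theorem sides_edge (i : ℕ) : Sides (SimpleGraph.edge i (i + 1)) i (i + 1) i (i + 1) := by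
  have h : (SimpleGraph.edge i (i + 1)).dist i (i + 1) = 1 :=
    SimpleGraph.dist_eq_one_iff_adj.2 (Tri.edge (V := fun _ _ => True) i).adj_ends
  have h' : (SimpleGraph.edge i (i + 1)).dist (i + 1) i = 1 := by
    rw [SimpleGraph.dist_comm, h]
  refine ⟨le_rfl, by omega, le_rfl, fun k hk hk' => ?_, fun k hk hk' => ?_⟩ <;>
  · obtain rfl | rfl : k = i ∨ k = i + 1 := by omega
    · simp [h]
    · simp [h']

theorem exists_sides (h : Tri V i j G) : ∃ x y, Sides G i j x y := by
  induction h with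
  | edge i => exact ⟨_, _, sides_edge i⟩
  | node h₁ h₂ _ _ ih₁ ih₂ =>
    obtain ⟨a, c, s₁⟩ := ih₁
    obtain ⟨e, g, s₂⟩ := ih₂
    exact ⟨_, _, (IsNode.mk h₁ h₂ rfl).sides s₁ s₂⟩

theorem exists_node (h : Tri V i j G) (hij : i + 1 < j) :
    ∃ d G₁ G₂, IsNode V i d j G₁ G₂ G ∧ V i d ∧ V d j := by
  cases h with
  | edge => omega
  | node h₁ h₂ v₁ v₂ => exact ⟨_, _, _, ⟨h₁, h₂, rfl⟩, v₁, v₂⟩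

theorem exists_special (h : Tri V i j G) (hij : i + 1 < j) : ∃ a c e g, Special G i j a c e g := by
  obtain ⟨d, G₁, G₂, hn, -⟩ := h.exists_node hij
  obtain ⟨a, c, s₁⟩ := hn.left.exists_sides
  obtain ⟨e, g, s₂⟩ := hn.right.exists_sides
  exact ⟨a, c, e, g, hn.special_iff.2 ⟨s₁, s₂⟩⟩

/-- Read backwards, this explains the arguments of the recursive calls: the middle special vertices
`c, e` of a part are prescribed so that its base edge gets the required sides `c - 1, e + 1`. -/
theorem sides_of_special (h : Tri V i j G) (hs : Special G i j a c e g) :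
    Sides G i j (c - 1) (e + 1) ∧ i ≤ a ∧ a < c ∧ c ≤ e ∧ e < g ∧ g ≤ j := by
  have hij : i + 1 < j := by
    obtain ⟨d, h₁, h₂, -⟩ := hs
    omega
  obtain ⟨d, G₁, G₂, hn, -⟩ := h.exists_node hij
  obtain ⟨s₁, s₂⟩ := hn.special_iff.1 hs
  exact ⟨hn.sides s₁ s₂, s₁.le_left, s₁.lt, s₁.le_right.trans s₂.le_left, s₂.lt, s₂.le_right⟩

end Tri

/-! ### The recursion of EXT -/

/-- The conditions on `d, a', g', a'', g''` in the recursion of EXT. -/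
structure Admissible (V : ℕ → ℕ → Prop) (i j a c e g d a' g' a'' g'' : ℕ) : Prop where
  lt_d : i < d
  d_lt : d < j
  a'_mem : i ≤ a' ∧ a' ≤ d
  g'_mem : i ≤ g' ∧ g' ≤ d
  a''_mem : d ≤ a'' ∧ a'' ≤ j
  g''_mem : d ≤ g'' ∧ g'' ≤ j
  sees_left : V i d
  sees_right : V d j
  left : if d = i + 1 then a = i ∧ c = d else a' ≤ a + 1 ∧ a + 1 ≤ c - 1 ∧ c - 1 ≤ g'
  right : if j = d + 1 then e = d ∧ g = j else a'' ≤ e + 1 ∧ e + 1 ≤ g - 1 ∧ g - 1 ≤ g''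

def extOffset (i j a e g α d : ℕ) : ℤ := (α + j - g + 1) * (d - a - 1) + (e - d + 1) * (i - d)

/-- The value that is minimized in the recursion of EXT. -/
noncomputable def extVal (V : ℕ → ℕ → Prop) (i j a c e g α d a' g' a'' g'' : ℕ) : WithTop ℤ :=
  ext V i d a' (a + 1) (c - 1) g' (α + (j - d)) +
    ext V d j a'' (e + 1) (g - 1) g'' (α + (d - i)) + (extOffset i j a e g α d : WithTop ℤ)

section Recursion

variable {V : ℕ → ℕ → Prop} {i j a c e g α : ℕ}

theorem ext_edge (V : ℕ → ℕ → Prop) (i a c e g α : ℕ) :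
    ext V i (i + 1) a c e g α = ((1 + α : ℤ) : WithTop ℤ) := by
  rw [ext, if_pos rfl]

theorem le_ite_top {p : Prop} {_ : Decidable p} {w x : WithTop ℤ} (h : p → w ≤ x) :
    w ≤ if p then x else ⊤ := by
  split_ifs with hp
  · exact h hp
  · exact le_top

/-- The separate base case for a triangle is an instance of the recursion with `d = i + 1`: both
sides are boundary edges and the formula returns the same value. As the base case does not test
visibility, neighbours have to see each other for this. -/
theorem le_ext_iff (hV : ∀ k, i ≤ k → k < j → V k (k + 1)) (hij : i + 1 < j) (w : WithTop ℤ) :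
    w ≤ ext V i j a c e g α ↔ ∀ d a' g' a'' g'', Admissible V i j a c e g d a' g' a'' g'' →
      w ≤ extVal V i j a c e g α d a' g' a'' g'' := by
  rw [ext, if_neg (by omega)]
  split_ifs with hb
  · obtain ⟨rfl, rfl, rfl, rfl, rfl⟩ := hb
    have key : ∀ a' g' a'' g'',
        extVal V a (a + 2) a (a + 1) (a + 1) (a + 2) α (a + 1) a' g' a'' g'' =
          ((3 + 2 * α : ℤ) : WithTop ℤ) := by
      intro a' g' a'' g''
      rw [extVal, ext_edge, ext_edge, ← WithTop.coe_add, ← WithTop.coe_add, WithTop.coe_inj,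
        extOffset, show a + 2 - (a + 1) = 1 by omega, show a + 1 - a = 1 by omega]
      push_cast
      ring
    constructor
    · intro h d a' g' a'' g'' hd
      obtain rfl : d = a + 1 := by
        have := hd.lt_d
        have := hd.d_lt
        omega
      rwa [key]
    · intro h
      rw [← key a a (a + 1) (a + 1)]
      exact h _ _ _ _ _ ⟨by omega, by omega, by omega, by omega, by omega, by omega,
        hV a le_rfl (by omega), hV (a + 1) (by omega) (by omega), by simp, by simp⟩
  · simp only [Finset.le_inf_iff, Finset.mem_Icc, Finset.mem_attach, Subtype.forall,
      Finset.mem_Ioo]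
    constructor
    · intro h d a' g' a'' g'' hd
      have := h d ⟨hd.lt_d, hd.d_lt⟩ trivial a' hd.a'_mem g' hd.g'_mem a'' hd.a''_mem g'' hd.g''_mem
      rw [if_pos] at this
      · exact this
      · refine ⟨hd.sees_left, hd.sees_right, ?_, ?_⟩
        · have h₁ := hd.left
          split_ifs at h₁ ⊢
          · exact h₁
          · exact ⟨hd.a'_mem.1, h₁.1, h₁.2.1, h₁.2.2, hd.g'_mem.2⟩
        · have h₁ := hd.right
          split_ifs at h₁ ⊢
          · exact h₁
          · exact ⟨hd.a''_mem.1, h₁.1, h₁.2.1, h₁.2.2, hd.g''_mem.2⟩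
    · intro h d hd _ a' ha' g' hg' a'' ha'' g'' hg''
      apply le_ite_top; intro hc
      refine h d a' g' a'' g'' ⟨hd.1, hd.2, ha', hg', ha'', hg'', hc.1, hc.2.1, ?_, ?_⟩
      · have h₁ := hc.2.2.1
        split_ifs at h₁ ⊢
        · exact h₁
        · exact ⟨h₁.2.1, h₁.2.2.1, h₁.2.2.2.1⟩
      · have h₁ := hc.2.2.2
        split_ifs at h₁ ⊢
        · exact h₁
        · exact ⟨h₁.2.1, h₁.2.2.1, h₁.2.2.2.1⟩

theorem exists_extVal_eq (hV : ∀ k, i ≤ k → k < j → V k (k + 1)) (hij : i + 1 < j)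
    (h : ext V i j a c e g α ≠ ⊤) :
    ∃ d a' g' a'' g'', Admissible V i j a c e g d a' g' a'' g'' ∧
      ext V i j a c e g α = extVal V i j a c e g α d a' g' a'' g'' := by
  obtain ⟨z, hz⟩ := WithTop.ne_top_iff_exists.1 h
  by_contra! hc
  have h₁ := (le_ext_iff (a := a) (c := c) (e := e) (g := g) (α := α) hV hij (ext V i j a c e g α)).1 le_rfl
  -- The minimum is attained because the values are integers: otherwise `z + 1` would still be a
  -- lower bound.
  have h₂ : ((z + 1 : ℤ) : WithTop ℤ) ≤ ext V i j a c e g α := by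
    rw [le_ext_iff hV hij]
    intro d a' g' a'' g'' hd
    have h₃ := lt_of_le_of_ne (h₁ d a' g' a'' g'' hd) (hc d a' g' a'' g'' hd)
    rw [← hz] at h₃
    cases hv : extVal V i j a c e g α d a' g' a'' g'' with
    | top => exact le_top
    | coe y =>
      rw [hv, WithTop.coe_lt_coe] at h₃
      rw [WithTop.coe_le_coe]
      omega
  rw [← hz, WithTop.coe_le_coe] at h₂
  omega

/-- `G` is a triangulation of `i, …, j` with special vertices `a, c, e, g`; these do not matter if
there is only one edge. -/
def TriSpecial (V : ℕ → ℕ → Prop) (i j a c e g : ℕ) (G : SimpleGraph ℕ) : Prop :=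
  Tri V i j G ∧ (j = i + 1 ∨ Special G i j a c e g)

theorem triCost_edge (i α : ℕ) : triCost (SimpleGraph.edge i (i + 1)) i (i + 1) α = 1 + α := by
  have h : (SimpleGraph.edge i (i + 1)).dist i (i + 1) = 1 :=
    SimpleGraph.dist_eq_one_iff_adj.2 (Tri.edge (V := fun _ _ => True) i).adj_ends
  unfold triCost
  simp only [sum_Icc_eq_add_Ioc (Nat.le_succ i)]
  simp [h]

theorem Tri.eq_edge {G : SimpleGraph ℕ} (h : Tri V i (i + 1) G) :
    G = SimpleGraph.edge i (i + 1) := by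
  generalize hj : i + 1 = j at h
  cases h with
  | edge => rfl
  | node h₁ h₂ =>
    have := h₁.lt
    have := h₂.lt
    omega

/-- A side that is a single edge is separate, since EXT then ignores its special vertices and fixes
`a, c` by the side condition instead. In the other case `a + 1 ≤ c - 1` excludes a truncated
subtraction. -/
theorem TriSpecial.sides {d a' g' : ℕ} {G : SimpleGraph ℕ}
    (h : TriSpecial V i d a' (a + 1) (c - 1) g' G)
    (hc : if d = i + 1 then a = i ∧ c = d else a' ≤ a + 1 ∧ a + 1 ≤ c - 1 ∧ c - 1 ≤ g') :
    Sides G i d a c := by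
  split_ifs at hc with hd
  · obtain ⟨rfl, rfl⟩ := hc
    subst hd
    rw [h.1.eq_edge]
    exact Tri.sides_edge a
  · have := (h.1.sides_of_special (h.2.resolve_left hd)).1
    rwa [show a + 1 - 1 = a by omega, show c - 1 + 1 = c by omega] at this

theorem Tri.exists_triSpecial {d : ℕ} {G : SimpleGraph ℕ} (h : Tri V i d G)
    (hs : Sides G i d a c) : ∃ a' g', TriSpecial V i d a' (a + 1) (c - 1) g' G ∧
      (i ≤ a' ∧ a' ≤ d) ∧ (i ≤ g' ∧ g' ≤ d) ∧
      (if d = i + 1 then a = i ∧ c = d else a' ≤ a + 1 ∧ a + 1 ≤ c - 1 ∧ c - 1 ≤ g') := by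
  have := h.lt
  have h₁ := hs.le_left
  have h₂ := hs.lt
  have h₃ := hs.le_right
  by_cases hd : d = i + 1
  · subst hd
    -- For a single edge `a'` and `g'` are irrelevant; they only have to lie in the range of the
    -- search.
    refine ⟨i, i, ⟨h, .inl rfl⟩, by omega, by omega, ?_⟩
    rw [if_pos rfl]
    omega
  · obtain ⟨a', c', e', g', hsp⟩ := h.exists_special (by omega)
    obtain ⟨hs', h₄, h₅, h₆, h₇, h₈⟩ := h.sides_of_special hsp
    obtain ⟨rfl, rfl⟩ := hs.unique hs'
    refine ⟨a', g', ⟨h, .inr ?_⟩, by omega, by omega, ?_⟩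
    · rwa [show c' - 1 + 1 = c' by omega, show e' + 1 - 1 = e' by omega]
    · rw [if_neg hd]
      omega

theorem Admissible.node {d a' g' a'' g'' : ℕ} {G₁ G₂ : SimpleGraph ℕ}
    (h : Admissible V i j a c e g d a' g' a'' g'')
    (h₁ : TriSpecial V i d a' (a + 1) (c - 1) g' G₁)
    (h₂ : TriSpecial V d j a'' (e + 1) (g - 1) g'' G₂) :
    TriSpecial V i j a c e g (G₁ ⊔ G₂ ⊔ SimpleGraph.edge i j) ∧
      triCost (G₁ ⊔ G₂ ⊔ SimpleGraph.edge i j) i j α =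
        triCost G₁ i d (α + (j - d)) + triCost G₂ d j (α + (d - i)) + extOffset i j a e g α d := by
  have hn : IsNode V i d j G₁ G₂ (G₁ ⊔ G₂ ⊔ SimpleGraph.edge i j) := ⟨h₁.1, h₂.1, rfl⟩
  have s₁ := h₁.sides h.left
  have s₂ := h₂.sides h.right
  exact ⟨⟨.node h₁.1 h₂.1 h.sees_left h.sees_right, .inr (hn.special_iff.2 ⟨s₁, s₂⟩)⟩,
    hn.triCost_eq s₁ s₂ α⟩

/-- The triangulation itself tells the recursion which `d` and which special vertices of the two
parts to guess. -/
theorem ext_le_triCost (hV : ∀ k, i ≤ k → k < j → V k (k + 1)) {G : SimpleGraph ℕ}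
    (h : TriSpecial V i j a c e g G) (α : ℕ) :
    ext V i j a c e g α ≤ (triCost G i j α : WithTop ℤ) := by
  obtain ⟨h, hs⟩ := h
  induction h generalizing a c e g α with
  | edge i => rw [ext_edge, triCost_edge]
  | @node i d j G₁ G₂ h₁ h₂ v₁ v₂ ih₁ ih₂ =>
    have := h₁.lt
    have := h₂.lt
    have hn : IsNode V i d j G₁ G₂ (G₁ ⊔ G₂ ⊔ SimpleGraph.edge i j) := ⟨h₁, h₂, rfl⟩
    obtain ⟨s₁, s₂⟩ := hn.special_iff.1 (hs.resolve_left (by omega))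
    obtain ⟨a', g', t₁, ha', hg', hl⟩ := h₁.exists_triSpecial s₁
    obtain ⟨a'', g'', t₂, ha'', hg'', hr⟩ := h₂.exists_triSpecial s₂
    refine ((le_ext_iff hV (by omega) _).1 le_rfl d a' g' a'' g''
      ⟨by omega, by omega, ha', hg', ha'', hg'', v₁, v₂, hl, hr⟩).trans ?_
    rw [hn.triCost_eq s₁ s₂ α, extVal, WithTop.coe_add, WithTop.coe_add]
    exact add_le_add (add_le_add (ih₁ (fun k hk hk' => hV k hk (by omega)) _ t₁.2)
      (ih₂ (fun k hk hk' => hV k (by omega) hk') _ t₂.2)) le_rfl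

/-- The choices that attain the minimum are glued to a triangulation of exactly that cost; the
offset is correct because the side conditions force the prescribed special vertices. -/
theorem exists_triCost_eq_ext (hV : ∀ k, i ≤ k → k < j → V k (k + 1)) (hij : i < j)
    (h : ext V i j a c e g α ≠ ⊤) :
    ∃ G, TriSpecial V i j a c e g G ∧ ext V i j a c e g α = (triCost G i j α : WithTop ℤ) := by
  induction hm : j - i using Nat.strong_induction_on generalizing i j a c e g α with
  | _ m ih =>
    subst hm
    by_cases hj : j = i + 1
    · subst hj
      exact ⟨_, ⟨.edge i, .inl rfl⟩, by rw [ext_edge, triCost_edge]⟩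
    · obtain ⟨d, a', g', a'', g'', hd, he⟩ := exists_extVal_eq hV (by omega) h
      have l := hd.lt_d
      have r := hd.d_lt
      rw [he, extVal, WithTop.add_ne_top, WithTop.add_ne_top] at h
      obtain ⟨G₁, t₁, e₁⟩ := ih (d - i) (by omega) (fun k hk hk' => hV k hk (by omega)) l h.1.1 rfl
      obtain ⟨G₂, t₂, e₂⟩ := ih (j - d) (by omega) (fun k hk hk' => hV k (by omega) hk') r h.1.2 rfl
      obtain ⟨t, e⟩ := hd.node (α := α) t₁ t₂
      exact ⟨_, t, by rw [he, e, extVal, e₁, e₂, WithTop.coe_add, WithTop.coe_add]⟩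

theorem triCost_nonneg (G : SimpleGraph ℕ) (i j α : ℕ) : 0 ≤ triCost G i j α := by
  unfold triCost
  positivity

end Recursion

section PlaneGeometry

open Filter Topology

/-! ### Crossing parities -/

section Segments

variable {A B q : ℝ × ℝ}

theorem mem_segment_iff_coord : q ∈ segment ℝ A B ↔ ∃ t : ℝ, 0 ≤ t ∧ t ≤ 1 ∧
    q.1 = A.1 + t * (B.1 - A.1) ∧ q.2 = A.2 + t * (B.2 - A.2) := by
  rw [segment_eq_image', Set.mem_image]
  constructor
  · rintro ⟨t, ht, rfl⟩
    exact ⟨t, ht.1, ht.2, by simp, by simp⟩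
  · rintro ⟨t, h0, h1, h2, h3⟩
    exact ⟨t, ⟨h0, h1⟩, Prod.ext (by simp [h2]) (by simp [h3])⟩

theorem mem_openSegment_iff_coord : q ∈ openSegment ℝ A B ↔ ∃ t : ℝ, 0 < t ∧ t < 1 ∧
    q.1 = A.1 + t * (B.1 - A.1) ∧ q.2 = A.2 + t * (B.2 - A.2) := by
  rw [openSegment_eq_image', Set.mem_image]
  constructor
  · rintro ⟨t, ht, rfl⟩
    exact ⟨t, ht.1, ht.2, by simp, by simp⟩
  · rintro ⟨t, h0, h1, h2, h3⟩
    exact ⟨t, ⟨h0, h1⟩, Prod.ext (by simp [h2]) (by simp [h3])⟩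

/-- Twice the signed area of the triangle `A B q`. -/
def crossP (A B q : ℝ × ℝ) : ℝ := (B.1 - A.1) * (q.2 - A.2) - (B.2 - A.2) * (q.1 - A.1)

theorem crossP_swap (A B q : ℝ × ℝ) : crossP B A q = -crossP A B q := by
  unfold crossP
  ring

theorem continuous_crossP (A B : ℝ × ℝ) : Continuous (crossP A B) := by
  unfold crossP
  fun_prop

/-- The horizontal ray from `q` to the right crosses the segment. -/
def SegCrosses (A B q : ℝ × ℝ) : Prop :=
  Xor (q.2 < A.2) (q.2 < B.2) ∧ ∃ x, q.1 < x ∧ (x, q.2) ∈ segment ℝ A B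

theorem segCrosses_comm : SegCrosses A B q ↔ SegCrosses B A q := by
  unfold SegCrosses
  rw [xor_comm, segment_symm]

/-- At the height of `q` the segment has abscissa `q.1 + crossP A B q / (B.2 - A.2)`. -/
theorem exists_right_iff (h : A.2 ≤ q.2) (h' : q.2 < B.2) :
    (∃ x, q.1 < x ∧ (x, q.2) ∈ segment ℝ A B) ↔ 0 < crossP A B q := by
  have hd : 0 < B.2 - A.2 := by linarith
  simp only [mem_segment_iff_coord]
  constructor
  · rintro ⟨x, hx, t, h0, h1, h2, h3⟩
    have : crossP A B q = (B.2 - A.2) * (x - q.1) := by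
      unfold crossP
      rw [h3, h2]
      ring
    rw [this]
    exact mul_pos hd (by linarith)
  · intro hc
    refine ⟨A.1 + (q.2 - A.2) / (B.2 - A.2) * (B.1 - A.1), ?_, (q.2 - A.2) / (B.2 - A.2),
      div_nonneg (by linarith) hd.le, (div_le_one hd).2 (by linarith), rfl, ?_⟩
    · have : A.1 + (q.2 - A.2) / (B.2 - A.2) * (B.1 - A.1) - q.1 = crossP A B q / (B.2 - A.2) := by
        unfold crossP
        field_simp
        ring
      have := div_pos hc hd
      linarith
    · field_simp
      ring

theorem segCrosses_iff : SegCrosses A B q ↔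
    (A.2 ≤ q.2 ∧ q.2 < B.2 ∧ 0 < crossP A B q) ∨ (B.2 ≤ q.2 ∧ q.2 < A.2 ∧ crossP A B q < 0) := by
  unfold SegCrosses Xor
  constructor
  · rintro ⟨⟨h, h'⟩ | ⟨h, h'⟩, hx⟩
    · right
      rw [segment_symm, exists_right_iff (not_lt.1 h') h, crossP_swap] at hx
      exact ⟨not_lt.1 h', h, by linarith⟩
    · left
      rw [exists_right_iff (not_lt.1 h') h] at hx
      exact ⟨not_lt.1 h', h, hx⟩
  · rintro (⟨h, h', hx⟩ | ⟨h, h', hx⟩)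
    · exact ⟨.inr ⟨h', not_lt.2 h⟩, (exists_right_iff h h').2 hx⟩
    · refine ⟨.inl ⟨h', not_lt.2 h⟩, ?_⟩
      rw [segment_symm]
      refine (exists_right_iff h h').2 ?_
      rw [crossP_swap]
      linarith

theorem mem_segment_of_crossP_eq_zero (hc : crossP A B q = 0) (h : A.2 ≤ q.2) (h' : q.2 ≤ B.2)
    (hAB : A.2 < B.2) : q ∈ segment ℝ A B := by
  have hd : 0 < B.2 - A.2 := by linarith
  rw [mem_segment_iff_coord]
  refine ⟨(q.2 - A.2) / (B.2 - A.2), div_nonneg (by linarith) hd.le,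
    (div_le_one hd).2 (by linarith), ?_, ?_⟩
  · unfold crossP at hc
    field_simp
    linarith
  · field_simp
    ring

theorem mem_segment_of_horizontal (hA : A.2 = q.2) (hB : B.2 = q.2) (h : A.1 ≤ q.1)
    (h' : q.1 ≤ B.1) : q ∈ segment ℝ A B := by
  rw [mem_segment_iff_coord]
  rcases h.eq_or_lt with h₁ | h₁
  · exact ⟨0, by norm_num, by norm_num, by simp [h₁], by simp [hA]⟩
  · have hd : 0 < B.1 - A.1 := by linarith
    refine ⟨(q.1 - A.1) / (B.1 - A.1), div_nonneg (by linarith) hd.le,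
      (div_le_one hd).2 (by linarith), ?_, ?_⟩
    · field_simp
      ring
    · rw [hA, hB]
      ring

-- Valued in `ZMod 2`, so that parities are sums and equal contributions cancel in pairs.
open Classical in
noncomputable def crossNum (A B q : ℝ × ℝ) : ZMod 2 := if SegCrosses A B q then 1 else 0

theorem crossNum_comm (A B q : ℝ × ℝ) : crossNum A B q = crossNum B A q := by
  unfold crossNum
  rw [segCrosses_comm]

open Classical in
/-- `A` lies on the open horizontal ray from `q` to the right. -/
noncomputable def rayVertex (A q : ℝ × ℝ) : ZMod 2 := if A.2 = q.2 ∧ q.1 < A.1 then 1 else 0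

theorem rayVertex_of_ne (h : A.2 ≠ q.2) : rayVertex A q = 0 := if_neg fun h' => h h'.1

theorem rayVertex_of_not_lt (h : ¬ q.1 < A.1) : rayVertex A q = 0 := if_neg fun h' => h h'.2

theorem rayVertex_of_lt (h : A.2 = q.2) (h' : q.1 < A.1) : rayVertex A q = 1 := if_pos ⟨h, h'⟩

theorem eventually_signs (A B q : ℝ × ℝ) : ∀ᶠ q' in 𝓝 q,
    (A.2 < q.2 → A.2 < q'.2) ∧ (q.2 < A.2 → q'.2 < A.2) ∧
    (B.2 < q.2 → B.2 < q'.2) ∧ (q.2 < B.2 → q'.2 < B.2) ∧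
    (0 < crossP A B q → 0 < crossP A B q') ∧ (crossP A B q < 0 → crossP A B q' < 0) := by
  have key : ∀ (f g : ℝ × ℝ → ℝ), Continuous f → Continuous g →
      ∀ᶠ q' in 𝓝 q, f q < g q → f q' < g q' := by
    intro f g hf hg
    by_cases h : f q < g q
    · filter_upwards [hf.continuousAt.eventually_lt hg.continuousAt h] with q' hq' _ using hq'
    · exact Eventually.of_forall fun _ h' => absurd h' h
  have hc := continuous_crossP A B
  filter_upwards [key (fun _ => A.2) Prod.snd continuous_const continuous_snd,
    key Prod.snd (fun _ => A.2) continuous_snd continuous_const,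
    key (fun _ => B.2) Prod.snd continuous_const continuous_snd,
    key Prod.snd (fun _ => B.2) continuous_snd continuous_const,
    key (fun _ => 0) (crossP A B) continuous_const hc,
    key (crossP A B) (fun _ => 0) hc continuous_const] with q' h₁ h₂ h₃ h₄ h₅ h₆
  exact ⟨h₁, h₂, h₃, h₄, h₅, h₆⟩

theorem two_eq_zero_zmod : (1 + 1 : ZMod 2) = 0 := by decide

theorem crossNum_eq_zero_of_below (h : A.2 ≤ q.2) (h' : B.2 ≤ q.2) : crossNum A B q = 0 := by
  rw [crossNum, if_neg]
  rw [segCrosses_iff]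
  rintro (⟨-, h₁, -⟩ | ⟨-, h₁, -⟩) <;> linarith

theorem crossNum_eq_zero_of_above (h : q.2 < A.2) (h' : q.2 < B.2) : crossNum A B q = 0 := by
  rw [crossNum, if_neg]
  rw [segCrosses_iff]
  rintro (⟨h₁, -, -⟩ | ⟨h₁, -, -⟩) <;> linarith

open Classical in
theorem crossNum_of_up (h : A.2 ≤ q.2) (h' : q.2 < B.2) :
    crossNum A B q = if 0 < crossP A B q then 1 else 0 := by
  rw [crossNum, segCrosses_iff]
  congr 1
  simp [h, h', not_lt.2 h]

open Classical in
theorem crossNum_of_down (h : B.2 ≤ q.2) (h' : q.2 < A.2) :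
    crossNum A B q = if crossP A B q < 0 then 1 else 0 := by
  rw [crossNum, segCrosses_iff]
  congr 1
  simp [h, h', not_lt.2 h]

open Classical in
/-- The change of the crossing number near a point that is not on the segment. -/
theorem eventually_crossNum (hq : q ∉ segment ℝ A B) : ∀ᶠ q' in 𝓝 q,
    crossNum A B q' = crossNum A B q + if q'.2 < q.2 then rayVertex A q + rayVertex B q else 0 := by
  wlog hAB : A.2 ≤ B.2 generalizing A B
  · rw [segment_symm] at hq
    filter_upwards [this hq (le_of_not_ge hAB)] with q' h
    rw [crossNum_comm A B q', crossNum_comm A B q, add_comm (rayVertex A q)]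
    exact h
  filter_upwards [eventually_signs A B q] with q' ⟨h₁, h₂, h₃, h₄, h₅, h₆⟩
  rcases lt_trichotomy B.2 q.2 with hB | hB | hB
  · have hA : A.2 < q.2 := by linarith
    rw [crossNum_eq_zero_of_below (h₁ hA).le (h₃ hB).le, crossNum_eq_zero_of_below hA.le hB.le,
      rayVertex_of_ne hA.ne, rayVertex_of_ne hB.ne]
    simp
  -- The upper end is at the height of `q`. The half-open rule counts no crossing at `q` or above;
  -- just below `q` the edge is crossed exactly if `B` lies to the right.
  · rcases lt_or_eq_of_le hAB with hA | hA
    · have hA' : A.2 < q.2 := by linarith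
      have hc : crossP A B q ≠ 0 := fun hc =>
        hq (mem_segment_of_crossP_eq_zero hc hA'.le hB.ge hA)
      rw [crossNum_eq_zero_of_below hA'.le hB.le, rayVertex_of_ne hA'.ne]
      by_cases hq' : q'.2 < q.2
      · rw [crossNum_of_up (h₁ hA').le (by linarith), if_pos hq']
        have hcr : crossP A B q = (B.2 - A.2) * (B.1 - q.1) := by
          unfold crossP
          rw [hB]
          ring
        by_cases hr : q.1 < B.1
        · have : 0 < crossP A B q := by
            rw [hcr]
            exact mul_pos (by linarith) (by linarith)
          rw [if_pos (h₅ this), rayVertex_of_lt hB hr]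
          simp
        · have : crossP A B q < 0 := by
            refine lt_of_le_of_ne ?_ hc
            rw [hcr]
            exact mul_nonpos_of_nonneg_of_nonpos (by linarith) (by linarith)
          rw [if_neg (not_lt.2 (h₆ this).le), rayVertex_of_not_lt hr]
          simp
      · rw [crossNum_eq_zero_of_below (h₁ hA').le (by linarith), if_neg hq']
        simp
    · have hA' : A.2 = q.2 := by linarith
      -- A horizontal segment that misses `q` has both ends to the right of `q` or none, so its
      -- corrections cancel.
      have hv : rayVertex A q = rayVertex B q := by
        have e₁ : ¬ (A.1 ≤ q.1 ∧ q.1 ≤ B.1) := fun h =>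
          hq (mem_segment_of_horizontal hA' hB h.1 h.2)
        have e₂ : ¬ (B.1 ≤ q.1 ∧ q.1 ≤ A.1) := fun h =>
          hq (segment_symm ℝ A B ▸ mem_segment_of_horizontal hB hA' h.1 h.2)
        unfold rayVertex
        congr 1
        simp only [hA', hB, true_and, eq_iff_iff]
        constructor
        · intro h
          by_contra h'
          exact e₂ ⟨not_lt.1 h', h.le⟩
        · intro h
          by_contra h'
          exact e₁ ⟨not_lt.1 h', h.le⟩
      rw [hv, CharTwo.add_self_eq_zero, crossNum_eq_zero_of_below hA'.le hB.le]
      by_cases hq' : q'.2 < q.2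
      · rw [crossNum_eq_zero_of_above (by linarith) (by linarith)]
        simp
      · rw [crossNum_eq_zero_of_below (by linarith) (by linarith)]
        simp
  · rw [rayVertex, rayVertex, if_neg (c := B.2 = q.2 ∧ q.1 < B.1) (fun h => hB.ne' h.1)]
    rcases lt_trichotomy A.2 q.2 with hA | hA | hA
    · have hc : crossP A B q ≠ 0 := fun hc =>
        hq (mem_segment_of_crossP_eq_zero hc hA.le hB.le (by linarith))
      rw [if_neg (c := A.2 = q.2 ∧ q.1 < A.1) (fun h => hA.ne h.1),
        crossNum_of_up (h₁ hA).le (h₄ hB), crossNum_of_up hA.le hB]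
      rcases hc.lt_or_gt with hc | hc
      · rw [if_neg (not_lt.2 (h₆ hc).le), if_neg (not_lt.2 hc.le)]
        simp
      · rw [if_pos (h₅ hc), if_pos hc]
        simp
    · have hc : crossP A B q ≠ 0 := fun hc =>
        hq (mem_segment_of_crossP_eq_zero hc hA.le hB.le (by linarith))
      have hcr : crossP A B q = (B.2 - A.2) * (A.1 - q.1) := by
        unfold crossP
        rw [hA]
        ring
      rw [crossNum_of_up hA.le hB]
      have hs : 0 < crossP A B q ↔ (A.2 = q.2 ∧ q.1 < A.1) := by
        rw [hcr, mul_pos_iff_of_pos_left (by linarith), sub_pos]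
        simp [hA]
      by_cases hq' : q'.2 < q.2
      · rw [crossNum_eq_zero_of_above (by linarith) (h₄ hB), if_pos hq']
        simp only [hs, add_zero]
        rw [CharTwo.add_self_eq_zero]
      · rw [crossNum_of_up (by linarith) (h₄ hB), if_neg hq', add_zero]
        rcases hc.lt_or_gt with hc | hc
        · rw [if_neg (not_lt.2 (h₆ hc).le), if_neg (not_lt.2 hc.le)]
        · rw [if_pos (h₅ hc), if_pos hc]
    · rw [if_neg (c := A.2 = q.2 ∧ q.1 < A.1) (fun h => hA.ne' h.1),
        crossNum_eq_zero_of_above (h₂ hA) (h₄ hB), crossNum_eq_zero_of_above hA hB]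
      simp

open Classical in
/-- The crossing number changes from one side of the segment to the other. -/
theorem eventually_crossNum_of_mem (hq : q ∈ openSegment ℝ A B) (hAB : A ≠ B) :
    ∃ κ : ZMod 2, ∀ᶠ q' in 𝓝 q, crossP A B q' ≠ 0 → crossNum A B q' =
      κ + (if 0 < crossP A B q' then 1 else 0) +
        if q'.2 < q.2 then rayVertex A q + rayVertex B q else 0 := by
  obtain ⟨t, h0, h1, hx, hy⟩ := mem_openSegment_iff_coord.1 hq
  rcases lt_trichotomy A.2 B.2 with h | h | h
  · have hA : A.2 < q.2 := by nlinarith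
    have hB : q.2 < B.2 := by nlinarith
    refine ⟨0, ?_⟩
    filter_upwards [eventually_signs A B q] with q' ⟨h₁, h₂, h₃, h₄, _, _⟩ hc
    rw [crossNum_of_up (h₁ hA).le (h₄ hB), rayVertex_of_ne hA.ne,
      rayVertex_of_ne hB.ne']
    simp
  · have hA : A.2 = q.2 := by rw [hy, ← h]; ring
    have hB : B.2 = q.2 := by rw [← hA, h]
    have hne : A.1 ≠ B.1 := fun h' => hAB (Prod.ext h' h)
    have hcr : ∀ q' : ℝ × ℝ, crossP A B q' = (B.1 - A.1) * (q'.2 - q.2) := by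
      intro q'
      unfold crossP
      rw [hA, hB]
      ring
    -- A horizontal edge is never crossed itself. Its jump is hidden in the correction: exactly one
    -- end lies to the right of `q`, so the correction is 1 below the edge.
    have hz : ∀ q' : ℝ × ℝ, crossP A B q' ≠ 0 → crossNum A B q' = 0 := by
      intro q' hc
      rcases lt_or_ge q'.2 q.2 with h' | h'
      · exact crossNum_eq_zero_of_above (by linarith) (by linarith)
      · exact crossNum_eq_zero_of_below (by linarith) (by linarith)
    rcases hne.lt_or_gt with h' | h'
    · refine ⟨1, Eventually.of_forall fun q' hc => ?_⟩
      have e₁ : ¬ q.1 < A.1 := by nlinarith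
      have e₂ : q.1 < B.1 := by nlinarith
      rw [hz q' hc, rayVertex_of_not_lt e₁, rayVertex_of_lt hB e₂]
      rw [hcr] at hc ⊢
      rcases lt_or_ge q'.2 q.2 with h'' | h''
      · rw [if_pos h'', if_neg (by nlinarith)]
        decide
      · have : q'.2 - q.2 ≠ 0 := right_ne_zero_of_mul hc
        have h3 : 0 < q'.2 - q.2 := lt_of_le_of_ne (by linarith) this.symm
        rw [if_neg (not_lt.2 h''), if_pos (mul_pos (by linarith) h3)]
        decide
    · refine ⟨0, Eventually.of_forall fun q' hc => ?_⟩
      have e₁ : q.1 < A.1 := by nlinarith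
      have e₂ : ¬ q.1 < B.1 := by nlinarith
      rw [hz q' hc, rayVertex_of_not_lt e₂, rayVertex_of_lt hA e₁]
      rw [hcr] at hc ⊢
      rcases lt_or_ge q'.2 q.2 with h'' | h''
      · rw [if_pos h'', if_pos (mul_pos_of_neg_of_neg (by linarith) (by linarith))]
        decide
      · rw [if_neg (not_lt.2 h''), if_neg (by nlinarith)]
        decide
  · have hA : q.2 < A.2 := by nlinarith
    have hB : B.2 < q.2 := by nlinarith
    refine ⟨1, ?_⟩
    filter_upwards [eventually_signs A B q] with q' ⟨h₁, h₂, h₃, h₄, _, _⟩ hc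
    rw [crossNum_of_down (h₃ hB).le (h₂ hA), rayVertex_of_ne hA.ne',
      rayVertex_of_ne hB.ne]
    rcases hc.lt_or_gt with hc | hc
    · rw [if_pos hc, if_neg (not_lt.2 hc.le)]
      simp
    · rw [if_neg (not_lt.2 hc.le), if_pos hc]
      simp [two_eq_zero_zmod]

end Segments

/-! ### The parity of a point with respect to a polygon -/

section Parity

variable {n : ℕ} [NeZero n] {p : Fin n → ℝ × ℝ} {q : ℝ × ℝ}

/-- The parity of the number of edges that the horizontal ray from `q` to the right crosses. -/
noncomputable def parity (p : Fin n → ℝ × ℝ) (q : ℝ × ℝ) : ZMod 2 :=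
  ∑ k, crossNum (p k) (p (k + 1)) q

theorem mem_polygonInterior_iff :
    q ∈ polygonInterior p ↔ q ∉ polygonBoundary p ∧ parity p q = 1 := by
  classical
  have : (({k | RayCrosses p q k}.ncard : ℕ) : ZMod 2) = parity p q := by
    rw [Set.ncard_eq_toFinset_card', Set.toFinset_ofPred, Finset.card_filter, Nat.cast_sum]
    refine Finset.sum_congr rfl fun k _ => ?_
    simp only [crossNum, Nat.cast_ite, Nat.cast_one, Nat.cast_zero]
    rfl
  rw [← this, ZMod.natCast_eq_one_iff_odd]
  rfl

theorem isClosed_segment (A B : ℝ × ℝ) : IsClosed (segment ℝ A B) := by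
  rw [segment_eq_image']
  exact (isCompact_Icc.image (by fun_prop)).isClosed

theorem isClosed_polygonBoundary (p : Fin n → ℝ × ℝ) : IsClosed (polygonBoundary p) :=
  isClosed_iUnion_of_finite fun _ => isClosed_segment _ _

/-- Each vertex belongs to two edges. This cancellation makes the parity locally constant although
single crossing numbers jump when the ray passes a vertex. -/
theorem sum_rayVertex (p : Fin n → ℝ × ℝ) (q : ℝ × ℝ) :
    ∑ k, (rayVertex (p k) q + rayVertex (p (k + 1)) q) = 0 := by
  have := Equiv.sum_comp (Equiv.addRight 1) fun k => rayVertex (p k) q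
  simp only [Equiv.coe_addRight] at this
  rw [Finset.sum_add_distrib, this, CharTwo.add_self_eq_zero]

theorem eventually_parity_eq (hq : q ∉ polygonBoundary p) :
    ∀ᶠ q' in 𝓝 q, parity p q' = parity p q := by
  classical
  have h : ∀ k, q ∉ segment ℝ (p k) (p (k + 1)) := fun k hk => hq (Set.mem_iUnion.2 ⟨k, hk⟩)
  filter_upwards [eventually_all.2 fun k => eventually_crossNum (h k)] with q' hq'
  unfold parity
  rw [Finset.sum_congr rfl fun k _ => hq' k, Finset.sum_add_distrib]
  split_ifs
  · rw [sum_rayVertex, add_zero]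
  · rw [Finset.sum_const_zero, add_zero]

-- Near an interior point of one edge, the other edges contribute constants and corrections. The
-- corrections of all edges, including this one, cancel, and only the side of the edge matters.
open Classical in
theorem eventually_parity_of_mem {k : Fin n} (hne : p k ≠ p (k + 1))
    (hq : q ∈ openSegment ℝ (p k) (p (k + 1))) (hk : ∀ l ≠ k, q ∉ polygonEdge p l) :
    ∃ κ : ZMod 2, ∀ᶠ q' in 𝓝 q, crossP (p k) (p (k + 1)) q' ≠ 0 →
      parity p q' = κ + if 0 < crossP (p k) (p (k + 1)) q' then 1 else 0 := by
  obtain ⟨κ, hκ⟩ := eventually_crossNum_of_mem hq hne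
  refine ⟨κ + ∑ l ∈ Finset.univ.erase k, crossNum (p l) (p (l + 1)) q, ?_⟩
  have h : ∀ᶠ q' in 𝓝 q, ∀ l, l ≠ k → crossNum (p l) (p (l + 1)) q' =
      crossNum (p l) (p (l + 1)) q +
        if q'.2 < q.2 then rayVertex (p l) q + rayVertex (p (l + 1)) q else 0 := by
    refine eventually_all.2 fun l => ?_
    by_cases hl : l = k
    · exact Eventually.of_forall fun _ h => absurd hl h
    · filter_upwards [eventually_crossNum (hk l hl)] with q' h _ using h
  filter_upwards [hκ, h] with q' h₁ h₂ hc
  have h₃ : ∑ l ∈ Finset.univ.erase k, crossNum (p l) (p (l + 1)) q' =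
      ∑ l ∈ Finset.univ.erase k, crossNum (p l) (p (l + 1)) q +
      ∑ l ∈ Finset.univ.erase k,
        if q'.2 < q.2 then rayVertex (p l) q + rayVertex (p (l + 1)) q else 0 := by
    rw [← Finset.sum_add_distrib]
    exact Finset.sum_congr rfl fun l hl => h₂ l (Finset.ne_of_mem_erase hl)
  have h₄ : (if q'.2 < q.2 then rayVertex (p k) q + rayVertex (p (k + 1)) q else 0) +
      ∑ l ∈ Finset.univ.erase k,
        (if q'.2 < q.2 then rayVertex (p l) q + rayVertex (p (l + 1)) q else 0) = 0 := by
    rw [Finset.add_sum_erase _ (fun l => if q'.2 < q.2 then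
      rayVertex (p l) q + rayVertex (p (l + 1)) q else 0) (Finset.mem_univ k)]
    split_ifs
    · exact sum_rayVertex p q
    · exact Finset.sum_const_zero
  unfold parity
  rw [← Finset.add_sum_erase _ _ (Finset.mem_univ k), h₁ hc, h₃]
  linear_combination h₄

theorem parity_eq_of_isPreconnected {S : Set (ℝ × ℝ)} (hS : IsPreconnected S)
    (hd : ∀ x ∈ S, x ∉ polygonBoundary p) {x y : ℝ × ℝ} (hx : x ∈ S) (hy : y ∈ S) :
    parity p x = parity p y := by
  apply ZMod.val_injective 2
  refine hS.constant (f := fun z => (parity p z).val) ?_ hx hy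
  intro z hz
  refine ContinuousAt.continuousWithinAt ?_
  refine continuousAt_const.congr (f := fun _ => (parity p z).val) ?_
  filter_upwards [eventually_parity_eq (hd z hz)] with z' hz'
  rw [hz']

theorem parity_eq_of_path {γ : ℝ → ℝ × ℝ} (hγ : Continuous γ) {I : Set ℝ} (hI : I.OrdConnected)
    (hd : ∀ t ∈ I, γ t ∉ polygonBoundary p) {s t : ℝ} (hs : s ∈ I) (ht : t ∈ I) :
    parity p (γ s) = parity p (γ t) := by
  refine parity_eq_of_isPreconnected (hI.isPreconnected.image γ hγ.continuousOn) ?_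
    (Set.mem_image_of_mem _ hs) (Set.mem_image_of_mem _ ht)
  rintro _ ⟨t, ht, rfl⟩
  exact hd t ht

theorem parity_eq_of_openSegment {A B : ℝ × ℝ}
    (hd : ∀ x ∈ openSegment ℝ A B, x ∉ polygonBoundary p) {x y : ℝ × ℝ}
    (hx : x ∈ openSegment ℝ A B) (hy : y ∈ openSegment ℝ A B) : parity p x = parity p y :=
  parity_eq_of_isPreconnected (convex_openSegment A B).isPreconnected hd hx hy

/-- The half-open version: `B` may lie on the boundary. It transports the parity of a vertex along a
diagonal that starts there. -/
theorem parity_eq_of_left {A B : ℝ × ℝ} (hA : A ∉ polygonBoundary p)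
    (hd : ∀ x ∈ openSegment ℝ A B, x ∉ polygonBoundary p) {x : ℝ × ℝ}
    (hx : x ∈ openSegment ℝ A B) : parity p x = parity p A := by
  have hS : Convex ℝ (insert A (openSegment ℝ A B)) := by
    rw [openSegment_eq_image_lineMap, show insert A (AffineMap.lineMap A B '' Set.Ioo (0 : ℝ) 1) =
      AffineMap.lineMap A B '' Set.Ico (0 : ℝ) 1 by
        rw [← Set.Ioo_insert_left one_pos, Set.image_insert_eq, AffineMap.lineMap_apply_zero]]
    exact (convex_Ico 0 1).affine_image (AffineMap.lineMap A B)
  refine parity_eq_of_isPreconnected hS.isPreconnected ?_ (.inr hx) (.inl rfl)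
  rintro y (rfl | hy)
  · exact hA
  · exact hd y hy

/-- The vertices as a periodic sequence. -/
def cyc (p : Fin n → ℝ × ℝ) (k : ℕ) : ℝ × ℝ := p (Fin.ofNat n k)

theorem cyc_val (p : Fin n → ℝ × ℝ) (k : Fin n) : cyc p k = p k := by
  simp [cyc]

theorem cyc_of_lt {k : ℕ} (hk : k < n) : cyc p k = p ⟨k, hk⟩ :=
  cyc_val p ⟨k, hk⟩

theorem cyc_succ (p : Fin n → ℝ × ℝ) (k : Fin n) : cyc p (k + 1) = p (k + 1) := by
  unfold cyc
  congr 1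
  ext
  simp [Fin.val_add]

theorem cyc_add_self (p : Fin n → ℝ × ℝ) (k : ℕ) : cyc p (k + n) = cyc p k := by
  unfold cyc
  congr 1
  ext
  simp

theorem cyc_self (p : Fin n → ℝ × ℝ) : cyc p n = cyc p 0 := by
  rw [← cyc_add_self p 0, zero_add]

theorem mem_polygonBoundary_iff :
    q ∈ polygonBoundary p ↔ ∃ k < n, q ∈ segment ℝ (cyc p k) (cyc p (k + 1)) := by
  simp only [polygonBoundary, Set.mem_iUnion, polygonEdge]
  constructor
  · rintro ⟨k, hk⟩
    exact ⟨k, k.2, by rwa [cyc_val, cyc_succ]⟩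
  · rintro ⟨k, hk, h⟩
    refine ⟨⟨k, hk⟩, ?_⟩
    rw [← cyc_val p, ← cyc_succ p]
    exact h

theorem parity_eq_sum_range (p : Fin n → ℝ × ℝ) (q : ℝ × ℝ) :
    parity p q = ∑ k ∈ Finset.range n, crossNum (cyc p k) (cyc p (k + 1)) q := by
  rw [← Fin.sum_univ_eq_sum_range (fun k => crossNum (cyc p k) (cyc p (k + 1)) q) n]
  unfold parity
  refine Finset.sum_congr rfl fun k _ => ?_
  rw [cyc_val, cyc_succ]

/-- The polygon with the numbering of the vertices rotated. -/
def rot (p : Fin n → ℝ × ℝ) (r : ℕ) : Fin n → ℝ × ℝ := fun k => cyc p (k + r)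

theorem cyc_mod (p : Fin n → ℝ × ℝ) (k : ℕ) : cyc p (k % n) = cyc p k := by
  unfold cyc
  congr 1
  ext
  simp

theorem cyc_rot (p : Fin n → ℝ × ℝ) (r k : ℕ) : cyc (rot p r) k = cyc p (k + r) := by
  rw [cyc, rot, Fin.val_ofNat, ← cyc_mod p (k % n + r), ← cyc_mod p (k + r), Nat.mod_add_mod]

/-- The polygon with vertices `0, …, m`. -/
def sub (p : Fin n → ℝ × ℝ) (m : ℕ) : Fin (m + 1) → ℝ × ℝ := fun k => cyc p k

theorem cyc_sub {m k : ℕ} (hk : k ≤ m) : cyc (sub p m) k = cyc p k := by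
  rw [cyc_of_lt (Nat.lt_succ_of_le hk)]
  rfl

theorem parity_sub (p : Fin n → ℝ × ℝ) (m : ℕ) (q : ℝ × ℝ) :
    parity (sub p m) q = ∑ k ∈ Finset.range m, crossNum (cyc p k) (cyc p (k + 1)) q +
      crossNum (cyc p 0) (cyc p m) q := by
  rw [parity_eq_sum_range, Finset.sum_range_succ, cyc_self, cyc_sub le_rfl, cyc_sub (Nat.zero_le m),
    crossNum_comm (cyc p m)]
  congr 1
  refine Finset.sum_congr rfl fun k hk => ?_
  rw [Finset.mem_range] at hk
  rw [cyc_sub hk.le, cyc_sub hk]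

theorem mem_polygonBoundary_sub {m : ℕ} : q ∈ polygonBoundary (sub p m) ↔
    (∃ k < m, q ∈ segment ℝ (cyc p k) (cyc p (k + 1))) ∨ q ∈ segment ℝ (cyc p 0) (cyc p m) := by
  rw [mem_polygonBoundary_iff]
  constructor
  · rintro ⟨k, hk, h⟩
    rcases (Nat.lt_succ_iff.1 hk).eq_or_lt with rfl | hk
    · right
      rwa [cyc_self, cyc_sub le_rfl, cyc_sub (Nat.zero_le _), segment_symm] at h
    · exact .inl ⟨k, hk, by rwa [cyc_sub hk.le, cyc_sub hk] at h⟩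
  · rintro (⟨k, hk, h⟩ | h)
    · exact ⟨k, by omega, by rwa [cyc_sub hk.le, cyc_sub hk]⟩
    · exact ⟨m, by omega, by rwa [cyc_self, cyc_sub le_rfl, cyc_sub (Nat.zero_le _), segment_symm]⟩

/-- The chord from `0` to `m` is an edge of both parts and cancels modulo 2. No simplicity is
needed. -/
theorem parity_eq_add {m : ℕ} (hm : m ≤ n) (q : ℝ × ℝ) :
    parity p q = parity (sub p m) q + parity (sub (rot p m) (n - m)) q := by
  have h : ∀ k, cyc (rot p m) k = cyc p (m + k) := fun k => by rw [cyc_rot, add_comm]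
  rw [parity_sub, parity_sub, parity_eq_sum_range]
  simp only [h]
  rw [show m + (n - m) = n by omega, cyc_self, add_zero, crossNum_comm (cyc p m),
    ← Finset.sum_range_add_sum_Ico _ hm, Finset.sum_Ico_eq_sum_range]
  simp only [add_assoc]
  linear_combination -CharTwo.add_self_eq_zero (crossNum (cyc p 0) (cyc p m) q)

theorem polygonBoundary_rot (p : Fin n → ℝ × ℝ) (r : ℕ) :
    polygonBoundary (rot p r) = polygonBoundary p := by
  have key : ∀ (p : Fin n → ℝ × ℝ) r, polygonBoundary (rot p r) ⊆ polygonBoundary p := by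
    intro p r q hq
    rw [mem_polygonBoundary_iff] at hq ⊢
    obtain ⟨k, hk, h⟩ := hq
    rw [cyc_rot, cyc_rot] at h
    refine ⟨(k + r) % n, Nat.mod_lt _ (NeZero.pos n), ?_⟩
    rwa [cyc_mod, ← cyc_mod p (_ + 1), Nat.mod_add_mod, cyc_mod, add_right_comm]
  refine (key p r).antisymm ?_
  -- Rotating by `n - r % n` undoes the rotation by `r`, so one inclusion gives the other.
  have h := key (rot p r) (n - r % n)
  rwa [show rot (rot p r) (n - r % n) = p by
    funext k
    rw [rot, cyc_rot, ← cyc_mod, show (k + (n - r % n) + r) % n = k from ?_, cyc_val]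
    have := Nat.mod_lt r (NeZero.pos n)
    rw [← Nat.add_mod_mod, show k + (n - r % n) + r % n = k + n by omega, Nat.add_mod_right,
      Nat.mod_eq_of_lt k.2]] at h

theorem parity_rot (p : Fin n → ℝ × ℝ) (r : ℕ) (q : ℝ × ℝ) : parity (rot p r) q = parity p q := by
  unfold parity
  rw [← Equiv.sum_comp (Equiv.addRight (Fin.ofNat n r)) (fun k => crossNum (p k) (p (k + 1)) q)]
  refine Finset.sum_congr rfl fun k _ => ?_
  have h : ∀ k, rot p r k = p (k + Fin.ofNat n r) := by
    intro k
    rw [rot, cyc]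
    congr 1
    ext
    simp [Fin.val_add]
  rw [h, h, Equiv.coe_addRight]
  congr 2
  exact add_right_comm _ _ _

theorem polygonInterior_rot (p : Fin n → ℝ × ℝ) (r : ℕ) :
    polygonInterior (rot p r) = polygonInterior p := by
  ext q
  rw [mem_polygonInterior_iff, mem_polygonInterior_iff, polygonBoundary_rot, parity_rot]

end Parity

/-! ### Simple polygons, exposed vertices and cuts along a diagonal -/

section Simple

variable {n : ℕ} [NeZero n] {p : Fin n → ℝ × ℝ} {q : ℝ × ℝ}

theorem polygonEdge_mk (p : Fin n → ℝ × ℝ) {k : ℕ} (hk : k < n) :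
    polygonEdge p ⟨k, hk⟩ = segment ℝ (cyc p k) (cyc p (k + 1)) := by
  rw [polygonEdge, ← cyc_succ p, ← cyc_val p]

theorem IsSimplePolygon.cyc_inj (h : IsSimplePolygon p) {k l : ℕ} (hk : k < n) (hl : l < n)
    (he : cyc p k = cyc p l) : k = l := by
  rw [cyc_of_lt hk, cyc_of_lt hl] at he
  exact Fin.mk.inj_iff.1 (h.injective he)

theorem Fin.mk_add_one {k : ℕ} (hk : k < n) (hk' : k + 1 < n) :
    (⟨k, hk⟩ : Fin n) + 1 = ⟨k + 1, hk'⟩ := by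
  ext
  rw [Fin.val_add, Fin.val_one', Nat.add_mod_mod]
  exact Nat.mod_eq_of_lt hk'

theorem Fin.mk_add_one_last {k : ℕ} (hk : k < n) (hk' : k + 1 = n) :
    (⟨k, hk⟩ : Fin n) + 1 = ⟨0, NeZero.pos n⟩ := by
  ext
  rw [Fin.val_add, Fin.val_one', Nat.add_mod_mod]
  simp [hk']

/-- Two edges of a simple polygon meet in a common vertex only. -/
theorem IsSimplePolygon.inter (h : IsSimplePolygon p) {k l : ℕ} (hkl : k < l) (hl : l < n)
    (hk' : q ∈ segment ℝ (cyc p k) (cyc p (k + 1)))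
    (hl' : q ∈ segment ℝ (cyc p l) (cyc p (l + 1))) :
    (l = k + 1 ∧ q = cyc p l) ∨ (k = 0 ∧ l + 1 = n ∧ q = cyc p 0) := by
  have hn := h.three_le
  have hk : k < n := by omega
  rw [← polygonEdge_mk p hk] at hk'
  rw [← polygonEdge_mk p hl] at hl'
  by_cases h₁ : l = k + 1
  · subst h₁
    have := h.consecutive ⟨k, hk⟩
    rw [Fin.mk_add_one hk hl] at this
    have hq := this.subset ⟨hk', hl'⟩
    rw [← cyc_of_lt (p := p) hl] at hq
    exact .inl ⟨rfl, hq⟩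
  by_cases h₂ : k = 0 ∧ l + 1 = n
  · obtain ⟨rfl, h₂⟩ := h₂
    have := h.consecutive ⟨l, hl⟩
    rw [Fin.mk_add_one_last hl h₂] at this
    have hq := this.subset ⟨hl', hk'⟩
    rw [← cyc_of_lt (p := p) hk] at hq
    exact .inr ⟨rfl, h₂, hq⟩
  · refine absurd hl' (Set.disjoint_left.1 (h.disjoint ⟨k, hk⟩ ⟨l, hl⟩ ?_ ?_ ?_) hk')
    · simp only [ne_eq, Fin.mk.injEq]
      omega
    · rw [Fin.mk_add_one hk (by omega)]
      simp only [ne_eq, Fin.mk.injEq]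
      omega
    · rcases Nat.lt_or_ge (l + 1) n with h₃ | h₃
      · rw [Fin.mk_add_one hl h₃]
        simp only [ne_eq, Fin.mk.injEq]
        omega
      · rw [Fin.mk_add_one_last hl (by omega)]
        simp only [ne_eq, Fin.mk.injEq]
        omega

theorem isSimplePolygon_of_inter (hn : 3 ≤ n)
    (inj : ∀ k l, k < l → l < n → cyc p k ≠ cyc p l)
    (inter : ∀ k l q, k < l → l < n → q ∈ segment ℝ (cyc p k) (cyc p (k + 1)) →
      q ∈ segment ℝ (cyc p l) (cyc p (l + 1)) →
      (l = k + 1 ∧ q = cyc p l) ∨ (k = 0 ∧ l + 1 = n ∧ q = cyc p 0)) : IsSimplePolygon p := by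
  refine ⟨hn, ?_, ?_, ?_⟩
  · rintro ⟨k, hk⟩ ⟨l, hl⟩ he
    rw [← cyc_of_lt (p := p) hk, ← cyc_of_lt (p := p) hl] at he
    rcases lt_trichotomy k l with h | rfl | h
    · exact absurd he (inj k l h hl)
    · rfl
    · exact absurd he.symm (inj l k h hk)
  · rintro ⟨k, hk⟩
    rcases Nat.lt_or_ge (k + 1) n with h | h
    · rw [Fin.mk_add_one hk h, polygonEdge_mk, polygonEdge_mk, ← cyc_of_lt (p := p) h]
      refine Set.Subset.antisymm ?_ ?_
      · rintro x ⟨h₁, h₂⟩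
        rcases inter k (k + 1) x (by omega) h h₁ h₂ with h₃ | h₃
        · exact h₃.2
        · omega
      · rintro x rfl
        exact ⟨right_mem_segment ℝ _ _, left_mem_segment ℝ _ _⟩
    · rw [Fin.mk_add_one_last hk (by omega), polygonEdge_mk, polygonEdge_mk,
        ← cyc_of_lt (p := p) (NeZero.pos n)]
      refine Set.Subset.antisymm ?_ ?_
      · rintro x ⟨h₁, h₂⟩
        rcases inter 0 k x (by omega) hk h₂ h₁ with h₃ | h₃
        · omega
        · exact h₃.2.2
      · rintro x rfl
        refine ⟨?_, left_mem_segment ℝ _ _⟩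
        rw [show k + 1 = n by omega, cyc_self]
        exact right_mem_segment ℝ _ _
  · have key : ∀ k l (hk : k < n) (hl : l < n), k < l → (⟨l, hl⟩ : Fin n) ≠ ⟨k, hk⟩ + 1 →
        (⟨k, hk⟩ : Fin n) ≠ ⟨l, hl⟩ + 1 →
        Disjoint (polygonEdge p ⟨k, hk⟩) (polygonEdge p ⟨l, hl⟩) := by
      intro k l hk hl hkl h₁ h₂
      rw [polygonEdge_mk, polygonEdge_mk, Set.disjoint_left]
      intro x hx hx'
      rcases inter k l x hkl hl hx hx' with ⟨rfl, -⟩ | ⟨rfl, h₃, -⟩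
      · exact h₁ (Fin.mk_add_one hk hl).symm
      · exact h₂ (Fin.mk_add_one_last hl h₃).symm
    rintro ⟨k, hk⟩ ⟨l, hl⟩ h₁ h₂ h₃
    rcases lt_trichotomy k l with h | rfl | h
    · exact key k l hk hl h h₂ h₃
    · exact absurd rfl h₁
    · exact (key l k hl hk h h₃ h₂).symm

theorem IsSimplePolygon.vertex_mem (h : IsSimplePolygon p) {r k : ℕ} (hr : r < n) (hk : k < n)
    (hm : cyc p r ∈ segment ℝ (cyc p k) (cyc p (k + 1))) :
    r = k ∨ r = k + 1 ∨ (r = 0 ∧ k + 1 = n) := by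
  have hm' : cyc p r ∈ segment ℝ (cyc p r) (cyc p (r + 1)) := left_mem_segment ℝ _ _
  rcases lt_trichotomy r k with hrk | hrk | hrk
  · rcases h.inter hrk hk hm' hm with h₁ | h₁
    · have := h.cyc_inj hr hk h₁.2
      omega
    · omega
  · exact .inl hrk
  · rcases h.inter hrk hr hm hm' with h₁ | h₁
    · omega
    · have := h.cyc_inj hr (NeZero.pos n) h₁.2.2
      omega

theorem IsSimplePolygon.rot (h : IsSimplePolygon p) (r : ℕ) : IsSimplePolygon (rot p r) := by
  have hr : ∀ k, _root_.rot p r k = p (k + Fin.ofNat n r) := by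
    intro k
    rw [_root_.rot, cyc]
    congr 1
    ext
    simp [Fin.val_add]
  have he : ∀ k, polygonEdge (_root_.rot p r) k = polygonEdge p (k + Fin.ofNat n r) := by
    intro k
    rw [polygonEdge, polygonEdge, hr, hr, add_right_comm]
  refine ⟨h.three_le, ?_, ?_, ?_⟩
  · intro k l hkl
    rw [hr, hr] at hkl
    exact add_right_cancel (h.injective hkl)
  · intro k
    rw [he, he, hr, add_right_comm]
    exact h.consecutive _
  · intro k l h₁ h₂ h₃
    rw [he, he]
    refine h.disjoint _ _ (by simpa using h₁) ?_ ?_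
    · rw [add_right_comm]
      simpa using h₂
    · rw [add_right_comm]
      simpa using h₃

theorem cyc_mem_polygonBoundary (p : Fin n → ℝ × ℝ) (k : ℕ) : cyc p k ∈ polygonBoundary p := by
  rw [mem_polygonBoundary_iff]
  refine ⟨k % n, Nat.mod_lt _ (NeZero.pos n), ?_⟩
  rw [cyc_mod]
  exact left_mem_segment ℝ _ _

/-- A vertical ray from `q` in the direction in which `f` does not decrease never meets the
boundary. Far out all vertices are on one side of the horizontal line, where the parity is visibly
0. -/
theorem parity_eq_zero_of_functional (f : ℝ × ℝ →L[ℝ] ℝ) (hf : ∀ k, f (p k) < f q) :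
    q ∉ polygonBoundary p ∧ parity p q = 0 := by
  have hlt : ∀ x ∈ polygonBoundary p, f x < f q := by
    intro x hx
    obtain ⟨k, hk⟩ := Set.mem_iUnion.1 hx
    have hc : Convex ℝ {x | f x < f q} := convex_halfSpace_lt f.toLinearMap.isLinear (f q)
    exact hc.segment_subset (hf k) (hf (k + 1)) hk
  refine ⟨fun h => (hlt q h).ne rfl, ?_⟩
  obtain ⟨σ, hσ, hfσ⟩ : ∃ σ : ℝ, (σ = 1 ∨ σ = -1) ∧ 0 ≤ f (0, σ) := by
    rcases le_total 0 (f (0, 1)) with h | h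
    · exact ⟨1, .inl rfl, h⟩
    · refine ⟨-1, .inr rfl, ?_⟩
      rw [show ((0 : ℝ), (-1 : ℝ)) = -(0, 1) by simp, map_neg]
      linarith
  have hM : ∀ k, |(p k).2| ≤ ∑ l, |(p l).2| := fun k =>
    Finset.single_le_sum (f := fun l => |(p l).2|) (fun _ _ => abs_nonneg _) (Finset.mem_univ k)
  set M := ∑ l, |(p l).2|
  have hM0 : 0 ≤ M := Finset.sum_nonneg fun _ _ => abs_nonneg _
  set t := M + |q.2| + 1
  have ht : 0 ≤ t := by positivity
  have hpath := parity_eq_of_path (p := p) (γ := fun s => q + s • ((0 : ℝ), σ)) (by fun_prop)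
    (I := Set.Ici 0) Set.ordConnected_Ici (fun s hs hb => by
      have := hlt _ hb
      rw [map_add, map_smul, smul_eq_mul] at this
      have := mul_nonneg (Set.mem_Ici.1 hs) hfσ
      linarith) (s := 0) (t := t) Set.self_mem_Ici ht
  simp only [zero_smul, add_zero] at hpath
  rw [hpath]
  refine Finset.sum_eq_zero fun k _ => ?_
  have hp := fun k => abs_le.1 (hM k)
  have hq := neg_abs_le q.2
  have hq' := le_abs_self q.2
  rcases hσ with rfl | rfl
  · refine crossNum_eq_zero_of_below ?_ ?_ <;>
    · simp only [Prod.snd_add, Prod.smul_snd, smul_eq_mul, mul_one]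
      refine (hp _).2.trans ?_
      linarith
  · refine crossNum_eq_zero_of_above ?_ ?_ <;>
    · simp only [Prod.snd_add, Prod.smul_snd, smul_eq_mul, mul_neg, mul_one]
      refine lt_of_lt_of_le ?_ (hp _).1
      linarith

/-- Some vertex outside the segment between two given vertices can be separated from all others. -/
theorem exists_exposed_vertex {ι : Type*} [Finite ι] {p : ι → ℝ × ℝ}
    (hp : Function.Injective p) (i j : ι)
    (hij : ∃ k, p k ∉ segment ℝ (p i) (p j)) :
    ∃ k, k ≠ i ∧ k ≠ j ∧ ∃ f : ℝ × ℝ →L[ℝ] ℝ, ∀ l ≠ k, f (p l) < f (p k) := by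
  set H := convexHull ℝ (Set.range p) with hH
  have hfin : (Set.range p).Finite := Set.finite_range p
  -- Otherwise, by Krein–Milman, the whole hull would be contained in the segment between the two
  -- vertices.
  have hext : ¬ H.extremePoints ℝ ⊆ {p i, p j} := by
    intro hsub
    obtain ⟨k, hk⟩ := hij
    refine hk ?_
    have h₁ : closure (convexHull ℝ (H.extremePoints ℝ)) = H :=
      closure_convexHull_extremePoints (hfin.isCompact_convexHull ℝ) (convex_convexHull ℝ _)
    have h₂ : p k ∈ H := subset_convexHull ℝ _ ⟨k, rfl⟩
    rw [← h₁] at h₂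
    refine closure_minimal ((convexHull_mono hsub).trans ?_) (isClosed_segment _ _) h₂
    rw [convexHull_pair]
  obtain ⟨x, hx, hx'⟩ := Set.not_subset.1 hext
  obtain ⟨k, rfl⟩ := extremePoints_convexHull_subset hx
  refine ⟨k, fun h => hx' (by simp [h]), fun h => hx' (by simp [h]), ?_⟩
  have hconv := ((convex_convexHull ℝ _).mem_extremePoints_iff_convex_sdiff.1 hx).2
  have hfin' : (p '' {k}ᶜ).Finite := Set.toFinite _
  have hsub : convexHull ℝ (p '' {k}ᶜ) ⊆ H \ {p k} := by
    refine convexHull_min ?_ hconv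
    -- Removing an extreme point leaves a convex set, so the hull of the other vertices misses `p k`
    -- and can be strictly separated from it.
    rintro _ ⟨l, hl, rfl⟩
    exact ⟨subset_convexHull ℝ _ ⟨l, rfl⟩, fun h => hl (hp h)⟩
  obtain ⟨f, u, h₁, h₂⟩ := geometric_hahn_banach_closed_point (convex_convexHull ℝ (p '' {k}ᶜ))
    (hfin'.isClosed_convexHull ℝ) (x := p k) fun h => (hsub h).2 rfl
  exact ⟨f, fun l hl => (h₁ _ (subset_convexHull ℝ _ ⟨l, hl, rfl⟩)).trans h₂⟩

/-- The segment between the vertices `0` and `m` is a diagonal. -/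
structure IsCut (p : Fin n → ℝ × ℝ) (m : ℕ) : Prop where
  simple : IsSimplePolygon p
  lt : m < n
  diag : openSegment ℝ (cyc p 0) (cyc p m) ⊆ polygonInterior p

namespace IsCut

variable {m : ℕ}

theorem not_mem_boundary (h : IsCut p m) (hq : q ∈ openSegment ℝ (cyc p 0) (cyc p m)) :
    q ∉ polygonBoundary p :=
  (mem_polygonInterior_iff.1 (h.diag hq)).1

/-- In the excluded cases the open segment degenerates to a vertex or lies on a boundary edge,
contrary to the interior avoiding the boundary. -/
theorem two_le (h : IsCut p m) : 2 ≤ m ∧ m + 2 ≤ n := by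
  have hm := h.lt
  have hn := h.simple.three_le
  have key : ∀ k < n, ∀ x ∈ openSegment ℝ (cyc p 0) (cyc p m),
      x ∉ segment ℝ (cyc p k) (cyc p (k + 1)) := fun k hk x hx hx' =>
    h.not_mem_boundary hx (mem_polygonBoundary_iff.2 ⟨k, hk, hx'⟩)
  have hx : ∃ x, x ∈ openSegment ℝ (cyc p 0) (cyc p m) := by
    rw [openSegment_eq_image']
    exact ⟨_, Set.mem_image_of_mem _ (⟨by norm_num, by norm_num⟩ : (1 / 2 : ℝ) ∈ Set.Ioo (0 : ℝ) 1)⟩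
  obtain ⟨x, hx⟩ := hx
  have h0 : m ≠ 0 := by
    rintro rfl
    rw [openSegment_same] at hx
    refine key 0 (by omega) x (by rwa [openSegment_same]) ?_
    rw [Set.mem_singleton_iff.1 hx]
    exact left_mem_segment ℝ _ _
  have h1 : m ≠ 1 := by
    rintro rfl
    exact key 0 (by omega) x hx (openSegment_subset_segment ℝ _ _ hx)
  have h2 : m + 1 ≠ n := by
    intro hmn
    refine key m (by omega) x hx ?_
    rw [hmn, cyc_self, segment_symm]
    exact openSegment_subset_segment ℝ _ _ hx
  omega

theorem rot (h : IsCut p m) : IsCut (rot p m) (n - m) := by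
  have := h.two_le
  refine ⟨h.simple.rot m, by omega, ?_⟩
  rw [cyc_rot, cyc_rot, zero_add, show n - m + m = n by omega, cyc_self, openSegment_symm,
    polygonInterior_rot]
  exact h.diag

theorem ne (h : IsCut p m) : cyc p 0 ≠ cyc p m := fun he => by
  have := h.two_le
  have := h.simple.cyc_inj (NeZero.pos n) h.lt he
  omega

/-- A point on the closed diagonal and on an edge is a common vertex. -/
theorem eq_of_mem (h : IsCut p m) {k : ℕ} (hk : k < n)
    (hq : q ∈ segment ℝ (cyc p 0) (cyc p m)) (hq' : q ∈ segment ℝ (cyc p k) (cyc p (k + 1))) :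
    (q = cyc p 0 ∧ (k = 0 ∨ k + 1 = n)) ∨ (q = cyc p m ∧ (k = m ∨ k + 1 = m)) := by
  have := h.two_le
  have hs := h.simple
  by_cases h0 : q = cyc p 0
  · subst h0
    rcases hs.vertex_mem (NeZero.pos n) hk hq' with h₁ | h₁ | h₁ <;> left <;> refine ⟨rfl, ?_⟩ <;>
      omega
  by_cases hm : q = cyc p m
  · subst hm
    rcases hs.vertex_mem h.lt hk hq' with h₁ | h₁ | h₁ <;> right <;> refine ⟨rfl, ?_⟩ <;> omega
  · refine absurd (mem_polygonBoundary_iff.2 ⟨k, hk, hq'⟩) (h.not_mem_boundary ?_)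
    exact mem_openSegment_of_ne_left_right (Ne.symm h0) (Ne.symm hm) hq

theorem simple_sub (h : IsCut p m) : IsSimplePolygon (sub p m) := by
  have := h.two_le
  have hs := h.simple
  refine isSimplePolygon_of_inter (by omega) ?_ ?_
  · intro k l hkl hl he
    rw [cyc_sub (by omega), cyc_sub (by omega)] at he
    have := hs.cyc_inj (by omega) (by omega) he
    omega
  · intro k l q hkl hl hk' hl'
    rw [cyc_sub (by omega), cyc_sub (by omega)] at hk'
    rw [cyc_sub (by omega), cyc_sub (by omega)]
    rcases Nat.lt_or_ge l m with hlm | hlm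
    · rw [cyc_sub (by omega), cyc_sub (by omega)] at hl'
      rcases hs.inter hkl (by omega) hk' hl' with h₁ | h₁
      · exact .inl h₁
      · omega
    · obtain rfl : l = m := by omega
      rw [cyc_self, cyc_sub le_rfl, cyc_sub (Nat.zero_le _), segment_symm] at hl'
      rcases h.eq_of_mem (by omega) hl' hk' with ⟨h₁, h₂⟩ | ⟨h₁, h₂⟩
      · exact .inr ⟨by omega, rfl, h₁⟩
      · exact .inl ⟨by omega, h₁⟩

end IsCut

end Simple

/-! ### The parities of two polygons with a common edge -/

section Corner

def det2 (u v : ℝ × ℝ) : ℝ := u.1 * v.2 - u.2 * v.1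

theorem det2_swap (u v : ℝ × ℝ) : det2 u v = -det2 v u := by
  unfold det2
  ring

@[simp] theorem det2_self (u : ℝ × ℝ) : det2 u u = 0 := by
  unfold det2
  ring

@[simp] theorem det2_smul_left (t : ℝ) (u v : ℝ × ℝ) : det2 (t • u) v = t * det2 u v := by
  simp only [det2, Prod.smul_fst, Prod.smul_snd, smul_eq_mul]
  ring

@[simp] theorem det2_smul_right (t : ℝ) (u v : ℝ × ℝ) : det2 u (t • v) = t * det2 u v := by
  simp only [det2, Prod.smul_fst, Prod.smul_snd, smul_eq_mul]
  ring

@[simp] theorem det2_neg_left (u v : ℝ × ℝ) : det2 (-u) v = -det2 u v := by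
  simp only [det2, Prod.fst_neg, Prod.snd_neg]
  ring

@[simp] theorem det2_neg_right (u v : ℝ × ℝ) : det2 u (-v) = -det2 u v := by
  simp only [det2, Prod.fst_neg, Prod.snd_neg]
  ring

@[simp] theorem det2_add_right (u v w : ℝ × ℝ) : det2 u (v + w) = det2 u v + det2 u w := by
  simp only [det2, Prod.fst_add, Prod.snd_add]
  ring

@[simp] theorem det2_sub_right (u v w : ℝ × ℝ) : det2 u (v - w) = det2 u v - det2 u w := by
  simp only [det2, Prod.fst_sub, Prod.snd_sub]
  ring

/-- `f` behaves near `0` like the parity of a polygon with a corner at `0` whose sides have the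
directions `a` and `c`. -/
structure IsCornerParity (f : ℝ × ℝ → ZMod 2) (ε : ℝ) (a c : ℝ × ℝ) : Prop where
  const : ∀ S : Set (ℝ × ℝ), Convex ℝ S → (∀ v ∈ S, ‖v‖ < ε) →
    (∀ v ∈ S, ∀ t : ℝ, 0 ≤ t → v ≠ t • a ∧ v ≠ t • c) → ∀ x ∈ S, ∀ y ∈ S, f x = f y
  left : ∀ w : ℝ × ℝ, det2 a w ≠ 0 →
    ∀ᶠ t : ℝ in 𝓝[>] 0, f (a + t • w) = f (a - t • w) + 1
  right : ∀ w : ℝ × ℝ, det2 c w ≠ 0 →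
    ∀ᶠ t : ℝ in 𝓝[>] 0, f (c + t • w) = f (c - t • w) + 1

theorem eventually_norm_add_smul_lt {ε : ℝ} {u w : ℝ × ℝ} (h : ‖u‖ < ε) :
    ∀ᶠ t : ℝ in 𝓝[>] 0, ‖u + t • w‖ < ε := by
  have hc : ContinuousAt (fun t : ℝ => ‖u + t • w‖) 0 := by fun_prop
  have := hc.eventually_lt continuousAt_const (by simpa using h)
  exact this.filter_mono nhdsWithin_le_nhds

theorem eventually_linear_pos {x y : ℝ} (h : 0 < x ∨ (x = 0 ∧ 0 < y)) :
    ∀ᶠ t : ℝ in 𝓝[>] 0, 0 < x + t * y := by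
  rcases h with h | ⟨rfl, h⟩
  · have hc : ContinuousAt (fun t : ℝ => x + t * y) 0 := by fun_prop
    have := continuousAt_const.eventually_lt hc (by simpa using h)
    exact this.filter_mono nhdsWithin_le_nhds
  · filter_upwards [self_mem_nhdsWithin] with t ht
    have := mul_pos (Set.mem_Ioi.1 ht) h
    linarith

variable {f g : ℝ × ℝ → ZMod 2} {ε σ : ℝ} {a b c : ℝ × ℝ}

theorem convex_wedge (ε : ℝ) (x y : ℝ × ℝ) : Convex ℝ {v : ℝ × ℝ | ‖v‖ < ε ∧
    0 < det2 x v ∧ 0 < det2 y v} := by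
  have h : ∀ x : ℝ × ℝ, Convex ℝ {v : ℝ × ℝ | 0 < det2 x v} := by
    intro x u hu v hv r s hr hs hrs
    simp only [Set.mem_ofPred_eq, det2_add_right, det2_smul_right] at hu hv ⊢
    rcases hr.eq_or_lt with rfl | hr
    · obtain rfl : s = 1 := by linarith
      simpa using hv
    · have := mul_pos hr hu
      have := mul_nonneg hs hv.le
      linarith
  have hb : Convex ℝ {v : ℝ × ℝ | ‖v‖ < ε} := by
    have := convex_ball (0 : ℝ × ℝ) ε
    rwa [show Metric.ball (0 : ℝ × ℝ) ε = {v : ℝ × ℝ | ‖v‖ < ε} by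
      ext v
      simp] at this
  exact hb.inter ((h x).inter (h y))

/-- An open wedge that contains neither side lies within one sector at the corner. With `x = y` the
wedge is a half-plane. -/
theorem IsCornerParity.const_wedge (hf : IsCornerParity f ε a c) (x y : ℝ × ℝ)
    (ha : det2 x a ≤ 0 ∨ det2 y a ≤ 0)
    (hc : det2 x c ≤ 0 ∨ det2 y c ≤ 0) {u v : ℝ × ℝ}
    (hu : ‖u‖ < ε) (hux : 0 < det2 x u) (huy : 0 < det2 y u)
    (hv : ‖v‖ < ε) (hvx : 0 < det2 x v) (hvy : 0 < det2 y v) :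
    f u = f v := by
  refine hf.const _ (convex_wedge ε x y) (fun w hw => hw.1) (fun w hw t ht => ?_) u ⟨hu, hux, huy⟩
    v ⟨hv, hvx, hvy⟩
  have key : ∀ r : ℝ × ℝ, (det2 x r ≤ 0 ∨ det2 y r ≤ 0) → w ≠ t • r := by
    rintro r hr rfl
    obtain ⟨-, h₁, h₂⟩ := hw
    simp only [det2_smul_right] at h₁ h₂
    rcases hr with hr | hr
    · have := mul_nonpos_of_nonneg_of_nonpos ht hr
      linarith
    · have := mul_nonpos_of_nonneg_of_nonpos ht hr
      linarith
  exact ⟨key a ha, key c hc⟩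

/-- The sides `a` and `b` lie on different sides of the common side `c`. -/
theorem IsCornerParity.eq_of_opposite (hf : IsCornerParity f ε a c) (hg : IsCornerParity g ε b c)
    (ha : ‖a‖ < ε / 2) (hb : ‖b‖ < ε / 2) (hc : ‖c‖ < ε / 2) (hc0 : c ≠ 0)
    (hfg : ∀ᶠ v in 𝓝 c, f v + g v = 1) (hσ : σ ≠ 0)
    (hac : 0 < σ * det2 c a ∨ (σ * det2 c b < 0 ∧ ∃ t : ℝ, t < 0 ∧ a = t • c))
    (hbc : σ * det2 c b < 0 ∨ (0 < σ * det2 c a ∧ ∃ t : ℝ, t < 0 ∧ b = t • c)) :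
    f b = g a := by
  have hε : 0 < ε := by linarith [norm_nonneg a]
  have hsum : ∀ x y : ℝ × ℝ, ‖x‖ < ε / 2 → ‖y‖ < ε / 2 → ‖-x - y‖ < ε := by
    intro x y hx hy
    calc ‖-x - y‖ ≤ ‖-x‖ + ‖y‖ := norm_sub_le _ _
      _ < ε := by rw [norm_neg]; linarith
  have hca : 0 ≤ σ * det2 c a := by
    rcases hac with h | ⟨-, t, -, rfl⟩
    · exact h.le
    · simp
  have hcb : σ * det2 c b ≤ 0 := by
    rcases hbc with h | ⟨-, t, -, rfl⟩
    · exact h.le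
    · simp
  obtain ⟨w, hwc⟩ : ∃ w, 0 < σ * det2 c w := by
    refine ⟨(-(σ * c.2), σ * c.1), ?_⟩
    have hcc : 0 < c.1 ^ 2 + c.2 ^ 2 := by
      by_contra h
      refine hc0 (Prod.ext ?_ ?_) <;> simp <;> nlinarith [sq_nonneg c.1, sq_nonneg c.2]
    have : σ * det2 c (-(σ * c.2), σ * c.1) = σ ^ 2 * (c.1 ^ 2 + c.2 ^ 2) := by
      unfold det2
      ring
    rw [this]
    positivity
  have hcw : det2 c w ≠ 0 := fun h => by simp [h] at hwc
  have hcont : Tendsto (fun t : ℝ => c + t • w) (𝓝[>] 0) (𝓝 c) := by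
    have : ContinuousAt (fun t : ℝ => c + t • w) 0 := by fun_prop
    have h' := this.tendsto
    simp only [zero_smul, add_zero] at h'
    exact h'.mono_left nhdsWithin_le_nhds
  -- The points `c ± t • w` are on either side of `c`, with `c + t • w` on the side of `a`. There
  -- `f` changes, and `f + g = 1` at `c + t • w`; it remains to connect `a` and `b` to these points.
  obtain ⟨t, ht, h₁, h₂, h₃, h₄⟩ := ((eventually_mem_nhdsWithin (a := (0 : ℝ)) (s := Set.Ioi 0)).and
    ((hf.right w hcw).and ((hcont.eventually hfg).and
    ((eventually_norm_add_smul_lt (u := c) (w := w) (by linarith : ‖c‖ < ε)).and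
    (eventually_norm_add_smul_lt (u := c) (w := -w) (by linarith : ‖c‖ < ε)))))).exists
  rw [smul_neg, ← sub_eq_add_neg] at h₄
  have htw := mul_pos (Set.mem_Ioi.1 ht) hwc
  have e₁ : 0 < det2 (σ • c) (c + t • w) := by
    simp
    linarith
  have e₂ : 0 < det2 (-(σ • c)) (c - t • w) := by
    simp
    linarith
  have ga : g a = g (c + t • w) := by
    rcases hac with h | ⟨h, s, hs, rfl⟩
    · refine hg.const_wedge (σ • c) (σ • c) (.inl ?_) (.inl ?_) (by linarith) ?_ ?_ h₃ e₁ e₁ <;>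
        simp <;> linarith
    · have hz := hsum b c hb hc
      have hbc' := det2_swap b c
      -- Here `a` is opposite to `c` and lies on the border of the half-plane used otherwise, so the
      -- connection makes a detour through `-b - c`.
      trans g (-b - c)
      · have := mul_pos_of_neg_of_neg hs h
        refine hg.const_wedge (-(σ • b)) (-(σ • b)) (.inl ?_) (.inl ?_) (by linarith) ?_ ?_ hz ?_ ?_ <;>
          simp [hbc'] <;> linarith
      · refine hg.const_wedge (σ • c) (σ • c) (.inl ?_) (.inl ?_) hz ?_ ?_ h₃ e₁ e₁ <;>
          simp <;> linarith
  have fb : f b = f (c - t • w) := by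
    rcases hbc with h | ⟨h, s, hs, rfl⟩
    · refine hf.const_wedge (-(σ • c)) (-(σ • c)) (.inl ?_) (.inl ?_) (by linarith) ?_ ?_ h₄ e₂ e₂ <;>
        simp <;> linarith
    · have hz := hsum a c ha hc
      have hac' := det2_swap a c
      trans f (-a - c)
      · have := mul_neg_of_neg_of_pos hs h
        refine hf.const_wedge (σ • a) (σ • a) (.inl ?_) (.inl ?_) (by linarith) ?_ ?_ hz ?_ ?_ <;>
          simp [hac'] <;> linarith
      · refine hf.const_wedge (-(σ • c)) (-(σ • c)) (.inl ?_) (.inl ?_) hz ?_ ?_ h₄ e₂ e₂ <;>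
          simp <;> linarith
  rw [ga, fb]
  have two : (1 + 1 : ZMod 2) = 0 := two_eq_zero_zmod
  linear_combination h₁ - h₂ + f (c - t • w) * two

/-- The side `b` lies between `c` and `a`. -/
theorem IsCornerParity.eq_of_between (hf : IsCornerParity f ε a c) (hg : IsCornerParity g ε b c)
    (ha : ‖a‖ < ε) (hb : ‖b‖ < ε) (hc : ‖c‖ < ε)
    (hfg : ∀ᶠ v in 𝓝 c, f v + g v = 1)
    (hca : 0 < σ * (det2 c a)) (hcb : 0 < σ * (det2 c b))
    (hba : 0 < σ * (det2 b a)) : f b = g a := by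
  have hcont : Tendsto (fun t : ℝ => c + t • b) (𝓝[>] 0) (𝓝 c) := by
    have : ContinuousAt (fun t : ℝ => c + t • b) 0 := by fun_prop
    have h' := this.tendsto
    simp only [zero_smul, add_zero] at h'
    exact h'.mono_left nhdsWithin_le_nhds
  have hba' : det2 b a ≠ 0 := fun h => by simp [h] at hba
  -- From `a` one moves to just beyond `b`, crosses `b`, where `g` changes, and continues in the
  -- wedge between `b` and `c` to `c + s • b`, where `f + g = 1`. That wedge does not contain `a`,
  -- so `f` has the value `f b` there.
  obtain ⟨t, ht, h₁, h₂, h₃, h₄⟩ := ((eventually_mem_nhdsWithin (a := (0 : ℝ)) (s := Set.Ioi 0)).and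
    ((hg.left a hba').and ((eventually_norm_add_smul_lt (u := b) (w := a) hb).and
    ((eventually_norm_add_smul_lt (u := b) (w := -a) hb).and
    (eventually_linear_pos (x := σ * (det2 c b))
      (y := -(σ * (det2 c a))) (.inl hcb)))))).exists
  obtain ⟨s, hs, h₅, h₆⟩ := ((eventually_mem_nhdsWithin (a := (0 : ℝ)) (s := Set.Ioi 0)).and
    ((hcont.eventually hfg).and (eventually_norm_add_smul_lt (u := c) (w := b) hc))).exists
  have ht' : (0 : ℝ) < t := ht
  have hs' : (0 : ℝ) < s := hs
  have m₁ := mul_pos ht' hba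
  have m₂ := mul_pos hs' hcb
  have m₃ := mul_pos hs' hba
  have m₄ := mul_pos ht' hca
  have ac := det2_swap a c
  have bc := det2_swap b c
  have ab := det2_swap a b
  rw [smul_neg, ← sub_eq_add_neg] at h₃
  have e₁ : g a = g (b + t • a) := by
    refine hg.const_wedge (σ • b) (σ • c) (.inl ?_) (.inr ?_) ha ?_ ?_ h₂ ?_ ?_ <;> simp <;> linarith
  have e₂ : g (b - t • a) = g (c + s • b) := by
    refine hg.const_wedge (σ • c) (-(σ • b)) (.inr ?_) (.inl ?_) h₃ ?_ ?_ h₆ ?_ ?_ <;>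
      simp [bc] <;> linarith
  have e₃ : f b = f (c + s • b) := by
    refine hf.const_wedge (σ • c) (-(σ • a)) (.inr ?_) (.inl ?_) hb ?_ ?_ h₆ ?_ ?_ <;>
      simp [ac, ab] <;> linarith
  rw [e₁, e₃, h₁, e₂]
  have two : (1 + 1 : ZMod 2) = 0 := two_eq_zero_zmod
  linear_combination h₅ - g (c + s • b) * two

theorem exists_smul_of_det_eq_zero {c a : ℝ × ℝ} (hc : c ≠ 0) (h : det2 c a = 0) :
    ∃ t : ℝ, a = t • c := by
  by_cases h1 : c.1 = 0
  · unfold det2 at h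
    have h2 : c.2 ≠ 0 := fun h2 => hc (Prod.ext h1 h2)
    refine ⟨a.2 / c.2, Prod.ext ?_ ?_⟩
    · simp only [Prod.smul_fst, smul_eq_mul, h1, mul_zero]
      rw [h1] at h
      have : c.2 * a.1 = 0 := by linarith
      exact (mul_eq_zero.1 this).resolve_left h2
    · simp only [Prod.smul_snd, smul_eq_mul]
      field_simp
  · refine ⟨a.1 / c.1, Prod.ext ?_ ?_⟩
    · simp only [Prod.smul_fst, smul_eq_mul]
      field_simp
    · simp only [Prod.smul_snd, smul_eq_mul]
      unfold det2 at h
      field_simp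
      linarith

/-- Three distinct rays at a corner bound the sectors of two polygons that share the side `c` and
complement each other near it. The side of either polygon lies in the other's sector or not, and
this answer is symmetric. The proof goes through the positions of `a` and `b` relative to the line
through `c`. -/
theorem IsCornerParity.eq (hf : IsCornerParity f ε a c) (hg : IsCornerParity g ε b c)
    (ha : ‖a‖ < ε / 2) (hb : ‖b‖ < ε / 2) (hc : ‖c‖ < ε / 2) (ha0 : a ≠ 0) (hb0 : b ≠ 0)
    (hc0 : c ≠ 0) (hac : ∀ t : ℝ, 0 ≤ t → a ≠ t • c) (hbc : ∀ t : ℝ, 0 ≤ t → b ≠ t • c)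
    (hab : ∀ t : ℝ, 0 ≤ t → a ≠ t • b) (hfg : ∀ᶠ v in 𝓝 c, f v + g v = 1) : f b = g a := by
  have hε : 0 < ε := by linarith [norm_nonneg a]
  have hneg : ∀ x : ℝ × ℝ, (∀ t : ℝ, 0 ≤ t → x ≠ t • c) → det2 c x = 0 →
      ∃ t : ℝ, t < 0 ∧ x = t • c := by
    intro x hx h
    obtain ⟨t, rfl⟩ := exists_smul_of_det_eq_zero hc0 h
    exact ⟨t, not_le.1 fun ht => hx t ht rfl, rfl⟩
  have hnot : ¬ (det2 c a = 0 ∧ det2 c b = 0) := by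
    rintro ⟨h₁, h₂⟩
    obtain ⟨s, hs, rfl⟩ := hneg a hac h₁
    obtain ⟨t, ht, rfl⟩ := hneg b hbc h₂
    refine hab (s / t) (div_nonneg_of_nonpos hs.le ht.le) ?_
    rw [smul_smul, div_mul_cancel₀ _ ht.ne]
  have opp : ∀ σ : ℝ, σ ≠ 0 → 0 ≤ σ * det2 c a → σ * det2 c b ≤ 0 → f b = g a := by
    intro σ hσ h₁ h₂
    refine hf.eq_of_opposite hg ha hb hc hc0 hfg hσ ?_ ?_
    · rcases h₁.eq_or_lt with h | h
      · have h0 := (mul_eq_zero.1 h.symm).resolve_left hσ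
        refine .inr ⟨?_, hneg a hac h0⟩
        exact lt_of_le_of_ne h₂ fun h' => hnot ⟨h0, (mul_eq_zero.1 h').resolve_left hσ⟩
      · exact .inl h
    · rcases h₂.eq_or_lt with h | h
      · have h0 := (mul_eq_zero.1 h).resolve_left hσ
        refine .inr ⟨?_, hneg b hbc h0⟩
        exact lt_of_le_of_ne h₁ fun h' => hnot ⟨(mul_eq_zero.1 h'.symm).resolve_left hσ, h0⟩
      · exact .inl h
  have btw : ∀ σ : ℝ, σ ≠ 0 → 0 < σ * (det2 c a) →
      0 < σ * (det2 c b) → f b = g a := by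
    intro σ hσ h₁ h₂
    rcases lt_trichotomy 0 (σ * (det2 b a)) with h | h | h
    · exact hf.eq_of_between hg (by linarith) (by linarith) (by linarith) hfg h₁ h₂ h
    · obtain ⟨t, rfl⟩ := exists_smul_of_det_eq_zero hb0 ((mul_eq_zero.1 h.symm).resolve_left hσ)
      refine absurd rfl (hab t ?_)
      by_contra ht
      rw [det2_smul_right] at h₁
      nlinarith
    · refine (hg.eq_of_between hf (by linarith) (by linarith) (by linarith) ?_ h₂ h₁ ?_).symm
      · filter_upwards [hfg] with v hv
        rw [add_comm, hv]
      · rw [det2_swap]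
        linarith
  rcases le_total 0 (det2 c a) with h₁ | h₁ <;>
  rcases le_total 0 (det2 c b) with h₂ | h₂
  · rcases h₁.eq_or_lt with h₁ | h₁
    · exact opp (-1) (by norm_num) (by linarith) (by linarith)
    · rcases h₂.eq_or_lt with h₂ | h₂
      · exact opp 1 (by norm_num) (by linarith) (by linarith)
      · exact btw 1 (by norm_num) (by linarith) (by linarith)
  · exact opp 1 (by norm_num) (by linarith) (by linarith)
  · exact opp (-1) (by norm_num) (by linarith) (by linarith)
  · rcases h₁.eq_or_lt with h₁ | h₁
    · exact opp 1 (by norm_num) (by linarith) (by linarith)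
    · rcases h₂.eq_or_lt with h₂ | h₂
      · exact opp (-1) (by norm_num) (by linarith) (by linarith)
      · exact btw (-1) (by norm_num) (by linarith) (by linarith)

end Corner

/-! ### The two chains of a cut have parity zero for the opposite parts -/

section Cut

variable {n : ℕ} [NeZero n] {p : Fin n → ℝ × ℝ} {q : ℝ × ℝ}

theorem IsSimplePolygon.cyc_ne_succ (h : IsSimplePolygon p) {k : ℕ} (hk : k < n) :
    cyc p k ≠ cyc p (k + 1) := by
  have := h.three_le
  intro he
  rcases Nat.lt_or_ge (k + 1) n with h₁ | h₁
  · have := h.cyc_inj hk h₁ he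
    omega
  · rw [show k + 1 = n by omega, cyc_self] at he
    have := h.cyc_inj hk (NeZero.pos n) he
    omega

theorem IsSimplePolygon.ne_vertex (h : IsSimplePolygon p) {k : ℕ} (hk : k < n)
    (hq : q ∈ openSegment ℝ (cyc p k) (cyc p (k + 1))) (r : ℕ) : q ≠ cyc p r := by
  rintro rfl
  rw [← cyc_mod p r] at hq
  have hne := h.cyc_ne_succ hk
  have hl : cyc p (r % n) ≠ cyc p k := fun h' => by
    rw [h', left_mem_openSegment_iff] at hq
    exact hne hq
  have hr : cyc p (r % n) ≠ cyc p (k + 1) := fun h' => by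
    rw [h', right_mem_openSegment_iff] at hq
    exact hne hq
  rcases h.vertex_mem (Nat.mod_lt r (NeZero.pos n)) hk (openSegment_subset_segment ℝ _ _ hq) with
    h₁ | h₁ | h₁
  · exact hl (by rw [h₁])
  · exact hr (by rw [h₁])
  · exact hr (by rw [h₁.1, h₁.2, cyc_self])

theorem IsSimplePolygon.unique_edge (h : IsSimplePolygon p) {k l : ℕ} (hk : k < n) (hl : l < n)
    (hq : q ∈ openSegment ℝ (cyc p k) (cyc p (k + 1)))
    (hq' : q ∈ segment ℝ (cyc p l) (cyc p (l + 1))) : l = k := by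
  have hq'' := openSegment_subset_segment ℝ _ _ hq
  rcases lt_trichotomy k l with hkl | hkl | hkl
  · rcases h.inter hkl hl hq'' hq' with h₁ | h₁
    · exact absurd h₁.2 (h.ne_vertex hk hq _)
    · exact absurd h₁.2.2 (h.ne_vertex hk hq _)
  · exact hkl.symm
  · rcases h.inter hkl hk hq' hq'' with h₁ | h₁
    · exact absurd h₁.2 (h.ne_vertex hk hq _)
    · exact absurd h₁.2.2 (h.ne_vertex hk hq _)

theorem crossP_eq_det2 (A B q : ℝ × ℝ) : crossP A B q = det2 (B - A) (q - A) := by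
  simp [crossP, det2]

theorem crossP_add_smul {A B q w : ℝ × ℝ} {t : ℝ} (hq : q ∈ segment ℝ A B) :
    crossP A B (q + t • w) = t * det2 (B - A) w := by
  obtain ⟨s, -, -, hx, hy⟩ := mem_segment_iff_coord.1 hq
  simp only [crossP, det2, Prod.fst_add, Prod.snd_add, Prod.smul_fst, Prod.smul_snd, smul_eq_mul,
    Prod.fst_sub, Prod.snd_sub, hx, hy]
  ring

theorem tendsto_add_smul (q w : ℝ × ℝ) : Tendsto (fun t : ℝ => q + t • w) (𝓝[>] 0) (𝓝 q) := by
  have : ContinuousAt (fun t : ℝ => q + t • w) 0 := by fun_prop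
  have h' := this.tendsto
  simp only [zero_smul, add_zero] at h'
  exact h'.mono_left nhdsWithin_le_nhds

/-- The parity changes from one side of an edge to the other. -/
theorem IsSimplePolygon.toggle (h : IsSimplePolygon p) {k : ℕ} (hk : k < n)
    (hq : q ∈ openSegment ℝ (cyc p k) (cyc p (k + 1))) {w : ℝ × ℝ}
    (hw : det2 (cyc p (k + 1) - cyc p k) w ≠ 0) :
    ∀ᶠ t : ℝ in 𝓝[>] 0, parity p (q + t • w) = parity p (q - t • w) + 1 := by
  classical
  have e₁ : p ⟨k, hk⟩ = cyc p k := (cyc_of_lt hk).symm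
  have e₂ : p (⟨k, hk⟩ + 1) = cyc p (k + 1) := (cyc_succ p ⟨k, hk⟩).symm
  obtain ⟨κ, hκ⟩ := eventually_parity_of_mem (p := p) (k := ⟨k, hk⟩) (q := q)
    (by rw [e₁, e₂]; exact h.cyc_ne_succ hk) (by rw [e₁, e₂]; exact hq) (by
      rintro ⟨l, hl⟩ hne hm
      rw [polygonEdge_mk] at hm
      exact hne (Fin.ext (h.unique_edge hk hl hq hm)))
  rw [e₁, e₂] at hκ
  have hq' := openSegment_subset_segment ℝ _ _ hq
  filter_upwards [(tendsto_add_smul q w).eventually hκ, (tendsto_add_smul q (-w)).eventually hκ,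
    self_mem_nhdsWithin] with t h₁ h₂ ht
  rw [crossP_add_smul hq'] at h₁ h₂
  rw [smul_neg, ← sub_eq_add_neg, det2_neg_right] at h₂
  have ht' : (0 : ℝ) < t := ht
  have hne := mul_ne_zero ht'.ne' hw
  rw [h₁ hne, h₂ (by simpa using hne)]
  rcases hw.lt_or_gt with hw | hw
  · rw [if_neg (by nlinarith), if_pos (by nlinarith), add_assoc, two_eq_zero_zmod]
  · rw [if_pos (by nlinarith), if_neg (by nlinarith), add_zero]

theorem IsCornerParity.symm {f : ℝ × ℝ → ZMod 2} {ε : ℝ} {a c : ℝ × ℝ}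
    (h : IsCornerParity f ε a c) : IsCornerParity f ε c a :=
  ⟨fun S hS hε hr => h.const S hS hε fun v hv t ht => (hr v hv t ht).symm, h.right, h.left⟩

theorem IsCornerParity.mono {f : ℝ × ℝ → ZMod 2} {ε ε' : ℝ} {a c : ℝ × ℝ}
    (h : IsCornerParity f ε a c) (hε : ε' ≤ ε) : IsCornerParity f ε' a c :=
  ⟨fun S hS hn hr => h.const S hS (fun v hv => (hn v hv).trans_le hε) hr, h.left, h.right⟩

theorem add_smul_sub_mem_openSegment {A B : ℝ × ℝ} {δ : ℝ} (h0 : 0 < δ) (h1 : δ < 1) :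
    A + δ • (B - A) ∈ openSegment ℝ A B := by
  rw [openSegment_eq_image']
  exact ⟨δ, ⟨h0, h1⟩, rfl⟩

/-- A small ball around the vertex meets only its two edges. Scaling by `δ < 1` makes the side
vectors end inside these edges, where the parity toggles. -/
theorem IsSimplePolygon.exists_isCornerParity (h : IsSimplePolygon p) : ∃ ε > 0, ∀ δ : ℝ, 0 < δ →
    δ < 1 → IsCornerParity (fun v => parity p (cyc p 0 + v)) ε (δ • (cyc p 1 - cyc p 0))
      (δ • (cyc p (n - 1) - cyc p 0)) := by
  have hn := h.three_le
  have hn1 : n - 1 + 1 = n := by omega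
  have hev : ∀ᶠ x in 𝓝 (cyc p 0), ∀ k : Fin n, k.1 ≠ 0 → k.1 + 1 ≠ n →
      x ∉ segment ℝ (cyc p k) (cyc p (k + 1)) := by
    refine eventually_all.2 fun k => ?_
    by_cases hk : k.1 ≠ 0 ∧ k.1 + 1 ≠ n
    · have : cyc p 0 ∈ (segment ℝ (cyc p k) (cyc p (k + 1)))ᶜ := fun hm => by
        have := h.vertex_mem (NeZero.pos n) k.2 hm
        omega
      filter_upwards [(isClosed_segment _ _).isOpen_compl.mem_nhds this] with x hx _ _ using hx
    · exact Eventually.of_forall fun x h₁ h₂ => absurd ⟨h₁, h₂⟩ hk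
  obtain ⟨ε, hε, hb⟩ := Metric.eventually_nhds_iff_ball.1 hev
  refine ⟨ε, hε, fun δ h0 h1 => ⟨?_, ?_, ?_⟩⟩
  · intro S hS hn' hr x hx y hy
    have hS' : IsPreconnected ((fun v => cyc p 0 + v) '' S) :=
      hS.isPreconnected.image _ (by fun_prop)
    refine parity_eq_of_isPreconnected hS' ?_ (Set.mem_image_of_mem _ hx) (Set.mem_image_of_mem _ hy)
    rintro _ ⟨v, hv, rfl⟩ hbd
    obtain ⟨k, hk, hm⟩ := mem_polygonBoundary_iff.1 hbd
    have hball := hb (cyc p 0 + v) (by simpa using hn' v hv) ⟨k, hk⟩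
    by_cases hk0 : k = 0
    · subst hk0
      rw [segment_eq_image', Set.mem_image] at hm
      obtain ⟨t, ht, he⟩ := hm
      refine (hr v hv (t / δ) (div_nonneg ht.1 h0.le)).1 ?_
      rw [smul_smul, div_mul_cancel₀ _ h0.ne']
      exact (add_left_cancel he).symm
    · have hk1 : k + 1 = n := by
        by_contra hk1
        exact hball hk0 hk1 hm
      rw [hk1, cyc_self, segment_symm, segment_eq_image', Set.mem_image] at hm
      obtain ⟨t, ht, he⟩ := hm
      refine (hr v hv (t / δ) (div_nonneg ht.1 h0.le)).2 ?_
      rw [smul_smul, div_mul_cancel₀ _ h0.ne', show n - 1 = k by omega]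
      exact (add_left_cancel he).symm
  · intro w hw
    have := h.toggle (k := 0) (NeZero.pos n) (add_smul_sub_mem_openSegment h0 h1) (w := w)
      (fun h' => hw (by
        have : det2 (δ • (cyc p 1 - cyc p 0)) w = 0 := by
          rw [det2_smul_left]
          exact mul_eq_zero_of_right _ h'
        exact this))
    filter_upwards [this] with t ht
    rw [← add_assoc, add_sub]
    exact ht
  · intro w hw
    have hm : cyc p 0 + δ • (cyc p (n - 1) - cyc p 0) ∈
        openSegment ℝ (cyc p (n - 1)) (cyc p (n - 1 + 1)) := by
      rw [hn1, cyc_self, openSegment_symm]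
      exact add_smul_sub_mem_openSegment h0 h1
    have := h.toggle (k := n - 1) (by omega) hm (w := w)
      (fun h' => hw (by
        have : det2 (δ • (cyc p (n - 1) - cyc p 0)) w = 0 := by
          rw [hn1, cyc_self, ← neg_sub, det2_neg_left, neg_eq_zero] at h'
          rw [det2_smul_left]
          exact mul_eq_zero_of_right _ h'
        exact this))
    filter_upwards [this] with t ht
    rw [← add_assoc, add_sub]
    exact ht

/-- If two rays from `I` coincide, the nearer of the two endpoints lies on the segment to the other.
-/
theorem sub_ne_smul_sub {I X Y : ℝ × ℝ} (hX : X ∉ segment ℝ I Y) (hY : Y ∉ segment ℝ I X) {δ : ℝ}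
    (hδ : 0 < δ) {t : ℝ} (ht : 0 ≤ t) : δ • (X - I) ≠ t • δ • (Y - I) := by
  intro h
  rw [smul_comm] at h
  have h' : X - I = t • (Y - I) := smul_right_injective _ hδ.ne' h
  rcases le_or_gt t 1 with h1 | h1
  · refine hX ?_
    rw [segment_eq_image']
    refine ⟨t, ⟨ht, h1⟩, ?_⟩
    simp only [← h', add_sub_cancel]
  · refine hY ?_
    rw [segment_eq_image']
    refine ⟨t⁻¹, ⟨by positivity, inv_le_one_of_one_le₀ h1.le⟩, ?_⟩
    simp only [h', smul_smul, inv_mul_cancel₀ (by linarith : t ≠ 0), one_smul, add_sub_cancel]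

namespace IsCut

variable {m : ℕ}

theorem not_mem_boundary_sub (h : IsCut p m) {k : ℕ} (hk : m ≤ k) (hk' : k < n)
    (hq : q ∈ segment ℝ (cyc p k) (cyc p (k + 1))) (h0 : q ≠ cyc p 0) (hm : q ≠ cyc p m) :
    q ∉ polygonBoundary (sub p m) := by
  rw [mem_polygonBoundary_sub]
  rintro (⟨l, hl, hql⟩ | hd)
  · rcases h.simple.inter (by omega) hk' hql hq with h₁ | h₁
    · rw [show k = m by omega] at h₁
      exact hm h₁.2
    · exact h0 h₁.2.2
  · rcases h.eq_of_mem hk' hd hq with h₁ | h₁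
    · exact h0 h₁.1
    · exact hm h₁.1

theorem parity_sub_eq_of_edge (h : IsCut p m) {k : ℕ} (hk : m ≤ k) (hk' : k < n) {x y : ℝ × ℝ}
    (hx : x ∈ segment ℝ (cyc p k) (cyc p (k + 1))) (hx0 : x ≠ cyc p 0) (hxm : x ≠ cyc p m)
    (hy : y ∈ segment ℝ (cyc p k) (cyc p (k + 1))) (hy0 : y ≠ cyc p 0) (hym : y ≠ cyc p m) :
    parity (sub p m) x = parity (sub p m) y := by
  have hs := h.simple
  set γ : ℝ → ℝ × ℝ := fun t => cyc p k + t • (cyc p (k + 1) - cyc p k) with hγ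
  have hopen : ∀ t, 0 < t → t < 1 → ∀ r, γ t ≠ cyc p r := fun t h0 h1 =>
    hs.ne_vertex hk' (add_smul_sub_mem_openSegment h0 h1)
  -- Vertices occur only at the ends of an edge, so the parameters that avoid two of them still form
  -- an interval.
  have hI : ({t : ℝ | 0 ≤ t ∧ t ≤ 1 ∧ γ t ≠ cyc p 0 ∧ γ t ≠ cyc p m}).OrdConnected := by
    refine ⟨fun s hs' t ht u hu => ?_⟩
    rcases hu.1.eq_or_lt with rfl | h₁
    · exact hs'
    rcases hu.2.eq_or_lt with rfl | h₂
    · exact ht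
    have h0 : 0 < u := hs'.1.trans_lt h₁
    have h1 : u < 1 := h₂.trans_le ht.2.1
    exact ⟨h0.le, h1.le, hopen u h0 h1 0, hopen u h0 h1 m⟩
  rw [segment_eq_image', Set.mem_image] at hx hy
  obtain ⟨s, hs', rfl⟩ := hx
  obtain ⟨t, ht', rfl⟩ := hy
  refine parity_eq_of_path (γ := γ) (by fun_prop) hI (fun u hu => ?_) ⟨hs'.1, hs'.2, hx0, hxm⟩
    ⟨ht'.1, ht'.2, hy0, hym⟩
  refine h.not_mem_boundary_sub hk hk' ?_ hu.2.2.1 hu.2.2.2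
  rw [segment_eq_image']
  exact ⟨u, ⟨hu.1, hu.2.1⟩, rfl⟩

theorem cyc_ne (h : IsCut p m) {k : ℕ} (hk : k < n) (h0 : k ≠ 0) (hm : k ≠ m) :
    cyc p k ≠ cyc p 0 ∧ cyc p k ≠ cyc p m :=
  ⟨fun e => h0 (h.simple.cyc_inj hk (NeZero.pos n) e), fun e => hm (h.simple.cyc_inj hk h.lt e)⟩

/-- The chain from `m` to `n` without its two ends is connected and disjoint from the boundary of
the opposite part. -/
theorem exists_parity_sub (h : IsCut p m) : ∃ v, ∀ k, m ≤ k → k < n →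
    ∀ x ∈ segment ℝ (cyc p k) (cyc p (k + 1)), x ≠ cyc p 0 → x ≠ cyc p m →
      parity (sub p m) x = v := by
  have h2 := h.two_le
  have hv : ∀ k, m + 1 ≤ k → k < n → parity (sub p m) (cyc p k) = parity (sub p m) (cyc p (m + 1)) := by
    intro k hk
    induction k, hk using Nat.le_induction with
    | base => exact fun _ => rfl
    | succ k hk ih =>
      intro hk'
      rw [← ih (by omega)]
      obtain ⟨e₁, e₂⟩ := h.cyc_ne hk' (by omega) (by omega)
      obtain ⟨e₃, e₄⟩ := h.cyc_ne (k := k) (by omega) (by omega) (by omega)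
      exact h.parity_sub_eq_of_edge (k := k) (by omega) (by omega) (right_mem_segment ℝ _ _) e₁ e₂
        (left_mem_segment ℝ _ _) e₃ e₄
  refine ⟨parity (sub p m) (cyc p (m + 1)), fun k hk hk' x hx h0 hm => ?_⟩
  rcases hk.eq_or_lt with rfl | hk
  · obtain ⟨e₁, e₂⟩ := h.cyc_ne (k := m + 1) (by omega) (by omega) (by omega)
    exact h.parity_sub_eq_of_edge le_rfl hk' hx h0 hm (right_mem_segment ℝ _ _) e₁ e₂
  · rw [← hv k hk hk']
    obtain ⟨e₁, e₂⟩ := h.cyc_ne hk' (by omega) (by omega)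
    exact h.parity_sub_eq_of_edge hk.le hk' hx h0 hm (left_mem_segment ℝ _ _) e₁ e₂

/-- The diagonal runs through the interior, where the total parity is 1; this persists nearby, on
both sides. -/
theorem eventually_parity_add (h : IsCut p m) (hq : q ∈ openSegment ℝ (cyc p 0) (cyc p m)) :
    ∀ᶠ x in 𝓝 q, parity (sub p m) x + parity (sub (_root_.rot p m) (n - m)) x = 1 := by
  obtain ⟨h₁, h₂⟩ := mem_polygonInterior_iff.1 (h.diag hq)
  filter_upwards [eventually_parity_eq h₁] with x hx
  rw [← parity_eq_add h.lt.le, hx, h₂]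

/-- At the vertex `0` the edge to `1` belongs to one part, the edge to `n - 1` to the other, and the
diagonal to both. `IsCornerParity.eq` compares the parity of each part on the edge of the other one.
-/
theorem parity_corner (h : IsCut p m) {u v : ZMod 2}
    (hv : ∀ k, m ≤ k → k < n → ∀ x ∈ segment ℝ (cyc p k) (cyc p (k + 1)), x ≠ cyc p 0 →
      x ≠ cyc p m → parity (sub p m) x = v)
    (hu : ∀ k < m, ∀ x ∈ segment ℝ (cyc p k) (cyc p (k + 1)), x ≠ cyc p 0 →
      x ≠ cyc p m → parity (sub (_root_.rot p m) (n - m)) x = u) : v = u := by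
  have h2 := h.two_le
  have hs := h.simple
  have hn1 : n - 1 + 1 = n := by omega
  obtain ⟨ε₁, hε₁, c₁⟩ := h.simple_sub.exists_isCornerParity
  -- The other part is numbered from `m` to `n`; rotating it by `n - m` moves the corner at the
  -- vertex `0` to its first position.
  obtain ⟨ε₂, hε₂, c₂⟩ := (h.rot.simple_sub.rot (n - m)).exists_isCornerParity
  simp only [cyc_rot, parity_rot, zero_add, cyc_sub (le_refl (n - m))] at c₂
  have s₀ : cyc (sub (_root_.rot p m) (n - m)) (1 + (n - m)) = cyc p m := by
    rw [show 1 + (n - m) = 0 + (n - m + 1) by omega, cyc_add_self, cyc_sub (Nat.zero_le _), cyc_rot,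
      zero_add]
  have s₁ : cyc (sub (_root_.rot p m) (n - m)) (n - m + 1 - 1 + (n - m)) = cyc p (n - 1) := by
    rw [show n - m + 1 - 1 + (n - m) = (n - m - 1) + (n - m + 1) by omega, cyc_add_self,
      cyc_sub (by omega), cyc_rot]
    congr 1
    omega
  rw [s₀, s₁, show n - m + m = n by omega, cyc_self] at c₂
  rw [cyc_sub (Nat.zero_le m), cyc_sub (by omega), show m + 1 - 1 = m by omega,
    cyc_sub le_rfl] at c₁
  set ε := min ε₁ ε₂
  have hε : 0 < ε := lt_min hε₁ hε₂
  have hsmall : ∀ w : ℝ × ℝ, ∀ᶠ δ : ℝ in 𝓝[>] 0, ‖δ • w‖ < ε / 2 := by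
    intro w
    have := eventually_norm_add_smul_lt (u := (0 : ℝ × ℝ)) (w := w) (ε := ε / 2)
      (by simpa using half_pos hε)
    simpa using this
  obtain ⟨δ, hδ, hδ1, na, nb, nc⟩ := ((eventually_mem_nhdsWithin (a := (0 : ℝ)) (s := Set.Ioi 0)).and
    (((eventually_lt_nhds (zero_lt_one' ℝ)).filter_mono nhdsWithin_le_nhds).and
    ((hsmall (cyc p 1 - cyc p 0)).and ((hsmall (cyc p (n - 1) - cyc p 0)).and
    (hsmall (cyc p m - cyc p 0)))))).exists
  have h0 : (0 : ℝ) < δ := hδ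
  have k₁ := (c₁ δ h0 hδ1).mono (min_le_left ε₁ ε₂)
  have k₂ := (c₂ δ h0 hδ1).symm.mono (min_le_right ε₁ ε₂)
  obtain ⟨a0, am⟩ := h.cyc_ne (k := 1) (by omega) (by omega) (by omega)
  obtain ⟨b0, bm⟩ := h.cyc_ne (k := n - 1) (by omega) (by omega) (by omega)
  have v₁ : cyc p 1 ∉ segment ℝ (cyc p 0) (cyc p m) := fun h' => by
    rcases h.eq_of_mem (k := 1) (by omega) h' (left_mem_segment ℝ _ _) with h₁ | h₁
    · exact a0 h₁.1
    · exact am h₁.1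
  have v₂ : cyc p (n - 1) ∉ segment ℝ (cyc p 0) (cyc p m) := fun h' => by
    rcases h.eq_of_mem (k := n - 1) (by omega) h' (left_mem_segment ℝ _ _) with h₁ | h₁
    · exact b0 h₁.1
    · exact bm h₁.1
  have v₃ : ∀ r < n, r ≠ 0 → r ≠ 1 → cyc p r ∉ segment ℝ (cyc p 0) (cyc p 1) := fun r hr hr0 hr1 h' => by
    have := hs.vertex_mem hr (NeZero.pos n) h'
    omega
  have v₄ : ∀ r < n, r ≠ 0 → r ≠ n - 1 → cyc p r ∉ segment ℝ (cyc p 0) (cyc p (n - 1)) :=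
    fun r hr hr0 hr1 h' => by
      have := hs.vertex_mem (k := n - 1) hr (by omega) (by rwa [hn1, cyc_self, segment_symm])
      omega
  have key := k₁.eq k₂ na nb nc (smul_ne_zero h0.ne' (sub_ne_zero.2 a0))
    (smul_ne_zero h0.ne' (sub_ne_zero.2 b0)) (smul_ne_zero h0.ne' (sub_ne_zero.2 h.ne.symm))
    (fun t ht => sub_ne_smul_sub v₁ (v₃ m h.lt (by omega) (by omega)) h0 ht)
    (fun t ht => sub_ne_smul_sub v₂ (v₄ m h.lt (by omega) (by omega)) h0 ht)
    (fun t ht => sub_ne_smul_sub (v₄ 1 (by omega) (by omega) (by omega))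
      (v₃ (n - 1) (by omega) (by omega) (by omega)) h0 ht)
    (by
      have := h.eventually_parity_add (add_smul_sub_mem_openSegment h0 hδ1)
      have hc : Tendsto (fun v => cyc p 0 + v) (𝓝 (δ • (cyc p m - cyc p 0)))
          (𝓝 (cyc p 0 + δ • (cyc p m - cyc p 0))) := by
        have : Continuous fun v => cyc p 0 + v := by fun_prop
        exact this.tendsto _
      exact hc.eventually this)
  have ma : cyc p 0 + δ • (cyc p 1 - cyc p 0) ∈ openSegment ℝ (cyc p 0) (cyc p (0 + 1)) :=
    add_smul_sub_mem_openSegment h0 hδ1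
  have mb : cyc p 0 + δ • (cyc p (n - 1) - cyc p 0) ∈
      openSegment ℝ (cyc p (n - 1)) (cyc p (n - 1 + 1)) := by
    rw [hn1, cyc_self, openSegment_symm]
    exact add_smul_sub_mem_openSegment h0 hδ1
  rw [hv (n - 1) (by omega) (by omega) _ (openSegment_subset_segment ℝ _ _ mb)
      (hs.ne_vertex (by omega) mb 0) (hs.ne_vertex (by omega) mb m),
    hu 0 (by omega) _ (openSegment_subset_segment ℝ _ _ ma)
      (hs.ne_vertex (by omega) ma 0) (hs.ne_vertex (by omega) ma m)] at key
  exact key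

/-- The other side of the diagonal, expressed for the same numbering. -/
theorem of_rot {Q : ℝ × ℝ → Prop} (h : IsCut p m)
    (hQ : ∀ k, n - m ≤ k → k < n → ∀ x ∈ segment ℝ (cyc (_root_.rot p m) k)
      (cyc (_root_.rot p m) (k + 1)), x ≠ cyc (_root_.rot p m) 0 →
      x ≠ cyc (_root_.rot p m) (n - m) → Q x) :
    ∀ k < m, ∀ x ∈ segment ℝ (cyc p k) (cyc p (k + 1)), x ≠ cyc p 0 → x ≠ cyc p m → Q x := by
  intro k hk x hx h0 hm
  have := h.two_le
  refine hQ (k + (n - m)) (by omega) (by omega) x ?_ ?_ ?_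
  · rwa [cyc_rot, cyc_rot, show k + (n - m) + m = k + n by omega,
      show k + (n - m) + 1 + m = k + 1 + n by omega, cyc_add_self, cyc_add_self]
  · rwa [cyc_rot, zero_add]
  · rwa [cyc_rot, show n - m + m = n by omega, cyc_self]

/-- The two constants agree by `parity_corner`. An exposed vertex other than the ends of the cut
lies on one of the chains, and the separating functional shows that its parity with respect to the
opposite part is 0. -/
theorem parity_chain_eq_zero (h : IsCut p m) :
    (∀ k, m ≤ k → k < n → ∀ x ∈ segment ℝ (cyc p k) (cyc p (k + 1)), x ≠ cyc p 0 →
      x ≠ cyc p m → parity (sub p m) x = 0) ∧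
    ∀ k < m, ∀ x ∈ segment ℝ (cyc p k) (cyc p (k + 1)), x ≠ cyc p 0 →
      x ≠ cyc p m → parity (sub (_root_.rot p m) (n - m)) x = 0 := by
  have h2 := h.two_le
  have hs := h.simple
  obtain ⟨v, hv⟩ := h.exists_parity_sub
  obtain ⟨u, hu'⟩ := h.rot.exists_parity_sub
  have hu := h.of_rot hu'
  obtain rfl := h.parity_corner hv hu
  suffices v = 0 by
    subst this
    exact ⟨hv, hu⟩
  have hlt := h.lt
  obtain ⟨⟨k, hk⟩, h0, hm, f, hf⟩ := exists_exposed_vertex hs.injective ⟨0, NeZero.pos n⟩ ⟨m, h.lt⟩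
    ⟨⟨1, by omega⟩, fun h' => by
      simp only [← cyc_of_lt (p := p)] at h'
      obtain ⟨a0, am⟩ := h.cyc_ne (k := 1) (by omega) (by omega) (by omega)
      rcases h.eq_of_mem (k := 1) (by omega) h' (left_mem_segment ℝ _ _) with h₁ | h₁
      · exact a0 h₁.1
      · exact am h₁.1⟩
  simp only [ne_eq, Fin.mk.injEq] at h0 hm
  have hf' : ∀ l, l % n ≠ k → f (cyc p l) < f (cyc p k) := by
    intro l hl
    rw [← cyc_mod, cyc_of_lt (Nat.mod_lt l (NeZero.pos n)), cyc_of_lt hk]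
    exact hf _ (by simpa using hl)
  obtain ⟨e₁, e₂⟩ := h.cyc_ne hk h0 hm
  rcases Nat.lt_or_ge k m with hkm | hkm
  · rw [← hu k hkm _ (left_mem_segment ℝ _ _) e₁ e₂]
    refine (parity_eq_zero_of_functional f fun l => ?_).2
    rw [sub, cyc_rot]
    refine hf' _ fun hl => ?_
    have hl' := l.2
    rcases Nat.lt_or_ge (l + m) n with h₁ | h₁
    · rw [Nat.mod_eq_of_lt h₁] at hl
      omega
    · rw [show l + m = n by omega, Nat.mod_self] at hl
      omega
  · rw [← hv k hkm hk _ (left_mem_segment ℝ _ _) e₁ e₂]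
    refine (parity_eq_zero_of_functional f fun l => ?_).2
    rw [sub]
    refine hf' _ fun hl => ?_
    have hl' := l.2
    rw [Nat.mod_eq_of_lt (by omega)] at hl
    omega

end IsCut

end Cut

/-! ### Diagonals relative to a cut -/

section CutConsequences

variable {n : ℕ} [NeZero n] {p : Fin n → ℝ × ℝ} {q : ℝ × ℝ}

theorem parity_eq_zero_of_below (h : ∀ k, (p k).2 ≤ q.2) : parity p q = 0 :=
  Finset.sum_eq_zero fun _ _ => crossNum_eq_zero_of_below (h _) (h _)

namespace IsCut

variable {m : ℕ}

theorem mem_polygonBoundary_other (h : IsCut p m) :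
    q ∈ polygonBoundary (sub (_root_.rot p m) (n - m)) ↔
      (∃ k, m ≤ k ∧ k < n ∧ q ∈ segment ℝ (cyc p k) (cyc p (k + 1))) ∨
        q ∈ segment ℝ (cyc p 0) (cyc p m) := by
  have h2 := h.two_le
  rw [mem_polygonBoundary_sub, cyc_rot, cyc_rot, zero_add, show n - m + m = n by omega, cyc_self,
    segment_symm ℝ (cyc p m)]
  refine or_congr_left ⟨?_, ?_⟩
  · rintro ⟨k, hk, hq⟩
    rw [cyc_rot, cyc_rot, add_right_comm] at hq
    exact ⟨k + m, by omega, by omega, hq⟩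
  · rintro ⟨k, hk, hk', hq⟩
    refine ⟨k - m, by omega, ?_⟩
    rwa [cyc_rot, cyc_rot, add_right_comm, show k - m + m = k by omega]

theorem left_mem_boundary_sub (_ : IsCut p m) : cyc p 0 ∈ polygonBoundary (sub p m) :=
  mem_polygonBoundary_sub.2 (.inr (left_mem_segment ℝ _ _))

theorem right_mem_boundary_sub (_ : IsCut p m) : cyc p m ∈ polygonBoundary (sub p m) :=
  mem_polygonBoundary_sub.2 (.inr (right_mem_segment ℝ _ _))

theorem not_mem_boundary_other (h : IsCut p m) {k : ℕ} (hk : k < m)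
    (hq : q ∈ segment ℝ (cyc p k) (cyc p (k + 1))) (h0 : q ≠ cyc p 0) (hm : q ≠ cyc p m) :
    q ∉ polygonBoundary (sub (_root_.rot p m) (n - m)) :=
  h.of_rot (Q := fun q => q ∉ polygonBoundary (sub (_root_.rot p m) (n - m)))
    (fun _ hk hk' _ hx h0 hm => h.rot.not_mem_boundary_sub hk hk' hx h0 hm) k hk q hq h0 hm

/-- It has to be shown that the other part has parity 0 at `q`. Along a ray from `q` to its first
hit with the boundary of this part, this part keeps parity 1; so the ray does not meet the other
chain, and the other parity is constant. At the hit it is 0: on this part's own chain by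
`parity_chain_eq_zero`, and near the diagonal because the two parities add up to 1. -/
theorem mem_polygonInterior_of_sub (h : IsCut p m) (hq : q ∈ polygonInterior (sub p m)) :
    q ∈ polygonInterior p := by
  obtain ⟨hqb, hq1⟩ := mem_polygonInterior_iff.1 hq
  obtain ⟨hz, hz'⟩ := h.parity_chain_eq_zero
  have hq0 : q ≠ cyc p 0 := fun e => hqb (e ▸ h.left_mem_boundary_sub)
  have hqm : q ≠ cyc p m := fun e => hqb (e ▸ h.right_mem_boundary_sub)
  -- A direction `(s, 1)` whose line through `q` avoids both ends of the cut; only two values of `s`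
  -- have to be excluded.
  obtain ⟨s, hs⟩ := Infinite.exists_notMem_finset
    ({((cyc p 0).1 - q.1) / ((cyc p 0).2 - q.2), ((cyc p m).1 - q.1) / ((cyc p m).2 - q.2)} :
      Finset ℝ)
  simp only [Finset.mem_insert, Finset.mem_singleton, not_or] at hs
  set γ : ℝ → ℝ × ℝ := fun t => q + t • (s, 1) with hγ
  have hγc : Continuous γ := by fun_prop
  have hγ0 : γ 0 = q := by simp [hγ]
  have avoid : ∀ X : ℝ × ℝ, q ≠ X → s ≠ (X.1 - q.1) / (X.2 - q.2) → ∀ t, γ t ≠ X := by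
    rintro X hX hsX t rfl
    have h1 : (γ t).1 - q.1 = t * s := by simp [hγ]
    have h2 : (γ t).2 - q.2 = t := by simp [hγ]
    rw [h1, h2] at hsX
    by_cases ht : t = 0
    · rw [ht, hγ0] at hX
      exact hX rfl
    · rw [mul_div_cancel_left₀ _ ht] at hsX
      exact hsX rfl
  have av0 := avoid _ hq0 hs.1
  have avm := avoid _ hqm hs.2
  set M := ∑ l, |(sub p m l).2|
  have hM : ∀ k, |(sub p m k).2| ≤ M := fun k =>
    Finset.single_le_sum (f := fun l => |(sub p m l).2|) (fun _ _ => abs_nonneg _)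
      (Finset.mem_univ k)
  have hM0 : 0 ≤ M := Finset.sum_nonneg fun _ _ => abs_nonneg _
  -- At this parameter the ray is at least as high as every vertex, so the parity is 0 there and a
  -- hit must occur before.
  set T := M + |q.2| with hT
  have hT0 : 0 ≤ T := by positivity
  have hfar : parity (sub p m) (γ T) = 0 := by
    refine parity_eq_zero_of_below fun k => ?_
    have h1 : (γ T).2 = q.2 + T := by simp [hγ]
    have := le_abs_self (sub p m k).2
    have := hM k
    have := neg_abs_le q.2
    rw [h1]
    linarith
  set Z := {t : ℝ | t ∈ Set.Icc 0 T ∧ γ t ∈ polygonBoundary (sub p m)} with hZ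
  have hZc : IsCompact Z := isCompact_Icc.inter_right
    ((isClosed_polygonBoundary (sub p m)).preimage hγc)
  have hZn : Z.Nonempty := by
    by_contra hne
    rw [Set.not_nonempty_iff_eq_empty] at hne
    have := parity_eq_of_path (p := sub p m) hγc (I := Set.Icc 0 T) Set.ordConnected_Icc
      (fun t ht hb => by
        have : t ∈ Z := ⟨ht, hb⟩
        rw [hne] at this
        exact this) (s := 0) (t := T) ⟨le_rfl, hT0⟩ ⟨hT0, le_rfl⟩
    rw [hfar, hγ0, hq1] at this
    exact one_ne_zero this
  obtain ⟨t₀, ⟨⟨ht0, htT⟩, hb⟩, hmin⟩ := hZc.exists_isLeast hZn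
  have ht0' : 0 < t₀ := by
    refine lt_of_le_of_ne ht0 fun e => hqb ?_
    rw [← e, hγ0] at hb
    exact hb
  have hin : ∀ t ∈ Set.Ico 0 t₀, γ t ∉ polygonBoundary (sub p m) := fun t ht hbt =>
    absurd (hmin ⟨⟨ht.1, ht.2.le.trans htT⟩, hbt⟩) (not_le.2 ht.2)
  have hf : ∀ t ∈ Set.Ico 0 t₀, parity (sub p m) (γ t) = 1 := by
    intro t ht
    rw [← hq1, ← hγ0]
    exact parity_eq_of_path hγc Set.ordConnected_Ico hin ht ⟨le_rfl, ht0'⟩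
  have hout : ∀ t ∈ Set.Ico 0 t₀,
      γ t ∉ polygonBoundary (sub (_root_.rot p m) (n - m)) := by
    intro t ht hbt
    rcases h.mem_polygonBoundary_other.1 hbt with ⟨k, hk, hk', hkq⟩ | hd
    · have := hz k hk hk' _ hkq (av0 t) (avm t)
      rw [hf t ht] at this
      exact one_ne_zero this
    · exact hin t ht (mem_polygonBoundary_sub.2 (.inr hd))
  have hg : ∀ t ∈ Set.Ico 0 t₀, parity (sub (_root_.rot p m) (n - m)) (γ t) =
      parity (sub (_root_.rot p m) (n - m)) q := by
    intro t ht
    rw [← hγ0]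
    exact parity_eq_of_path hγc Set.ordConnected_Ico hout ht ⟨le_rfl, ht0'⟩
  have hev : ∀ᶠ x in 𝓝 (γ t₀), parity (sub p m) x = 1 →
      parity (sub (_root_.rot p m) (n - m)) x = 0 := by
    rcases mem_polygonBoundary_sub.1 hb with ⟨k, hk, hkq⟩ | hd
    · filter_upwards [eventually_parity_eq
        (h.not_mem_boundary_other hk hkq (av0 t₀) (avm t₀))] with x hx _
      rw [hx, hz' k hk _ hkq (av0 t₀) (avm t₀)]
    · have hd' := mem_openSegment_of_ne_left_right (av0 t₀).symm (avm t₀).symm hd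
      filter_upwards [h.eventually_parity_add hd'] with x hx h1
      rw [h1] at hx
      simpa using hx
  have hlim : Tendsto γ (𝓝[<] t₀) (𝓝 (γ t₀)) := (hγc.tendsto t₀).mono_left nhdsWithin_le_nhds
  obtain ⟨t, h₁, h₂⟩ := ((hlim.eventually hev).and (Ico_mem_nhdsLT ht0')).exists
  have hg0 := hg t h₂
  rw [h₁ (hf t h₂)] at hg0
  refine mem_polygonInterior_iff.2 ⟨fun hbd => ?_, ?_⟩
  · obtain ⟨k, hk, hkq⟩ := mem_polygonBoundary_iff.1 hbd
    rcases Nat.lt_or_ge k m with hkm | hkm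
    · exact hqb (mem_polygonBoundary_sub.2 (.inl ⟨k, hkm, hkq⟩))
    · have := hz k hkm hk q hkq hq0 hqm
      rw [hq1] at this
      exact one_ne_zero this
  · rw [parity_eq_add h.lt.le, hq1, ← hg0, add_zero]

theorem vertex_left (h : IsCut p m) {k : ℕ} (hk : k ≤ m) (h0 : k ≠ 0) (hm : k ≠ m) :
    cyc p k ∉ polygonBoundary (sub (_root_.rot p m) (n - m)) ∧
      parity (sub (_root_.rot p m) (n - m)) (cyc p k) = 0 := by
  have h2 := h.two_le
  obtain ⟨e₁, e₂⟩ := h.cyc_ne (by omega) h0 hm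
  exact ⟨h.not_mem_boundary_other (by omega) (left_mem_segment ℝ _ _) e₁ e₂,
    h.parity_chain_eq_zero.2 k (by omega) _ (left_mem_segment ℝ _ _) e₁ e₂⟩

theorem vertex_right (h : IsCut p m) {k : ℕ} (hk : m < k) (hk' : k < n) :
    cyc p k ∉ polygonBoundary (sub p m) ∧ parity (sub p m) (cyc p k) = 0 := by
  obtain ⟨e₁, e₂⟩ := h.cyc_ne hk' (by omega) (by omega)
  exact ⟨h.not_mem_boundary_sub hk.le hk' (left_mem_segment ℝ _ _) e₁ e₂,
    h.parity_chain_eq_zero.1 k hk.le hk' _ (left_mem_segment ℝ _ _) e₁ e₂⟩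

theorem not_mem_of_not_mem (h : IsCut p m) (hq : q ∉ polygonBoundary p)
    (hd : q ∉ openSegment ℝ (cyc p 0) (cyc p m)) : q ∉ polygonBoundary (sub p m) ∧
      q ∉ polygonBoundary (sub (_root_.rot p m) (n - m)) := by
  have h2 := h.two_le
  have hd' : q ∉ segment ℝ (cyc p 0) (cyc p m) := fun h' => by
    refine hd (mem_openSegment_of_ne_left_right ?_ ?_ h') <;> rintro rfl
    · exact hq (cyc_mem_polygonBoundary p 0)
    · exact hq (cyc_mem_polygonBoundary p m)
  constructor
  · rw [mem_polygonBoundary_sub]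
    rintro (⟨k, hk, hkq⟩ | h')
    · exact hq (mem_polygonBoundary_iff.2 ⟨k, by omega, hkq⟩)
    · exact hd' h'
  · rw [h.mem_polygonBoundary_other]
    rintro (⟨k, -, hk, hkq⟩ | h')
    · exact hq (mem_polygonBoundary_iff.2 ⟨k, hk, hkq⟩)
    · exact hd' h'

end IsCut

theorem crossP_of_mem_segment {A B : ℝ × ℝ} (hq : q ∈ segment ℝ A B) : crossP A B q = 0 := by
  have := crossP_add_smul (w := 0) (t := 0) hq
  simpa using this

theorem eventually_mem_openSegment {A B z : ℝ × ℝ} (hz : z ∈ openSegment ℝ A B) :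
    ∀ᶠ t : ℝ in 𝓝[>] 0, z + t • (B - A) ∈ openSegment ℝ B z := by
  rw [openSegment_eq_image', Set.mem_image] at hz
  obtain ⟨s, hs, rfl⟩ := hz
  have h1s : 0 < 1 - s := by linarith [hs.2]
  filter_upwards [self_mem_nhdsWithin,
    (eventually_lt_nhds h1s).filter_mono nhdsWithin_le_nhds] with t h0 h1
  have h0 : 0 < t := h0
  rw [openSegment_symm, openSegment_eq_image']
  refine ⟨t / (1 - s), ⟨by positivity, (div_lt_one h1s).2 h1⟩, ?_⟩
  have : B - (A + s • (B - A)) = (1 - s) • (B - A) := by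
    rw [sub_smul, one_smul]
    abel
  simp only [this, smul_smul, div_mul_cancel₀ _ h1s.ne']

theorem openSegment_subset_openSegment_left {A B z : ℝ × ℝ} (hz : z ∈ openSegment ℝ A B) :
    openSegment ℝ A z ⊆ openSegment ℝ A B := by
  rw [openSegment_eq_image', Set.mem_image] at hz
  obtain ⟨s, ⟨hs0, hs1⟩, rfl⟩ := hz
  intro x hx
  rw [openSegment_eq_image', Set.mem_image] at hx
  obtain ⟨t, ⟨ht0, ht1⟩, rfl⟩ := hx
  rw [add_sub_cancel_left, smul_smul]
  exact add_smul_sub_mem_openSegment (by positivity) (by nlinarith)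

theorem crossP_comb (A B x y : ℝ × ℝ) {a b : ℝ} (hab : a + b = 1) :
    crossP A B (a • x + b • y) = a * crossP A B x + b * crossP A B y := by
  obtain rfl : a = 1 - b := by linarith
  simp only [crossP, Prod.fst_add, Prod.snd_add, Prod.smul_fst, Prod.smul_snd, smul_eq_mul]
  ring

theorem exists_param_of_crossP_eq_zero {X Y K : ℝ × ℝ} (hXY : X ≠ Y) (h : crossP X Y K = 0) :
    ∃ κ : ℝ, K = X + κ • (Y - X) := by
  rw [crossP_eq_det2] at h
  obtain ⟨t, ht⟩ := exists_smul_of_det_eq_zero (sub_ne_zero.2 hXY.symm) h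
  exact ⟨t, by rw [← ht]; abel⟩

theorem param_mem_openSegment {X D : ℝ × ℝ} {κ μ l : ℝ} (h₁ : κ < μ) (h₂ : μ < l) :
    X + μ • D ∈ openSegment ℝ (X + κ • D) (X + l • D) := by
  have h : 0 < l - κ := by linarith
  refine ⟨(l - μ) / (l - κ), (μ - κ) / (l - κ), div_pos (by linarith) h, div_pos (by linarith) h, ?_,
    ?_⟩
  · field_simp
    ring
  · ext
    · simp
      field_simp
      ring
    · simp
      field_simp
      ring

theorem param_of_mem_openSegment {X D z : ℝ × ℝ} {κ l : ℝ} (hl : κ < l)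
    (hz : z ∈ openSegment ℝ (X + κ • D) (X + l • D)) :
    ∃ μ, κ < μ ∧ μ < l ∧ z = X + μ • D := by
  rw [openSegment_eq_image', Set.mem_image] at hz
  obtain ⟨s, hs, rfl⟩ := hz
  refine ⟨κ + s * (l - κ), by nlinarith [hs.1], by nlinarith [hs.2], ?_⟩
  ext
  · simp
    ring
  · simp
    ring

/-- Two collinear open segments that meet, neither containing an endpoint of the other, coincide. -/
theorem eq_of_collinear {K L X Y z : ℝ × ℝ} (hXY : X ≠ Y) (hKL : K ≠ L)
    (hK : crossP X Y K = 0) (hL : crossP X Y L = 0)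
    (hz : z ∈ openSegment ℝ K L) (hz' : z ∈ openSegment ℝ X Y)
    (hK' : K ∉ openSegment ℝ X Y) (hL' : L ∉ openSegment ℝ X Y)
    (hX' : X ∉ openSegment ℝ K L) (hY' : Y ∉ openSegment ℝ K L) :
    (K = X ∧ L = Y) ∨ (K = Y ∧ L = X) := by
  obtain ⟨κ, hκ⟩ := exists_param_of_crossP_eq_zero hXY hK
  obtain ⟨l, hl⟩ := exists_param_of_crossP_eq_zero hXY hL
  -- In the parametrization `X + t • (Y - X)` these are two intersecting open intervals, `(κ, l)`
  -- and `(0, 1)`, neither of which contains an end of the other.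
  have key : ∀ {K L : ℝ × ℝ} {κ l : ℝ}, κ < l → K = X + κ • (Y - X) → L = X + l • (Y - X) →
      z ∈ openSegment ℝ K L → K ∉ openSegment ℝ X Y → L ∉ openSegment ℝ X Y →
      X ∉ openSegment ℝ K L → Y ∉ openSegment ℝ K L → K = X ∧ L = Y := by
    rintro K L κ l hlt rfl rfl hz hK' hL' hX' hY'
    have eX : X = X + (0 : ℝ) • (Y - X) := by simp
    have eY : Y = X + (1 : ℝ) • (Y - X) := by simp
    have hinj : ∀ {x y : ℝ}, X + x • (Y - X) = X + y • (Y - X) → x = y := fun h =>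
      smul_left_injective _ (sub_ne_zero.2 hXY.symm) (add_left_cancel h)
    have mXY : ∀ {x : ℝ}, 0 < x → x < 1 → X + x • (Y - X) ∈ openSegment ℝ X Y := fun h0 h1 =>
      add_smul_sub_mem_openSegment h0 h1
    obtain ⟨μ, h1, h2, e⟩ := param_of_mem_openSegment hlt hz
    rw [eX, eY] at hz'
    simp only [zero_smul, add_zero, one_smul, add_sub_cancel] at hz'
    obtain ⟨ν, h3, h4, e'⟩ := param_of_mem_openSegment (X := X) (D := Y - X) zero_lt_one
      (z := z) (by simpa using hz')
    obtain rfl : μ = ν := hinj (e.symm.trans e')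
    have a1 : κ ≤ 0 := by
      by_contra h
      exact hK' (mXY (not_le.1 h) (by linarith))
    have a2 : 1 ≤ l := by
      by_contra h
      exact hL' (mXY (by linarith) (not_le.1 h))
    have a3 : 0 ≤ κ := by
      by_contra h
      refine hX' ?_
      have := param_mem_openSegment (X := X) (D := Y - X) (not_le.1 h) (show 0 < l by linarith)
      rwa [← eX] at this
    have a4 : l ≤ 1 := by
      by_contra h
      refine hY' ?_
      have := param_mem_openSegment (X := X) (D := Y - X) (show κ < 1 by linarith) (not_le.1 h)
      rwa [← eY] at this
    obtain rfl : κ = 0 := le_antisymm a1 a3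
    obtain rfl : l = 1 := le_antisymm a4 a2
    exact ⟨eX.symm, eY.symm⟩
  rcases lt_trichotomy κ l with h | h | h
  · exact .inl (key h hκ hl hz hK' hL' hX' hY')
  · exact absurd (by rw [hκ, hl, h]) hKL
  · rw [openSegment_symm] at hz hX' hY'
    exact .inr (key h hl hκ hz hL' hK' hX' hY').symm

namespace IsCut

variable {m : ℕ}

/-- Suppose that the diagonal crosses the cut at `z`. From both of its ends, where the other part
has parity 0, this value is carried up to `z`, so this part has parity 1 on both sides of `z`. But
it toggles across its own edge, the cut. Collinear position is excluded separately. -/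
theorem disjoint (h : IsCut p m) {k l : ℕ} (hk : k ≤ m) (hl : l ≤ m) (hkl : k ≠ l)
    (h₁ : ¬ (k = 0 ∧ l = m)) (h₂ : ¬ (k = m ∧ l = 0))
    (hd : openSegment ℝ (cyc p k) (cyc p l) ⊆ polygonInterior p) :
    Disjoint (openSegment ℝ (cyc p k) (cyc p l)) (openSegment ℝ (cyc p 0) (cyc p m)) := by
  have hm := h.two_le
  rw [Set.disjoint_left]
  intro z hz hz'
  have hb : ∀ {A B : ℝ × ℝ}, openSegment ℝ A B ⊆ polygonInterior p → ∀ r,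
      cyc p r ∉ openSegment ℝ A B := fun hAB r hr =>
    (mem_polygonInterior_iff.1 (hAB hr)).1 (cyc_mem_polygonBoundary p r)
  have hne : cyc p k ≠ cyc p l := fun e =>
    hkl (h.simple.cyc_inj (by omega) (by omega) e)
  have hzc := crossP_of_mem_segment (openSegment_subset_segment ℝ _ _ hz')
  obtain ⟨a, b, ha, hb', hab, hzab⟩ := hz
  have hz : z ∈ openSegment ℝ (cyc p k) (cyc p l) := ⟨a, b, ha, hb', hab, hzab⟩
  rw [← hzab, crossP_comb _ _ _ _ hab] at hzc
  by_cases hL : crossP (cyc p 0) (cyc p m) (cyc p l) = 0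
  · have hK : crossP (cyc p 0) (cyc p m) (cyc p k) = 0 := by
      rw [hL] at hzc
      simpa [ha.ne'] using hzc
    rcases eq_of_collinear h.ne hne hK hL hz hz' (hb h.diag _) (hb h.diag _) (hb hd _) (hb hd _)
      with ⟨e₁, e₂⟩ | ⟨e₁, e₂⟩
    · exact h₁ ⟨h.simple.cyc_inj (by omega) (by omega) e₁,
        h.simple.cyc_inj (by omega) (by omega) e₂⟩
    · exact h₂ ⟨h.simple.cyc_inj (by omega) (by omega) e₁,
        h.simple.cyc_inj (by omega) (by omega) e₂⟩
  have hK : crossP (cyc p 0) (cyc p m) (cyc p k) ≠ 0 := by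
    intro hK
    rw [hK] at hzc
    simp [hb'.ne', hL] at hzc
  have hzz := crossP_of_mem_segment (openSegment_subset_segment ℝ _ _ hz')
  have side : ∀ r ≤ m, crossP (cyc p 0) (cyc p m) (cyc p r) ≠ 0 →
      openSegment ℝ (cyc p r) z ⊆ polygonInterior p →
      ∀ x ∈ openSegment ℝ (cyc p r) z, parity (sub (_root_.rot p m) (n - m)) x = 0 := by
    intro r hr hrc hsub x hx
    have h0 : r ≠ 0 := by
      rintro rfl
      exact hrc (crossP_of_mem_segment (left_mem_segment ℝ _ _))
    have h1 : r ≠ m := by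
      rintro rfl
      exact hrc (crossP_of_mem_segment (right_mem_segment ℝ _ _))
    obtain ⟨e₁, e₂⟩ := h.vertex_left hr h0 h1
    rw [parity_eq_of_left e₁ (fun y hy => ?_) hx, e₂]
    refine (h.not_mem_of_not_mem (mem_polygonInterior_iff.1 (hsub hy)).1 fun hyd => ?_).2
    have := crossP_of_mem_segment (openSegment_subset_segment ℝ _ _ hyd)
    obtain ⟨u, v, hu, hv, huv, rfl⟩ := hy
    rw [crossP_comb _ _ _ _ huv, hzz] at this
    simp [hu.ne', hrc] at this
  have hsub : ∀ {A B : ℝ × ℝ}, z ∈ openSegment ℝ A B → openSegment ℝ B z ⊆ openSegment ℝ A B := by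
    intro A B hz
    rw [openSegment_symm ℝ A B] at hz ⊢
    exact openSegment_subset_openSegment_left hz
  have hz₂ : z ∈ openSegment ℝ (cyc p l) (cyc p k) := openSegment_symm ℝ (cyc p k) _ ▸ hz
  have hd₂ : openSegment ℝ (cyc p l) (cyc p k) ⊆ polygonInterior p := openSegment_symm ℝ (cyc p k) _ ▸ hd
  have hsl := side l hl hL ((hsub hz).trans hd)
  have hsk := side k hk hK ((hsub hz₂).trans hd₂)
  have htog := h.simple_sub.toggle (k := m) (Nat.lt_succ_self m) (q := z)
    (w := cyc p l - cyc p k)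
    (by rwa [cyc_self, cyc_sub le_rfl, cyc_sub (Nat.zero_le _), openSegment_symm])
    (by
      rw [cyc_self, cyc_sub le_rfl, cyc_sub (Nat.zero_le _)]
      intro h0
      have h1 : crossP (cyc p 0) (cyc p m) (cyc p l) - crossP (cyc p 0) (cyc p m) (cyc p k) = 0 := by
        simp only [crossP, det2, Prod.fst_sub, Prod.snd_sub] at h0 ⊢
        linarith
      rw [sub_eq_zero] at h1
      rw [h1, ← add_mul, hab, one_mul] at hzc
      exact hK hzc)
  have hsum := h.eventually_parity_add hz'
  have hs₁ := (tendsto_add_smul z (cyc p l - cyc p k)).eventually hsum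
  have hs₂ := (tendsto_add_smul z (cyc p k - cyc p l)).eventually hsum
  obtain ⟨t, e₁, e₂, e₃, e₄, e₅⟩ := (htog.and (hs₁.and (hs₂.and
    ((eventually_mem_openSegment hz).and (eventually_mem_openSegment hz₂))))).exists
  rw [hsl _ e₄, add_zero] at e₂
  rw [hsk _ e₅, add_zero] at e₃
  rw [e₂, show z - t • (cyc p l - cyc p k) = z + t • (cyc p k - cyc p l) by
    rw [← neg_sub (cyc p l), smul_neg, sub_eq_add_neg], e₃] at e₁
  exact absurd e₁ (by decide)

/-- Since the diagonal misses the cut, it avoids the boundary of both parts. At least one of its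
ends is not on the cut and has parity 0 for the other part, so that parity is 0 all along. -/
theorem isDiagonal_sub (h : IsCut p m) {k l : ℕ} (hk : k ≤ m) (hl : l ≤ m) (hkl : k ≠ l)
    (h₁ : ¬ (k = 0 ∧ l = m)) (h₂ : ¬ (k = m ∧ l = 0))
    (hd : openSegment ℝ (cyc p k) (cyc p l) ⊆ polygonInterior p) :
    openSegment ℝ (cyc p k) (cyc p l) ⊆ polygonInterior (sub p m) := by
  have hdis := Set.disjoint_left.1 (h.disjoint hk hl hkl h₁ h₂ hd)
  have hnot : ∀ x ∈ openSegment ℝ (cyc p k) (cyc p l), x ∉ polygonBoundary (sub p m) ∧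
      x ∉ polygonBoundary (sub (_root_.rot p m) (n - m)) := fun x hx =>
    h.not_mem_of_not_mem (mem_polygonInterior_iff.1 (hd hx)).1 (hdis hx)
  intro x hx
  have h0 : parity (sub (_root_.rot p m) (n - m)) x = 0 := by
    by_cases hk0 : k = 0 ∨ k = m
    · obtain ⟨e₁, e₂⟩ := h.vertex_left hl (by omega) (by omega)
      rw [openSegment_symm] at hnot hx
      rw [parity_eq_of_left e₁ (fun y hy => (hnot y hy).2) hx, e₂]
    · obtain ⟨e₁, e₂⟩ := h.vertex_left hk (by omega) (by omega)
      rw [parity_eq_of_left e₁ (fun y hy => (hnot y hy).2) hx, e₂]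
  have h1 := (mem_polygonInterior_iff.1 (hd hx)).2
  rw [parity_eq_add h.lt.le, h0, add_zero] at h1
  exact mem_polygonInterior_iff.2 ⟨(hnot x hx).1, h1⟩

/-- If the diagonal missed the cut, the end `k` would force parity 0 for one part along it and the
end `l` for the other, so it would be outside the polygon. -/
theorem not_disjoint (h : IsCut p m) {k l : ℕ} (hk0 : k ≠ 0) (hkm : k < m) (hml : m < l)
    (hl : l < n) (hd : openSegment ℝ (cyc p k) (cyc p l) ⊆ polygonInterior p) :
    ¬ Disjoint (openSegment ℝ (cyc p k) (cyc p l)) (openSegment ℝ (cyc p 0) (cyc p m)) := by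
  intro hdis
  rw [Set.disjoint_left] at hdis
  have hnot : ∀ x ∈ openSegment ℝ (cyc p k) (cyc p l), x ∉ polygonBoundary (sub p m) ∧
      x ∉ polygonBoundary (sub (_root_.rot p m) (n - m)) := fun x hx =>
    h.not_mem_of_not_mem (mem_polygonInterior_iff.1 (hd hx)).1 (hdis hx)
  have hx : cyc p k + (1 / 2 : ℝ) • (cyc p l - cyc p k) ∈ openSegment ℝ (cyc p k) (cyc p l) :=
    add_smul_sub_mem_openSegment (by norm_num) (by norm_num)
  have h1 := (mem_polygonInterior_iff.1 (hd hx)).2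
  obtain ⟨a₁, a₂⟩ := h.vertex_left hkm.le hk0 hkm.ne
  obtain ⟨b₁, b₂⟩ := h.vertex_right hml hl
  rw [parity_eq_add h.lt.le, parity_eq_of_left a₁ (fun y hy => (hnot y hy).2) hx, a₂,
    parity_eq_of_left b₁ (fun y hy => (hnot y (openSegment_symm ℝ (cyc p k) _ ▸ hy)).1)
      (openSegment_symm ℝ (cyc p k) _ ▸ hx), b₂] at h1
  exact absurd h1 (by decide)

/-- Edges and diagonals of the other part do not enter the interior of this one. -/
theorem disjoint_interior (h : IsCut p m) {k l : ℕ} (hk : m ≤ k) (hk' : k ≤ n) (hl : m ≤ l)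
    (hl' : l ≤ n) (hkl : k ≠ l)
    (hd : l = k + 1 ∨ openSegment ℝ (cyc p k) (cyc p l) ⊆ polygonInterior p) :
    Disjoint (openSegment ℝ (cyc p k) (cyc p l)) (polygonInterior (sub p m)) := by
  have hm := h.two_le
  rw [Set.disjoint_left]
  intro x hx hxi
  obtain ⟨hxb, hx1⟩ := mem_polygonInterior_iff.1 hxi
  rcases hd with rfl | hd
  · rw [h.parity_chain_eq_zero.1 k hk (by omega) x (openSegment_subset_segment ℝ _ _ hx)
      (fun e => hxb (e ▸ h.left_mem_boundary_sub))
      (fun e => hxb (e ▸ h.right_mem_boundary_sub))] at hx1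
    exact zero_ne_one hx1
  · by_cases hc : (k = m ∧ l = n) ∨ (k = n ∧ l = m)
    · refine hxb (mem_polygonBoundary_sub.2 (.inr (openSegment_subset_segment ℝ _ _ ?_)))
      rcases hc with ⟨rfl, rfl⟩ | ⟨rfl, rfl⟩
      · rwa [openSegment_symm, cyc_self] at hx
      · rwa [cyc_self] at hx
    · have := h.rot.isDiagonal_sub (k := k - m) (l := l - m) (by omega) (by omega) (by omega)
        (by omega) (by omega)
      rw [cyc_rot, cyc_rot, Nat.sub_add_cancel hk, Nat.sub_add_cancel hl, polygonInterior_rot] at this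
      have h1 := (mem_polygonInterior_iff.1 (this hd hx)).2
      have h2 := (mem_polygonInterior_iff.1 (hd hx)).2
      rw [parity_eq_add h.lt.le, h1, hx1] at h2
      exact absurd h2 (by decide)

end IsCut

end CutConsequences

/-! ### Existence of a diagonal at an exposed vertex -/

theorem exists_axis_hit {x₁ x₂ a₁ a₂ : ℝ} (h₁ : 0 < x₁) (h₂ : 0 < x₂) (h : a₁ < 0 ∨ a₂ < 0) :
    ∃ t : ℝ, 0 < t ∧ t < 1 ∧
      (((1 - t) * x₁ + t * a₁ = 0 ∧ 0 ≤ (1 - t) * x₂ + t * a₂) ∨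
        ((1 - t) * x₂ + t * a₂ = 0 ∧ 0 ≤ (1 - t) * x₁ + t * a₁)) := by
  have key : ∀ {x₁ x₂ a₁ a₂ : ℝ}, 0 < x₁ → 0 < x₂ → a₁ < 0 → 0 ≤ x₁ * a₂ - a₁ * x₂ →
      ∃ t : ℝ, 0 < t ∧ t < 1 ∧ (1 - t) * x₁ + t * a₁ = 0 ∧ 0 ≤ (1 - t) * x₂ + t * a₂ := by
    intro x₁ x₂ a₁ a₂ h₁ h₂ h h'
    have hd : 0 < x₁ - a₁ := by linarith
    refine ⟨x₁ / (x₁ - a₁), by positivity, (div_lt_one hd).2 (by linarith), ?_, ?_⟩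
    · field_simp
      ring
    · have : (1 - x₁ / (x₁ - a₁)) * x₂ + x₁ / (x₁ - a₁) * a₂ =
          (x₁ * a₂ - a₁ * x₂) / (x₁ - a₁) := by
        field_simp
        ring
      rw [this]
      positivity
  -- The sign of this determinant tells which of the two axes the segment reaches while the other
  -- coordinate is still nonnegative.
  by_cases c₁ : a₁ < 0 ∧ 0 ≤ x₁ * a₂ - a₁ * x₂
  · obtain ⟨t, h0, h1, h2⟩ := key h₁ h₂ c₁.1 c₁.2
    exact ⟨t, h0, h1, .inl h2⟩
  · have c₂ : a₂ < 0 ∧ 0 ≤ x₂ * a₁ - a₂ * x₁ := by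
      by_cases ha : a₁ < 0
      · have hlt : x₁ * a₂ - a₁ * x₂ < 0 := not_le.1 fun h' => c₁ ⟨ha, h'⟩
        exact ⟨by nlinarith, by linarith⟩
      · have ha₂ := h.resolve_left ha
        exact ⟨ha₂, by nlinarith⟩
    obtain ⟨t, h0, h1, h2⟩ := key h₂ h₁ c₂.1 c₂.2
    exact ⟨t, h0, h1, .inr h2⟩

section Corner

variable {n : ℕ} [NeZero n] {p : Fin n → ℝ × ℝ} {α β : ℝ × ℝ → ℝ}

/-- `α` and `β` are the affine coordinates with respect to the corner at the vertex `0`. -/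
structure IsCornerCoord (p : Fin n → ℝ × ℝ) (α β : ℝ × ℝ → ℝ) : Prop where
  simple : IsSimplePolygon p
  left_comb : ∀ x y : ℝ × ℝ, ∀ a b : ℝ, a + b = 1 → α (a • x + b • y) = a * α x + b * α y
  right_comb : ∀ x y : ℝ × ℝ, ∀ a b : ℝ, a + b = 1 → β (a • x + b • y) = a * β x + b * β y
  repr : ∀ q, q = cyc p 0 + α q • (cyc p 1 - cyc p 0) + β q • (cyc p (n - 1) - cyc p 0)
  left_coord : ∀ a b : ℝ,
    α (cyc p 0 + a • (cyc p 1 - cyc p 0) + b • (cyc p (n - 1) - cyc p 0)) = a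
  right_coord : ∀ a b : ℝ,
    β (cyc p 0 + a • (cyc p 1 - cyc p 0) + b • (cyc p (n - 1) - cyc p 0)) = b
  left_zero : α (cyc p 0) = 0
  right_zero : β (cyc p 0) = 0
  left_next : α (cyc p 1) = 1
  right_next : β (cyc p 1) = 0
  left_prev : α (cyc p (n - 1)) = 0
  right_prev : β (cyc p (n - 1)) = 1

namespace IsCornerCoord

theorem mem_next (h : IsCornerCoord p α β) {q : ℝ × ℝ} (h₀ : β q = 0) (h₁ : 0 ≤ α q)
    (h₂ : α q ≤ 1) : q ∈ segment ℝ (cyc p 0) (cyc p 1) := by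
  rw [segment_eq_image']
  refine ⟨α q, ⟨h₁, h₂⟩, ?_⟩
  have := h.repr q
  rw [h₀, zero_smul, add_zero] at this
  exact this.symm

theorem mem_prev (h : IsCornerCoord p α β) {q : ℝ × ℝ} (h₀ : α q = 0) (h₁ : 0 ≤ β q)
    (h₂ : β q ≤ 1) : q ∈ segment ℝ (cyc p 0) (cyc p (n - 1)) := by
  rw [segment_eq_image']
  refine ⟨β q, ⟨h₁, h₂⟩, ?_⟩
  have := h.repr q
  rw [h₀, zero_smul, add_zero] at this
  exact this.symm

theorem prev_edge (h : IsCornerCoord p α β) : segment ℝ (cyc p 0) (cyc p (n - 1)) =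
    segment ℝ (cyc p (n - 1)) (cyc p (n - 1 + 1)) := by
  have := h.simple.three_le
  rw [show n - 1 + 1 = n by omega, cyc_self, segment_symm]

/-- Two edges at the corner are not met by the relative interior of another edge. -/
theorem not_mem_edge (h : IsCornerCoord p α β) {k : ℕ} (hk : 1 ≤ k) (hk' : k + 2 ≤ n) {q : ℝ × ℝ}
    (hq : q ∈ openSegment ℝ (cyc p k) (cyc p (k + 1))) :
    q ∉ segment ℝ (cyc p 0) (cyc p 1) ∧ q ∉ segment ℝ (cyc p 0) (cyc p (n - 1)) := by
  constructor
  · intro hq'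
    have := h.simple.unique_edge (l := 0) (by omega) (by omega) hq hq'
    omega
  · intro hq'
    rw [h.prev_edge] at hq'
    have := h.simple.unique_edge (by omega) (by omega) hq hq'
    omega

/-- An edge that runs from inside the corner triangle to a point with a negative coordinate leaves
the triangle through one of the two edges at the corner, as the level `α + β` stays at most 1. Edges
of a simple polygon do not do that. -/
theorem false_of_outside (h : IsCornerCoord p α β) {k : ℕ} (hk : 1 ≤ k) (hk' : k + 2 ≤ n)
    {x a : ℝ × ℝ} (hsub : openSegment ℝ x a ⊆ openSegment ℝ (cyc p k) (cyc p (k + 1)))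
    (hx₁ : 0 < α x) (hx₂ : 0 < β x) (hx : α x + β x ≤ 1) (ha : α a + β a ≤ 1)
    (ha' : α a < 0 ∨ β a < 0) : False := by
  obtain ⟨t, h0, h1, ht⟩ := exists_axis_hit hx₁ hx₂ ha'
  set y := (1 - t) • x + t • a with hy
  have hyo : y ∈ openSegment ℝ x a := ⟨1 - t, t, by linarith, h0, by ring, rfl⟩
  obtain ⟨n₁, n₂⟩ := h.not_mem_edge hk hk' (hsub hyo)
  have e₁ : α y = (1 - t) * α x + t * α a := h.left_comb _ _ _ _ (by ring)
  have e₂ : β y = (1 - t) * β x + t * β a := h.right_comb _ _ _ _ (by ring)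
  have e₃ : α y + β y ≤ 1 := by
    rw [e₁, e₂]
    nlinarith
  rw [← e₁, ← e₂] at ht
  rcases ht with ⟨a₁, a₂⟩ | ⟨a₁, a₂⟩
  · exact n₂ (h.mem_prev a₁ a₂ (by linarith))
  · exact n₁ (h.mem_next a₁ a₂ (by linarith))

theorem openSegment_subset_edge {x A B : ℝ × ℝ} (hx : x ∈ segment ℝ A B) (hxB : x ≠ B) :
    openSegment ℝ x B ⊆ openSegment ℝ A B := by
  by_cases hA : x = A
  · rw [hA]
  · have hx' := mem_openSegment_of_ne_left_right (Ne.symm hA) hxB.symm hx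
    rw [openSegment_symm ℝ x, openSegment_symm ℝ A]
    exact openSegment_subset_openSegment_left (openSegment_symm ℝ A B ▸ hx')

/-- The part of the corner below all vertices is not met by the boundary. -/
theorem not_mem_boundary (h : IsCornerCoord p α β) {x : ℝ × ℝ} (hx₁ : 0 < α x) (hx₂ : 0 < β x)
    (hx : α x + β x ≤ 1)
    (hne : ∀ k, x ≠ cyc p k)
    (hv : ∀ k, 1 ≤ k → k + 2 ≤ n → x ∈ segment ℝ (cyc p k) (cyc p (k + 1)) →
      ∃ a, (a = cyc p k ∨ a = cyc p (k + 1)) ∧ α a + β a ≤ 1 ∧ (α a < 0 ∨ β a < 0)) :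
    x ∉ polygonBoundary p := by
  intro hb
  have hn := h.simple.three_le
  obtain ⟨k, hk, hxk⟩ := mem_polygonBoundary_iff.1 hb
  by_cases hk0 : k = 0
  · subst hk0
    obtain ⟨a, b, _, _, hab, rfl⟩ := hxk
    rw [h.right_comb _ _ _ _ hab, zero_add, h.right_zero, h.right_next] at hx₂
    simp at hx₂
  by_cases hk1 : k = n - 1
  · subst hk1
    rw [← h.prev_edge] at hxk
    obtain ⟨a, b, _, _, hab, rfl⟩ := hxk
    rw [h.left_comb _ _ _ _ hab, h.left_zero, h.left_prev] at hx₁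
    simp at hx₁
  obtain ⟨a, ha | ha, ha1, ha2⟩ := hv k (by omega) (by omega) hxk
  · refine h.false_of_outside (k := k) (by omega) (by omega) ?_ hx₁ hx₂ hx ha1 ha2
    rw [ha, openSegment_symm ℝ (cyc p k)]
    exact openSegment_subset_edge (segment_symm ℝ (cyc p k) _ ▸ hxk) (hne k)
  · refine h.false_of_outside (k := k) (by omega) (by omega) ?_ hx₁ hx₂ hx ha1 ha2
    rw [ha]
    exact openSegment_subset_edge hxk (hne (k + 1))

end IsCornerCoord

/-- Cramer's rule. -/
theorem exists_isCornerCoord (h : IsSimplePolygon p)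
    (hD : det2 (cyc p 1 - cyc p 0) (cyc p (n - 1) - cyc p 0) ≠ 0) :
    ∃ α β, IsCornerCoord p α β := by
  set u := cyc p 1 - cyc p 0 with hu
  set w := cyc p (n - 1) - cyc p 0 with hw
  refine ⟨fun q => det2 (q - cyc p 0) w / det2 u w, fun q => det2 u (q - cyc p 0) / det2 u w,
    ⟨h, ?_, ?_, ?_, ?_, ?_, ?_, ?_, ?_, ?_, ?_, ?_⟩⟩
  · intro x y a b hab
    obtain rfl : a = 1 - b := by linarith
    simp only [det2, Prod.fst_add, Prod.snd_add, Prod.smul_fst, Prod.smul_snd, smul_eq_mul,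
      Prod.fst_sub, Prod.snd_sub]
    ring
  · intro x y a b hab
    obtain rfl : a = 1 - b := by linarith
    simp only [det2, Prod.fst_add, Prod.snd_add, Prod.smul_fst, Prod.smul_snd, smul_eq_mul,
      Prod.fst_sub, Prod.snd_sub]
    ring
  · intro q
    rw [← hu, ← hw]
    have e : ∀ c : ℝ × ℝ, c = (det2 c w / det2 u w) • u + (det2 u c / det2 u w) • w := by
      intro c
      ext
      · simp only [Prod.fst_add, Prod.smul_fst, smul_eq_mul]
        field_simp
        simp only [det2]
        ring
      · simp only [Prod.snd_add, Prod.smul_snd, smul_eq_mul]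
        field_simp
        simp only [det2]
        ring
    rw [add_assoc, ← e]
    abel
  · intro a b
    rw [← hu, ← hw, add_assoc, add_sub_cancel_left, div_eq_iff hD]
    simp only [det2, Prod.fst_add, Prod.snd_add, Prod.smul_fst, Prod.smul_snd, smul_eq_mul]
    ring
  · intro a b
    rw [← hu, ← hw, add_assoc, add_sub_cancel_left, div_eq_iff hD]
    simp only [det2, Prod.fst_add, Prod.snd_add, Prod.smul_fst, Prod.smul_snd, smul_eq_mul]
    ring
  · simp [det2]
  · simp [det2]
  · exact div_self hD
  · simp [← hu]
  · simp [← hw]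
  · exact div_self hD

theorem IsCornerCoord.det_ne_zero (h : IsCornerCoord p α β) :
    det2 (cyc p 1 - cyc p 0) (cyc p (n - 1) - cyc p 0) ≠ 0 := by
  intro hd
  have hw : cyc p (n - 1) - cyc p 0 ≠ 0 := fun e => by
    have := h.left_prev
    have := h.right_prev
    rw [sub_eq_zero.1 e, h.right_zero] at this
    exact zero_ne_one this
  rw [det2_swap, neg_eq_zero] at hd
  obtain ⟨t, ht⟩ := exists_smul_of_det_eq_zero hw hd
  have h₁ := h.left_coord 1 0
  have h₂ := h.left_coord 0 t
  rw [one_smul, zero_smul, add_zero, ht] at h₁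
  rw [zero_smul, add_zero, h₁] at h₂
  exact one_ne_zero h₂

/-- As the corner is exposed, the point `-δ • w` beyond it has parity 0. From there one reaches `δ •
u - t • w` within the half-plane bounded by the line of `u` and opposite to `w`, which contains
neither side, and then crosses the edge with direction `u` into the corner. -/
theorem IsCornerCoord.exists_parity_eq_one (h : IsCornerCoord p α β) (f : ℝ × ℝ →L[ℝ] ℝ)
    (hf : ∀ k, 0 < k → k < n → f (cyc p k) < f (cyc p 0)) {ε : ℝ} (hε : 0 < ε) :
    ∃ x, 0 < α x ∧ 0 < β x ∧ α x + β x < ε ∧ parity p x = 1 := by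
  have hn := h.simple.three_le
  obtain ⟨ε₀, hε₀, hc⟩ := h.simple.exists_isCornerParity
  set v := cyc p 0 with hv
  set u := cyc p 1 - v with hu
  set w := cyc p (n - 1) - v with hw
  have hD : det2 u w ≠ 0 := h.det_ne_zero
  have hsmall : ∀ y : ℝ × ℝ, ∀ᶠ δ : ℝ in 𝓝[>] 0, ‖δ • y‖ < ε₀ := by
    intro y
    simpa using eventually_norm_add_smul_lt (u := 0) (w := y) (ε := ε₀) (by simpa using hε₀)
  obtain ⟨δ, hδ1, hδ2, hδ3, hδ4, hδ0⟩ := ((hsmall u).and ((hsmall w).and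
    (((eventually_lt_nhds (half_pos hε)).filter_mono nhdsWithin_le_nhds).and
    (((eventually_lt_nhds one_pos).filter_mono nhdsWithin_le_nhds).and
      self_mem_nhdsWithin)))).exists
  have hδ0 : 0 < δ := hδ0
  have hcor := hc δ hδ0 hδ4
  have htog := hcor.left w (by
    rw [det2_smul_left]
    exact mul_ne_zero hδ0.ne' hD)
  have hball := eventually_norm_add_smul_lt (w := -w) hδ1
  obtain ⟨t, ht1, ht2, ht3, ht0⟩ := (htog.and (hball.and
    (((eventually_lt_nhds (half_pos hε)).filter_mono nhdsWithin_le_nhds).and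
      self_mem_nhdsWithin))).exists
  have ht0 : 0 < t := ht0
  have hconv : Convex ℝ {y : ℝ × ℝ | ‖y‖ < ε₀ ∧ det2 u w * det2 u y < 0} := by
    have h₁ : Convex ℝ {y : ℝ × ℝ | ‖y‖ < ε₀} := by
      have : {y : ℝ × ℝ | ‖y‖ < ε₀} = Metric.ball 0 ε₀ := by
        ext
        simp
      rw [this]
      exact convex_ball 0 ε₀
    refine h₁.inter (t := {y | det2 u w * det2 u y < 0}) ?_
    intro y hy z hz r s hr hs hrs
    simp only [Set.mem_ofPred_eq, det2_add_right, det2_smul_right] at hy hz ⊢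
    rcases hr.eq_or_lt with rfl | hr
    · rw [zero_add] at hrs
      rw [hrs]
      simpa using hz
    · nlinarith
  have hD2 : 0 < det2 u w * det2 u w := mul_self_pos.2 hD
  have hconst := hcor.const _ hconv (fun y hy => hy.1) (fun y hy s hs => by
    constructor
    · rintro rfl
      have := hy.2
      simp at this
    · rintro rfl
      have := hy.2
      rw [det2_smul_right, det2_smul_right] at this
      have h2 : 0 ≤ (s * δ) * (det2 u w * det2 u w) := by positivity
      nlinarith)
    (-(δ • w)) ⟨by rwa [norm_neg], by
      rw [← neg_smul, det2_smul_right]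
      nlinarith⟩ (δ • u - t • w) ⟨by simpa [sub_eq_add_neg] using ht2, by
      rw [sub_eq_add_neg, ← neg_smul, det2_add_right, det2_smul_right, det2_smul_right, det2_self]
      nlinarith⟩
  have hzero : parity p (v + -(δ • w)) = 0 := by
    refine (parity_eq_zero_of_functional f fun k => ?_).2
    have hw' : f w < 0 := by
      rw [hw, map_sub]
      linarith [hf (n - 1) (by omega) (by omega)]
    have : f (p k) ≤ f v := by
      rw [← cyc_val p]
      rcases Nat.eq_zero_or_pos k.1 with h0 | h0
      · rw [h0]
      · exact (hf k h0 k.2).le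
    rw [map_add, map_neg, map_smul, smul_eq_mul]
    nlinarith
  refine ⟨v + δ • u + t • w, ?_, ?_, ?_, ?_⟩
  · rw [h.left_coord]
    exact hδ0
  · rw [h.right_coord]
    exact ht0
  · rw [h.left_coord, h.right_coord]
    linarith
  · rw [add_assoc, ht1, ← hconst, hzero, zero_add]

theorem IsCornerCoord.convex_region (h : IsCornerCoord p α β) (H : ℝ) :
    Convex ℝ {x | 0 < α x ∧ 0 < β x ∧ α x + β x < H} := by
  intro x hx y hy r s hr hs hrs
  obtain ⟨a₁, a₂, a₃⟩ := hx
  obtain ⟨b₁, b₂, b₃⟩ := hy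
  simp only [Set.mem_ofPred_eq, h.left_comb _ _ _ _ hrs, h.right_comb _ _ _ _ hrs]
  rcases hr.eq_or_lt with rfl | hr
  · obtain rfl : s = 1 := by linarith
    simp only [zero_mul, one_mul, zero_add]
    exact ⟨b₁, b₂, b₃⟩
  · obtain rfl : s = 1 - r := by linarith
    refine ⟨?_, ?_, ?_⟩ <;> nlinarith

/-- A boundary edge through a point of level below `H` has an end of level below `H`, which by
assumption has a negative coordinate, so `not_mem_boundary` applies. The region is convex and
contains points of parity 1. -/
theorem IsCornerCoord.region_subset (h : IsCornerCoord p α β) (f : ℝ × ℝ →L[ℝ] ℝ)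
    (hf : ∀ k, 0 < k → k < n → f (cyc p k) < f (cyc p 0)) {H : ℝ} (hH0 : 0 < H) (hH : H ≤ 1)
    (hS : ∀ k, 2 ≤ k → k + 2 ≤ n → 0 ≤ α (cyc p k) → 0 ≤ β (cyc p k) →
      H ≤ α (cyc p k) + β (cyc p k)) :
    {x | 0 < α x ∧ 0 < β x ∧ α x + β x < H} ⊆ polygonInterior p := by
  have hn := h.simple.three_le
  have hout : ∀ k, 1 ≤ k → k < n → α (cyc p k) + β (cyc p k) < H →
      α (cyc p k) < 0 ∨ β (cyc p k) < 0 := by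
    intro k hk hkn hlt
    by_contra! hc
    by_cases h1 : k = 1
    · subst h1
      rw [h.left_next, h.right_next] at hlt
      linarith
    by_cases h2 : k = n - 1
    · subst h2
      rw [h.left_prev, h.right_prev] at hlt
      linarith
    exact absurd (hS k (by omega) (by omega) hc.1 hc.2) (not_le.2 hlt)
  have hb : ∀ x ∈ {x | 0 < α x ∧ 0 < β x ∧ α x + β x < H}, x ∉ polygonBoundary p := by
    rintro x ⟨hx₁, hx₂, hx⟩
    refine h.not_mem_boundary hx₁ hx₂ (by linarith) (fun k hk => ?_) fun k hk hk' hxk => ?_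
    · rw [← cyc_mod] at hk
      have hmod := Nat.mod_lt k (NeZero.pos n)
      rcases Nat.eq_zero_or_pos (k % n) with h0 | h0
      · rw [hk, h0, h.left_zero] at hx₁
        exact lt_irrefl _ hx₁
      · rw [hk] at hx₁ hx₂ hx
        rcases hout _ h0 hmod hx with h' | h' <;> linarith
    · obtain ⟨r, s, hr, hs, hrs, rfl⟩ := hxk
      rw [h.left_comb _ _ _ _ hrs, h.right_comb _ _ _ _ hrs] at hx
      by_cases hA : α (cyc p k) + β (cyc p k) < H
      · exact ⟨_, .inl rfl, by linarith, hout k hk (by omega) hA⟩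
      · by_cases hB : α (cyc p (k + 1)) + β (cyc p (k + 1)) < H
        · exact ⟨_, .inr rfl, by linarith, hout (k + 1) (by omega) (by omega) hB⟩
        · obtain rfl : s = 1 - r := by linarith
          nlinarith
  obtain ⟨y, hy₁, hy₂, hy₃, hy⟩ := h.exists_parity_eq_one f hf hH0
  intro x hx
  refine mem_polygonInterior_iff.2 ⟨hb x hx, ?_⟩
  rw [parity_eq_of_isPreconnected (h.convex_region H).isPreconnected hb hx ⟨hy₁, hy₂, hy₃⟩, hy]

/-- An exposed vertex is an endpoint of a diagonal, or its neighbours see each other. -/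
theorem IsCornerCoord.exists_diagonal (h : IsCornerCoord p α β) (f : ℝ × ℝ →L[ℝ] ℝ)
    (hf : ∀ k, 0 < k → k < n → f (cyc p k) < f (cyc p 0)) (hn : 4 ≤ n) :
    (∃ m < n, openSegment ℝ (cyc p 0) (cyc p m) ⊆ polygonInterior p) ∨
      openSegment ℝ (cyc p 1) (cyc p (n - 1)) ⊆ polygonInterior p := by
  set S := {k ∈ Finset.Icc 2 (n - 2) | 0 ≤ α (cyc p k) ∧ 0 ≤ β (cyc p k) ∧
    α (cyc p k) + β (cyc p k) ≤ 1} with hSdef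
  have memS : ∀ k, k ∈ S ↔ (2 ≤ k ∧ k ≤ n - 2) ∧ 0 ≤ α (cyc p k) ∧ 0 ≤ β (cyc p k) ∧
      α (cyc p k) + β (cyc p k) ≤ 1 := fun k => by simp [hSdef]
  by_cases hS : S.Nonempty
  · left
    -- Among the vertices in the corner triangle, one that is nearest to the corner, measured
    -- parallel to the opposite side, sees the corner.
    obtain ⟨z, hz, hmin⟩ := S.exists_min_image (fun k => α (cyc p k) + β (cyc p k)) hS
    obtain ⟨⟨z₁, z₂⟩, z₃, z₄, z₅⟩ := (memS z).1 hz
    -- A vanishing coordinate would place the vertex on one of the two edges at the corner.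
    have hα : 0 < α (cyc p z) := by
      refine lt_of_le_of_ne z₃ fun e => ?_
      have := h.mem_prev e.symm z₄ (by linarith)
      rw [h.prev_edge] at this
      have := h.simple.vertex_mem (by omega) (by omega) this
      omega
    have hβ : 0 < β (cyc p z) := by
      refine lt_of_le_of_ne z₄ fun e => ?_
      have := h.simple.vertex_mem (k := 0) (by omega) (by omega)
        (h.mem_next e.symm z₃ (by linarith))
      omega
    refine ⟨z, by omega, Set.Subset.trans ?_ (h.region_subset f hf
      (H := α (cyc p z) + β (cyc p z)) (by linarith) z₅ fun k hk hk' h₁ h₂ => ?_)⟩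
    · rintro x ⟨r, s, hr, hs, hrs, rfl⟩
      simp only [Set.mem_ofPred_eq, h.left_comb _ _ _ _ hrs, h.right_comb _ _ _ _ hrs, h.left_zero,
        h.right_zero, mul_zero, zero_add]
      refine ⟨by positivity, by positivity, by nlinarith⟩
    · by_cases h1 : α (cyc p k) + β (cyc p k) ≤ 1
      · exact hmin k ((memS k).2 ⟨⟨hk, by omega⟩, h₁, h₂, h1⟩)
      · linarith
  · right
    rw [Finset.not_nonempty_iff_eq_empty] at hS
    have hout : ∀ k, 2 ≤ k → k + 2 ≤ n → α (cyc p k) + β (cyc p k) ≤ 1 →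
        α (cyc p k) < 0 ∨ β (cyc p k) < 0 := by
      intro k hk hk' h1
      by_contra! hc
      have := (memS k).2 ⟨⟨hk, by omega⟩, hc.1, hc.2, h1⟩
      rw [hS] at this
      exact absurd this (Finset.notMem_empty k)
    have hreg := h.region_subset f hf zero_lt_one le_rfl fun k hk hk' h₁ h₂ => by
      by_contra! hc
      rcases hout k hk hk' hc.le with h' | h' <;> linarith
    intro x hx
    obtain ⟨r, s, hr, hs, hrs, hxe⟩ := hx
    have hx₁ : α x = r := by
      rw [← hxe, h.left_comb _ _ _ _ hrs, h.left_next, h.left_prev]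
      ring
    have hx₂ : β x = s := by
      rw [← hxe, h.right_comb _ _ _ _ hrs, h.right_next, h.right_prev]
      ring
    have hne : ∀ k, x ≠ cyc p k := by
      intro k hk
      rw [← cyc_mod] at hk
      have hmod := Nat.mod_lt k (NeZero.pos n)
      rcases Nat.eq_zero_or_pos (k % n) with h0 | h0
      · rw [hk, h0, h.left_zero] at hx₁
        linarith
      by_cases h1 : k % n = 1
      · rw [hk, h1, h.right_next] at hx₂
        linarith
      by_cases h2 : k % n = n - 1
      · rw [hk, h2, h.left_prev] at hx₁
        linarith
      rw [hk] at hx₁ hx₂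
      rcases hout (k % n) (by omega) (by omega) (by linarith) with h' | h' <;> linarith
    have hb : x ∉ polygonBoundary p := by
      refine h.not_mem_boundary (by linarith) (by linarith) (by linarith) hne
        fun k hk hk' hxk => ?_
      by_cases hA : 2 ≤ k ∧ α (cyc p k) + β (cyc p k) ≤ 1
      · exact ⟨_, .inl rfl, hA.2, hout k hA.1 hk' hA.2⟩
      by_cases hB : k + 3 ≤ n ∧ α (cyc p (k + 1)) + β (cyc p (k + 1)) ≤ 1
      · exact ⟨_, .inr rfl, hB.2, hout (k + 1) (by omega) (by omega) hB.2⟩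
      -- Now both ends of the edge have level at least 1, and one of them more, since they are not
      -- both neighbours of the corner as `4 ≤ n`. But `x` has level exactly 1, so it would be the
      -- other end, a vertex.
      exfalso
      obtain ⟨c, d, hc, hd, hcd, e⟩ := hxk
      have hsum : c * (α (cyc p k) + β (cyc p k)) +
          d * (α (cyc p (k + 1)) + β (cyc p (k + 1))) = 1 := by
        have e₁ := h.left_comb (cyc p k) (cyc p (k + 1)) c d hcd
        have e₂ := h.right_comb (cyc p k) (cyc p (k + 1)) c d hcd
        rw [e, hx₁] at e₁
        rw [e, hx₂] at e₂
        linarith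
      have hA1 : 1 ≤ α (cyc p k) + β (cyc p k) := by
        by_cases h2 : 2 ≤ k
        · exact (not_le.1 fun h' => hA ⟨h2, h'⟩).le
        · obtain rfl : k = 1 := by omega
          rw [h.left_next, h.right_next, add_zero]
      have hB1 : 1 ≤ α (cyc p (k + 1)) + β (cyc p (k + 1)) := by
        by_cases h2 : k + 3 ≤ n
        · exact (not_le.1 fun h' => hB ⟨h2, h'⟩).le
        · obtain rfl : k = n - 2 := by omega
          rw [show n - 2 + 1 = n - 1 by omega, h.left_prev, h.right_prev, zero_add]
      by_cases h2 : 2 ≤ k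
      · have hA2 : 1 < α (cyc p k) + β (cyc p k) := not_le.1 fun h' => hA ⟨h2, h'⟩
        have hc0 : c = 0 := by
          by_contra hc0
          have : 0 < c := lt_of_le_of_ne hc (Ne.symm hc0)
          nlinarith
        obtain rfl : d = 1 := by linarith
        rw [hc0] at e
        exact hne (k + 1) (by simpa using e.symm)
      · have hB2 : 1 < α (cyc p (k + 1)) + β (cyc p (k + 1)) :=
          not_le.1 fun h' => hB ⟨by omega, h'⟩
        have hd0 : d = 0 := by
          by_contra hd0
          have : 0 < d := lt_of_le_of_ne hd (Ne.symm hd0)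
          nlinarith
        obtain rfl : c = 1 := by linarith
        rw [hd0] at e
        exact hne k (by simpa using e.symm)
    refine mem_polygonInterior_iff.2 ⟨hb, ?_⟩
    -- Moving `x` slightly towards the corner enters the region that is already known to be
    -- interior, without changing the parity.
    obtain ⟨t, ht, ht1, ht0⟩ := (((tendsto_add_smul x (cyc p 0 - x)).eventually
      (eventually_parity_eq hb)).and
      (((eventually_lt_nhds one_pos).filter_mono nhdsWithin_le_nhds).and
        self_mem_nhdsWithin)).exists
    have ht0 : 0 < t := ht0
    rw [← ht]
    refine (mem_polygonInterior_iff.1 (hreg ?_)).2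
    have e : x + t • (cyc p 0 - x) = (1 - t) • x + t • cyc p 0 := by
      rw [smul_sub, sub_smul, one_smul]
      abel
    rw [e]
    simp only [Set.mem_ofPred_eq, h.left_comb _ _ _ _ (sub_add_cancel 1 t),
      h.right_comb _ _ _ _ (sub_add_cancel 1 t), h.left_zero, h.right_zero, hx₁, hx₂, mul_zero,
      add_zero]
    have : 0 < 1 - t := by linarith
    refine ⟨by positivity, by positivity, by nlinarith⟩

theorem rot_rot (p : Fin n → ℝ × ℝ) (r s : ℕ) : rot (rot p r) s = rot p (s + r) := by
  funext k
  rw [rot, cyc_rot, rot, add_assoc]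

theorem IsSimplePolygon.exists_isCut (h : IsSimplePolygon p) (hn : 4 ≤ n) :
    ∃ r < n, ∃ m, IsCut (_root_.rot p r) m := by
  have hmod : ∀ r m, IsCut (_root_.rot p r) m → ∃ r < n, ∃ m, IsCut (_root_.rot p r) m := by
    intro r m hc
    have e : _root_.rot p r = _root_.rot p (r % n) := by
      funext k
      rw [_root_.rot, _root_.rot, ← cyc_mod, ← cyc_mod p (k + r % n), Nat.add_mod_mod]
    exact ⟨r % n, Nat.mod_lt _ (NeZero.pos n), m, e ▸ hc⟩
  obtain ⟨k, -, -, f, hf⟩ := exists_exposed_vertex h.injective ⟨0, by omega⟩ ⟨1, by omega⟩ (by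
    refine ⟨⟨2, by omega⟩, fun hmem => ?_⟩
    have h2 := h.vertex_mem (r := 2) (k := 0) (by omega) (by omega) (by
      rwa [cyc_of_lt (by omega : 2 < n), cyc_of_lt (by omega : 0 < n),
        cyc_of_lt (by omega : 0 + 1 < n)])
    omega)
  set p' := _root_.rot p k with hp'
  have h' : IsSimplePolygon p' := h.rot k
  have hf' : ∀ l, 0 < l → l < n → f (cyc p' l) < f (cyc p' 0) := by
    intro l h0 hl
    have hne : Fin.ofNat n (l + k) ≠ k := by
      intro e
      have e1 : cyc p' l = cyc p' 0 := by
        rw [hp', cyc_rot, cyc_rot, zero_add, cyc_val, cyc, e]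
      have := h'.cyc_inj hl (by omega) e1
      omega
    have := hf _ hne
    rw [hp', cyc_rot, cyc_rot, zero_add, cyc_val]
    exact this
  -- An exposed vertex is not straight: collinear neighbours would be on the same side of it by the
  -- functional, and then one of them lies on the edge to the other.
  have hD : det2 (cyc p' 1 - cyc p' 0) (cyc p' (n - 1) - cyc p' 0) ≠ 0 := by
    intro hd
    have hu := hf' 1 (by omega) (by omega)
    have hw := hf' (n - 1) (by omega) (by omega)
    have hu0 : cyc p' 1 - cyc p' 0 ≠ 0 := fun e => by
      rw [sub_eq_zero.1 e] at hu
      exact lt_irrefl _ hu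
    obtain ⟨t, ht⟩ := exists_smul_of_det_eq_zero hu0 hd
    have hft : f (cyc p' (n - 1)) - f (cyc p' 0) = t * (f (cyc p' 1) - f (cyc p' 0)) := by
      rw [← map_sub, ht, map_smul, map_sub, smul_eq_mul]
    have ht0 : 0 < t := by nlinarith
    rcases le_total t 1 with h1 | h1
    · have hm : cyc p' (n - 1) ∈ segment ℝ (cyc p' 0) (cyc p' (0 + 1)) := by
        rw [segment_eq_image']
        refine ⟨t, ⟨ht0.le, h1⟩, ?_⟩
        simp only [zero_add, ← ht, add_sub_cancel]
      have := h'.vertex_mem (by omega) (by omega) hm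
      omega
    · have hm : cyc p' 1 ∈ segment ℝ (cyc p' (n - 1)) (cyc p' (n - 1 + 1)) := by
        rw [show n - 1 + 1 = n by omega, cyc_self, segment_symm, segment_eq_image']
        refine ⟨t⁻¹, ⟨by positivity, inv_le_one_of_one_le₀ h1⟩, ?_⟩
        simp only [ht, smul_smul, inv_mul_cancel₀ ht0.ne', one_smul, add_sub_cancel]
      have := h'.vertex_mem (by omega) (by omega) hm
      omega
  obtain ⟨α, β, hc⟩ := exists_isCornerCoord h' hD
  rcases hc.exists_diagonal f hf' hn with ⟨m, hm, hd⟩ | hd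
  · exact hmod k m ⟨h', hm, hd⟩
  · refine hmod (1 + k) (n - 2) ⟨h.rot _, by omega, ?_⟩
    rw [← rot_rot, ← hp', polygonInterior_rot, cyc_rot p', cyc_rot p', zero_add,
      show n - 2 + 1 = n - 1 by omega]
    exact hd

end Corner

/-! ### Triangulations and cuts -/

section Triangulations

variable {n : ℕ} [NeZero n] {p : Fin n → ℝ × ℝ} {T : SimpleGraph (Fin n)}

theorem Fin.ofNat_of_lt {k : ℕ} (hk : k < n) : Fin.ofNat n k = ⟨k, hk⟩ := by
  ext
  simp [Nat.mod_eq_of_lt hk]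

theorem Fin.ofNat_val_self (k : Fin n) : Fin.ofNat n k = k := Fin.ofNat_of_lt k.2

theorem Fin.ofNat_add' (k l : ℕ) : Fin.ofNat n (k + l) = Fin.ofNat n k + Fin.ofNat n l := by
  ext
  simp [Fin.val_add]

theorem Fin.ofNat_succ (k : ℕ) : Fin.ofNat n (k + 1) = Fin.ofNat n k + 1 := by
  ext
  simp [Fin.val_add]

theorem isBoundaryEdge_iff {k l : Fin n} : IsBoundaryEdge k l ↔
    l.1 = k.1 + 1 ∨ k.1 = l.1 + 1 ∨ (k.1 = 0 ∧ l.1 + 1 = n) ∨ (l.1 = 0 ∧ k.1 + 1 = n) := by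
  have key : ∀ k l : Fin n, l = k + 1 ↔ l.1 = k.1 + 1 ∨ (l.1 = 0 ∧ k.1 + 1 = n) := by
    intro k l
    obtain ⟨k, hk⟩ := k
    obtain ⟨l, hl⟩ := l
    rcases Nat.lt_or_ge (k + 1) n with h | h
    · rw [Fin.mk_add_one hk h, Fin.mk.injEq]
      simp only
      omega
    · rw [Fin.mk_add_one_last hk (by omega), Fin.mk.injEq]
      simp only
      omega
  rw [IsBoundaryEdge, key, key]
  tauto

theorem isDiagonal_iff {k l : Fin n} :
    IsDiagonal p k l ↔ openSegment ℝ (cyc p k) (cyc p l) ⊆ polygonInterior p := by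
  rw [IsDiagonal, cyc_val, cyc_val]

theorem IsDiagonal.symm {k l : Fin n} (h : IsDiagonal p k l) : IsDiagonal p l k := by
  rw [IsDiagonal, openSegment_symm]
  exact h

theorem IsBoundaryEdge.symm {k l : Fin n} (h : IsBoundaryEdge k l) : IsBoundaryEdge l k :=
  Or.symm h

theorem IsBoundaryEdge.subset_boundary {k l : Fin n} (h : IsBoundaryEdge k l) :
    openSegment ℝ (p k) (p l) ⊆ polygonBoundary p := by
  rcases h with rfl | rfl
  · exact (openSegment_subset_segment ℝ _ _).trans (Set.subset_iUnion (polygonEdge p) k)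
  · rw [openSegment_symm]
    exact (openSegment_subset_segment ℝ _ _).trans (Set.subset_iUnion (polygonEdge p) l)

theorem disjoint_boundary_interior : Disjoint (polygonBoundary p) (polygonInterior p) :=
  Set.disjoint_left.2 fun _ hx hx' => (mem_polygonInterior_iff.1 hx').1 hx

/-- Two edges of a simple polygon do not cross. -/
theorem IsSimplePolygon.nonCrossing_boundary (h : IsSimplePolygon p) {k l k' l' : Fin n}
    (hb : IsBoundaryEdge k l) (hb' : IsBoundaryEdge k' l') (hne : s(k, l) ≠ s(k', l')) :
    NonCrossing p k l k' l' := by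
  have key : ∀ k k' : Fin n, k ≠ k' → NonCrossing p k (k + 1) k' (k' + 1) := by
    intro k k' hk
    rw [NonCrossing, Set.disjoint_left]
    intro x hx hx'
    have hx'' := openSegment_subset_segment ℝ _ _ hx'
    rw [← cyc_succ p, ← cyc_val p] at hx hx''
    exact hk (Fin.ext (h.unique_edge k.2 k'.2 hx hx'').symm)
  unfold NonCrossing at key ⊢
  rcases hb with rfl | rfl <;> rcases hb' with rfl | rfl
  · exact key _ _ (by rintro rfl; exact hne rfl)
  · rw [openSegment_symm ℝ (p (l' + 1))]
    exact key _ _ (by rintro rfl; exact hne Sym2.eq_swap)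
  · rw [openSegment_symm ℝ (p (l + 1))]
    exact key _ _ (by rintro rfl; exact hne Sym2.eq_swap)
  · rw [openSegment_symm ℝ (p (l' + 1)), openSegment_symm ℝ (p (l + 1))]
    exact key _ _ (by rintro rfl; exact hne rfl)

/-- A pair of vertices `i < j` that see each other and are not neighbours cuts the polygon. -/
theorem IsSimplePolygon.isCut_rot (h : IsSimplePolygon p) {i j : ℕ} (hij : i < j) (hj : j < n)
    (hd : openSegment ℝ (cyc p i) (cyc p j) ⊆ polygonInterior p) :
    IsCut (_root_.rot p i) (j - i) := by
  refine ⟨h.rot i, by omega, ?_⟩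
  rwa [cyc_rot, cyc_rot, zero_add, Nat.sub_add_cancel hij.le, polygonInterior_rot]

/-- Together with the next two lemmas: whether two diagonals cross depends only on the cyclic order
of their ends. All three are statements about a cut, after a rotation that moves one end to the
vertex `0`. -/
theorem IsSimplePolygon.cross_of_interleave (h : IsSimplePolygon p) {i k j l : ℕ} (hik : i < k)
    (hkj : k < j) (hjl : j < l) (hl : l < n)
    (hd : openSegment ℝ (cyc p i) (cyc p j) ⊆ polygonInterior p)
    (hd' : openSegment ℝ (cyc p k) (cyc p l) ⊆ polygonInterior p) :
    ¬ Disjoint (openSegment ℝ (cyc p k) (cyc p l)) (openSegment ℝ (cyc p i) (cyc p j)) := by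
  have hc := h.isCut_rot (hik.trans hkj) (hjl.trans hl) hd
  have := hc.not_disjoint (k := k - i) (l := l - i) (by omega) (by omega) (by omega) (by omega)
  simp only [cyc_rot, zero_add, polygonInterior_rot] at this
  rw [Nat.sub_add_cancel (by omega), Nat.sub_add_cancel (by omega),
    Nat.sub_add_cancel (by omega)] at this
  exact this hd'

theorem IsSimplePolygon.disjoint_of_nested (h : IsSimplePolygon p) {i k j l : ℕ} (hik : i ≤ k)
    (hkl : k < l) (hlj : l ≤ j) (hj : j < n) (hne : ¬ (i = k ∧ j = l))
    (hd : openSegment ℝ (cyc p i) (cyc p j) ⊆ polygonInterior p)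
    (hd' : openSegment ℝ (cyc p k) (cyc p l) ⊆ polygonInterior p) :
    Disjoint (openSegment ℝ (cyc p k) (cyc p l)) (openSegment ℝ (cyc p i) (cyc p j)) := by
  have hc := h.isCut_rot (by omega) hj hd
  have := hc.disjoint (k := k - i) (l := l - i) (by omega) (by omega) (by omega) (by omega)
    (by omega)
  simp only [cyc_rot, zero_add, polygonInterior_rot] at this
  rw [Nat.sub_add_cancel (by omega), Nat.sub_add_cancel (by omega),
    Nat.sub_add_cancel (by omega)] at this
  exact this hd'

theorem IsSimplePolygon.disjoint_of_beside (h : IsSimplePolygon p) {i k j l : ℕ} (hij : i < j)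
    (hjk : j ≤ k) (hkl : k < l) (hl : l < n)
    (hd : openSegment ℝ (cyc p i) (cyc p j) ⊆ polygonInterior p)
    (hd' : openSegment ℝ (cyc p k) (cyc p l) ⊆ polygonInterior p) :
    Disjoint (openSegment ℝ (cyc p k) (cyc p l)) (openSegment ℝ (cyc p i) (cyc p j)) := by
  have hc := (h.isCut_rot hij (by omega) hd).rot
  rw [rot_rot, Nat.sub_add_cancel hij.le] at hc
  have := hc.disjoint (k := k - j) (l := l - j) (by omega) (by omega) (by omega) (by omega)
    (by omega)
  simp only [cyc_rot, zero_add, polygonInterior_rot] at this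
  rw [Nat.sub_add_cancel (by omega), Nat.sub_add_cancel (by omega),
    show n - (j - i) + j = i + n by omega, cyc_add_self, openSegment_symm ℝ (cyc p j)] at this
  exact this hd'

/-- Rotation of a graph on the vertices. -/
def rotGraph (T : SimpleGraph (Fin n)) (r : ℕ) : SimpleGraph (Fin n) :=
  T.comap fun k => k + Fin.ofNat n r

/-- Restriction of a graph to the vertices `0, …, m`. -/
def subGraph (T : SimpleGraph (Fin n)) (m : ℕ) : SimpleGraph (Fin (m + 1)) where
  Adj k l := T.Adj (Fin.ofNat n k) (Fin.ofNat n l)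
  symm := ⟨fun _ _ h => T.adj_symm h⟩
  loopless := ⟨fun _ h => T.irrefl h⟩

theorem rotGraph_adj {r k l : ℕ} : (rotGraph T r).Adj (Fin.ofNat n k) (Fin.ofNat n l) ↔
    T.Adj (Fin.ofNat n (k + r)) (Fin.ofNat n (l + r)) := by
  rw [rotGraph, SimpleGraph.comap_adj, Fin.ofNat_add', Fin.ofNat_add']

theorem rot_apply (p : Fin n → ℝ × ℝ) (r : ℕ) (k : Fin n) : rot p r k = p (k + Fin.ofNat n r) := by
  rw [rot, cyc, Fin.ofNat_add', Fin.ofNat_val_self]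

theorem IsTriangulation.rot (hT : IsTriangulation p T) (r : ℕ) :
    IsTriangulation (rot p r) (rotGraph T r) where
  boundary k := by
    rw [rotGraph, SimpleGraph.comap_adj, add_right_comm]
    exact hT.boundary _
  inside k l h := by
    rcases hT.inside _ _ h with h' | h'
    · left
      rcases h' with h' | h'
      · rw [add_right_comm] at h'
        exact .inl (add_right_cancel h')
      · rw [add_right_comm] at h'
        exact .inr (add_right_cancel h')
    · right
      rwa [IsDiagonal, rot_apply, rot_apply, polygonInterior_rot]
  nonCrossing k l k' l' h h' hne := by
    have := hT.nonCrossing _ _ _ _ h h' fun e => hne (by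
      simpa only [Sym2.eq_iff, add_left_inj] using e)
    rwa [NonCrossing, rot_apply, rot_apply, rot_apply, rot_apply]
  maximal k l hd h := by
    refine hT.maximal _ _ ?_ fun k' l' hkl hne => ?_
    · rwa [IsDiagonal, rot_apply, rot_apply, polygonInterior_rot] at hd
    · have := h (k' - Fin.ofNat n r) (l' - Fin.ofNat n r) (by
        rwa [rotGraph, SimpleGraph.comap_adj, sub_add_cancel, sub_add_cancel]) (fun e => hne (by
        simpa only [Sym2.eq_iff, eq_sub_iff_add_eq] using e))
      rwa [NonCrossing, rot_apply, rot_apply, rot_apply, rot_apply, sub_add_cancel,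
        sub_add_cancel] at this

/-- Maximality is the point: a diagonal of the part is a diagonal of the whole polygon, and edges of
`T` with an end beyond the cut either stay in the other part, outside the interior of this one, or
would cross the cut, which belongs to `T`. -/
theorem IsTriangulation.sub {m : ℕ} (hT : IsTriangulation p T) (hc : IsCut p m)
    (hm : T.Adj (Fin.ofNat n 0) (Fin.ofNat n m)) :
    IsTriangulation (sub p m) (subGraph T m) := by
  have h2 := hc.two_le
  have hval : ∀ k : Fin (m + 1), (Fin.ofNat n k.1).1 = k.1 := fun k => by
    have := k.2
    rw [Fin.ofNat_of_lt (by omega)]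
  have hinj : ∀ {k l : Fin (m + 1)}, Fin.ofNat n k.1 = Fin.ofNat n l.1 → k = l := fun {k l} e => by
    ext
    rw [← hval k, e, hval]
  have hp : ∀ k : Fin (m + 1), _root_.sub p m k = p (Fin.ofNat n k.1) := fun k => rfl
  refine ⟨fun k => ?_, fun k l h => ?_, fun k l k' l' h h' hne => ?_, fun k l hd h => ?_⟩
  · change T.Adj _ _
    obtain ⟨k, hk⟩ := k
    rcases Nat.lt_or_ge (k + 1) (m + 1) with h | h
    · rw [Fin.mk_add_one hk h]
      simp only
      rw [Fin.ofNat_succ]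
      exact hT.boundary _
    · rw [Fin.mk_add_one_last hk (by omega)]
      obtain rfl : k = m := by omega
      exact hm.symm
  · change T.Adj _ _ at h
    have hk := k.2
    have hl := l.2
    by_cases hb : IsBoundaryEdge k l
    · exact .inl hb
    right
    rw [isBoundaryEdge_iff] at hb
    rcases hT.inside _ _ h with h' | h'
    · rw [isBoundaryEdge_iff, hval, hval] at h'
      omega
    · rw [isDiagonal_iff, hval, hval] at h'
      rw [isDiagonal_iff, cyc_sub (by omega), cyc_sub (by omega)]
      refine hc.isDiagonal_sub (by omega) (by omega) (fun e => h.ne ?_) (by omega) (by omega) h'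
      rw [e]
  · change T.Adj _ _ at h h'
    have := hT.nonCrossing _ _ _ _ h h' fun e => hne (by
      rcases Sym2.eq_iff.1 e with e | e
      · rw [hinj e.1, hinj e.2]
      · rw [hinj e.1, hinj e.2, Sym2.eq_swap])
    exact this
  · change T.Adj _ _
    have hd' : openSegment ℝ (_root_.sub p m k) (_root_.sub p m l) ⊆
        polygonInterior (_root_.sub p m) := hd
    refine hT.maximal _ _ (hd'.trans fun x hx => hc.mem_polygonInterior_of_sub hx)
      fun k' l' hkl hne => ?_
    have hout : ∀ k' l' : Fin n, T.Adj k' l' → m ≤ k'.1 → (m ≤ l'.1 ∨ l'.1 = 0) →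
        Disjoint (openSegment ℝ (p k') (p l')) (polygonInterior (_root_.sub p m)) := by
      intro k' l' hkl hk hl
      have hkn := k'.2
      have hln := l'.2
      have hne : k'.1 ≠ l'.1 := fun e => hkl.ne (Fin.ext e)
      -- The vertex `0` is read as `n`, so that the other chain has the consecutive indices `m, …,
      -- n`.
      set l₁ := if l'.1 = 0 then n else l'.1 with hl₁
      have e₁ : cyc p l₁ = p l' := by
        rw [hl₁, ← cyc_val p l']
        split_ifs with h0
        · rw [cyc_self, h0]
        · rfl
      have hl₁' : (l'.1 = 0 ∧ l₁ = n) ∨ (l'.1 ≠ 0 ∧ l₁ = l'.1) := by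
        rw [hl₁]
        split_ifs with h0
        · exact .inl ⟨h0, rfl⟩
        · exact .inr ⟨h0, rfl⟩
      rw [← cyc_val p k', ← e₁]
      rcases hT.inside _ _ hkl with h' | h'
      · rw [isBoundaryEdge_iff] at h'
        by_cases hs : l₁ = k'.1 + 1
        · exact hc.disjoint_interior hk (by omega) (by omega) (by omega) (by omega) (.inl hs)
        · rw [openSegment_symm]
          exact hc.disjoint_interior (by omega) (by omega) hk (by omega) (by omega)
            (.inl (by omega))
      · refine hc.disjoint_interior hk (by omega) (by omega) (by omega) (by omega) (.inr ?_)
        rw [e₁, cyc_val]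
        exact h'
    have hcr : ∀ k' l' : Fin n, T.Adj k' l' → k'.1 ≠ 0 → k'.1 < m → m < l'.1 → False := by
      intro k' l' hkl h0 hk hl
      have hln := l'.2
      have hd : IsDiagonal p k' l' := by
        refine (hT.inside _ _ hkl).resolve_left fun hb => ?_
        rw [isBoundaryEdge_iff] at hb
        omega
      refine hc.not_disjoint h0 hk hl hln (isDiagonal_iff.1 hd) ?_
      rw [cyc_val, cyc_val]
      exact hT.nonCrossing _ _ _ _ hkl hm fun e => by
        rcases Sym2.eq_iff.1 e with ⟨e, -⟩ | ⟨e, -⟩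
        · rw [e, Fin.ofNat_of_lt (by omega)] at h0
          exact h0 rfl
        · rw [e, Fin.ofNat_of_lt (by omega)] at hk
          exact lt_irrefl _ hk
    rw [NonCrossing, ← hp, ← hp]
    by_cases hin : k'.1 ≤ m ∧ l'.1 ≤ m
    · have e₁ : Fin.ofNat n (⟨k'.1, by omega⟩ : Fin (m + 1)).1 = k' := Fin.ofNat_val_self k'
      have e₂ : Fin.ofNat n (⟨l'.1, by omega⟩ : Fin (m + 1)).1 = l' := Fin.ofNat_val_self l'
      have := h ⟨k'.1, by omega⟩ ⟨l'.1, by omega⟩ (by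
        change T.Adj _ _
        rwa [e₁, e₂]) (fun e => hne (by
          rcases Sym2.eq_iff.1 e with ⟨a, b⟩ | ⟨a, b⟩
          · rw [a, b, e₁, e₂]
          · rw [a, b, e₁, e₂, Sym2.eq_swap]))
      rwa [NonCrossing, hp ⟨k'.1, _⟩, hp ⟨l'.1, _⟩, e₁, e₂] at this
    · refine Disjoint.mono_left hd' (Disjoint.symm ?_)
      by_cases h1 : m ≤ k'.1 ∧ (m ≤ l'.1 ∨ l'.1 = 0)
      · exact hout k' l' hkl h1.1 h1.2
      by_cases h2 : m ≤ l'.1 ∧ (m ≤ k'.1 ∨ k'.1 = 0)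
      · rw [openSegment_symm]
        exact hout l' k' hkl.symm h2.1 h2.2
      exfalso
      rcases Nat.lt_or_ge k'.1 m with h3 | h3
      · exact hcr k' l' hkl (by omega) h3 (by omega)
      · exact hcr l' k' hkl.symm (by omega) (by omega) (by omega)

/-- The polygon has a diagonal. If `T` had none, all edges of `T` would be boundary edges, which
cross no diagonal, and maximality would add it. A diagonal of `T` becomes a cut by rotating one end
to `0`. -/
theorem IsTriangulation.exists_isCut (h : IsSimplePolygon p) (hT : IsTriangulation p T)
    (hn : 4 ≤ n) : ∃ r m, IsCut (_root_.rot p r) m ∧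
      (rotGraph T r).Adj (Fin.ofNat n 0) (Fin.ofNat n m) := by
  obtain ⟨r, hr, m, hc⟩ := h.exists_isCut hn
  by_cases hm : (rotGraph T r).Adj (Fin.ofNat n 0) (Fin.ofNat n m)
  · exact ⟨r, m, hc, hm⟩
  have hT' := hT.rot r
  have hex : ∃ k l, (rotGraph T r).Adj k l ∧ IsDiagonal (_root_.rot p r) k l := by
    by_contra! hno
    refine hm (hT'.maximal _ _ hc.diag fun k l hkl _ => ?_)
    have hb := (hT'.inside _ _ hkl).resolve_right (hno k l hkl)
    rw [NonCrossing]
    exact disjoint_boundary_interior.symm.mono hc.diag hb.subset_boundary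
  obtain ⟨k, l, hkl, hd⟩ := hex
  have e : k.1 + (l - k).1 = l.1 ∨ k.1 + (l - k).1 = l.1 + n := by
    have := k.2
    have := l.2
    rcases le_or_gt k l with h1 | h1
    · left
      rw [Fin.sub_val_of_le h1]
      have : k.1 ≤ l.1 := h1
      omega
    · right
      rw [Fin.val_sub]
      have : l.1 < k.1 := h1
      rw [Nat.mod_eq_of_lt (by omega)]
      omega
  have hl : Fin.ofNat n ((l - k).1 + k.1) = l := by
    rw [Fin.ofNat_add', Fin.ofNat_val_self, Fin.ofNat_val_self, sub_add_cancel]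
  refine ⟨k + r, (l - k).1, ⟨h.rot _, (l - k).2, ?_⟩, ?_⟩
  · rw [← rot_rot, polygonInterior_rot, cyc_rot, cyc_rot (_root_.rot p r), zero_add,
      cyc_val (_root_.rot p r), cyc, hl]
    exact hd
  · rw [rotGraph_adj, ← add_assoc, ← add_assoc, zero_add, ← rotGraph_adj, hl, Fin.ofNat_val_self]
    exact hkl

/-- Every boundary edge lies on a triangle. -/
theorem IsTriangulation.exists_apex (h : IsSimplePolygon p) (hT : IsTriangulation p T) (k : Fin n) :
    ∃ d, T.Adj k d ∧ T.Adj (k + 1) d := by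
  induction n using Nat.strong_induction_on generalizing ‹NeZero n› with
  | _ n ih =>
  rcases (Nat.lt_or_ge n 4) with hn | hn
  · obtain rfl : n = 3 := by
      have := h.three_le
      omega
    refine ⟨k + 1 + 1, ?_, hT.boundary _⟩
    have := hT.boundary (k + 1 + 1)
    rw [add_assoc, add_assoc, show (1 : Fin 3) + 1 + 1 = 0 from rfl, add_zero] at this
    rw [add_assoc]
    exact this.symm
  -- Cut along a diagonal of `T`: every boundary edge is a boundary edge of one of the two smaller
  -- parts, whose triangulation is the restriction of `T`.
  obtain ⟨r, m, hc, hm⟩ := hT.exists_isCut h hn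
  have hT' := hT.rot r
  have h2 := hc.two_le
  have key : ∀ (p' : Fin n → ℝ × ℝ) (T' : SimpleGraph (Fin n)) (m : ℕ), IsTriangulation p' T' →
      IsCut p' m → T'.Adj (Fin.ofNat n 0) (Fin.ofNat n m) → ∀ k < m,
      ∃ d, T'.Adj (Fin.ofNat n k) d ∧ T'.Adj (Fin.ofNat n (k + 1)) d := by
    intro p' T' m hT' hc hm k hk
    have h2 := hc.two_le
    obtain ⟨d, hd₁, hd₂⟩ := ih (m + 1) (by omega) hc.simple_sub (hT'.sub hc hm) ⟨k, by omega⟩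
    rw [Fin.mk_add_one (by omega) (by omega)] at hd₂
    exact ⟨_, hd₁, hd₂⟩
  have hall : ∀ k < n, ∃ d, (rotGraph T r).Adj (Fin.ofNat n k) d ∧
      (rotGraph T r).Adj (Fin.ofNat n (k + 1)) d := by
    intro k hk
    rcases Nat.lt_or_ge k m with hkm | hkm
    · exact key _ _ m hT' hc hm k hkm
    · obtain ⟨d, hd₁, hd₂⟩ := key _ _ _ (hT'.rot m) hc.rot (by
        rw [rotGraph_adj, show n - m + m = n by omega, zero_add, Fin.ofNat_self]
        exact hm.symm) (k - m) (by omega)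
      rw [← Fin.ofNat_val_self d, rotGraph_adj] at hd₁ hd₂
      rw [show k - m + m = k by omega] at hd₁
      rw [show k - m + 1 + m = k + 1 by omega] at hd₂
      exact ⟨_, hd₁, hd₂⟩
  obtain ⟨d, hd₁, hd₂⟩ := hall (k - Fin.ofNat n r).1 (Fin.is_lt _)
  rw [← Fin.ofNat_val_self d, rotGraph_adj, Fin.ofNat_add', Fin.ofNat_val_self,
    sub_add_cancel] at hd₁
  rw [← Fin.ofNat_val_self d, rotGraph_adj, add_right_comm, Fin.ofNat_succ, Fin.ofNat_add',
    Fin.ofNat_val_self, sub_add_cancel] at hd₂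
  exact ⟨_, hd₁, hd₂⟩

end Triangulations

/-! ### Crossings in combinatorial triangulations -/

namespace Tri

variable {V : ℕ → ℕ → Prop} {i j : ℕ} {G : SimpleGraph ℕ}

theorem adj_succ (h : Tri V i j G) {k : ℕ} (hk : i ≤ k) (hk' : k < j) : G.Adj k (k + 1) := by
  induction h with
  | edge i =>
    obtain rfl : k = i := by omega
    simp [SimpleGraph.edge_adj]
  | @node i d j G₁ G₂ h₁ h₂ _ _ ih₁ ih₂ =>
    rw [(IsNode.mk h₁ h₂ rfl).adj_iff]
    rcases Nat.lt_or_ge k d with hd | hd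
    · exact .inl (ih₁ hk hd)
    · exact .inr (.inl (ih₂ hd hk'))

theorem sees (h : Tri V i j G) {u v : ℕ} (huv : G.Adj u v) (hlt : u < v) :
    (u = i ∧ v = j) ∨ V u v := by
  induction h with
  | edge i =>
    rw [SimpleGraph.edge_adj] at huv
    omega
  | @node i d j G₁ G₂ h₁ h₂ v₁ v₂ ih₁ ih₂ =>
    rcases (IsNode.mk h₁ h₂ rfl).adj_iff.1 huv with h' | h' | h'
    · rcases ih₁ h' with ⟨rfl, rfl⟩ | h'
      · exact .inr v₁
      · exact .inr h'
    · rcases ih₂ h' with ⟨rfl, rfl⟩ | h'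
      · exact .inr v₂
      · exact .inr h'
    · have := h₁.lt
      have := h₂.lt
      left
      omega

theorem not_interleave (h : Tri V i j G) {u x v y : ℕ} (huv : G.Adj u v) (hxy : G.Adj x y)
    (h₁ : u < x) (h₂ : x < v) (h₃ : v < y) : False := by
  induction h with
  | edge i =>
    rw [SimpleGraph.edge_adj] at huv hxy
    omega
  | @node i d j G₁ G₂ t₁ t₂ v₁ v₂ ih₁ ih₂ =>
    rcases (IsNode.mk t₁ t₂ rfl).adj_iff.1 huv with h' | h' | h' <;>
    rcases (IsNode.mk t₁ t₂ rfl).adj_iff.1 hxy with h'' | h'' | h''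
    · exact ih₁ h' h''
    · have := t₁.adj_range h'.symm
      have := t₂.adj_range h''
      omega
    · have := t₁.adj_range h'
      have := t₁.adj_range h'.symm
      have := t₂.lt
      omega
    · have := t₂.adj_range h'
      have := t₁.adj_range h''
      omega
    · exact ih₂ h' h''
    · have := t₂.adj_range h'
      have := t₁.lt
      omega
    · have := t₁.adj_range h''.symm
      have := t₂.lt
      have := t₁.adj_range h''
      omega
    · have := t₂.adj_range h''.symm
      have := t₁.lt
      have := t₂.adj_range h''
      omega
    · omega

/-- This is maximality in combinatorial form: a missing pair inside one part is handled by
recursion, and a missing pair on both sides of `d` is crossed by `i d` or `d j`. -/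
theorem exists_interleave (h : Tri V i j G) {u v : ℕ} (hu : i ≤ u) (huv : u < v) (hv : v ≤ j)
    (hn : ¬ G.Adj u v) :
    ∃ x y, G.Adj x y ∧ ((x < u ∧ u < y ∧ y < v) ∨ (u < x ∧ x < v ∧ v < y)) := by
  induction h with
  | edge i =>
    rw [SimpleGraph.edge_adj] at hn
    omega
  | @node i d j G₁ G₂ t₁ t₂ v₁ v₂ ih₁ ih₂ =>
    have ht := IsNode.mk t₁ t₂ rfl
    rw [ht.adj_iff] at hn
    push Not at hn
    by_cases hd : v ≤ d
    · obtain ⟨x, y, hxy, hc⟩ := ih₁ hu hd hn.1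
      exact ⟨x, y, ht.adj_iff.2 (.inl hxy), hc⟩
    by_cases hd' : d ≤ u
    · obtain ⟨x, y, hxy, hc⟩ := ih₂ hd' hv hn.2.1
      exact ⟨x, y, ht.adj_iff.2 (.inr (.inl hxy)), hc⟩
    by_cases hui : u = i
    · exact ⟨d, j, ht.adj_right, .inr ⟨by omega, by omega, by omega⟩⟩
    · exact ⟨i, d, ht.adj_left, .inl ⟨by omega, by omega, by omega⟩⟩

end Tri

/-! ### Triangulations of a simple polygon as combinatorial triangulations -/

section Correspondence

variable {n : ℕ} [NeZero n] {p : Fin n → ℝ × ℝ} {T : SimpleGraph (Fin n)}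

/-- The graph on the vertices `i, …, j`, as a graph on the natural numbers. -/
def spanGraph (T : SimpleGraph (Fin n)) (i j : ℕ) : SimpleGraph ℕ where
  Adj k l := i ≤ k ∧ k ≤ j ∧ i ≤ l ∧ l ≤ j ∧ ∃ (hk : k < n) (hl : l < n), T.Adj ⟨k, hk⟩ ⟨l, hl⟩
  symm := ⟨fun _ _ ⟨a, b, c, d, hk, hl, h⟩ => ⟨c, d, a, b, hl, hk, h.symm⟩⟩
  loopless := ⟨fun _ ⟨_, _, _, _, _, _, h⟩ => T.irrefl h⟩

theorem sees_succ {k : ℕ} (hk : k + 1 < n) : Sees p k (k + 1) :=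
  ⟨by omega, hk, .inl (isBoundaryEdge_iff.2 (.inl rfl))⟩

theorem IsTriangulation.isDiagonal (hT : IsTriangulation p T) {k l : ℕ} (hk : k < n) (hl : l < n)
    (h : T.Adj ⟨k, hk⟩ ⟨l, hl⟩) (hkl : k + 1 < l) (hne : k ≠ 0 ∨ l + 1 ≠ n) :
    openSegment ℝ (cyc p k) (cyc p l) ⊆ polygonInterior p := by
  refine isDiagonal_iff.1 ((hT.inside _ _ h).resolve_left fun hb => ?_)
  rw [isBoundaryEdge_iff] at hb
  simp only at hb
  omega

theorem IsTriangulation.not_interleave (h : IsSimplePolygon p) (hT : IsTriangulation p T)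
    {i k j l : ℕ} (hik : i < k) (hkj : k < j) (hjl : j < l) (hl : l < n)
    (h₁ : T.Adj ⟨i, by omega⟩ ⟨j, by omega⟩) (h₂ : T.Adj ⟨k, by omega⟩ ⟨l, hl⟩) : False := by
  refine h.cross_of_interleave hik hkj hjl hl (hT.isDiagonal _ _ h₁ (by omega) (by omega))
    (hT.isDiagonal _ _ h₂ (by omega) (by omega)) ?_
  rw [cyc_of_lt hl, cyc_of_lt (by omega : i < n), cyc_of_lt (by omega : j < n),
    cyc_of_lt (by omega : k < n)]
  refine hT.nonCrossing _ _ _ _ h₂ h₁ fun e => ?_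
  simp only [Sym2.eq_iff, Fin.mk.injEq] at e
  omega

/-- The apex is found on the closing edge of the subpolygon `i, …, j`, which is cut off by the
diagonal `i j` unless it is the whole polygon. This gives it an index between `i` and `j`. -/
theorem IsTriangulation.exists_between (h : IsSimplePolygon p) (hT : IsTriangulation p T)
    {i j : ℕ} (hij : i + 1 < j) (hj : j < n) (ha : T.Adj ⟨i, by omega⟩ ⟨j, hj⟩) :
    ∃ (d : ℕ) (_ : i < d) (_ : d < j), T.Adj ⟨i, by omega⟩ ⟨d, by omega⟩ ∧
      T.Adj ⟨d, by omega⟩ ⟨j, hj⟩ := by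
  by_cases hb : i = 0 ∧ j + 1 = n
  · obtain ⟨rfl, hb⟩ := hb
    obtain ⟨⟨d, hd⟩, h₁, h₂⟩ := hT.exists_apex h ⟨j, hj⟩
    rw [Fin.mk_add_one_last hj hb] at h₂
    have n₁ : j ≠ d := fun e => h₁.ne (Fin.ext e)
    have n₂ : 0 ≠ d := fun e => h₂.ne (Fin.ext e)
    exact ⟨d, by omega, by omega, h₂, h₁.symm⟩
  · have hc := h.isCut_rot (by omega) hj (hT.isDiagonal _ _ ha hij (by omega))
    obtain ⟨⟨d, hd⟩, h₁, h₂⟩ := ((hT.rot i).sub hc (by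
      rw [rotGraph_adj, zero_add, Nat.sub_add_cancel (by omega), Fin.ofNat_of_lt (by omega),
        Fin.ofNat_of_lt hj]
      exact ha)).exists_apex hc.simple_sub ⟨j - i, by omega⟩
    rw [Fin.mk_add_one_last _ rfl] at h₂
    have n₁ : j - i ≠ d := fun e => h₁.ne (Fin.ext e)
    have n₂ : 0 ≠ d := fun e => h₂.ne (Fin.ext e)
    have h₁' := rotGraph_adj.1 h₁
    have h₂' := rotGraph_adj.1 h₂
    simp only [zero_add] at h₁' h₂'
    rw [Nat.sub_add_cancel (by omega), Fin.ofNat_of_lt hj,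
      Fin.ofNat_of_lt (by omega : d + i < n)] at h₁'
    rw [Fin.ofNat_of_lt (by omega : i < n), Fin.ofNat_of_lt (by omega : d + i < n)] at h₂'
    exact ⟨d + i, by omega, by omega, h₂', h₁'.symm⟩

theorem IsTriangulation.tri_span (h : IsSimplePolygon p) (hT : IsTriangulation p T) {i j : ℕ}
    (hij : i < j) (hj : j < n) (ha : T.Adj ⟨i, by omega⟩ ⟨j, hj⟩) :
    Tri (Sees p) i j (spanGraph T i j) := by
  induction hm : j - i using Nat.strong_induction_on generalizing i j with
  | _ m ih =>
    subst hm
    by_cases hs : j = i + 1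
    · subst hs
      have e : spanGraph T i (i + 1) = SimpleGraph.edge i (i + 1) := by
        ext k l
        rw [SimpleGraph.edge_adj]
        constructor
        · rintro ⟨h₁, h₂, h₃, h₄, hk, hl, h₅⟩
          have : k ≠ l := fun e => h₅.ne (Fin.ext e)
          omega
        · rintro ⟨⟨rfl, rfl⟩ | ⟨rfl, rfl⟩, _⟩
          · exact ⟨by omega, by omega, by omega, by omega, by omega, by omega, ha⟩
          · exact ⟨by omega, by omega, by omega, by omega, by omega, by omega, ha.symm⟩
      rw [e]
      exact Tri.edge i
    · obtain ⟨d, hid, hdj, h₁, h₂⟩ := hT.exists_between h (by omega) hj ha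
      have t₁ := ih (d - i) (by omega) hid (by omega) h₁ rfl
      have t₂ := ih (j - d) (by omega) hdj hj h₂ rfl
      have hn : IsNode (Sees p) i d j (spanGraph T i d) (spanGraph T d j) _ := ⟨t₁, t₂, rfl⟩
      have e : spanGraph T i j = spanGraph T i d ⊔ spanGraph T d j ⊔ SimpleGraph.edge i j := by
        -- An edge that joins both parts, other than `i j`, interleaves with `i d` or `d j`.
        have key : ∀ k l, k < l → (spanGraph T i j).Adj k l →
            (spanGraph T i d).Adj k l ∨ (spanGraph T d j).Adj k l ∨ (k = i ∧ l = j) := by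
          rintro k l hkl ⟨a₁, a₂, a₃, a₄, hk, hl, a₅⟩
          by_cases hl' : l ≤ d
          · exact .inl ⟨a₁, by omega, a₃, hl', hk, hl, a₅⟩
          by_cases hk' : d ≤ k
          · exact .inr (.inl ⟨hk', a₂, by omega, a₄, hk, hl, a₅⟩)
          by_cases hki : k = i
          · subst hki
            by_cases hlj : l = j
            · exact .inr (.inr ⟨rfl, hlj⟩)
            · exact (hT.not_interleave h (by omega) (by omega) (by omega) hj a₅ h₂).elim
          · exact (hT.not_interleave h (by omega) (by omega) (by omega) hl h₁ a₅).elim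
        ext k l
        rw [hn.adj_iff]
        constructor
        · intro hkl
          rcases lt_trichotomy k l with hlt | rfl | hlt
          · rcases key k l hlt hkl with h' | h' | h'
            · exact .inl h'
            · exact .inr (.inl h')
            · exact .inr (.inr (.inl h'))
          · exact (hkl.ne rfl).elim
          · rcases key l k hlt hkl.symm with h' | h' | h'
            · exact .inl h'.symm
            · exact .inr (.inl h'.symm)
            · exact .inr (.inr (.inr h'.symm))
        · rintro (⟨a₁, a₂, a₃, a₄, hk, hl, a₅⟩ | ⟨a₁, a₂, a₃, a₄, hk, hl, a₅⟩ | ⟨rfl, rfl⟩ | ⟨rfl, rfl⟩)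
          · exact ⟨a₁, by omega, a₃, by omega, hk, hl, a₅⟩
          · exact ⟨by omega, a₂, by omega, a₄, hk, hl, a₅⟩
          · exact ⟨by omega, by omega, by omega, by omega, by omega, by omega, ha⟩
          · exact ⟨by omega, by omega, by omega, by omega, by omega, by omega, ha.symm⟩
      rw [e]
      refine Tri.node t₁ t₂ ⟨by omega, by omega, hT.inside _ _ h₁⟩ ⟨by omega, hj, hT.inside _ _ h₂⟩

theorem IsTriangulation.exists_tri (h : IsSimplePolygon p) (hT : IsTriangulation p T) :
    ∃ G, Tri (Sees p) 0 (n - 1) G ∧ T = G.comap Fin.val := by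
  have hn := h.three_le
  refine ⟨spanGraph T 0 (n - 1), hT.tri_span h (by omega) (by omega) ?_, ?_⟩
  · have := hT.boundary ⟨n - 1, by omega⟩
    rw [Fin.mk_add_one_last _ (by omega)] at this
    exact this.symm
  · ext k l
    have := k.2
    have := l.2
    rw [SimpleGraph.comap_adj]
    constructor
    · intro hkl
      exact ⟨by omega, by omega, by omega, by omega, k.2, l.2, hkl⟩
    · rintro ⟨_, _, _, _, _, _, h⟩
      exact h

/-- Geometric crossing is equivalent to interleaving of indices. So non-crossing comes from
`Tri.not_interleave`, and maximality from `Tri.exists_interleave`. -/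
theorem Tri.isTriangulation (h : IsSimplePolygon p) {G : SimpleGraph ℕ}
    (hG : Tri (Sees p) 0 (n - 1) G) : IsTriangulation p (G.comap Fin.val) := by
  have hn := h.three_le
  have hin : ∀ k l : Fin n, (G.comap Fin.val).Adj k l → IsBoundaryEdge k l ∨ IsDiagonal p k l := by
    have key : ∀ k l : Fin n, k < l → (G.comap Fin.val).Adj k l →
        IsBoundaryEdge k l ∨ IsDiagonal p k l := by
      intro k l hkl hadj
      rcases hG.sees hadj hkl with ⟨h₁, h₂⟩ | ⟨_, _, h'⟩
      · left
        rw [isBoundaryEdge_iff]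
        omega
      · exact h'
    intro k l hadj
    rcases lt_trichotomy k l with hlt | rfl | hlt
    · exact key k l hlt hadj
    · exact (hadj.ne rfl).elim
    · exact (key l k hlt hadj.symm).imp IsBoundaryEdge.symm IsDiagonal.symm
  refine ⟨fun k => ?_, hin, ?_, ?_⟩
  · rw [SimpleGraph.comap_adj]
    obtain ⟨k, hk⟩ := k
    rcases Nat.lt_or_ge (k + 1) n with h' | h'
    · rw [Fin.mk_add_one hk h']
      have hk' : k < n - 1 := by omega
      exact hG.adj_succ (Nat.zero_le k) hk'
    · rw [Fin.mk_add_one_last hk (by omega)]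
      obtain rfl : k = n - 1 := by omega
      exact hG.adj_ends.symm
  · have key : ∀ k l k' l' : Fin n, k < l → k' < l' → (G.comap Fin.val).Adj k l →
        (G.comap Fin.val).Adj k' l' → s(k, l) ≠ s(k', l') → NonCrossing p k l k' l' := by
      intro k l k' l' hkl hkl' ha ha' hne
      have hkl₁ : k.1 < l.1 := hkl
      have hkl₂ : k'.1 < l'.1 := hkl'
      have hl := l.2
      have hl' := l'.2
      have hne' : ¬ (k.1 = k'.1 ∧ l.1 = l'.1) := fun e => hne (by rw [Fin.ext e.1, Fin.ext e.2])
      rcases hin _ _ ha with hb | hd <;> rcases hin _ _ ha' with hb' | hd'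
      · exact h.nonCrossing_boundary hb hb' hne
      · exact disjoint_boundary_interior.mono hb.subset_boundary hd'
      · exact disjoint_boundary_interior.symm.mono hd hb'.subset_boundary
      · have c₁ := fun a b c => hG.not_interleave ha ha' a b c
        have c₂ := fun a b c => hG.not_interleave ha' ha a b c
        rw [NonCrossing, ← cyc_val p, ← cyc_val p, ← cyc_val p, ← cyc_val p]
        rw [isDiagonal_iff] at hd hd'
        by_cases a₁ : l'.1 ≤ k.1
        · exact h.disjoint_of_beside hkl₂ a₁ hkl₁ hl hd' hd
        by_cases a₂ : l.1 ≤ k'.1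
        · exact (h.disjoint_of_beside hkl₁ a₂ hkl₂ hl' hd hd').symm
        by_cases a₃ : k'.1 ≤ k.1 ∧ l.1 ≤ l'.1
        · exact h.disjoint_of_nested a₃.1 hkl₁ a₃.2 hl' (by omega) hd' hd
        by_cases a₄ : k.1 ≤ k'.1 ∧ l'.1 ≤ l.1
        · exact (h.disjoint_of_nested a₄.1 hkl₂ a₄.2 hl (by omega) hd hd').symm
        exfalso
        rcases Nat.lt_or_ge k.1 k'.1 with a₅ | a₅
        · exact c₁ a₅ (by omega) (by omega)
        · exact c₂ (by omega) (by omega) (by omega)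
    have key' : ∀ k l k' l' : Fin n, k < l → (G.comap Fin.val).Adj k l →
        (G.comap Fin.val).Adj k' l' → s(k, l) ≠ s(k', l') → NonCrossing p k l k' l' := by
      intro k l k' l' hkl ha ha' hne
      rcases lt_trichotomy k' l' with hlt | rfl | hlt
      · exact key k l k' l' hkl hlt ha ha' hne
      · exact (ha'.ne rfl).elim
      · rw [NonCrossing, openSegment_symm ℝ (p k')]
        exact key k l l' k' hkl hlt ha ha'.symm (by rwa [Sym2.eq_swap (a := l')])
    intro k l k' l' ha ha' hne
    rcases lt_trichotomy k l with hlt | rfl | hlt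
    · exact key' k l k' l' hlt ha ha' hne
    · exact (ha.ne rfl).elim
    · rw [NonCrossing, openSegment_symm ℝ (p k)]
      exact key' l k k' l' hlt ha.symm ha' (by rwa [Sym2.eq_swap (a := l)])
  · have key : ∀ k l : Fin n, k < l → IsDiagonal p k l →
        (∀ k' l', (G.comap Fin.val).Adj k' l' → s(k, l) ≠ s(k', l') → NonCrossing p k l k' l') →
        (G.comap Fin.val).Adj k l := by
      intro k l hkl hd hall
      have hkl₁ : k.1 < l.1 := hkl
      have hl := l.2
      by_contra hno
      obtain ⟨x, y, hxy, hc⟩ := hG.exists_interleave (Nat.zero_le _) hkl (by omega) hno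
      have hx : x < n := by
        have := hG.adj_range hxy
        omega
      have hy : y < n := by
        have := hG.adj_range hxy.symm
        omega
      have hxyd : openSegment ℝ (cyc p x) (cyc p y) ⊆ polygonInterior p := by
        have := (hin ⟨x, hx⟩ ⟨y, hy⟩ hxy).resolve_left (fun hb => by
          rw [isBoundaryEdge_iff] at hb
          simp only at hb
          omega)
        rw [isDiagonal_iff] at this
        exact this
      have hnc := hall ⟨x, hx⟩ ⟨y, hy⟩ hxy (fun e => by
        simp only [Sym2.eq_iff, Fin.ext_iff] at e
        omega)
      rw [NonCrossing, ← cyc_val p, ← cyc_val p, ← cyc_val p, ← cyc_val p] at hnc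
      rw [isDiagonal_iff] at hd
      rcases hc with ⟨b₁, b₂, b₃⟩ | ⟨b₁, b₂, b₃⟩
      · exact h.cross_of_interleave b₁ b₂ b₃ hl hxyd hd hnc
      · exact h.cross_of_interleave b₁ b₂ b₃ hy hd hxyd hnc.symm
    intro k l hd hall
    rcases lt_trichotomy k l with hlt | rfl | hlt
    · exact key k l hlt hd hall
    · exfalso
      have := hd (by rw [openSegment_same]; rfl : p k ∈ openSegment ℝ (p k) (p k))
      rw [← cyc_val p] at this
      exact (mem_polygonInterior_iff.1 this).1 (cyc_mem_polygonBoundary p _)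
    · refine (key l k hlt hd.symm fun k' l' h' hne => ?_).symm
      have := hall k' l' h' (by rwa [Sym2.eq_swap])
      rwa [NonCrossing, openSegment_symm] at this

/-- A maximal element of the finite family of admissible graphs. It is maximal in the required sense
because a single non-crossing diagonal could be added within the family. -/
theorem exists_isTriangulation (h : IsSimplePolygon p) : ∃ T, IsTriangulation p T := by
  classical
  have hn := h.three_le
  set F : Set (SimpleGraph (Fin n)) := {T | (∀ k, T.Adj k (k + 1)) ∧
    (∀ k l, T.Adj k l → IsBoundaryEdge k l ∨ IsDiagonal p k l) ∧
    ∀ k l k' l', T.Adj k l → T.Adj k' l' → s(k, l) ≠ s(k', l') → NonCrossing p k l k' l'} with hF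
  have hne : F.Nonempty := by
    refine ⟨⟨IsBoundaryEdge, ⟨fun _ _ h => h.symm⟩, ⟨fun k hk => ?_⟩⟩, fun k => .inl rfl,
      fun k l h => .inl h, fun k l k' l' h₁ h₂ hne => h.nonCrossing_boundary h₁ h₂ hne⟩
    rw [isBoundaryEdge_iff] at hk
    omega
  obtain ⟨T, hT⟩ := (Set.toFinite F).exists_maximal hne
  obtain ⟨h₁, h₂, h₃⟩ := hT.prop
  refine ⟨T, h₁, h₂, h₃, fun k l hd hall => ?_⟩
  have hkl : k ≠ l := by
    rintro rfl
    have := hd (by rw [openSegment_same]; rfl : p k ∈ openSegment ℝ (p k) (p k))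
    rw [← cyc_val p] at this
    exact (mem_polygonInterior_iff.1 this).1 (cyc_mem_polygonBoundary p _)
  have hedge : ∀ {x y : Fin n}, (SimpleGraph.edge k l).Adj x y → s(x, y) = s(k, l) := by
    intro x y hxy
    rw [SimpleGraph.edge_adj] at hxy
    exact Sym2.eq_iff.2 hxy.1
  have hsym : ∀ {x y x' y' : Fin n}, s(x, y) = s(x', y') →
      openSegment ℝ (p x) (p y) = openSegment ℝ (p x') (p y') := by
    intro x y x' y' e
    rcases Sym2.eq_iff.1 e with ⟨rfl, rfl⟩ | ⟨rfl, rfl⟩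
    · rfl
    · exact openSegment_symm ℝ _ _
  have hmem : T ⊔ SimpleGraph.edge k l ∈ F := by
    refine ⟨fun x => .inl (h₁ x), ?_, ?_⟩
    · rintro x y (hxy | hxy)
      · exact h₂ x y hxy
      · right
        rw [IsDiagonal, hsym (hedge hxy)]
        exact hd
    · rintro x y x' y' (hxy | hxy) (hxy' | hxy') hne
      · exact h₃ _ _ _ _ hxy hxy' hne
      · rw [NonCrossing, hsym (hedge hxy')]
        exact (hall x y hxy (by rw [← hedge hxy']; exact hne.symm)).symm
      · rw [NonCrossing, hsym (hedge hxy)]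
        exact hall x' y' hxy' (by rwa [← hedge hxy])
      · exact absurd ((hedge hxy).trans (hedge hxy').symm) hne
  have := hT.le_of_ge hmem le_sup_left
  exact this (.inr (by rw [SimpleGraph.edge_adj]; exact ⟨.inl ⟨rfl, rfl⟩, hkl⟩))

end Correspondence

end PlaneGeometry

/-! ### Correctness of EXT -/

section Correctness

variable {n : ℕ} [NeZero n] {p : Fin n → ℝ × ℝ} {V : ℕ → ℕ → Prop} {G : SimpleGraph ℕ}

theorem Fin.val_top' : (⊤ : Fin n).1 = n - 1 := by
  have h₁ : (⟨n - 1, by have := NeZero.pos n; omega⟩ : Fin n) ≤ ⊤ := le_top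
  have h₂ := (⊤ : Fin n).2
  have h₃ : n - 1 ≤ (⊤ : Fin n).1 := h₁
  omega

/-- All edges lie between vertices below `n`, where `Fin.ofNat` is inverse to `Fin.val`; both maps
preserve edges, so neither increases distances. -/
theorem Tri.dist_comap (hG : Tri V 0 (n - 1) G) (x y : Fin n) :
    (G.comap Fin.val).dist x y = G.dist x.1 y.1 := by
  have hx := x.2
  have hy := y.2
  have hr := hG.reachable (k := x.1) (l := y.1) (Nat.zero_le _) (by omega) (Nat.zero_le _) (by omega)
  have hadj : ∀ u v, G.Adj u v → (G.comap Fin.val).Adj (Fin.ofNat n u) (Fin.ofNat n v) := by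
    intro u v huv
    have h₁ := hG.adj_range huv
    have h₂ := hG.adj_range huv.symm
    rw [Fin.ofNat_of_lt (by omega : u < n), Fin.ofNat_of_lt (by omega : v < n)]
    exact huv
  let f : G →g G.comap (Fin.val : Fin n → ℕ) := ⟨Fin.ofNat n, fun h => hadj _ _ h⟩
  have hr' : (G.comap Fin.val).Reachable x y := by
    have := hr.map f
    change (G.comap Fin.val).Reachable (Fin.ofNat n x) (Fin.ofNat n y) at this
    rwa [Fin.ofNat_val_self, Fin.ofNat_val_self] at this
  apply le_antisymm
  · have := hr.dist_map_le (H := G.comap Fin.val) (Fin.ofNat n) fun u v h => .inr (hadj u v h)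
    rwa [Fin.ofNat_val_self, Fin.ofNat_val_self] at this
  · exact hr'.dist_map_le (H := G) Fin.val fun u v h => .inr h

theorem sum_Ioi_fin {n : ℕ} (f : ℕ → ℤ) (x : Fin n) :
    ∑ y ∈ Finset.Ioi x, f y = ∑ y ∈ Finset.Ioc x.1 (n - 1), f y := by
  refine Finset.sum_bij (fun y _ => y.1) ?_ ?_ ?_ ?_
  · intro y hy
    have hxy : x < y := Finset.mem_Ioi.1 hy
    have := y.2
    exact Finset.mem_Ioc.2 ⟨hxy, by omega⟩
  · intro y _ z _ e
    exact Fin.ext e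
  · intro y hy
    have := Finset.mem_Ioc.1 hy
    exact ⟨⟨y, by omega⟩, Finset.mem_Ioi.2 this.1, rfl⟩
  · intros
    rfl

theorem sum_univ_fin_Icc (f : ℕ → ℤ) : ∑ x : Fin n, f x = ∑ x ∈ Finset.Icc 0 (n - 1), f x := by
  rw [Fin.sum_univ_eq_sum_range f n]
  refine Finset.sum_congr ?_ fun _ _ => rfl
  have := NeZero.pos n
  ext x
  simp only [Finset.mem_range, Finset.mem_Icc]
  omega

theorem Tri.extCost_comap (hG : Tri V 0 (n - 1) G) (α : ℕ) :
    (extCost (G.comap (Fin.val : Fin n → ℕ)) α : ℤ) = triCost G 0 (n - 1) α := by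
  unfold extCost totalDist triCost
  push_cast
  simp only [hG.dist_comap, Fin.val_top']
  rw [← sum_univ_fin_Icc (fun x => ∑ y ∈ Finset.Ioc x (n - 1), (G.dist x y : ℤ)),
    ← sum_univ_fin_Icc (fun x => (G.dist x (n - 1) : ℤ))]
  simp only [← sum_Ioi_fin (fun y => (G.dist _ y : ℤ))]

theorem Sides.isGreatest_iff {i j x y : ℕ} (h : Sides G i j x y) {a : ℕ} :
    IsGreatest {k | i ≤ k ∧ k ≤ j ∧ G.dist k i < G.dist k j} a ↔ a = x := by
  have h₁ := h.le_left
  have h₂ := h.lt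
  have h₃ := h.le_right
  have hx : IsGreatest {k | i ≤ k ∧ k ≤ j ∧ G.dist k i < G.dist k j} x :=
    ⟨⟨h₁, by omega, (h.left_iff x h₁ (by omega)).2 le_rfl⟩,
      fun k hk => (h.left_iff k hk.1 hk.2.1).1 hk.2.2⟩
  exact ⟨fun ha => ha.unique hx, fun e => e ▸ hx⟩

theorem Sides.isLeast_iff {i j x y : ℕ} (h : Sides G i j x y) {a : ℕ} :
    IsLeast {k | i ≤ k ∧ k ≤ j ∧ G.dist k j < G.dist k i} a ↔ a = y := by
  have h₁ := h.le_left
  have h₂ := h.lt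
  have h₃ := h.le_right
  have hx : IsLeast {k | i ≤ k ∧ k ≤ j ∧ G.dist k j < G.dist k i} y :=
    ⟨⟨by omega, h₃, (h.right_iff y (by omega) h₃).2 le_rfl⟩,
      fun k hk => (h.right_iff k hk.1 hk.2.1).1 hk.2.2⟩
  exact ⟨fun ha => ha.unique hx, fun e => e ▸ hx⟩

theorem isGreatest_fin_iff {n : ℕ} {S : Set (Fin n)} {R : Set ℕ} (h : ∀ k : Fin n, k ∈ S ↔ k.1 ∈ R)
    (hR : ∀ k ∈ R, k < n) {a : Fin n} : IsGreatest S a ↔ IsGreatest R a.1 :=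
  ⟨fun ha => ⟨(h a).1 ha.1, fun k hk => ha.2 ((h ⟨k, hR k hk⟩).2 hk)⟩,
    fun ha => ⟨(h a).2 ha.1, fun k hk => ha.2 ((h k).1 hk)⟩⟩

theorem isLeast_fin_iff {n : ℕ} {S : Set (Fin n)} {R : Set ℕ} (h : ∀ k : Fin n, k ∈ S ↔ k.1 ∈ R)
    (hR : ∀ k ∈ R, k < n) {a : Fin n} : IsLeast S a ↔ IsLeast R a.1 :=
  ⟨fun ha => ⟨(h a).1 ha.1, fun k hk => ha.2 ((h ⟨k, hR k hk⟩).2 hk)⟩,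
    fun ha => ⟨(h a).2 ha.1, fun k hk => ha.2 ((h k).1 hk)⟩⟩

/-- The apex is unique, and by `Sides` the sets in question are initial and final segments, whose
greatest and least elements are the recorded ends. -/
theorem Tri.hasSpecialVertices_iff (hG : Tri V 0 (n - 1) G) (hn : 3 ≤ n) {a c e g : Fin n} :
    HasSpecialVertices (G.comap Fin.val) a c e g ↔ Special G 0 (n - 1) a c e g := by
  obtain ⟨d, G₁, G₂, hnode, -⟩ := hG.exists_node (by omega)
  have hd0 := hnode.left.lt
  have hdn := hnode.right.lt
  obtain ⟨x, y, s₁⟩ := hnode.left.exists_sides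
  obtain ⟨z, w, s₂⟩ := hnode.right.exists_sides
  rw [hnode.special_iff]
  have e₁ := hnode.sides_left.2 s₁
  have e₂ := hnode.sides_right.2 s₂
  have hsides : (Sides G₁ 0 d a c ∧ Sides G₂ d (n - 1) e g) ↔
      ((a.1 = x ∧ c.1 = y) ∧ (e.1 = z ∧ g.1 = w)) := by
    constructor
    · rintro ⟨t₁, t₂⟩
      exact ⟨t₁.unique s₁, t₂.unique s₂⟩
    · rintro ⟨⟨h₁, h₂⟩, h₃, h₄⟩
      rw [h₁, h₂, h₃, h₄]
      exact ⟨s₁, s₂⟩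
  rw [hsides]
  have hzero : ((0 : Fin n) : ℕ) = 0 := by simp
  set D : Fin n := ⟨d, by omega⟩ with hD
  have main : (IsGreatest {k | k ≤ D ∧ (G.comap Fin.val).dist k 0 < (G.comap Fin.val).dist k D} a ∧
      IsLeast {k | k ≤ D ∧ (G.comap Fin.val).dist k D < (G.comap Fin.val).dist k 0} c ∧
      IsGreatest {k | D ≤ k ∧ (G.comap Fin.val).dist k D < (G.comap Fin.val).dist k ⊤} e ∧
      IsLeast {k | D ≤ k ∧ (G.comap Fin.val).dist k ⊤ < (G.comap Fin.val).dist k D} g) ↔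
      ((a.1 = x ∧ c.1 = y) ∧ (e.1 = z ∧ g.1 = w)) := by
    simp only [hG.dist_comap, Fin.val_top', hzero]
    rw [isGreatest_fin_iff (R := {k | 0 ≤ k ∧ k ≤ d ∧ G.dist k 0 < G.dist k d})
        (fun k => by simp [Fin.le_def, hD]) (fun k hk => by have := hk.2.1; omega),
      isLeast_fin_iff (R := {k | 0 ≤ k ∧ k ≤ d ∧ G.dist k d < G.dist k 0})
        (fun k => by simp [Fin.le_def, hD]) (fun k hk => by have := hk.2.1; omega),
      isGreatest_fin_iff (R := {k | d ≤ k ∧ k ≤ n - 1 ∧ G.dist k d < G.dist k (n - 1)})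
        (fun k => by
          have : k.1 ≤ n - 1 := by omega
          simp [Fin.le_def, hD, this]) (fun k hk => by have := hk.2.1; omega),
      isLeast_fin_iff (R := {k | d ≤ k ∧ k ≤ n - 1 ∧ G.dist k (n - 1) < G.dist k d})
        (fun k => by
          have : k.1 ≤ n - 1 := by omega
          simp [Fin.le_def, hD, this]) (fun k hk => by have := hk.2.1; omega),
      e₁.isGreatest_iff, e₁.isLeast_iff, e₂.isGreatest_iff, e₂.isLeast_iff, and_assoc]
  rw [← main]
  constructor
  · rintro ⟨d', h0, h1, h2, h3, h4⟩
    rw [SimpleGraph.comap_adj, hzero] at h2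
    rw [SimpleGraph.comap_adj, Fin.val_top'] at h3
    have a₁ : 0 < d'.1 := by
      have : (0 : Fin n).1 < d'.1 := h0
      omega
    have a₂ : d'.1 < n - 1 := by
      have : d'.1 < (⊤ : Fin n).1 := h1
      rwa [Fin.val_top'] at this
    have : d' = D := Fin.ext (hnode.apex_unique a₁ a₂ h2 h3)
    rw [← this]
    exact h4
  · intro h
    refine ⟨D, ?_, ?_, ?_, ?_, h⟩
    · rw [Fin.lt_def, hzero]
      exact hd0
    · rw [Fin.lt_def, Fin.val_top']
      exact hdn
    · rw [SimpleGraph.comap_adj, hzero]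
      exact hnode.adj_left
    · rw [SimpleGraph.comap_adj, Fin.val_top']
      exact hnode.adj_right

theorem sees_succ_of_lt (k : ℕ) (_ : 0 ≤ k) (hk : k < n - 1) : Sees p k (k + 1) :=
  sees_succ (by omega)

theorem ext_le_extCost (h : IsSimplePolygon p) {T : SimpleGraph (Fin n)} (hT : IsTriangulation p T)
    {a c e g : Fin n} (hs : HasSpecialVertices T a c e g) (α : ℕ) :
    ext (Sees p) 0 (n - 1) a c e g α ≤ ((extCost T α : ℤ) : WithTop ℤ) := by
  obtain ⟨G, hG, rfl⟩ := hT.exists_tri h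
  rw [hG.hasSpecialVertices_iff h.three_le] at hs
  rw [hG.extCost_comap]
  exact ext_le_triCost sees_succ_of_lt ⟨hG, .inr hs⟩ α

theorem exists_extCost_eq_ext (h : IsSimplePolygon p) {a c e g : Fin n} {α : ℕ}
    (hne : ext (Sees p) 0 (n - 1) a c e g α ≠ ⊤) :
    ∃ T, IsTriangulation p T ∧ HasSpecialVertices T a c e g ∧
      ext (Sees p) 0 (n - 1) a c e g α = ((extCost T α : ℤ) : WithTop ℤ) := by
  have hn := h.three_le
  obtain ⟨G, ⟨hG, hs⟩, he⟩ := exists_triCost_eq_ext sees_succ_of_lt (by omega) hne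
  refine ⟨G.comap Fin.val, hG.isTriangulation h, ?_, ?_⟩
  · rw [hG.hasSpecialVertices_iff hn]
    exact hs.resolve_left (by omega)
  · rw [hG.extCost_comap, he]

theorem IsTriangulation.exists_special (h : IsSimplePolygon p) {T : SimpleGraph (Fin n)}
    (hT : IsTriangulation p T) : ∃ a c e g, HasSpecialVertices T a c e g := by
  have hn := h.three_le
  obtain ⟨G, hG, rfl⟩ := hT.exists_tri h
  obtain ⟨a, c, e, g, hs⟩ := hG.exists_special (by omega)
  obtain ⟨-, h₁, h₂, h₃, h₄, h₅⟩ := hG.sides_of_special hs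
  refine ⟨⟨a, by omega⟩, ⟨c, by omega⟩, ⟨e, by omega⟩, ⟨g, by omega⟩, ?_⟩
  rw [hG.hasSpecialVertices_iff hn]
  exact hs

/-- As a greatest lower bound the statement covers the empty set, with value `⊤`. A finite value is
attained, by `exists_extCost_eq_ext`. -/
theorem isGLB_ext (h : IsSimplePolygon p) (α : ℕ) (a c e g : Fin n) :
    IsGLB {w : WithTop ℤ | ∃ T : SimpleGraph (Fin n), IsTriangulation p T ∧
        HasSpecialVertices T a c e g ∧ w = ((extCost T α : ℤ) : WithTop ℤ)}
      (ext (Sees p) 0 (n - 1) a c e g α) := by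
  constructor
  · rintro w ⟨T, hT, hs, rfl⟩
    exact ext_le_extCost h hT hs α
  · intro w hw
    by_cases hne : ext (Sees p) 0 (n - 1) a c e g α = ⊤
    · rw [hne]
      exact le_top
    · obtain ⟨T, hT, hs, he⟩ := exists_extCost_eq_ext h hne
      exact hw ⟨T, hT, hs, he⟩

theorem extMin_le_extCost (h : IsSimplePolygon p) {T : SimpleGraph (Fin n)}
    (hT : IsTriangulation p T) (α : ℕ) : extMin p α ≤ ((extCost T α : ℤ) : WithTop ℤ) := by
  obtain ⟨a, c, e, g, hs⟩ := hT.exists_special h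
  exact (Finset.inf_le (Finset.mem_univ (a, c, e, g))).trans (ext_le_extCost h hT hs α)

theorem isLeast_extMin (h : IsSimplePolygon p) (α : ℕ) :
    IsLeast {w : WithTop ℤ | ∃ T : SimpleGraph (Fin n), IsTriangulation p T ∧
        w = ((extCost T α : ℤ) : WithTop ℤ)} (extMin p α) := by
  refine ⟨?_, ?_⟩
  · obtain ⟨⟨a, c, e, g⟩, -, hq⟩ := Finset.exists_mem_eq_inf
      (Finset.univ : Finset (Fin n × Fin n × Fin n × Fin n)) Finset.univ_nonempty
      fun q => ext (Sees p) 0 (n - 1) q.1 q.2.1 q.2.2.1 q.2.2.2 α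
    change extMin p α = _ at hq
    obtain ⟨T, hT⟩ := exists_isTriangulation h
    have hne : ext (Sees p) 0 (n - 1) a c e g α ≠ ⊤ := fun e => by
      have := extMin_le_extCost h hT α
      rw [hq] at this
      simp only [e, top_le_iff] at this
      exact WithTop.coe_ne_top this
    obtain ⟨T', hT', -, he⟩ := exists_extCost_eq_ext h hne
    exact ⟨T', hT', hq.trans he⟩
  · rintro w ⟨T, hT, rfl⟩
    exact extMin_le_extCost h hT α

end Correctness

/-! ### Structured programs -/

/-- Boolean combinations of comparisons. -/
inductive BExp : Type
  | ilt (x y : IExp)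
  | rlt (x y : RExp)
  | and (b c : BExp)
  | or (b c : BExp)
  | not (b : BExp)

namespace BExp

def Holds (s : Memory) : BExp → Prop
  | ilt x y => x.eval s < y.eval s
  | rlt x y => x.eval s < y.eval s
  | and b c => b.Holds s ∧ c.Holds s
  | or b c => b.Holds s ∨ c.Holds s
  | not b => ¬ b.Holds s

/-- Includes the branching step of each comparison, hence the summand 2. -/
def cost : BExp → ℕ
  | ilt x y => x.cost + y.cost + 2
  | rlt x y => x.cost + y.cost + 2
  | and b c => b.cost + c.cost
  | or b c => b.cost + c.cost
  | not b => b.cost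

/-- The program that branches on the value of a Boolean combination. -/
def branch : BExp → Prog → Prog → Prog
  | ilt x y, P, Q => .ite (.ilt x y) P Q
  | rlt x y, P, Q => .ite (.rlt x y) P Q
  | and b c, P, Q => b.branch (c.branch P Q) Q
  | or b c, P, Q => b.branch P (c.branch P Q)
  | not b, P, Q => b.branch Q P

/-- Branching on a conjunction or disjunction duplicates code but not time: an execution passes each
comparison at most once. -/
theorem runs_branch {B : ℤ} {P Q : Prog} {s s' : Memory} {t : ℕ} (b : BExp)
    (hP : b.Holds s → Runs B P s t s') (hQ : ¬ b.Holds s → Runs B Q s t s') :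
    ∃ t' ≤ t + b.cost, Runs B (b.branch P Q) s t' s' := by
  induction b generalizing P Q t with
  | ilt x y =>
    by_cases h : x.eval s < y.eval s
    · exact ⟨_, by simp only [cost, Cond.cost]; omega, .ite_true h (hP h)⟩
    · exact ⟨_, by simp only [cost, Cond.cost]; omega, .ite_false h (hQ h)⟩
  | rlt x y =>
    by_cases h : x.eval s < y.eval s
    · exact ⟨_, by simp only [cost, Cond.cost]; omega, .ite_true h (hP h)⟩
    · exact ⟨_, by simp only [cost, Cond.cost]; omega, .ite_false h (hQ h)⟩
  | and b c ihb ihc =>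
    by_cases hb : b.Holds s
    · obtain ⟨t₁, h₁, r₁⟩ := ihc (P := P) (Q := Q) (fun hc => hP ⟨hb, hc⟩) fun hc => hQ fun h => hc h.2
      obtain ⟨t₂, h₂, r₂⟩ := ihb (P := c.branch P Q) (Q := Q) (fun _ => r₁) fun h => (h hb).elim
      exact ⟨t₂, by simp only [cost]; omega, r₂⟩
    · obtain ⟨t₂, h₂, r₂⟩ := ihb (P := c.branch P Q) (Q := Q) (fun h => (hb h).elim) fun h =>
        hQ fun h' => h h'.1
      exact ⟨t₂, by simp only [cost]; omega, r₂⟩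
  | or b c ihb ihc =>
    by_cases hb : b.Holds s
    · obtain ⟨t₂, h₂, r₂⟩ := ihb (P := P) (Q := c.branch P Q) (fun h => hP (.inl h)) fun h =>
        (h hb).elim
      exact ⟨t₂, by simp only [cost]; omega, r₂⟩
    · obtain ⟨t₁, h₁, r₁⟩ := ihc (P := P) (Q := Q) (fun hc => hP (.inr hc)) fun hc =>
        hQ fun h => h.elim hb hc
      obtain ⟨t₂, h₂, r₂⟩ := ihb (P := P) (Q := c.branch P Q) (fun h => (hb h).elim) fun _ => r₁
      exact ⟨t₂, by simp only [cost]; omega, r₂⟩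
  | not b ih =>
    obtain ⟨t₂, h₂, r₂⟩ := ih (P := Q) (Q := P) (fun h => hQ fun h' => h' h) fun h => hP h
    exact ⟨t₂, by simpa only [cost] using h₂, r₂⟩

end BExp

/-- The value of a scalar variable: cell `0` of an integer array. -/
def IExp.var (v : ℕ) : IExp := .get v (.const 0)

/-- Structured programs without writes to the real arrays. The loop `forN v P` executes `P` for the
values `0, …, n - 1` of the variable `v`, where `n` is the size of the input. -/
inductive SProg : Type
  | skip
  | set (arr : ℕ) (idx val : IExp)
  | seq (P Q : SProg)
  | ite (b : BExp) (P Q : SProg)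
  | forN (v : ℕ) (P : SProg)

namespace SProg

def compile : SProg → Prog
  | skip => .skip
  | set arr idx val => .iset arr idx val
  | seq P Q => .seq P.compile Q.compile
  | ite b P Q => b.branch P.compile Q.compile
  | forN v P => .seq (.iset v (.const 0) (.const 0)) (.loop (.ilt (.var v) (.var 0))
      (.seq P.compile (.iset v (.const 0) (.add (.var v) (.const 1)))))

/-- The integer arrays that a program may write to. -/
def writes : SProg → List ℕ
  | skip => []
  | set arr _ _ => [arr]
  | seq P Q => P.writes ++ Q.writes
  | ite _ P Q => P.writes ++ Q.writes
  | forN v P => v :: P.writes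

/-- A bound on the running time. -/
def time (n : ℕ) : SProg → ℕ
  | skip => 1
  | set _ idx val => idx.cost + val.cost + 1
  | seq P Q => P.time n + Q.time n
  | ite b P Q => b.cost + P.time n + Q.time n
  -- Per iteration, 6 steps for the test of the loop condition and 6 for the increment; in addition
  -- 3 for the initialization and 6 for the last test.
  | forN _ P => n * (P.time n + 12) + 9

/-- The nesting depth of loops. -/
def depth : SProg → ℕ
  | skip => 0
  | set _ _ _ => 0
  | seq P Q => max P.depth Q.depth
  | ite _ P Q => max P.depth Q.depth
  | forN _ P => P.depth + 1

/-- The constant in the bound `time_le`; the loop overhead contributes `21 = 12 + 9`. -/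
def coeff : SProg → ℕ
  | skip => 1
  | set _ idx val => idx.cost + val.cost + 1
  | seq P Q => P.coeff + Q.coeff
  | ite b P Q => b.cost + P.coeff + Q.coeff
  | forN _ P => P.coeff + 21

theorem time_le {n : ℕ} (hn : 1 ≤ n) (P : SProg) {m : ℕ} (hm : P.depth ≤ m) :
    P.time n ≤ P.coeff * n ^ m := by
  induction P generalizing m with
  | skip => simpa [time, coeff] using Nat.one_le_pow _ _ hn
  | set arr idx val =>
    simp only [time, coeff]
    exact Nat.le_mul_of_pos_right _ (Nat.pow_pos hn)
  | seq P Q ihP ihQ =>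
    simp only [depth, max_le_iff] at hm
    simp only [time, coeff, add_mul]
    exact add_le_add (ihP hm.1) (ihQ hm.2)
  | ite b P Q ihP ihQ =>
    simp only [depth, max_le_iff] at hm
    simp only [time, coeff, add_mul]
    exact add_le_add (add_le_add (Nat.le_mul_of_pos_right _ (Nat.pow_pos hn)) (ihP hm.1)) (ihQ hm.2)
  | forN v P ih =>
    obtain ⟨m, rfl⟩ : ∃ m', m = m' + 1 := ⟨m - 1, by simp only [depth] at hm; omega⟩
    have h := ih (m := m) (by simpa [depth] using hm)
    have h1 : 1 ≤ n ^ m := Nat.one_le_pow _ _ hn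
    simp only [time, coeff, pow_succ]
    calc n * (P.time n + 12) + 9 ≤ n * (P.coeff * n ^ m + 12 * n ^ m) + 9 * (n * n ^ m) := by
          have : 1 ≤ n * n ^ m := Nat.mul_pos hn h1
          gcongr
          · omega
          · omega
      _ = (P.coeff + 21) * (n ^ m * n) := by ring

end SProg

theorem Memory.setInt_ints (s : Memory) (arr : ℕ) (idx val : ℤ) (a : ℕ) (z : ℤ) :
    (s.setInt arr idx val).ints a z = if a = arr ∧ z = idx then val else s.ints a z := by
  simp only [Memory.setInt, Function.update_apply]
  by_cases h : a = arr
  · subst h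
    simp [Function.update_apply]
  · simp [h]

theorem Memory.setInt_ints_ne (s : Memory) {arr : ℕ} (idx val : ℤ) {a : ℕ} (h : a ≠ arr) :
    (s.setInt arr idx val).ints a = s.ints a := by
  simp [Memory.setInt, h]

theorem Memory.setInt_ints_same (s : Memory) (arr : ℕ) (idx val : ℤ) :
    (s.setInt arr idx val).ints arr idx = val := by
  simp [Memory.setInt]

@[simp] theorem Memory.setInt_reals (s : Memory) (arr : ℕ) (idx val : ℤ) :
    (s.setInt arr idx val).reals = s.reals := rfl

theorem IExp.eval_var (s : Memory) (v : ℕ) : (IExp.var v).eval s = s.ints v 0 := rfl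

/-- Started on `s`, the program halts within its time bound, keeps all integers within `B`, changes
only the arrays it mentions, and ends in a memory that satisfies `Q`. -/
def Spec (B : ℤ) (n : ℕ) (P : SProg) (s : Memory) (Q : Memory → Prop) : Prop :=
  ∃ t s', Runs B P.compile s t s' ∧ t ≤ P.time n ∧ Q s' ∧
    (∀ a, a ∉ P.writes → s'.ints a = s.ints a) ∧ s'.reals = s.reals

namespace Spec

variable {B : ℤ} {n : ℕ} {P R : SProg} {s : Memory} {Q Q' : Memory → Prop}

theorem mono (h : Spec B n P s Q) (hQ : ∀ s', Q s' → (∀ a, a ∉ P.writes → s'.ints a = s.ints a) →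
    s'.reals = s.reals → Q' s') : Spec B n P s Q' := by
  obtain ⟨t, s', h₁, h₂, h₃, h₄, h₅⟩ := h
  exact ⟨t, s', h₁, h₂, hQ s' h₃ h₄ h₅, h₄, h₅⟩

theorem skip (h : Q s) : Spec B n .skip s Q :=
  ⟨1, s, .skip s, le_rfl, h, fun _ _ => rfl, rfl⟩

theorem set {arr : ℕ} {idx val : IExp} (hi : |idx.eval s| ≤ B) (hv : |val.eval s| ≤ B)
    (h : Q (s.setInt arr (idx.eval s) (val.eval s))) : Spec B n (.set arr idx val) s Q :=
  ⟨_, _, .iset s arr idx val hi hv, le_rfl, h,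
    fun _ ha => s.setInt_ints_ne _ _ (by simpa [SProg.writes] using ha), rfl⟩

theorem seq (h : Spec B n P s fun s' => Spec B n R s' Q) : Spec B n (.seq P R) s Q := by
  obtain ⟨t, s', h₁, h₂, ⟨t', s'', k₁, k₂, k₃, k₄, k₅⟩, h₄, h₅⟩ := h
  refine ⟨t + t', s'', .seq h₁ k₁, add_le_add h₂ k₂, k₃, fun a ha => ?_, k₅.trans h₅⟩
  simp only [SProg.writes, List.mem_append, not_or] at ha
  rw [k₄ a ha.2, h₄ a ha.1]

theorem ite {b : BExp} (hP : b.Holds s → Spec B n P s Q) (hR : ¬ b.Holds s → Spec B n R s Q) :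
    Spec B n (.ite b P R) s Q := by
  by_cases hb : b.Holds s
  · obtain ⟨t, s', h₁, h₂, h₃, h₄, h₅⟩ := hP hb
    obtain ⟨t', ht', hr⟩ := b.runs_branch (Q := R.compile) (fun _ => h₁) (fun h => (h hb).elim)
    refine ⟨t', s', hr, ?_, h₃, fun a ha => h₄ a fun h => ha ?_, h₅⟩
    · simp only [SProg.time]
      omega
    · exact List.mem_append_left _ h
  · obtain ⟨t, s', h₁, h₂, h₃, h₄, h₅⟩ := hR hb
    obtain ⟨t', ht', hr⟩ := b.runs_branch (P := P.compile) (fun h => (hb h).elim) (fun _ => h₁)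
    refine ⟨t', s', hr, ?_, h₃, fun a ha => h₄ a fun h => ha ?_, h₅⟩
    · simp only [SProg.time]
      omega
    · exact List.mem_append_right _ h

/-- The hypothesis `hI` says that the invariant does not depend on cell `0` of array `v`, which the
loop itself changes. The loop variable reaches at most `n`, hence `n ≤ B`. -/
theorem forN {v : ℕ} (hn : s.ints 0 0 = n) (hB : (n : ℤ) ≤ B) (hv : v ∉ P.writes)
    (h0 : 0 ∉ v :: P.writes) (I : ℕ → Memory → Prop)
    (hI : ∀ k s' x, I k s' → I k (s'.setInt v 0 x)) (hs : I 0 s)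
    (step : ∀ k < n, ∀ s', I k s' → s'.ints v 0 = k →
      (∀ a, a ∉ v :: P.writes → s'.ints a = s.ints a) → s'.reals = s.reals →
      Spec B n P s' (I (k + 1))) : Spec B n (.forN v P) s (I n) := by
  have h0v : 0 ≠ v := fun e => h0 (e ▸ List.mem_cons_self)
  have hB0 : 0 ≤ B := (Int.natCast_nonneg n).trans hB
  have hzero : |(IExp.const 0).eval s| ≤ B := by simpa [IExp.eval] using hB0
  have loop : ∀ m k, k + m = n → ∀ s', I k s' → s'.ints v 0 = k →
      (∀ a, a ∉ v :: P.writes → s'.ints a = s.ints a) → s'.reals = s.reals →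
      ∃ t s'', Runs B (.loop (.ilt (.var v) (.var 0))
        (.seq P.compile (.iset v (.const 0) (.add (.var v) (.const 1))))) s' t s'' ∧
        t ≤ m * (P.time n + 12) + 6 ∧ I n s'' ∧
        (∀ a, a ∉ v :: P.writes → s''.ints a = s.ints a) ∧ s''.reals = s.reals := by
    intro m
    induction m with
    | zero =>
      intro k hk s' hIk hvk hf hr
      obtain rfl : k = n := by omega
      refine ⟨_, s', .loop_false ?_, ?_, hIk, hf, hr⟩
      · simp only [Cond.Holds, IExp.eval_var]
        rw [hvk, hf 0 h0, hn]
        exact lt_irrefl _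
      · simp [Cond.cost, IExp.var, IExp.cost]
    | succ m ih =>
      intro k hk s' hIk hvk hf hr
      obtain ⟨t, s₁, r₁, ht, hI₁, hf₁, hr₁⟩ := step k (by omega) s' hIk hvk hf hr
      have hv₁ : s₁.ints v 0 = k := by rw [hf₁ v hv, hvk]
      have he : (IExp.add (.var v) (.const 1)).eval s₁ = ((k + 1 : ℕ) : ℤ) := by
        simp [IExp.eval, IExp.eval_var, hv₁]
      obtain ⟨t₂, s₂, r₂, ht₂, hI₂, hf₂, hr₂⟩ := ih (k + 1) (by omega)
        (s₁.setInt v 0 ((k + 1 : ℕ) : ℤ)) (hI _ _ _ hI₁) (s₁.setInt_ints_same _ _ _)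
        (fun a ha => by
          have hav : a ≠ v := fun e => ha (by rw [e]; exact List.mem_cons_self)
          rw [Memory.setInt_ints_ne _ _ _ hav,
            hf₁ a (fun h => ha (List.mem_cons_of_mem _ h)), hf a ha])
        (hr₁.trans hr)
      have rset : Runs B (.iset v (.const 0) (.add (.var v) (.const 1))) s₁ 6
          (s₁.setInt v 0 ((k + 1 : ℕ) : ℤ)) := by
        have := Runs.iset (B := B) s₁ v (.const 0) (.add (.var v) (.const 1))
          (by simpa [IExp.eval] using hB0) (by
            rw [he, Nat.abs_cast]
            exact le_trans (by exact_mod_cast (by omega : k + 1 ≤ n)) hB)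
        rwa [he] at this
      refine ⟨_, s₂, .loop_true ?_ (.seq r₁ rset) r₂, ?_, hI₂, hf₂, hr₂⟩
      · simp only [Cond.Holds, IExp.eval_var]
        rw [hvk, hf 0 h0, hn]
        exact_mod_cast (by omega : k < n)
      · simp only [Cond.cost, IExp.var, IExp.cost]
        rw [Nat.succ_mul]
        omega
  obtain ⟨t, s', r, ht, hIn, hf, hr⟩ := loop n 0 (by omega) (s.setInt v 0 0) (hI _ _ _ hs)
    (by rw [Memory.setInt_ints_same]; rfl)
    (fun a ha => Memory.setInt_ints_ne _ _ _ fun e => ha (e ▸ List.mem_cons_self)) rfl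
  refine ⟨_, s', .seq (.iset s v (.const 0) (.const 0) hzero hzero) r, ?_, hIn, hf, hr⟩
  simp only [SProg.time, IExp.cost]
  omega

end Spec

/-- The variables in the list have the values given by `ρ`, which are less than `n`. -/
def HasValues (n : ℕ) (l : List ℕ) (ρ : ℕ → ℕ) (s : Memory) : Prop :=
  s.ints 0 0 = n ∧ ∀ v ∈ l, s.ints v 0 = ρ v ∧ ρ v < n

theorem HasValues.congr {n : ℕ} {l w : List ℕ} {ρ : ℕ → ℕ} {s s' : Memory} (h : HasValues n l ρ s)
    (hf : ∀ a, a ∉ w → s'.ints a = s.ints a) (hd : ∀ a ∈ 0 :: l, a ∉ w) : HasValues n l ρ s' := by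
  refine ⟨by rw [hf 0 (hd 0 List.mem_cons_self), h.1], fun v hv => ?_⟩
  rw [hf v (hd v (List.mem_cons_of_mem _ hv))]
  exact h.2 v hv

/-- On any memory that agrees with `ρ` on the variables of the list, the program adds the set `Y ρ` to
the set parameter of `A`. -/
def Adds {ι : Type*} (B : ℤ) (n : ℕ) (l : List ℕ) (P : SProg) (A : Set ι → Memory → Prop)
    (Y : (ℕ → ℕ) → Set ι) : Prop :=
  ∀ ρ X s, HasValues n l ρ s → A X s → Spec B n P s (A (X ∪ Y ρ))

/-- A loop replaces the processed set by its union over the values of the loop variable. Nested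
loops are thereby reduced to their innermost body, without a separate invariant for each level. -/
theorem Adds.forN {ι : Type*} {B : ℤ} {n : ℕ} {l : List ℕ} {P : SProg} {A : Set ι → Memory → Prop}
    {Y : (ℕ → ℕ) → Set ι} {v : ℕ} (h : Adds B n (v :: l) P A Y) (hB : (n : ℤ) ≤ B)
    (hv : v ∉ P.writes) (hd : ∀ a ∈ 0 :: l, a ∉ v :: P.writes)
    (hA : ∀ X s x, A X s → A X (s.setInt v 0 x)) :
    Adds B n l (.forN v P) A fun ρ => {x | ∃ k < n, x ∈ Y (Function.update ρ v k)} := by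
  intro ρ X s hρ hX
  have := Spec.forN (P := P) hρ.1 hB hv (hd 0 List.mem_cons_self)
    (fun k s' => A (X ∪ {x | ∃ k' < k, x ∈ Y (Function.update ρ v k')}) s')
    (fun k s' x h' => hA _ _ _ h') (by simpa using hX) ?_
  · exact this
  · intro k hk s' hX' hvk hf _
    have := h (Function.update ρ v k) _ s' ?_ hX'
    · refine this.mono fun s'' h'' _ _ => ?_
      convert h'' using 1
      ext x
      simp only [Set.mem_union, Set.mem_ofPred_eq, Nat.lt_succ_iff_lt_or_eq]
      constructor
      · rintro (hx | ⟨k', hk' | rfl, hx⟩)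
        · exact .inl (.inl hx)
        · exact .inl (.inr ⟨k', hk', hx⟩)
        · exact .inr hx
      · rintro ((hx | ⟨k', hk', hx⟩) | hx)
        · exact .inl hx
        · exact .inr ⟨k', .inl hk', hx⟩
        · exact .inr ⟨k, .inr rfl, hx⟩
    · have hρ' := hρ.congr hf hd
      refine ⟨hρ'.1, fun u hu => ?_⟩
      rcases List.mem_cons.1 hu with rfl | hu
      · rw [Function.update_self]
        exact ⟨hvk, hk⟩
      · have hne : u ≠ v := fun e => hd u (List.mem_cons_of_mem _ hu) (e ▸ List.mem_cons_self)
        rw [Function.update_of_ne hne]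
        exact hρ'.2 u hu

/-! ### A polynomial test for visibility -/

section VisibilityTest

/-- `M` lies on the open segment `K L`, tested by polynomials in the coordinates. -/
def OnSegment (K L M : ℝ × ℝ) : Prop :=
  crossP K L M = 0 ∧ 0 < (M.1 - K.1) * (L.1 - M.1) + (M.2 - K.2) * (L.2 - M.2)

/-- `K` and `L` lie on different sides of the line `A B`, and the line `K L` meets the segment
`A B`. -/
def CrossesSegment (K L A B : ℝ × ℝ) : Prop :=
  crossP A B K * crossP A B L < 0 ∧ crossP K L A * crossP K L B ≤ 0

/-- For `M = K + t • (L - K)` the inner product in the test is `t * (1 - t)` times the squared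
length of `K L`. -/
theorem onSegment_iff {K L M : ℝ × ℝ} (hKL : K ≠ L) :
    OnSegment K L M ↔ M ∈ openSegment ℝ K L := by
  have hpos : 0 < (L.1 - K.1) ^ 2 + (L.2 - K.2) ^ 2 := by
    by_contra! hle
    refine hKL (Prod.ext ?_ ?_)
    · nlinarith [sq_nonneg (L.1 - K.1), sq_nonneg (L.2 - K.2)]
    · nlinarith [sq_nonneg (L.1 - K.1), sq_nonneg (L.2 - K.2)]
  have key : ∀ t : ℝ, M = K + t • (L - K) →
      (M.1 - K.1) * (L.1 - M.1) + (M.2 - K.2) * (L.2 - M.2) =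
        t * (1 - t) * ((L.1 - K.1) ^ 2 + (L.2 - K.2) ^ 2) := by
    rintro t rfl
    simp only [Prod.fst_add, Prod.snd_add, Prod.smul_fst, Prod.smul_snd, Prod.fst_sub,
      Prod.snd_sub, smul_eq_mul]
    ring
  constructor
  · rintro ⟨h₁, h₂⟩
    obtain ⟨t, ht⟩ := exists_param_of_crossP_eq_zero hKL h₁
    rw [key t ht] at h₂
    have h₃ : 0 < t * (1 - t) := pos_of_mul_pos_left h₂ hpos.le
    rw [ht]
    exact add_smul_sub_mem_openSegment (by nlinarith) (by nlinarith)
  · intro hM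
    refine ⟨crossP_of_mem_segment (openSegment_subset_segment ℝ _ _ hM), ?_⟩
    rw [openSegment_eq_image', Set.mem_image] at hM
    obtain ⟨t, ⟨h0, h1⟩, hM⟩ := hM
    rw [key t hM.symm]
    have : 0 < 1 - t := by linarith
    positivity

/-- The intersection of the two lines has parameter `u / (u - v)` on `K L` and `x / (x - y)` on `A
B`. The signs place the first strictly and the second weakly between 0 and 1, and the identity `u -
v = y - x` makes the two points equal. -/
theorem CrossesSegment.exists_mem {K L A B : ℝ × ℝ} (h : CrossesSegment K L A B) :
    ∃ z, z ∈ openSegment ℝ K L ∧ z ∈ segment ℝ A B := by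
  obtain ⟨h₁, h₂⟩ := h
  set u := crossP A B K with hu
  set v := crossP A B L with hv
  set x := crossP K L A with hx
  set y := crossP K L B with hy
  have huv : u - v = y - x := by
    rw [hu, hv, hx, hy]
    simp only [crossP]
    ring
  have hne : u - v ≠ 0 := by
    intro h0
    have : u = v := by linarith
    rw [this] at h₁
    nlinarith [mul_self_nonneg v]
  refine ⟨K + (u / (u - v)) • (L - K), add_smul_sub_mem_openSegment ?_ ?_, ?_⟩
  · rcases lt_or_gt_of_ne hne with h0 | h0
    · exact div_pos_of_neg_of_neg (by nlinarith) h0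
    · exact div_pos (by nlinarith) h0
  · rcases lt_or_gt_of_ne hne with h0 | h0
    · rw [div_lt_one_of_neg h0]
      nlinarith
    · rw [div_lt_one h0]
      nlinarith
  · rw [segment_eq_image']
    refine ⟨x / (x - y), ⟨?_, ?_⟩, ?_⟩
    · rcases lt_or_gt_of_ne hne with h0 | h0
      · exact div_nonneg (by nlinarith) (by linarith)
      · exact div_nonneg_of_nonpos (by nlinarith) (by linarith)
    · rcases lt_or_gt_of_ne hne with h0 | h0
      · rw [div_le_one (by linarith)]
        nlinarith
      · rw [div_le_one_of_neg (by linarith)]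
        nlinarith
    · have hxy : x - y = -(u - v) := by linarith
      rw [hxy, div_neg]
      ext
      · simp only [Prod.fst_add, Prod.smul_fst, Prod.fst_sub, smul_eq_mul]
        field_simp
        rw [hu, hv, hx]
        simp only [crossP]
        ring
      · simp only [Prod.snd_add, Prod.smul_snd, Prod.snd_sub, smul_eq_mul]
        field_simp
        rw [hu, hv, hx]
        simp only [crossP]
        ring

variable {n : ℕ} [NeZero n] {p : Fin n → ℝ × ℝ}

/-- The edge with index `m` does not obstruct the view between the vertices `k` and `l`. -/
def EdgeClear (p : Fin n → ℝ × ℝ) (k l m : ℕ) : Prop :=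
  ¬ OnSegment (cyc p k) (cyc p l) (cyc p m) ∧
    ¬ CrossesSegment (cyc p k) (cyc p l) (cyc p m) (cyc p (m + 1))

/-- The midpoint of two vertices. -/
noncomputable def mid (p : Fin n → ℝ × ℝ) (k l : ℕ) : ℝ × ℝ :=
  (1 / 2 : ℝ) • cyc p k + (1 / 2 : ℝ) • cyc p l

theorem mid_mem (p : Fin n → ℝ × ℝ) (k l : ℕ) : mid p k l ∈ openSegment ℝ (cyc p k) (cyc p l) :=
  ⟨1 / 2, 1 / 2, by norm_num, by norm_num, by norm_num, rfl⟩

/-- If no vertex lies on the open segment, it can meet the boundary only inside an edge, and a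
transversal meeting shows in the signs. It suffices to test the first end of each edge, as every
vertex is the first end of one. -/
theorem IsSimplePolygon.disjoint_boundary_iff (h : IsSimplePolygon p) {k l : ℕ} (hkl : k + 1 < l)
    (hl : l < n) (hne : k ≠ 0 ∨ l + 1 ≠ n) :
    (∀ m < n, EdgeClear p k l m) ↔
      ∀ x ∈ openSegment ℝ (cyc p k) (cyc p l), x ∉ polygonBoundary p := by
  have hKL : cyc p k ≠ cyc p l := fun e => by
    have := h.cyc_inj (by omega) hl e
    omega
  constructor
  · intro hall x hx hb
    have hv : ∀ r, cyc p r ∉ openSegment ℝ (cyc p k) (cyc p l) := fun r hr => by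
      rw [← cyc_mod p r, ← onSegment_iff hKL] at hr
      exact (hall (r % n) (Nat.mod_lt _ (NeZero.pos n))).1 hr
    obtain ⟨m, hm, hxm⟩ := mem_polygonBoundary_iff.1 hb
    have hxm' : x ∈ openSegment ℝ (cyc p m) (cyc p (m + 1)) := by
      refine mem_openSegment_of_ne_left_right ?_ ?_ hxm <;> rintro rfl
      · exact hv _ hx
      · exact hv _ hx
    have hx0 := crossP_of_mem_segment hxm
    obtain ⟨s, t, hs, ht, hst, hxe⟩ := hx
    have hx : x ∈ openSegment ℝ (cyc p k) (cyc p l) := ⟨s, t, hs, ht, hst, hxe⟩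
    rw [← hxe, crossP_comb _ _ _ _ hst] at hx0
    -- In the collinear case the segment would coincide with the edge, so `k` and `l` would be
    -- neighbours.
    by_cases hu : crossP (cyc p m) (cyc p (m + 1)) (cyc p k) = 0
    · have hv' : crossP (cyc p m) (cyc p (m + 1)) (cyc p l) = 0 := by
        rw [hu] at hx0
        simpa [ht.ne'] using hx0
      have hmv : ∀ r, cyc p r ∉ openSegment ℝ (cyc p m) (cyc p (m + 1)) := fun r hr =>
        h.ne_vertex hm hr r rfl
      have heq := eq_of_collinear (h.cyc_ne_succ hm) hKL hu hv' hx hxm' (hmv _) (hmv _) (hv _) (hv _)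
      rw [← cyc_mod p (m + 1)] at heq
      have hmod := Nat.mod_lt (m + 1) (NeZero.pos n)
      have hm1 : (m + 1) % n = m + 1 ∨ (m + 1 = n ∧ (m + 1) % n = 0) := by
        rcases Nat.lt_or_ge (m + 1) n with h1 | h1
        · exact .inl (Nat.mod_eq_of_lt h1)
        · obtain e : m + 1 = n := by omega
          exact .inr ⟨e, by rw [e, Nat.mod_self]⟩
      rcases heq with ⟨e₁, e₂⟩ | ⟨e₁, e₂⟩
      · have := h.cyc_inj (by omega) hm e₁
        have := h.cyc_inj hl hmod e₂
        omega
      · have := h.cyc_inj (by omega) hmod e₁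
        have := h.cyc_inj hl hm e₂
        omega
    · refine (hall m hm).2 ⟨?_, ?_⟩
      · have hu2 : 0 < crossP (cyc p m) (cyc p (m + 1)) (cyc p k) ^ 2 := by positivity
        have : t * (crossP (cyc p m) (cyc p (m + 1)) (cyc p k) *
            crossP (cyc p m) (cyc p (m + 1)) (cyc p l)) =
            -(s * crossP (cyc p m) (cyc p (m + 1)) (cyc p k) ^ 2) := by
          have : t * crossP (cyc p m) (cyc p (m + 1)) (cyc p l) =
            -(s * crossP (cyc p m) (cyc p (m + 1)) (cyc p k)) := by linarith
          rw [mul_left_comm, this]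
          ring
        nlinarith [mul_pos hs hu2]
      · have hy0 := crossP_of_mem_segment (openSegment_subset_segment ℝ _ _ hx)
        obtain ⟨a, b, ha, hb, hab, hxe'⟩ := hxm'
        rw [← hxe', crossP_comb _ _ _ _ hab] at hy0
        have : b * (crossP (cyc p k) (cyc p l) (cyc p m) *
            crossP (cyc p k) (cyc p l) (cyc p (m + 1))) =
            -(a * crossP (cyc p k) (cyc p l) (cyc p m) ^ 2) := by
          have : b * crossP (cyc p k) (cyc p l) (cyc p (m + 1)) =
            -(a * crossP (cyc p k) (cyc p l) (cyc p m)) := by linarith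
          rw [mul_left_comm, this]
          ring
        have h2 : 0 ≤ a * crossP (cyc p k) (cyc p l) (cyc p m) ^ 2 := by positivity
        by_contra! hlt
        have := mul_pos hb hlt
        linarith
  · intro hall m hm
    constructor
    · intro hon
      exact hall _ ((onSegment_iff hKL).1 hon) (cyc_mem_polygonBoundary p m)
    · intro hc
      obtain ⟨z, hz, hz'⟩ := hc.exists_mem
      exact hall z hz (mem_polygonBoundary_iff.2 ⟨m, hm, hz'⟩)

/-- The parity is constant along an open segment that misses the boundary, so it is enough to
evaluate it at the midpoint. -/
theorem IsSimplePolygon.sees_iff (h : IsSimplePolygon p) {k l : ℕ} (hkl : k < l) (hl : l < n) :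
    Sees p k l ↔ (l = k + 1 ∨ (k = 0 ∧ l + 1 = n)) ∨ ((∀ m < n, EdgeClear p k l m) ∧
      ∑ m ∈ Finset.range n, crossNum (cyc p m) (cyc p (m + 1)) (mid p k l) = 1) := by
  have hsees : Sees p k l ↔ (l = k + 1 ∨ (k = 0 ∧ l + 1 = n)) ∨
      openSegment ℝ (cyc p k) (cyc p l) ⊆ polygonInterior p := by
    constructor
    · rintro ⟨hk, hl, hb | hd⟩
      · left
        rw [isBoundaryEdge_iff] at hb
        simp only at hb
        omega
      · exact .inr (isDiagonal_iff.1 hd)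
    · rintro (hb | hd)
      · refine ⟨by omega, hl, .inl (isBoundaryEdge_iff.2 ?_)⟩
        simp only
        omega
      · exact ⟨by omega, hl, .inr (isDiagonal_iff.2 hd)⟩
  rw [hsees]
  by_cases hb : l = k + 1 ∨ (k = 0 ∧ l + 1 = n)
  · simp only [hb, true_or]
  · simp only [hb, false_or]
    rw [h.disjoint_boundary_iff (by omega) hl (by omega), ← parity_eq_sum_range]
    constructor
    · intro hd
      exact ⟨fun x hx => (mem_polygonInterior_iff.1 (hd hx)).1,
        (mem_polygonInterior_iff.1 (hd (mid_mem p k l))).2⟩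
    · rintro ⟨h₁, h₂⟩ x hx
      exact mem_polygonInterior_iff.2 ⟨h₁ x hx,
        (parity_eq_of_openSegment h₁ hx (mid_mem p k l)).trans h₂⟩

/-- All quantities at the midpoint are doubled, since the machine cannot divide. -/
theorem segCrosses_mid_iff {k l m : ℕ} : SegCrosses (cyc p m) (cyc p (m + 1)) (mid p k l) ↔
    (¬ (cyc p k).2 + (cyc p l).2 < 2 * (cyc p m).2 ∧
      (cyc p k).2 + (cyc p l).2 < 2 * (cyc p (m + 1)).2 ∧
      0 < crossP (cyc p m) (cyc p (m + 1)) (cyc p k) +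
        crossP (cyc p m) (cyc p (m + 1)) (cyc p l)) ∨
    (¬ (cyc p k).2 + (cyc p l).2 < 2 * (cyc p (m + 1)).2 ∧
      (cyc p k).2 + (cyc p l).2 < 2 * (cyc p m).2 ∧
      crossP (cyc p m) (cyc p (m + 1)) (cyc p k) +
        crossP (cyc p m) (cyc p (m + 1)) (cyc p l) < 0) := by
  have h₁ : (mid p k l).2 = ((cyc p k).2 + (cyc p l).2) / 2 := by
    simp [mid]
    ring
  have h₂ : crossP (cyc p m) (cyc p (m + 1)) (mid p k l) =
      (crossP (cyc p m) (cyc p (m + 1)) (cyc p k) +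
        crossP (cyc p m) (cyc p (m + 1)) (cyc p l)) / 2 := by
    rw [mid, crossP_comb _ _ _ _ (by norm_num)]
    ring
  rw [segCrosses_iff, h₁, h₂]
  refine or_congr (and_congr ?_ (and_congr ?_ ?_)) (and_congr ?_ (and_congr ?_ ?_)) <;>
  constructor <;> intro h <;> linarith

end VisibilityTest

/-! ### Computing the visibility relation -/

/-- Assignment to a scalar variable. -/
def SProg.assign (v : ℕ) (e : IExp) : SProg := .set v (.const 0) e

theorem Spec.assign {B : ℤ} {n : ℕ} {s : Memory} {Q : Memory → Prop} {v : ℕ} {e : IExp} {x : ℤ}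
    (he : e.eval s = x) (hx : |x| ≤ B) (h : Q (s.setInt v 0 x)) : Spec B n (.assign v e) s Q := by
  refine Spec.set ?_ (he ▸ hx) (he ▸ h)
  simpa [IExp.eval] using (abs_nonneg x).trans hx

/-- Equality of integers, by two comparisons. -/
def BExp.ieq (x y : IExp) : BExp := .and (.not (.ilt x y)) (.not (.ilt y x))

def BExp.ile (x y : IExp) : BExp := .not (.ilt y x)

theorem BExp.holds_ieq {s : Memory} {x y : IExp} : (BExp.ieq x y).Holds s ↔ x.eval s = y.eval s := by
  simp only [BExp.ieq, BExp.Holds]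
  omega

theorem BExp.holds_ile {s : Memory} {x y : IExp} : (BExp.ile x y).Holds s ↔ x.eval s ≤ y.eval s := by
  simp only [BExp.ile, BExp.Holds]
  omega

/-- The point whose index is the value of the variable. -/
def ptOf (s : Memory) (v : ℕ) : ℝ × ℝ := (s.reals 0 (s.ints v 0), s.reals 1 (s.ints v 0))

def xCoord (v : ℕ) : RExp := .get 0 (.var v)

def yCoord (v : ℕ) : RExp := .get 1 (.var v)

theorem eval_xCoord (s : Memory) (v : ℕ) : (xCoord v).eval s = (ptOf s v).1 := rfl

theorem eval_yCoord (s : Memory) (v : ℕ) : (yCoord v).eval s = (ptOf s v).2 := rfl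

def crossE (a b q : ℕ) : RExp :=
  .sub (.mul (.sub (xCoord b) (xCoord a)) (.sub (yCoord q) (yCoord a)))
    (.mul (.sub (yCoord b) (yCoord a)) (.sub (xCoord q) (xCoord a)))

theorem eval_crossE (s : Memory) (a b q : ℕ) :
    (crossE a b q).eval s = crossP (ptOf s a) (ptOf s b) (ptOf s q) := rfl

def onSegB (k l m : ℕ) : BExp :=
  .and (.and (.not (.rlt (crossE k l m) (.const 0))) (.not (.rlt (.const 0) (crossE k l m))))
    (.rlt (.const 0) (.add (.mul (.sub (xCoord m) (xCoord k)) (.sub (xCoord l) (xCoord m)))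
      (.mul (.sub (yCoord m) (yCoord k)) (.sub (yCoord l) (yCoord m)))))

theorem holds_onSegB {s : Memory} {k l m : ℕ} :
    (onSegB k l m).Holds s ↔ OnSegment (ptOf s k) (ptOf s l) (ptOf s m) := by
  simp only [onSegB, BExp.Holds, RExp.eval, eval_crossE, eval_xCoord, eval_yCoord, OnSegment,
    Int.cast_zero, not_lt]
  exact and_congr_left fun _ => ⟨fun h => le_antisymm h.2 h.1, fun h => ⟨h.ge, h.le⟩⟩

def crossB (k l a b : ℕ) : BExp :=
  .and (.rlt (.mul (crossE a b k) (crossE a b l)) (.const 0))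
    (.not (.rlt (.const 0) (.mul (crossE k l a) (crossE k l b))))

theorem holds_crossB {s : Memory} {k l a b : ℕ} : (crossB k l a b).Holds s ↔
    CrossesSegment (ptOf s k) (ptOf s l) (ptOf s a) (ptOf s b) := by
  simp only [crossB, BExp.Holds, RExp.eval, eval_crossE, CrossesSegment, Int.cast_zero, not_lt]

/-- The horizontal ray from the midpoint of `k` and `l` crosses the edge from `a` to `b`. -/
def rayB (k l a b : ℕ) : BExp :=
  .or (.and (.not (.rlt (.add (yCoord k) (yCoord l)) (.mul (.const 2) (yCoord a))))
      (.and (.rlt (.add (yCoord k) (yCoord l)) (.mul (.const 2) (yCoord b)))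
        (.rlt (.const 0) (.add (crossE a b k) (crossE a b l)))))
    (.and (.not (.rlt (.add (yCoord k) (yCoord l)) (.mul (.const 2) (yCoord b))))
      (.and (.rlt (.add (yCoord k) (yCoord l)) (.mul (.const 2) (yCoord a)))
        (.rlt (.add (crossE a b k) (crossE a b l)) (.const 0))))

/-- Accounts for the edge with index in variable `12` in the test of the pair in variables `10` and
`11`. -/
def visStep : SProg :=
  .seq (.assign 15 (.add (.var 12) (.const 1)))
    (.seq (.ite (.ilt (.var 15) (.var 0)) .skip (.assign 15 (.const 0)))
      (.seq (.ite (.or (onSegB 10 11 12) (crossB 10 11 12 15)) (.assign 13 (.const 0)) .skip)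
        (.ite (rayB 10 11 12 15) (.assign 14 (.sub (.const 1) (.var 14))) .skip)))

/-- Variable `13` is 1 as long as no edge obstructs the view, `14` is the parity at the midpoint,
and `15` the index of the second end of the current edge, modulo `n`. -/
def visPair : SProg :=
  .seq (.assign 13 (.const 1)) (.seq (.assign 14 (.const 0)) (.seq (.forN 12 visStep)
    (.ite (.or (.ieq (.var 11) (.add (.var 10) (.const 1)))
        (.and (.ieq (.var 10) (.const 0)) (.ieq (.add (.var 11) (.const 1)) (.var 0))))
      (.set 5 (.add (.mul (.var 10) (.var 0)) (.var 11)) (.const 1))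
      (.set 5 (.add (.mul (.var 10) (.var 0)) (.var 11)) (.mul (.var 13) (.var 14))))))

/-- Fills integer array `5` with the visibility relation for pairs `k < l`. -/
def visProg : SProg := .forN 10 (.forN 11 visPair)

section Visibility

variable {n : ℕ} [NeZero n] {p : Fin n → ℝ × ℝ} {B : ℤ}

theorem ptOf_eq {s : Memory} {v k : ℕ} (hr : s.reals = (inputMemory p).reals) (hv : s.ints v 0 = k)
    (hk : k < n) : ptOf s v = cyc p k := by
  rw [ptOf, hr, hv, cyc_of_lt hk]
  simp [inputMemory, hk]

open Classical in
/-- What the test of the pair `k, l` has recorded after the edges with index less than `m`. -/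
def VisInv (p : Fin n → ℝ × ℝ) (k l m : ℕ) (s : Memory) : Prop :=
  s.ints 13 0 = (if ∀ m' < m, EdgeClear p k l m' then 1 else 0) ∧
    s.ints 14 0 = ((∑ m' ∈ Finset.range m, crossNum (cyc p m') (cyc p (m' + 1)) (mid p k l)).val : ℤ)

theorem one_sub_val_zmod_two (x : ZMod 2) : 1 - (x.val : ℤ) = ((x + 1).val : ℤ) := by
  revert x
  decide

theorem abs_val_zmod_two_le (x : ZMod 2) : |(x.val : ℤ)| ≤ 1 := by
  revert x
  decide

theorem visStep_spec (hB : (n : ℤ) ≤ B) {k l m : ℕ} (hk : k < n) (hl : l < n) (hm : m < n)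
    {s : Memory} (hn : s.ints 0 0 = n) (hr : s.reals = (inputMemory p).reals)
    (h10 : s.ints 10 0 = k) (h11 : s.ints 11 0 = l) (h12 : s.ints 12 0 = m)
    (h : VisInv p k l m s) : Spec B n visStep s (VisInv p k l (m + 1)) := by
  classical
  have hB1 : 1 ≤ B := le_trans (by exact_mod_cast NeZero.one_le) hB
  obtain ⟨h₁, h₂⟩ := h
  refine Spec.seq (Spec.assign (x := ((m + 1 : ℕ) : ℤ)) (by simp [IExp.eval, IExp.eval_var, h12])
    (by rw [Nat.abs_cast]; exact le_trans (by exact_mod_cast hm) hB) ?_)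
  have hnext : Spec B n (.ite (.ilt (.var 15) (.var 0)) .skip (.assign 15 (.const 0)))
      (s.setInt 15 0 ((m + 1 : ℕ) : ℤ)) fun s' => s'.ints 15 0 = ((m + 1) % n : ℕ) := by
    refine Spec.ite (fun hb => Spec.skip ?_) fun hb => Spec.assign (x := 0) rfl (by simp; omega) ?_
    · simp only [BExp.Holds, IExp.eval_var, Memory.setInt_ints, hn] at hb
      rw [Memory.setInt_ints_same, Nat.mod_eq_of_lt]
      simp at hb
      omega
    · simp only [BExp.Holds, IExp.eval_var, Memory.setInt_ints, hn] at hb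
      rw [Memory.setInt_ints_same, show m + 1 = n by simp at hb; omega, Nat.mod_self]
      rfl
  refine Spec.seq (hnext.mono fun s₁ h15 hf hr₁ => ?_)
  have hf' : ∀ a, a ≠ 15 → s₁.ints a = s.ints a := fun a ha => by
    rw [hf a (by simpa [SProg.writes, SProg.assign] using ha), Memory.setInt_ints_ne _ _ _ ha]
  have hr' : s₁.reals = (inputMemory p).reals := by rw [hr₁, Memory.setInt_reals, hr]
  have e₁ : ptOf s₁ 10 = cyc p k := ptOf_eq hr' (by rw [hf' 10 (by decide), h10]) hk
  have e₂ : ptOf s₁ 11 = cyc p l := ptOf_eq hr' (by rw [hf' 11 (by decide), h11]) hl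
  have e₃ : ptOf s₁ 12 = cyc p m := ptOf_eq hr' (by rw [hf' 12 (by decide), h12]) hm
  have e₄ : ptOf s₁ 15 = cyc p (m + 1) := by
    rw [ptOf_eq hr' h15 (Nat.mod_lt _ (NeZero.pos n)), cyc_mod]
  have hsucc : (∀ m' < m + 1, EdgeClear p k l m') ↔
      (∀ m' < m, EdgeClear p k l m') ∧ EdgeClear p k l m := by
    constructor
    · exact fun h => ⟨fun m' hm' => h m' (by omega), h m (by omega)⟩
    · rintro ⟨ha, hb⟩ m' hm'
      rcases Nat.lt_succ_iff_lt_or_eq.1 hm' with h' | rfl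
      · exact ha m' h'
      · exact hb
  have hclear : (BExp.or (onSegB 10 11 12) (crossB 10 11 12 15)).Holds s₁ ↔ ¬ EdgeClear p k l m := by
    simp only [BExp.Holds, holds_onSegB, holds_crossB, e₁, e₂, e₃, e₄, EdgeClear]
    tauto
  have hok : Spec B n (.ite (.or (onSegB 10 11 12) (crossB 10 11 12 15)) (.assign 13 (.const 0))
      .skip) s₁ fun s' => s'.ints 13 0 = if ∀ m' < m + 1, EdgeClear p k l m' then 1 else 0 := by
    refine Spec.ite (fun hb => Spec.assign (x := 0) rfl (by simp; omega) ?_) fun hb => Spec.skip ?_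
    · rw [Memory.setInt_ints_same, if_neg]
      rw [hsucc]
      exact fun h => hclear.1 hb h.2
    · have hb' := not_not.1 fun h => hb (hclear.2 h)
      rw [hf' 13 (by decide), h₁]
      simp only [hsucc, hb', and_true]
  refine Spec.seq (hok.mono fun s₂ h13 hf₂ hr₂ => ?_)
  have hf₂' : ∀ a, a ≠ 13 → s₂.ints a = s₁.ints a := fun a ha =>
    hf₂ a (by simpa [SProg.writes, SProg.assign] using ha)
  have hpt : ∀ v, v ≠ 13 → ptOf s₂ v = ptOf s₁ v := fun v hv => by
    rw [ptOf, ptOf, hr₂, hf₂' v hv]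
  have hray : (rayB 10 11 12 15).Holds s₂ ↔
      SegCrosses (cyc p m) (cyc p (m + 1)) (mid p k l) := by
    rw [segCrosses_mid_iff]
    simp only [rayB, BExp.Holds, RExp.eval, eval_crossE, eval_yCoord, hpt 10 (by decide),
      hpt 11 (by decide), hpt 12 (by decide), hpt 15 (by decide), e₁, e₂, e₃, e₄, Int.cast_zero,
      Int.cast_ofNat]
  have h14 : s₂.ints 14 0 = ((∑ m' ∈ Finset.range m,
      crossNum (cyc p m') (cyc p (m' + 1)) (mid p k l)).val : ℤ) := by
    rw [hf₂' 14 (by decide), hf' 14 (by decide), h₂]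
  refine Spec.ite (fun hb => ?_) fun hb => Spec.skip ⟨h13, ?_⟩
  · have hc : crossNum (cyc p m) (cyc p (m + 1)) (mid p k l) = 1 := by
      rw [crossNum, if_pos (hray.1 hb)]
    refine Spec.assign (x := ((∑ m' ∈ Finset.range (m + 1),
      crossNum (cyc p m') (cyc p (m' + 1)) (mid p k l)).val : ℤ)) ?_
      ((abs_val_zmod_two_le _).trans hB1) ⟨?_, ?_⟩
    · simp only [IExp.eval, IExp.eval_var, h14, one_sub_val_zmod_two, Finset.sum_range_succ, hc]
    · rw [Memory.setInt_ints_ne _ _ _ (by decide), h13]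
    · rw [Memory.setInt_ints_same]
  · have hc : crossNum (cyc p m) (cyc p (m + 1)) (mid p k l) = 0 := by
      rw [crossNum, if_neg fun h => hb (hray.2 h)]
    rw [h14, Finset.sum_range_succ, hc, add_zero]

open Classical in
/-- The pairs in `X` have been treated. -/
def VisDone (p : Fin n → ℝ × ℝ) (X : Set (ℕ × ℕ)) (s : Memory) : Prop :=
  s.reals = (inputMemory p).reals ∧ ∀ k l, (k, l) ∈ X → k < l → l < n →
    s.ints 5 ((k : ℤ) * n + l) = if Sees p k l then 1 else 0

theorem mul_add_inj {n k l k' l' : ℕ} (hl : l < n) (hl' : l' < n) (h : k * n + l = k' * n + l') :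
    k = k' ∧ l = l' := by
  have h₁ : (k * n + l) / n = (k' * n + l') / n := by rw [h]
  have hn : 0 < n := by omega
  rw [mul_comm k, mul_comm k', Nat.mul_add_div hn, Nat.mul_add_div hn, Nat.div_eq_of_lt hl,
    Nat.div_eq_of_lt hl', add_zero, add_zero] at h₁
  subst h₁
  omega

theorem mul_add_lt_pow {n k l m : ℕ} (hk : k < n ^ m) (hl : l < n) : k * n + l < n ^ (m + 1) := by
  calc k * n + l < k * n + n := by omega
    _ = (k + 1) * n := by ring
    _ ≤ n ^ m * n := Nat.mul_le_mul_right n hk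
    _ = n ^ (m + 1) := by rw [pow_succ]

/-- Pairs with `k ≥ l` are processed too; `VisDone` makes no claim about their cells. -/
theorem visPair_adds (h : IsSimplePolygon p) (hB : (n : ℤ) ^ 2 ≤ B) :
    Adds B n [11, 10] visPair (VisDone p) fun ρ => {(ρ 10, ρ 11)} := by
  classical
  intro ρ X s hρ hX
  have hn1 : 1 ≤ n := NeZero.one_le
  have hnB : (n : ℤ) ≤ B := le_trans (by exact_mod_cast Nat.le_self_pow two_ne_zero n) hB
  have hB1 : 1 ≤ B := le_trans (by exact_mod_cast hn1) hnB
  obtain ⟨hn, hv⟩ := hρ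
  obtain ⟨h10, hk⟩ := hv 10 (by decide)
  obtain ⟨h11, hl⟩ := hv 11 (by decide)
  set k := ρ 10
  set l := ρ 11
  refine Spec.seq (Spec.assign (x := 1) rfl (by simpa using hB1) ?_)
  refine Spec.seq (Spec.assign (x := 0) rfl (by simp; omega) ?_)
  set s₁ := (s.setInt 13 0 1).setInt 14 0 0 with hs₁
  have hf₁ : ∀ a, a ≠ 13 → a ≠ 14 → s₁.ints a = s.ints a := fun a h₁ h₂ => by
    rw [hs₁, Memory.setInt_ints_ne _ _ _ h₂, Memory.setInt_ints_ne _ _ _ h₁]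
  have hloop : Spec B n (.forN 12 visStep) s₁ (VisInv p k l n) := by
    refine Spec.forN (by rw [hf₁ 0 (by decide) (by decide), hn]) hnB (by decide) (by decide) _
      (fun m s' x h' => ?_) ⟨?_, ?_⟩ ?_
    · obtain ⟨a₁, a₂⟩ := h'
      exact ⟨by rw [Memory.setInt_ints_ne _ _ _ (by decide), a₁],
        by rw [Memory.setInt_ints_ne _ _ _ (by decide), a₂]⟩
    · rw [hs₁, Memory.setInt_ints_ne _ _ _ (by decide), Memory.setInt_ints_same, if_pos]
      intro m' hm'
      omega
    · rw [hs₁, Memory.setInt_ints_same]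
      simp
    · intro m hm s' hI h12 hf hr
      exact visStep_spec hnB hk hl hm
        (by rw [hf 0 (by decide), hf₁ 0 (by decide) (by decide), hn]) (hr.trans hX.1)
        (by rw [hf 10 (by decide), hf₁ 10 (by decide) (by decide), h10])
        (by rw [hf 11 (by decide), hf₁ 11 (by decide) (by decide), h11]) h12 hI
  refine Spec.seq (hloop.mono fun s₂ hI hf hr => ?_)
  have hf₂ : ∀ a, a ∉ [12, 13, 14, 15] → s₂.ints a = s.ints a := by
    intro a ha
    simp only [List.mem_cons, List.not_mem_nil, or_false, not_or] at ha
    rw [hf a (by simp [SProg.writes, visStep, SProg.assign, ha]), hf₁ a ha.2.1 ha.2.2.1]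
  have g0 : s₂.ints 0 0 = n := by rw [hf₂ 0 (by decide), hn]
  have g10 : s₂.ints 10 0 = k := by rw [hf₂ 10 (by decide), h10]
  have g11 : s₂.ints 11 0 = l := by rw [hf₂ 11 (by decide), h11]
  have haddr : (IExp.add (.mul (.var 10) (.var 0)) (.var 11)).eval s₂ = ((k * n + l : ℕ) : ℤ) := by
    simp [IExp.eval, IExp.eval_var, g0, g10, g11]
  have haddrB : |((k * n + l : ℕ) : ℤ)| ≤ B := by
    rw [Nat.abs_cast]
    refine le_trans ?_ hB
    exact_mod_cast (mul_add_lt_pow (m := 1) (by simpa using hk) hl).le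
  have hfin : ∀ x : ℤ, (k < l → x = if Sees p k l then 1 else 0) →
      VisDone p (X ∪ {(k, l)}) (s₂.setInt 5 ((k * n + l : ℕ) : ℤ) x) := by
    intro x hx
    refine ⟨hr.trans hX.1, fun k' l' hm hlt hl' => ?_⟩
    rw [Memory.setInt_ints]
    by_cases hc : 5 = 5 ∧ (k' : ℤ) * n + l' = ((k * n + l : ℕ) : ℤ)
    · rw [if_pos hc]
      obtain ⟨rfl, rfl⟩ := mul_add_inj hl' hl (by exact_mod_cast hc.2 : k' * n + l' = k * n + l)
      exact hx hlt
    · rw [if_neg hc, hf₂ 5 (by decide)]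
      rcases hm with hm | hm
      · exact hX.2 k' l' hm hlt hl'
      · obtain ⟨rfl, rfl⟩ := Prod.mk.inj hm
        exact absurd ⟨rfl, by push_cast; rfl⟩ hc
  have hcond : (BExp.or (.ieq (.var 11) (.add (.var 10) (.const 1)))
      (.and (.ieq (.var 10) (.const 0)) (.ieq (.add (.var 11) (.const 1)) (.var 0)))).Holds s₂ ↔
      (l = k + 1 ∨ (k = 0 ∧ l + 1 = n)) := by
    simp only [BExp.Holds, BExp.holds_ieq, IExp.eval, IExp.eval_var, g0, g10, g11]
    omega
  refine Spec.ite (fun hb => ?_) fun hb => ?_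
  · refine Spec.set (by rw [haddr]; exact haddrB) (by simpa [IExp.eval] using hB1) ?_
    rw [haddr]
    refine hfin _ fun hlt => ?_
    rw [if_pos ((h.sees_iff hlt hl).2 (.inl (hcond.1 hb)))]
    rfl
  · have hval : (IExp.mul (.var 13) (.var 14)).eval s₂ = s₂.ints 13 0 * s₂.ints 14 0 := rfl
    obtain ⟨h13, h14⟩ := hI
    refine Spec.set (by rw [haddr]; exact haddrB) ?_ ?_
    · rw [hval, h13, h14, abs_mul]
      have := abs_val_zmod_two_le (∑ m' ∈ Finset.range n,
        crossNum (cyc p m') (cyc p (m' + 1)) (mid p k l))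
      split_ifs
      · simpa using this.trans hB1
      · simp
        omega
    · rw [haddr]
      refine hfin _ fun hlt => ?_
      rw [hval, h13, h14]
      have hs := h.sees_iff hlt hl
      rw [or_iff_right (fun h' => hb (hcond.2 h'))] at hs
      simp only [hs]
      generalize (∑ m' ∈ Finset.range n,
        crossNum (cyc p m') (cyc p (m' + 1)) (mid p k l)) = x
      by_cases hc : ∀ m < n, EdgeClear p k l m
      · rw [if_pos hc, one_mul]
        simp only [eq_true hc, true_and]
        revert x
        decide
      · rw [if_neg hc, zero_mul, if_neg fun h' => hc h'.1]

theorem visProg_spec (h : IsSimplePolygon p) (hB : (n : ℤ) ^ 2 ≤ B) {s : Memory}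
    (hn : s.ints 0 0 = n) (hr : s.reals = (inputMemory p).reals) :
    Spec B n visProg s (VisDone p {x | x.1 < n ∧ x.2 < n}) := by
  have hnB : (n : ℤ) ≤ B := le_trans (by exact_mod_cast Nat.le_self_pow two_ne_zero n) hB
  have hA : ∀ v, v ≠ 5 → ∀ X s x, VisDone p X s → VisDone p X (s.setInt v 0 x) := by
    intro v hv X s x hX
    refine ⟨hX.1, fun k l hm hlt hl => ?_⟩
    rw [Memory.setInt_ints_ne _ _ _ hv.symm, hX.2 k l hm hlt hl]
  have := ((visPair_adds h hB).forN hnB (by decide) (by decide) (hA 11 (by decide))).forN hnB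
    (by decide) (by decide) (hA 10 (by decide)) (fun _ => 0) ∅ s ⟨hn, by simp⟩ ⟨hr, by simp⟩
  refine this.mono fun s' hs' _ _ => ?_
  convert hs' using 1
  ext ⟨k, l⟩
  simp only [Set.mem_ofPred_eq, Set.empty_union, Set.mem_singleton_iff, Prod.mk.injEq,
    Function.update_apply]
  constructor
  · rintro ⟨hk, hl⟩
    exact ⟨k, hk, l, hl, by simp⟩
  · rintro ⟨k', hk, l', hl, h⟩
    simp at h
    omega

end Visibility

/-! ### The candidates of the recursion -/

/-- The path along the boundary has length `k`. This crude bound keeps all costs polynomial in `n`.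
-/
theorem Tri.dist_add_le {V : ℕ → ℕ → Prop} {i j : ℕ} {G : SimpleGraph ℕ} (h : Tri V i j G) {x : ℕ}
    (hx : i ≤ x) (k : ℕ) (hk : x + k ≤ j) : G.dist x (x + k) ≤ k := by
  induction k with
  | zero => simp
  | succ k ih =>
    have := SimpleGraph.dist_le_dist_add_one (x := x)
      (h.adj_succ (k := x + k) (by omega) (by omega))
    have := ih (by omega)
    rw [← add_assoc]
    omega

theorem Tri.triCost_le {V : ℕ → ℕ → Prop} {i j n α : ℕ} {G : SimpleGraph ℕ} (h : Tri V i j G)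
    (hj : j < n) (hα : α ≤ n) : triCost G i j α ≤ 2 * (n : ℤ) ^ 3 := by
  have hd : ∀ x y, i ≤ x → x ≤ y → y ≤ j → (G.dist x y : ℤ) ≤ n := by
    intro x y hx hxy hy
    have := h.dist_add_le hx (y - x) (by omega)
    rw [Nat.add_sub_cancel' hxy] at this
    exact_mod_cast (by omega : G.dist x y ≤ n)
  have hcard : ((Finset.Icc i j).card : ℤ) ≤ n := by
    rw [Nat.card_Icc]
    exact_mod_cast (by omega : j + 1 - i ≤ n)
  have h₁ : ∑ x ∈ Finset.Icc i j, ∑ y ∈ Finset.Ioc x j, (G.dist x y : ℤ) ≤ n * (n * n) := by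
    have : ∀ x ∈ Finset.Icc i j, ∑ y ∈ Finset.Ioc x j, (G.dist x y : ℤ) ≤ n * n := by
      intro x hx
      rw [Finset.mem_Icc] at hx
      refine (Finset.sum_le_card_nsmul _ _ (n : ℤ) fun y hy => ?_).trans ?_
      · rw [Finset.mem_Ioc] at hy
        exact hd x y hx.1 hy.1.le hy.2
      · rw [Nat.card_Ioc, nsmul_eq_mul]
        gcongr
        omega
    refine (Finset.sum_le_card_nsmul _ _ _ this).trans ?_
    rw [nsmul_eq_mul]
    gcongr
  have h₂ : ∑ x ∈ Finset.Icc i j, (G.dist x j : ℤ) ≤ n * n := by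
    refine (Finset.sum_le_card_nsmul _ _ (n : ℤ) fun x hx => ?_).trans ?_
    · rw [Finset.mem_Icc] at hx
      exact hd x j hx.1 hx.2 le_rfl
    · rw [nsmul_eq_mul]
      gcongr
  have h₃ : (α : ℤ) * ∑ x ∈ Finset.Icc i j, (G.dist x j : ℤ) ≤ n * (n * n) := by
    have : (α : ℤ) ≤ n := by exact_mod_cast hα
    have h0 : (0 : ℤ) ≤ ∑ x ∈ Finset.Icc i j, (G.dist x j : ℤ) :=
      Finset.sum_nonneg fun _ _ => Int.natCast_nonneg _
    exact mul_le_mul this h₂ h0 (by positivity)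
  unfold triCost
  linarith [show 2 * (n : ℤ) ^ 3 = n * (n * n) + n * (n * n) by ring]

/-- The cost is of order `n ^ 3`; the exponent 8 is dictated by the addresses of `n ^ 6` matrices
with `n ^ 2` cells each. -/
theorem Tri.abs_triCost_le {V : ℕ → ℕ → Prop} {i j n α : ℕ} {G : SimpleGraph ℕ} (h : Tri V i j G)
    (hn : 3 ≤ n) (hj : j < n) (hα : α ≤ n) : |triCost G i j α| ≤ (n : ℤ) ^ 8 := by
  rw [abs_of_nonneg (triCost_nonneg _ _ _ _)]
  have h3 : (3 : ℤ) ≤ n := by exact_mod_cast hn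
  calc triCost G i j α ≤ 2 * (n : ℤ) ^ 3 := h.triCost_le hj hα
    _ ≤ (n : ℤ) * (n : ℤ) ^ 3 := by gcongr; omega
    _ = (n : ℤ) ^ 4 := by ring
    _ ≤ (n : ℤ) ^ 8 := pow_le_pow_right₀ (by omega) (by decide)

/-- The address of the table entry for given `i, j, a, c, e, g`. -/
def addr (n i j a c e g : ℕ) : ℕ := ((((i * n + j) * n + a) * n + c) * n + e) * n + g

theorem addr_lt {n i j a c e g : ℕ} (hi : i < n) (hj : j < n) (ha : a < n) (hc : c < n) (he : e < n)
    (hg : g < n) : addr n i j a c e g < n ^ 6 :=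
  mul_add_lt_pow (mul_add_lt_pow (mul_add_lt_pow (mul_add_lt_pow (mul_add_lt_pow
    (by simpa using hi) hj) ha) hc) he) hg

theorem addr_inj {n i j a c e g i' j' a' c' e' g' : ℕ} (hj : j < n) (ha : a < n) (hc : c < n)
    (he : e < n) (hg : g < n) (hj' : j' < n) (ha' : a' < n) (hc' : c' < n) (he' : e' < n)
    (hg' : g' < n) (h : addr n i j a c e g = addr n i' j' a' c' e' g') :
    i = i' ∧ j = j' ∧ a = a' ∧ c = c' ∧ e = e' ∧ g = g' := by
  unfold addr at h
  obtain ⟨h₁, hg⟩ := mul_add_inj hg hg' h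
  obtain ⟨h₂, he⟩ := mul_add_inj he he' h₁
  obtain ⟨h₃, hc⟩ := mul_add_inj hc hc' h₂
  obtain ⟨h₄, ha⟩ := mul_add_inj ha ha' h₃
  obtain ⟨hi, hj⟩ := mul_add_inj hj hj' h₄
  exact ⟨hi, hj, ha, hc, he, hg⟩

def addrE (i j a c e g : IExp) : IExp :=
  .add (.mul (.add (.mul (.add (.mul (.add (.mul (.add (.mul i (.var 0)) j) (.var 0)) a) (.var 0)) c)
    (.var 0)) e) (.var 0)) g

theorem eval_addrE {s : Memory} {n i j a c e g : ℕ} {i' j' a' c' e' g' : IExp} (hn : s.ints 0 0 = n)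
    (hi : i'.eval s = i) (hj : j'.eval s = j) (ha : a'.eval s = a) (hc : c'.eval s = c)
    (he : e'.eval s = e) (hg : g'.eval s = g) :
    (addrE i' j' a' c' e' g').eval s = (addr n i j a c e g : ℕ) := by
  simp only [addrE, addr, IExp.eval, IExp.eval_var, hn, hi, hj, ha, hc, he, hg]
  push_cast
  rfl

section Best

variable {ι : Type*} {val : ι → WithTop ℤ} {f₁ f₂ : ι → ℤ} {X : Set ι} {best b₁ b₂ : ℤ}

/-- `best` is the minimum of `val` on `X`, with `-1` for `⊤`, and `b₁, b₂` are the values of `f₁, f₂`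
where it is attained. -/
def BestInv (val : ι → WithTop ℤ) (f₁ f₂ : ι → ℤ) (X : Set ι) (best b₁ b₂ : ℤ) : Prop :=
  (best = -1 ∧ b₁ = 0 ∧ b₂ = 0 ∧ ∀ t ∈ X, val t = ⊤) ∨
    (0 ≤ best ∧ (∀ t ∈ X, (best : WithTop ℤ) ≤ val t) ∧
      ∃ t ∈ X, val t = best ∧ b₁ = f₁ t ∧ b₂ = f₂ t)

theorem BestInv.add_of_top (h : BestInv val f₁ f₂ X best b₁ b₂) {t : ι} (ht : val t = ⊤) :
    BestInv val f₁ f₂ (X ∪ {t}) best b₁ b₂ := by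
  rcases h with ⟨h₁, h₂, h₃, h₄⟩ | ⟨h₁, h₂, t', ht', h₃⟩
  · refine .inl ⟨h₁, h₂, h₃, ?_⟩
    rintro t' (h' | rfl)
    · exact h₄ t' h'
    · exact ht
  · refine .inr ⟨h₁, ?_, t', .inl ht', h₃⟩
    rintro t' (h' | rfl)
    · exact h₂ t' h'
    · rw [ht]
      exact le_top

theorem BestInv.keep (h : BestInv val f₁ f₂ X best b₁ b₂) {t : ι} {x : ℤ} (ht : val t = x)
    (h0 : 0 ≤ best) (hx : best ≤ x) : BestInv val f₁ f₂ (X ∪ {t}) best b₁ b₂ := by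
  rcases h with ⟨h₁, -⟩ | ⟨h₁, h₂, t', ht', h₃⟩
  · omega
  · refine .inr ⟨h₁, ?_, t', .inl ht', h₃⟩
    rintro t' (h' | rfl)
    · exact h₂ t' h'
    · rw [ht]
      exact_mod_cast hx

theorem BestInv.replace (h : BestInv val f₁ f₂ X best b₁ b₂) {t : ι} {x : ℤ} (ht : val t = x)
    (h0 : 0 ≤ x) (hx : best < 0 ∨ x < best) : BestInv val f₁ f₂ (X ∪ {t}) x (f₁ t) (f₂ t) := by
  refine .inr ⟨h0, ?_, t, .inr rfl, ht, rfl, rfl⟩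
  rintro t' (h' | rfl)
  · rcases h with ⟨-, -, -, h₁⟩ | ⟨h₁, h₂, -⟩
    · rw [h₁ t' h']
      exact le_top
    · refine le_trans ?_ (h₂ t' h')
      exact_mod_cast (by omega : x ≤ best)
  · rw [ht]

/-- Replaces the recorded optimum if the value of the first expression is better. -/
def improve (x a₁ a₂ : IExp) : SProg :=
  .ite (.or (.ilt (.var 31) (.const 0)) (.ilt x (.var 31)))
    (.seq (.assign 32 a₁) (.seq (.assign 33 a₂) (.assign 31 x))) .skip

/-- The hypothesis `he` says that the three expressions do not read the variables `31, 32, 33`, so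
they keep their values during the three assignments. -/
theorem improve_spec {B : ℤ} {n : ℕ} {s : Memory} {xE a₁ a₂ : IExp} {x : ℤ} {t : ι}
    (he : ∀ s' : Memory, (∀ a, a ∉ [31, 32, 33] → s'.ints a = s.ints a) →
      xE.eval s' = x ∧ a₁.eval s' = f₁ t ∧ a₂.eval s' = f₂ t)
    (hval : val t = x) (h0 : 0 ≤ x) (hx : x ≤ B) (h₁ : |f₁ t| ≤ B) (h₂ : |f₂ t| ≤ B)
    (h : BestInv val f₁ f₂ X (s.ints 31 0) (s.ints 32 0) (s.ints 33 0)) :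
    Spec B n (improve xE a₁ a₂) s fun s' =>
      BestInv val f₁ f₂ (X ∪ {t}) (s'.ints 31 0) (s'.ints 32 0) (s'.ints 33 0) := by
  have e₀ := he s fun _ _ => rfl
  refine Spec.ite (fun hb => ?_) fun hb => Spec.skip ?_
  · simp only [BExp.Holds, IExp.eval, IExp.eval_var, e₀.1] at hb
    refine Spec.seq (Spec.assign e₀.2.1 h₁ ?_)
    refine Spec.seq (Spec.assign (he _ fun a ha => ?_).2.2 h₂ ?_)
    · simp only [List.mem_cons, List.not_mem_nil, or_false, not_or] at ha
      rw [Memory.setInt_ints_ne _ _ _ ha.2.1]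
    refine Spec.assign (he _ fun a ha => ?_).1 (by rwa [abs_of_nonneg h0]) ?_
    · simp only [List.mem_cons, List.not_mem_nil, or_false, not_or] at ha
      rw [Memory.setInt_ints_ne _ _ _ ha.2.2, Memory.setInt_ints_ne _ _ _ ha.2.1]
    simp only [Memory.setInt_ints]
    exact h.replace hval h0 hb
  · simp only [BExp.Holds, IExp.eval, IExp.eval_var, e₀.1, not_or, not_lt] at hb
    exact h.keep hval hb.1 hb.2

end Best

/-- The variables of the outer loops have the given values. -/
structure StateVals (n len i a c e g : ℕ) (s : Memory) : Prop where
  size : s.ints 0 0 = n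
  len_eq : s.ints 20 0 = len
  i_eq : s.ints 21 0 = i
  a_eq : s.ints 22 0 = a
  c_eq : s.ints 23 0 = c
  e_eq : s.ints 24 0 = e
  g_eq : s.ints 25 0 = g

theorem StateVals.congr {n len i a c e g : ℕ} {s s' : Memory} (h : StateVals n len i a c e g s)
    (hf : ∀ v ∈ [0, 20, 21, 22, 23, 24, 25], s'.ints v = s.ints v) :
    StateVals n len i a c e g s' := by
  obtain ⟨h₀, h₁, h₂, h₃, h₄, h₅, h₆⟩ := h
  refine ⟨?_, ?_, ?_, ?_, ?_, ?_, ?_⟩ <;> rw [hf _ (by decide)] <;> assumption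

/-- From here on, variable `20` is `j - i`, `21` is `i`, `22` to `25` are `a, c, e, g`, and `26` to
`30` are `d, a', g', a'', g''`. Variable `31` is the best value so far, and `32, 33` are the table
addresses of the two parts that attain it. -/
def endE : IExp := .add (.var 21) (.var 20)

def coeffE : IExp := .sub (.sub (.var 0) (.var 20)) (.const 1)

def leftE : IExp :=
  addrE (.var 21) (.var 26) (.var 27) (.add (.var 22) (.const 1)) (.sub (.var 23) (.const 1)) (.var 28)

def rightE : IExp :=
  addrE (.var 26) endE (.var 29) (.add (.var 24) (.const 1)) (.sub (.var 25) (.const 1)) (.var 30)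

def costE : IExp :=
  .add (.add (.get 3 leftE) (.get 3 rightE))
    (.add (.mul (.add (.sub (.add coeffE endE) (.var 25)) (.const 1))
        (.sub (.sub (.var 26) (.var 22)) (.const 1)))
      (.mul (.add (.sub (.var 24) (.var 26)) (.const 1)) (.sub (.var 21) (.var 26))))

/-- The choice of `d, a', g', a'', g''` is admissible. -/
def admissibleB : BExp :=
  .and (.and (.ilt (.var 21) (.var 26)) (.ilt (.var 26) endE))
    (.and (.and (.and (.ile (.var 21) (.var 27)) (.ile (.var 27) (.var 26)))
        (.and (.ile (.var 21) (.var 28)) (.ile (.var 28) (.var 26))))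
      (.and (.and (.and (.ile (.var 26) (.var 29)) (.ile (.var 29) endE))
          (.and (.ile (.var 26) (.var 30)) (.ile (.var 30) endE)))
        (.and (.and (.ilt (.const 0) (.get 5 (.add (.mul (.var 21) (.var 0)) (.var 26))))
            (.ilt (.const 0) (.get 5 (.add (.mul (.var 26) (.var 0)) endE))))
          (.and
            (.or (.and (.ieq (.var 26) (.add (.var 21) (.const 1)))
                (.and (.ieq (.var 22) (.var 21)) (.ieq (.var 23) (.var 26))))
              (.and (.not (.ieq (.var 26) (.add (.var 21) (.const 1))))
                (.and (.ile (.var 27) (.add (.var 22) (.const 1)))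
                  (.and (.ile (.add (.var 22) (.const 1)) (.sub (.var 23) (.const 1)))
                    (.ile (.sub (.var 23) (.const 1)) (.var 28))))))
            (.or (.and (.ieq endE (.add (.var 26) (.const 1)))
                (.and (.ieq (.var 24) (.var 26)) (.ieq (.var 25) endE)))
              (.and (.not (.ieq endE (.add (.var 26) (.const 1))))
                (.and (.ile (.var 29) (.add (.var 24) (.const 1)))
                  (.and (.ile (.add (.var 24) (.const 1)) (.sub (.var 25) (.const 1)))
                    (.ile (.sub (.var 25) (.const 1)) (.var 30))))))))))

/-- A negative entry stands for `⊤`, so such a candidate is skipped. -/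
def candidate : SProg :=
  .ite (.and admissibleB (.and (.ile (.const 0) (.get 3 leftE)) (.ile (.const 0) (.get 3 rightE))))
    (improve costE leftE rightE) .skip

section Candidates

variable {V : ℕ → ℕ → Prop} {n len i a c e g d a' g' a'' g'' : ℕ} {s : Memory}

open Classical in
/-- Integer array `5` is the visibility relation, for pairs in increasing order. -/
def HoldsVis (V : ℕ → ℕ → Prop) (n : ℕ) (f : ℤ → ℤ) : Prop :=
  ∀ k l : ℕ, k < l → l < n → f ((k : ℤ) * n + l) = if V k l then 1 else 0

theorem holds_admissibleB (hs : StateVals n len i a c e g s) (hj : i + len < n)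
    (hvis : HoldsVis V n (s.ints 5)) (h26 : s.ints 26 0 = d) (h27 : s.ints 27 0 = a')
    (h28 : s.ints 28 0 = g') (h29 : s.ints 29 0 = a'') (h30 : s.ints 30 0 = g'') :
    admissibleB.Holds s ↔ Admissible V i (i + len) a c e g d a' g' a'' g'' := by
  have hpos : ∀ k l : ℕ, k < l → l < n → (0 < s.ints 5 ((k : ℤ) * n + l) ↔ V k l) := by
    intro k l hkl hl
    rw [hvis k l hkl hl]
    split_ifs with hv <;> simp [hv]
  simp only [admissibleB, BExp.Holds, BExp.holds_ieq, BExp.holds_ile, IExp.eval, IExp.eval_var, endE,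
    hs.size, hs.len_eq, hs.i_eq, hs.a_eq, hs.c_eq, hs.e_eq, hs.g_eq, h26, h27, h28, h29, h30]
  constructor
  · rintro ⟨⟨h₁, h₂⟩, ⟨⟨h₃, h₄⟩, h₅, h₆⟩, ⟨⟨h₇, h₈⟩, h₉, h₁₀⟩, ⟨h₁₁, h₁₂⟩, h₁₃, h₁₄⟩
    have v₂ := hpos d (i + len) (by omega) hj
    push_cast at v₂
    refine ⟨by omega, by omega, by omega, by omega, by omega, by omega,
      (hpos i d (by omega) (by omega)).1 h₁₁, v₂.1 h₁₂, ?_, ?_⟩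
    · split_ifs <;> omega
    · split_ifs <;> omega
  · rintro ⟨h₁, h₂, h₃, h₄, h₅, h₆, h₇, h₈, h₉, h₁₀⟩
    have v₂ := (hpos d (i + len) (by omega) hj).2 h₈
    push_cast at v₂
    refine ⟨by omega, by omega, by omega, ⟨(hpos i d (by omega) (by omega)).2 h₇, v₂⟩, ?_, ?_⟩
    · split_ifs at h₉ <;> omega
    · split_ifs at h₁₀ <;> omega

/-- Guarantees that the recursive calls refer to existing table entries, and that `c - 1` and `g -
1` are the same in `ℕ` and in the program. -/
theorem Admissible.bounds {j : ℕ} (h : Admissible V i j a c e g d a' g' a'' g'') (hj : j < n) :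
    (1 ≤ c ∧ a + 1 < n ∧ c - 1 < n ∧ a' < n ∧ g' < n ∧ d < n) ∧
      (1 ≤ g ∧ e + 1 < n ∧ g - 1 < n ∧ a'' < n ∧ g'' < n) := by
  obtain ⟨h₁, h₂, h₃, h₄, h₅, h₆, -, -, h₉, h₁₀⟩ := h
  split_ifs at h₉ h₁₀ <;> omega

open Classical in
/-- The value of a choice of `d, a', g', a'', g''` in the recursion. -/
noncomputable def candVal (V : ℕ → ℕ → Prop) (n i j a c e g : ℕ) (t : ℕ × ℕ × ℕ × ℕ × ℕ) :
    WithTop ℤ :=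
  if Admissible V i j a c e g t.1 t.2.1 t.2.2.1 t.2.2.2.1 t.2.2.2.2 then
    extVal V i j a c e g (n - (j - i + 1)) t.1 t.2.1 t.2.2.1 t.2.2.2.1 t.2.2.2.2 else ⊤

def leftAddr (n i a c : ℕ) (t : ℕ × ℕ × ℕ × ℕ × ℕ) : ℤ :=
  (addr n i t.1 t.2.1 (a + 1) (c - 1) t.2.2.1 : ℕ)

def rightAddr (n j e g : ℕ) (t : ℕ × ℕ × ℕ × ℕ × ℕ) : ℤ :=
  (addr n t.1 j t.2.2.2.1 (e + 1) (g - 1) t.2.2.2.2 : ℕ)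

open Classical in
/-- The block of integer array `4` with the given number is the adjacency matrix of `G`. -/
def Block (f : ℤ → ℤ) (n β : ℕ) (G : SimpleGraph ℕ) : Prop :=
  ∀ k < n, ∀ l < n, f ((((β * n + k) * n + l : ℕ)) : ℤ) = if G.Adj k l then 1 else 0

/-- The table entry is correct, and so is the adjacency matrix of an optimal triangulation. -/
def EntryOk (V : ℕ → ℕ → Prop) (n : ℕ) (f₃ f₄ : ℤ → ℤ) (i j a c e g : ℕ) : Prop :=
  f₃ (addr n i j a c e g : ℕ) = (ext V i j a c e g (n - (j - i + 1))).untopD (-1) ∧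
    (ext V i j a c e g (n - (j - i + 1)) ≠ ⊤ → ∃ G, TriSpecial V i j a c e g G ∧
      ext V i j a c e g (n - (j - i + 1)) = (triCost G i j (n - (j - i + 1)) : WithTop ℤ) ∧
      Block f₄ n (addr n i j a c e g) G)

/-- Entry correct for every shorter subpolygon. -/
def ShorterOk (V : ℕ → ℕ → Prop) (n : ℕ) (f₃ f₄ : ℤ → ℤ) (len : ℕ) : Prop :=
  ∀ i j a c e g, i < j → j < n → j - i < len → a < n → c < n → e < n → g < n →
    EntryOk V n f₃ f₄ i j a c e g

/-- Costs are nonnegative, so `-1` is an unambiguous code for `⊤`. -/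
theorem EntryOk.nonneg_iff {f₃ f₄ : ℤ → ℤ} {i j a c e g : ℕ} (h : EntryOk V n f₃ f₄ i j a c e g) :
    0 ≤ f₃ (addr n i j a c e g : ℕ) ↔ ext V i j a c e g (n - (j - i + 1)) ≠ ⊤ := by
  obtain ⟨h₁, h₂⟩ := h
  constructor
  · intro h0 ht
    rw [h₁, ht] at h0
    simp at h0
  · intro ht
    obtain ⟨G, -, hG, -⟩ := h₂ ht
    rw [h₁, hG]
    exact triCost_nonneg G i j _

/-- The table is closed under the recursion: adding `j - d` to `n - (j - i + 1)` gives `n - (d - i +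
1)`, the coefficient tabulated for `i, …, d`, and likewise on the right. -/
theorem candVal_eq {f₃ f₄ : ℤ → ℤ} {j : ℕ} (hok : ShorterOk V n f₃ f₄ (j - i)) (hj : j < n)
    (h : Admissible V i j a c e g d a' g' a'' g'')
    (h₁ : 0 ≤ f₃ (addr n i d a' (a + 1) (c - 1) g' : ℕ))
    (h₂ : 0 ≤ f₃ (addr n d j a'' (e + 1) (g - 1) g'' : ℕ)) :
    ∃ G₁ G₂, Block f₄ n (addr n i d a' (a + 1) (c - 1) g') G₁ ∧
      Block f₄ n (addr n d j a'' (e + 1) (g - 1) g'') G₂ ∧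
      TriSpecial V i j a c e g (G₁ ⊔ G₂ ⊔ SimpleGraph.edge i j) ∧
      candVal V n i j a c e g (d, a', g', a'', g'') =
        (triCost (G₁ ⊔ G₂ ⊔ SimpleGraph.edge i j) i j (n - (j - i + 1)) : WithTop ℤ) ∧
      triCost (G₁ ⊔ G₂ ⊔ SimpleGraph.edge i j) i j (n - (j - i + 1)) =
        f₃ (addr n i d a' (a + 1) (c - 1) g' : ℕ) + f₃ (addr n d j a'' (e + 1) (g - 1) g'' : ℕ) +
          extOffset i j a e g (n - (j - i + 1)) d := by
  have hd₁ := h.lt_d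
  have hd₂ := h.d_lt
  obtain ⟨⟨b₁, b₂, b₃, b₄, b₅, b₆⟩, b₇, b₈, b₉, b₁₀, b₁₁⟩ := h.bounds hj
  have o₁ := hok i d a' (a + 1) (c - 1) g' hd₁ b₆ (by omega) b₄ b₂ b₃ b₅
  have o₂ := hok d j a'' (e + 1) (g - 1) g'' hd₂ hj (by omega) b₁₀ b₈ b₉ b₁₁
  obtain ⟨G₁, t₁, c₁, k₁⟩ := o₁.2 (o₁.nonneg_iff.1 h₁)
  obtain ⟨G₂, t₂, c₂, k₂⟩ := o₂.2 (o₂.nonneg_iff.1 h₂)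
  obtain ⟨hT, hcost⟩ := h.node (α := n - (j - i + 1)) t₁ t₂
  rw [show n - (j - i + 1) + (j - d) = n - (d - i + 1) by omega,
    show n - (j - i + 1) + (d - i) = n - (j - d + 1) by omega] at hcost
  refine ⟨G₁, G₂, k₁, k₂, hT, ?_, ?_⟩
  · rw [candVal, if_pos h, extVal, show n - (j - i + 1) + (j - d) = n - (d - i + 1) by omega,
      show n - (j - i + 1) + (d - i) = n - (j - d + 1) by omega, c₁, c₂, hcost]
    push_cast
    rfl
  · rw [hcost, o₁.1, o₂.1, c₁, c₂]
    rfl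

/-- The memory during the search for the best choice, after the choices in `X`. -/
def SearchInv (V : ℕ → ℕ → Prop) (n len i a c e g : ℕ) (s₀ : Memory)
    (X : Set (ℕ × ℕ × ℕ × ℕ × ℕ)) (s : Memory) : Prop :=
  (∀ v ∈ [0, 3, 4, 5, 20, 21, 22, 23, 24, 25], s.ints v = s₀.ints v) ∧
    BestInv (candVal V n i (i + len) a c e g) (leftAddr n i a c) (rightAddr n (i + len) e g) X
      (s.ints 31 0) (s.ints 32 0) (s.ints 33 0)

theorem candidate_adds {B : ℤ} {s₀ : Memory} (hB : (n : ℤ) ^ 8 ≤ B) (hn : 3 ≤ n)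
    (hs₀ : StateVals n len i a c e g s₀) (hi : i + len < n)
    (hvis : HoldsVis V n (s₀.ints 5)) (hok : ShorterOk V n (s₀.ints 3) (s₀.ints 4) len) :
    Adds B n [30, 29, 28, 27, 26] candidate (SearchInv V n len i a c e g s₀)
      fun ρ => {(ρ 26, ρ 27, ρ 28, ρ 29, ρ 30)} := by
  intro ρ X s hρ hX
  obtain ⟨h26, hd⟩ := hρ.2 26 (by decide)
  obtain ⟨h27, ha'⟩ := hρ.2 27 (by decide)
  obtain ⟨h28, hg'⟩ := hρ.2 28 (by decide)
  obtain ⟨h29, ha''⟩ := hρ.2 29 (by decide)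
  obtain ⟨h30, hg''⟩ := hρ.2 30 (by decide)
  change Spec B n candidate s
    (SearchInv V n len i a c e g s₀ (X ∪ {(ρ 26, ρ 27, ρ 28, ρ 29, ρ 30)}))
  generalize ρ 26 = d at *
  generalize ρ 27 = a' at *
  generalize ρ 28 = g' at *
  generalize ρ 29 = a'' at *
  generalize ρ 30 = g'' at *
  obtain ⟨hf, hbest⟩ := hX
  have hs : StateVals n len i a c e g s := hs₀.congr fun v hv => hf v (by revert v; decide)
  have e₃ := hf 3 (by decide)
  have hadm := holds_admissibleB hs hi (by rw [hf 5 (by decide)]; exact hvis) h26 h27 h28 h29 h30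
  have hlen : ShorterOk V n (s₀.ints 3) (s₀.ints 4) (i + len - i) := by
    rwa [Nat.add_sub_cancel_left]
  have heval : ∀ s' : Memory, (∀ v, v ∉ [31, 32, 33] → s'.ints v = s.ints v) → 1 ≤ c → 1 ≤ g →
      leftE.eval s' = (addr n i d a' (a + 1) (c - 1) g' : ℕ) ∧
        rightE.eval s' = (addr n d (i + len) a'' (e + 1) (g - 1) g'' : ℕ) := by
    intro s' hs' hc hg
    have hst : StateVals n len i a c e g s' := hs.congr fun v hv => hs' v (by revert v; decide)
    constructor
    · refine eval_addrE hst.size hst.i_eq ?_ ?_ ?_ ?_ ?_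
      · rw [IExp.eval_var, hs' 26 (by decide), h26]
      · rw [IExp.eval_var, hs' 27 (by decide), h27]
      · simp [IExp.eval, IExp.eval_var, hst.a_eq]
      · simp only [IExp.eval, IExp.eval_var, hst.c_eq]
        omega
      · rw [IExp.eval_var, hs' 28 (by decide), h28]
    · refine eval_addrE hst.size ?_ ?_ ?_ ?_ ?_ ?_
      · rw [IExp.eval_var, hs' 26 (by decide), h26]
      · simp [endE, IExp.eval, IExp.eval_var, hst.i_eq, hst.len_eq]
      · rw [IExp.eval_var, hs' 29 (by decide), h29]
      · simp [IExp.eval, IExp.eval_var, hst.e_eq]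
      · simp only [IExp.eval, IExp.eval_var, hst.g_eq]
        omega
      · rw [IExp.eval_var, hs' 30 (by decide), h30]
  have hmain : Spec B n candidate s fun s' =>
      BestInv (candVal V n i (i + len) a c e g) (leftAddr n i a c) (rightAddr n (i + len) e g)
        (X ∪ {(d, a', g', a'', g'')}) (s'.ints 31 0) (s'.ints 32 0) (s'.ints 33 0) := by
    refine Spec.ite (fun hb => ?_) fun hb => Spec.skip ?_
    · obtain ⟨hb₁, hb₂, hb₃⟩ := hb
      have had := hadm.1 hb₁
      have hd₁ := had.lt_d
      have hd₂ := had.d_lt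
      obtain ⟨⟨b₁, b₂, b₃, b₄, b₅, b₆⟩, b₇, b₈, b₉, b₁₀, b₁₁⟩ := had.bounds hi
      obtain ⟨el, er⟩ := heval s (fun _ _ => rfl) b₁ b₇
      simp only [BExp.holds_ile, IExp.eval, el, er, e₃] at hb₂ hb₃
      obtain ⟨G₁, G₂, -, -, hT, hv, hcost⟩ := candVal_eq hlen hi had hb₂ hb₃
      have hlt₁ := addr_lt (n := n) (i := i) (by omega) b₆ b₄ b₂ b₃ b₅
      have hlt₂ := addr_lt (n := n) b₆ hi b₁₀ b₈ b₉ b₁₁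
      have hpow : ∀ x : ℕ, x < n ^ 6 → |(x : ℤ)| ≤ B := by
        intro x hx
        rw [Nat.abs_cast]
        refine le_trans ?_ hB
        exact_mod_cast hx.le.trans (Nat.pow_le_pow_right (by omega) (by decide))
      refine improve_spec (x := triCost (G₁ ⊔ G₂ ⊔ SimpleGraph.edge i (i + len)) i (i + len)
        (n - (i + len - i + 1))) (fun s' hs' => ?_) hv (triCost_nonneg _ _ _ _) ?_ ?_ ?_ hbest
      · obtain ⟨el', er'⟩ := heval s' hs' b₁ b₇
        have hst : StateVals n len i a c e g s' := hs.congr fun v hv => hs' v (by revert v; decide)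
        refine ⟨?_, el', er'⟩
        rw [hcost]
        have h26' : s'.ints 26 0 = d := by rw [hs' 26 (by decide), h26]
        have h3' : s'.ints 3 = s₀.ints 3 := by rw [hs' 3 (by decide), e₃]
        simp only [costE, IExp.eval, IExp.eval_var, el', er', h3', coeffE, endE, hst.size,
          hst.len_eq, hst.i_eq, hst.a_eq, hst.e_eq, hst.g_eq, h26', extOffset]
        rw [show ((n - (i + len - i + 1) : ℕ) : ℤ) = n - len - 1 by omega]
        push_cast
        rfl
      · exact (le_abs_self _).trans ((hT.1.abs_triCost_le hn hi (by omega)).trans hB)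
      · exact hpow _ hlt₁
      · exact hpow _ hlt₂
    · refine hbest.add_of_top ?_
      by_cases had : Admissible V i (i + len) a c e g d a' g' a'' g''
      · have hd₁ := had.lt_d
        have hd₂ := had.d_lt
        obtain ⟨⟨b₁, b₂, b₃, b₄, b₅, b₆⟩, b₇, b₈, b₉, b₁₀, b₁₁⟩ := had.bounds hi
        obtain ⟨el, er⟩ := heval s (fun _ _ => rfl) b₁ b₇
        have hb' : ¬ (0 ≤ s₀.ints 3 (addr n i d a' (a + 1) (c - 1) g' : ℕ) ∧
            0 ≤ s₀.ints 3 (addr n d (i + len) a'' (e + 1) (g - 1) g'' : ℕ)) := by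
          intro hc
          refine hb ⟨hadm.2 had, ?_⟩
          simpa only [BExp.Holds, BExp.holds_ile, IExp.eval, el, er, e₃] using hc
        rw [(hok i d a' (a + 1) (c - 1) g' hd₁ b₆ (by omega) b₄ b₂ b₃ b₅).nonneg_iff,
          (hok d (i + len) a'' (e + 1) (g - 1) g'' hd₂ hi (by omega) b₁₀ b₈ b₉ b₁₁).nonneg_iff,
          not_and_or, not_not, not_not] at hb'
        rw [candVal, if_pos had, extVal,
          show n - (i + len - i + 1) + (i + len - d) = n - (d - i + 1) by omega,
          show n - (i + len - i + 1) + (d - i) = n - (i + len - d + 1) by omega]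
        rcases hb' with hb' | hb' <;> rw [hb'] <;> simp
      · rw [candVal, if_neg had]
  refine hmain.mono fun s' h' hfr _ => ⟨fun v hv => ?_, h'⟩
  rw [hfr v (by revert v; decide), hf v hv]

def search : SProg := .forN 26 (.forN 27 (.forN 28 (.forN 29 (.forN 30 candidate))))

theorem search_spec {B : ℤ} (hB : (n : ℤ) ^ 8 ≤ B) (hn : 3 ≤ n)
    (hs : StateVals n len i a c e g s) (hi : i + len < n)
    (hvis : HoldsVis V n (s.ints 5)) (hok : ShorterOk V n (s.ints 3) (s.ints 4) len)
    (h31 : s.ints 31 0 = -1) (h32 : s.ints 32 0 = 0) (h33 : s.ints 33 0 = 0) :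
    Spec B n search s (SearchInv V n len i a c e g s
      {t | t.1 < n ∧ t.2.1 < n ∧ t.2.2.1 < n ∧ t.2.2.2.1 < n ∧ t.2.2.2.2 < n}) := by
  have hnB : (n : ℤ) ≤ B := le_trans (by exact_mod_cast Nat.le_self_pow (by decide) n) hB
  have hA : ∀ v, v ∉ [0, 3, 4, 5, 20, 21, 22, 23, 24, 25, 31, 32, 33] → ∀ X s' x,
      SearchInv V n len i a c e g s X s' → SearchInv V n len i a c e g s X (s'.setInt v 0 x) := by
    intro v hv X s' x hX
    simp only [List.mem_cons, List.not_mem_nil, or_false, not_or] at hv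
    refine ⟨fun u hu => ?_, ?_⟩
    · rw [Memory.setInt_ints_ne, hX.1 u hu]
      simp only [List.mem_cons, List.not_mem_nil, or_false] at hu
      rintro rfl
      tauto
    · rw [Memory.setInt_ints_ne _ _ _ (Ne.symm hv.2.2.2.2.2.2.2.2.2.2.1),
        Memory.setInt_ints_ne _ _ _ (Ne.symm hv.2.2.2.2.2.2.2.2.2.2.2.1),
        Memory.setInt_ints_ne _ _ _ (Ne.symm hv.2.2.2.2.2.2.2.2.2.2.2.2)]
      exact hX.2
  have h := ((((((candidate_adds hB hn hs hi hvis hok).forN hnB (by decide) (by decide)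
    (hA 30 (by decide))).forN hnB (by decide) (by decide) (hA 29 (by decide))).forN hnB (by decide)
    (by decide) (hA 28 (by decide))).forN hnB (by decide) (by decide) (hA 27 (by decide))).forN hnB
    (by decide) (by decide) (hA 26 (by decide))) (fun _ => 0) ∅ s ⟨hs.size, by simp⟩
    ⟨fun _ _ => rfl, .inl ⟨h31, h32, h33, by simp⟩⟩
  refine h.mono fun s' hs' _ _ => ?_
  convert hs' using 1
  ext ⟨d, a', g', a'', g''⟩
  simp only [Set.mem_ofPred_eq, Set.empty_union, Set.mem_singleton_iff, Prod.mk.injEq,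
    Function.update_apply]
  constructor
  · rintro ⟨h₁, h₂, h₃, h₄, h₅⟩
    exact ⟨d, h₁, a', h₂, g', h₃, a'', h₄, g'', h₅, by simp⟩
  · rintro ⟨d', h₁, a₁, h₂, g₁, h₃, a₂, h₄, g₂, h₅, h⟩
    simp at h
    omega

end Candidates

/-! ### Filling in one table entry -/

section Entries

variable {V : ℕ → ℕ → Prop} {n len i a c e g : ℕ} {s : Memory} {B : ℤ}

theorem Block.congr {f f' : ℤ → ℤ} {β : ℕ} {G : SimpleGraph ℕ} (h : Block f n β G)
    (hf : ∀ k < n, ∀ l < n, f' (((β * n + k) * n + l : ℕ) : ℤ) = f (((β * n + k) * n + l : ℕ) : ℤ)) :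
    Block f' n β G :=
  fun k hk l hl => (hf k hk l hl).trans (h k hk l hl)

theorem EntryOk.congr {f₃ f₄ f₃' f₄' : ℤ → ℤ} {j : ℕ} (h : EntryOk V n f₃ f₄ i j a c e g)
    (h₃ : f₃' (addr n i j a c e g : ℕ) = f₃ (addr n i j a c e g : ℕ))
    (h₄ : ∀ k < n, ∀ l < n, f₄' (((addr n i j a c e g * n + k) * n + l : ℕ) : ℤ) =
      f₄ (((addr n i j a c e g * n + k) * n + l : ℕ) : ℤ)) :
    EntryOk V n f₃' f₄' i j a c e g := by
  refine ⟨h₃.trans h.1, fun ht => ?_⟩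
  obtain ⟨G, hG, he, hb⟩ := h.2 ht
  exact ⟨G, hG, he, hb.congr h₄⟩

def hereE : IExp := addrE (.var 21) endE (.var 22) (.var 23) (.var 24) (.var 25)

def cellE (b : IExp) : IExp := .add (.mul (.add (.mul b (.var 0)) (.var 34)) (.var 0)) (.var 35)

theorem eval_hereE (h : StateVals n len i a c e g s) :
    hereE.eval s = (addr n i (i + len) a c e g : ℕ) :=
  eval_addrE h.size h.i_eq (by simp [endE, IExp.eval, IExp.eval_var, h.i_eq, h.len_eq]) h.a_eq h.c_eq
    h.e_eq h.g_eq

theorem eval_cellE {b : IExp} {β k l : ℕ} (hn : s.ints 0 0 = n) (hb : b.eval s = β)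
    (hk : s.ints 34 0 = k) (hl : s.ints 35 0 = l) :
    (cellE b).eval s = (((β * n + k) * n + l : ℕ) : ℤ) := by
  simp [cellE, IExp.eval, IExp.eval_var, hn, hb, hk, hl]

/-- Writes one cell of the adjacency matrix of the union of two graphs and the edge `i j`. -/
def joinCell : SProg :=
  .ite (.or (.and (.ieq (.var 34) (.var 21)) (.ieq (.var 35) endE))
      (.and (.ieq (.var 34) endE) (.ieq (.var 35) (.var 21))))
    (.set 4 (cellE hereE) (.const 1))
    (.set 4 (cellE hereE) (.sub (.add (.get 4 (cellE (.var 32))) (.get 4 (cellE (.var 33))))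
      (.mul (.get 4 (cellE (.var 32))) (.get 4 (cellE (.var 33))))))

open Classical in
/-- The memory while the matrix with number `S` is written, after the cells in `X`. -/
def JoinInv (n S : ℕ) (G : SimpleGraph ℕ) (s₀ : Memory) (X : Set (ℕ × ℕ)) (s : Memory) : Prop :=
  (∀ v ∈ [0, 3, 5, 20, 21, 22, 23, 24, 25, 31, 32, 33], s.ints v = s₀.ints v) ∧
    (∀ k < n, ∀ l < n, (k, l) ∈ X →
      s.ints 4 (((S * n + k) * n + l : ℕ) : ℤ) = if G.Adj k l then 1 else 0) ∧
    ∀ β ≠ S, ∀ k < n, ∀ l < n, s.ints 4 (((β * n + k) * n + l : ℕ) : ℤ) =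
      s₀.ints 4 (((β * n + k) * n + l : ℕ) : ℤ)

theorem joinCell_adds {β₁ β₂ : ℕ} {G₁ G₂ : SimpleGraph ℕ} (hB : (n : ℤ) ^ 8 ≤ B)
    (hs₀ : StateVals n len i a c e g s) (hlen : 1 ≤ len)
    (hS : addr n i (i + len) a c e g < n ^ 6) (h32 : s.ints 32 0 = β₁) (h33 : s.ints 33 0 = β₂)
    (hβ₁ : β₁ ≠ addr n i (i + len) a c e g) (hβ₂ : β₂ ≠ addr n i (i + len) a c e g)
    (hG₁ : Block (s.ints 4) n β₁ G₁) (hG₂ : Block (s.ints 4) n β₂ G₂) :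
    Adds B n [35, 34] joinCell (JoinInv n (addr n i (i + len) a c e g)
      (G₁ ⊔ G₂ ⊔ SimpleGraph.edge i (i + len)) s) fun ρ => {(ρ 34, ρ 35)} := by
  intro ρ X s' hρ hX
  obtain ⟨h34, hk⟩ := hρ.2 34 (by decide)
  obtain ⟨h35, hl⟩ := hρ.2 35 (by decide)
  change Spec B n joinCell s' (JoinInv n (addr n i (i + len) a c e g)
      (G₁ ⊔ G₂ ⊔ SimpleGraph.edge i (i + len)) s (X ∪ {(ρ 34, ρ 35)}))
  generalize ρ 34 = k at *
  generalize ρ 35 = l at *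
  obtain ⟨hf, hX₁, hX₂⟩ := hX
  have hs : StateVals n len i a c e g s' := hs₀.congr fun v hv => hf v (by revert v; decide)
  have ehere := eval_cellE hs.size (eval_hereE hs) h34 h35
  have e₁ := eval_cellE (b := .var 32) (β := β₁) hs.size
    (by rw [IExp.eval_var, hf 32 (by decide), h32]) h34 h35
  have e₂ := eval_cellE (b := .var 33) (β := β₂) hs.size
    (by rw [IExp.eval_var, hf 33 (by decide), h33]) h34 h35
  generalize hSdef : addr n i (i + len) a c e g = S at *
  have hidx : |(((S * n + k) * n + l : ℕ) : ℤ)| ≤ B := by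
    rw [Nat.abs_cast]
    refine le_trans ?_ hB
    exact_mod_cast (mul_add_lt_pow (mul_add_lt_pow hS hk) hl).le
  have hB1 : 1 ≤ B := le_trans (by
    have : 0 < n ^ 8 := Nat.pow_pos (by omega)
    exact_mod_cast this) hB
  classical
  have hfin : ∀ x : ℤ, x = (if (G₁ ⊔ G₂ ⊔ SimpleGraph.edge i (i + len)).Adj k l then 1 else 0) →
      JoinInv n S (G₁ ⊔ G₂ ⊔ SimpleGraph.edge i (i + len)) s (X ∪ {(k, l)})
        (s'.setInt 4 (((S * n + k) * n + l : ℕ) : ℤ) x) := by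
    intro x hx
    refine ⟨fun v hv => ?_, fun k' hk' l' hl' hm => ?_, fun β hβ k' hk' l' hl' => ?_⟩
    · rw [Memory.setInt_ints_ne _ _ _ (by revert v; decide), hf v hv]
    · rw [Memory.setInt_ints]
      by_cases hc : 4 = 4 ∧ (((S * n + k') * n + l' : ℕ) : ℤ) = (((S * n + k) * n + l : ℕ) : ℤ)
      · rw [if_pos hc, hx]
        obtain ⟨h₁, rfl⟩ := mul_add_inj hl' hl (by exact_mod_cast hc.2)
        obtain ⟨-, rfl⟩ := mul_add_inj hk' hk h₁
        congr
      · rw [if_neg hc]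
        rcases hm with hm | hm
        · exact (hX₁ k' hk' l' hl' hm).trans (by congr)
        · obtain ⟨rfl, rfl⟩ := Prod.mk.inj hm
          exact (hc ⟨rfl, rfl⟩).elim
    · rw [Memory.setInt_ints, if_neg, hX₂ β hβ k' hk' l' hl']
      rintro ⟨-, hc⟩
      obtain ⟨h₁, -⟩ := mul_add_inj hl' hl (by exact_mod_cast hc)
      exact hβ (mul_add_inj hk' hk h₁).1
  refine Spec.ite (fun hb => ?_) fun hb => ?_
  · simp only [BExp.Holds, BExp.holds_ieq, endE, IExp.eval, IExp.eval_var, hs.i_eq, hs.len_eq, h34,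
      h35] at hb
    refine Spec.set (by rwa [ehere]) (by simpa [IExp.eval] using hB1) ?_
    rw [ehere]
    refine hfin _ ?_
    rw [if_pos]
    · rfl
    · refine .inr ((SimpleGraph.edge_adj _ _ _ _).2 ⟨?_, ?_⟩) <;> omega
  · simp only [BExp.Holds, BExp.holds_ieq, endE, IExp.eval, IExp.eval_var, hs.i_eq, hs.len_eq, h34,
      h35] at hb
    have hedge : ¬ (SimpleGraph.edge i (i + len)).Adj k l := by
      rw [SimpleGraph.edge_adj]
      omega
    -- For bits, `x + y - x * y` is the disjunction.
    have hval : (IExp.sub (.add (.get 4 (cellE (.var 32))) (.get 4 (cellE (.var 33))))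
        (.mul (.get 4 (cellE (.var 32))) (.get 4 (cellE (.var 33))))).eval s' =
        if (G₁ ⊔ G₂ ⊔ SimpleGraph.edge i (i + len)).Adj k l then 1 else 0 := by
      simp only [IExp.eval, e₁, e₂]
      rw [hX₂ β₁ hβ₁ k hk l hl, hX₂ β₂ hβ₂ k hk l hl, hG₁ k hk l hl, hG₂ k hk l hl]
      simp only [SimpleGraph.sup_adj, hedge, or_false]
      by_cases h₁ : G₁.Adj k l <;> by_cases h₂ : G₂.Adj k l <;> simp [h₁, h₂]
    refine Spec.set (by rwa [ehere]) ?_ ?_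
    · rw [hval]
      split_ifs <;> simp <;> omega
    · rw [ehere]
      exact hfin _ hval

def join : SProg := .forN 34 (.forN 35 joinCell)

theorem join_spec {β₁ β₂ : ℕ} {G₁ G₂ : SimpleGraph ℕ} (hB : (n : ℤ) ^ 8 ≤ B)
    (hs : StateVals n len i a c e g s) (hlen : 1 ≤ len)
    (hS : addr n i (i + len) a c e g < n ^ 6) (h32 : s.ints 32 0 = β₁) (h33 : s.ints 33 0 = β₂)
    (hβ₁ : β₁ ≠ addr n i (i + len) a c e g) (hβ₂ : β₂ ≠ addr n i (i + len) a c e g)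
    (hG₁ : Block (s.ints 4) n β₁ G₁) (hG₂ : Block (s.ints 4) n β₂ G₂) :
    Spec B n join s fun s' =>
      Block (s'.ints 4) n (addr n i (i + len) a c e g) (G₁ ⊔ G₂ ⊔ SimpleGraph.edge i (i + len)) ∧
      ∀ β ≠ addr n i (i + len) a c e g, ∀ k < n, ∀ l < n,
        s'.ints 4 (((β * n + k) * n + l : ℕ) : ℤ) = s.ints 4 (((β * n + k) * n + l : ℕ) : ℤ) := by
  have hnB : (n : ℤ) ≤ B := le_trans (by exact_mod_cast Nat.le_self_pow (by decide) n) hB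
  have hA : ∀ v, v ∉ [0, 3, 4, 5, 20, 21, 22, 23, 24, 25, 31, 32, 33] → ∀ S G X s' x,
      JoinInv n S G s X s' → JoinInv n S G s X (s'.setInt v 0 x) := by
    intro v hv S G X s' x hX
    have h4 : (s'.setInt v 0 x).ints 4 = s'.ints 4 :=
      Memory.setInt_ints_ne _ _ _ fun e => hv (e ▸ by decide)
    rw [JoinInv, h4]
    refine ⟨fun u hu => ?_, hX.2⟩
    rw [Memory.setInt_ints_ne, hX.1 u hu]
    rintro rfl
    refine hv ?_
    clear hv h4
    revert u
    decide
  have h := ((joinCell_adds hB hs hlen hS h32 h33 hβ₁ hβ₂ hG₁ hG₂).forN hnB (by decide) (by decide)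
    (hA 35 (by decide) _ _)).forN hnB (by decide) (by decide) (hA 34 (by decide) _ _) (fun _ => 0) ∅ s
    ⟨hs.size, by simp⟩ ⟨fun _ _ => rfl, by simp, fun _ _ _ _ _ _ => rfl⟩
  refine h.mono fun s' hs' _ _ => ⟨fun k hk l hl => hs'.2.1 k hk l hl (.inr ⟨k, hk, l, hl, ?_⟩), hs'.2.2⟩
  simp

/-- Computes the value and the optimal subtriangulations for one table entry. -/
def solve : SProg :=
  .seq (.assign 31 (.const (-1))) (.seq (.assign 32 (.const 0)) (.seq (.assign 33 (.const 0))
    (.ite (.ieq (.var 20) (.const 1)) (.assign 31 (.add coeffE (.const 1))) search)))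

/-- The variables `31, 32, 33` hold the value and the numbers of the matrices of two graphs that,
together with the edge `i j`, form an optimal triangulation. -/
def Solved (V : ℕ → ℕ → Prop) (n i j a c e g : ℕ) (f₄ : ℤ → ℤ) (s : Memory) : Prop :=
  s.ints 31 0 = (ext V i j a c e g (n - (j - i + 1))).untopD (-1) ∧
    ∃ (β₁ β₂ : ℕ) (G₁ G₂ : SimpleGraph ℕ), s.ints 32 0 = β₁ ∧ s.ints 33 0 = β₂ ∧
      β₁ ≠ addr n i j a c e g ∧ β₂ ≠ addr n i j a c e g ∧ Block f₄ n β₁ G₁ ∧ Block f₄ n β₂ G₂ ∧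
      (ext V i j a c e g (n - (j - i + 1)) ≠ ⊤ →
        TriSpecial V i j a c e g (G₁ ⊔ G₂ ⊔ SimpleGraph.edge i j) ∧
        ext V i j a c e g (n - (j - i + 1)) =
          (triCost (G₁ ⊔ G₂ ⊔ SimpleGraph.edge i j) i j (n - (j - i + 1)) : WithTop ℤ))

/-- All admissible choices consist of numbers below `n`, so the exhaustive search covers them, and
its minimum is the value of EXT by `le_ext_iff`. -/
theorem SearchInv.solved {s' : Memory} (hV : ∀ k, k + 1 < n → V k (k + 1)) (hlen : 2 ≤ len)
    (hi : i + len < n) (ha : a < n) (hc : c < n) (he : e < n) (hg : g < n)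
    (hzero : Block (s.ints 4) n 0 ⊥) (hok : ShorterOk V n (s.ints 3) (s.ints 4) len)
    (h : SearchInv V n len i a c e g s
      {t | t.1 < n ∧ t.2.1 < n ∧ t.2.2.1 < n ∧ t.2.2.2.1 < n ∧ t.2.2.2.2 < n} s') :
    Solved V n i (i + len) a c e g (s.ints 4) s' := by
  have hle := fun w => le_ext_iff (V := V) (i := i) (j := i + len) (a := a) (c := c) (e := e) (g := g)
    (α := n - (i + len - i + 1)) (fun k _ hk => hV k (by omega)) (by omega) w
  have hmem : ∀ d a' g' a'' g'', Admissible V i (i + len) a c e g d a' g' a'' g'' →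
      (d, a', g', a'', g'') ∈ {t : ℕ × ℕ × ℕ × ℕ × ℕ |
        t.1 < n ∧ t.2.1 < n ∧ t.2.2.1 < n ∧ t.2.2.2.1 < n ∧ t.2.2.2.2 < n} ∧
      candVal V n i (i + len) a c e g (d, a', g', a'', g'') =
        extVal V i (i + len) a c e g (n - (i + len - i + 1)) d a' g' a'' g'' := by
    intro d a' g' a'' g'' had
    obtain ⟨⟨-, -, -, b₄, b₅, b₆⟩, -, -, -, b₁₀, b₁₁⟩ := had.bounds hi
    exact ⟨⟨b₆, b₄, b₅, b₁₀, b₁₁⟩, by rw [candVal, if_pos had]⟩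
  rcases h.2 with ⟨h31, h32, h33, hall⟩ | ⟨h0, hall, ⟨d, a', g', a'', g''⟩, -, hval, h32, h33⟩
  · have htop : ext V i (i + len) a c e g (n - (i + len - i + 1)) = ⊤ := by
      rw [← top_le_iff, hle]
      intro d a' g' a'' g'' had
      obtain ⟨hm, hv⟩ := hmem d a' g' a'' g'' had
      rw [← hv, hall _ hm]
    -- Block `0` would belong to `i = j = 0` and is never written, as table entries have `i < j`. It
    -- stays zero and serves as the empty graph.
    have hS : 0 ≠ addr n i (i + len) a c e g := by
      intro h0
      have : addr n 0 0 0 0 0 0 = addr n i (i + len) a c e g := by rw [← h0]; simp [addr]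
      have := (addr_inj (by omega) (by omega) (by omega) (by omega) (by omega) hi ha hc he hg this).2.1
      omega
    refine ⟨by rw [h31, htop]; rfl, 0, 0, ⊥, ⊥, h32, h33, hS, hS, hzero, hzero, fun h => (h htop).elim⟩
  · have had : Admissible V i (i + len) a c e g d a' g' a'' g'' := by
      by_contra hn
      rw [candVal, if_neg hn] at hval
      exact WithTop.top_ne_coe hval
    obtain ⟨⟨b₁, b₂, b₃, b₄, b₅, b₆⟩, b₇, b₈, b₉, b₁₀, b₁₁⟩ := had.bounds hi
    have hd₁ := had.lt_d
    have hd₂ := had.d_lt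
    have hex : ext V i (i + len) a c e g (n - (i + len - i + 1)) = (s'.ints 31 0 : WithTop ℤ) := by
      refine le_antisymm ?_ ((hle _).2 fun d a' g' a'' g'' had => ?_)
      · rw [← hval, (hmem _ _ _ _ _ had).2]
        exact (hle _).1 le_rfl _ _ _ _ _ had
      · obtain ⟨hm, hv⟩ := hmem d a' g' a'' g'' had
        rw [← hv]
        exact hall _ hm
    have hne := (hmem _ _ _ _ _ had).2.symm.trans hval
    rw [extVal, show n - (i + len - i + 1) + (i + len - d) = n - (d - i + 1) by omega,
      show n - (i + len - i + 1) + (d - i) = n - (i + len - d + 1) by omega] at hne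
    have hne' := WithTop.add_ne_top.1 (hne.trans_ne (WithTop.coe_ne_top))
    have hne'' := WithTop.add_ne_top.1 hne'.1
    have hlen' : ShorterOk V n (s.ints 3) (s.ints 4) (i + len - i) := by
      rwa [Nat.add_sub_cancel_left]
    obtain ⟨G₁, G₂, hG₁, hG₂, hT, hv, -⟩ := candVal_eq hlen' hi had
      ((hok i d a' (a + 1) (c - 1) g' hd₁ b₆ (by omega) b₄ b₂ b₃ b₅).nonneg_iff.2 hne''.1)
      ((hok d (i + len) a'' (e + 1) (g - 1) g'' hd₂ hi (by omega) b₁₀ b₈ b₉ b₁₁).nonneg_iff.2 hne''.2)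
    refine ⟨by rw [hex]; rfl, _, _, G₁, G₂, h32, h33, fun h => ?_, fun h => ?_, hG₁, hG₂, fun _ =>
      ⟨hT, by rw [hex, ← hval, hv]⟩⟩
    · have := (addr_inj b₆ b₄ b₂ b₃ b₅ hi ha hc he hg h).2.1
      omega
    · have := (addr_inj hi b₁₀ b₈ b₉ b₁₁ hi ha hc he hg h).1
      omega

theorem solve_spec (hB : (n : ℤ) ^ 8 ≤ B) (hn : 3 ≤ n) (hV : ∀ k, k + 1 < n → V k (k + 1))
    (hs : StateVals n len i a c e g s) (hlen : 1 ≤ len) (hi : i + len < n) (ha : a < n) (hc : c < n)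
    (he : e < n) (hg : g < n) (hvis : HoldsVis V n (s.ints 5)) (hzero : Block (s.ints 4) n 0 ⊥)
    (hok : ShorterOk V n (s.ints 3) (s.ints 4) len) :
    Spec B n solve s (Solved V n i (i + len) a c e g (s.ints 4)) := by
  have hnB : (n : ℤ) ≤ B := le_trans (by exact_mod_cast Nat.le_self_pow (by decide) n) hB
  refine Spec.seq (Spec.assign (x := -1) rfl (by simp; omega) (Spec.seq (Spec.assign (x := 0) rfl
    (by simp; omega) (Spec.seq (Spec.assign (x := 0) rfl (by simp; omega) ?_)))))
  set s₁ := ((s.setInt 31 0 (-1)).setInt 32 0 0).setInt 33 0 0 with hs₁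
  have hf : ∀ v, v ∉ [31, 32, 33] → s₁.ints v = s.ints v := by
    intro v hv
    simp only [List.mem_cons, List.not_mem_nil, or_false, not_or] at hv
    rw [hs₁, Memory.setInt_ints_ne _ _ _ hv.2.2, Memory.setInt_ints_ne _ _ _ hv.2.1,
      Memory.setInt_ints_ne _ _ _ hv.1]
  have h31 : s₁.ints 31 0 = -1 := by simp [hs₁, Memory.setInt_ints]
  have h32 : s₁.ints 32 0 = 0 := by simp [hs₁, Memory.setInt_ints]
  have h33 : s₁.ints 33 0 = 0 := by simp [hs₁, Memory.setInt_ints]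
  clear_value s₁
  have hst : StateVals n len i a c e g s₁ := hs.congr fun v hv => hf v (by revert v; decide)
  rw [← hf 4 (by decide)] at hzero hok ⊢
  rw [← hf 3 (by decide)] at hok
  rw [← hf 5 (by decide)] at hvis
  refine Spec.ite (fun hb => ?_) fun hb => ?_
  · obtain rfl : len = 1 := by
      simp only [BExp.holds_ieq, IExp.eval_var, IExp.eval, hst.len_eq] at hb
      omega
    -- A single edge has two vertices, so its tabulated value `1 + α` is `n - 1`.
    have hα : (n - (i + 1 - i + 1) : ℕ) = n - 2 := by omega
    refine Spec.assign (x := (n : ℤ) - 1) ?_ (by rw [abs_of_nonneg] <;> omega) ?_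
    · simp [coeffE, IExp.eval, IExp.eval_var, hst.size, hst.len_eq]
    have hS : 0 ≠ addr n i (i + 1) a c e g := by
      intro h0
      have : addr n 0 0 0 0 0 0 = addr n i (i + 1) a c e g := by rw [← h0]; simp [addr]
      have := (addr_inj (by omega) (by omega) (by omega) (by omega) (by omega) hi ha hc he hg this).2.1
      omega
    refine ⟨?_, 0, 0, ⊥, ⊥, ?_, ?_, hS, hS, hzero, hzero, fun _ => ?_⟩
    · rw [Memory.setInt_ints_same, ext_edge, hα, WithTop.untopD_coe]
      omega
    · rw [Memory.setInt_ints_ne _ _ _ (by decide), h32]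
      rfl
    · rw [Memory.setInt_ints_ne _ _ _ (by decide), h33]
      rfl
    · rw [bot_sup_eq, bot_sup_eq, ext_edge, triCost_edge]
      exact ⟨⟨.edge i, .inl rfl⟩, rfl⟩
  · have hlen' : 2 ≤ len := by
      simp only [BExp.holds_ieq, IExp.eval_var, IExp.eval, hst.len_eq] at hb
      omega
    exact (search_spec hB hn hst hi hvis hok h31 h32 h33).mono fun s' h' _ _ =>
      h'.solved hV hlen' hi ha hc he hg hzero hok

/-- Fills in the table entry for the values of the variables, with the matrix of an optimal
triangulation. -/
def fillEntry : SProg := .seq solve (.seq (.set 3 hereE (.var 31)) join)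

/-- A matrix is written even if the value is `⊤`; the entry then promises nothing about it. All
other entries and matrices are left intact. -/
theorem fillEntry_spec (hB : (n : ℤ) ^ 8 ≤ B) (hn : 3 ≤ n) (hV : ∀ k, k + 1 < n → V k (k + 1))
    (hs : StateVals n len i a c e g s) (hlen : 1 ≤ len) (hi : i + len < n) (ha : a < n) (hc : c < n)
    (he : e < n) (hg : g < n) (hvis : HoldsVis V n (s.ints 5)) (hzero : Block (s.ints 4) n 0 ⊥)
    (hok : ShorterOk V n (s.ints 3) (s.ints 4) len) :
    Spec B n fillEntry s fun s' => EntryOk V n (s'.ints 3) (s'.ints 4) i (i + len) a c e g ∧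
      (∀ β : ℕ, β ≠ addr n i (i + len) a c e g → s'.ints 3 β = s.ints 3 β) ∧
      ∀ β ≠ addr n i (i + len) a c e g, ∀ k < n, ∀ l < n,
        s'.ints 4 (((β * n + k) * n + l : ℕ) : ℤ) = s.ints 4 (((β * n + k) * n + l : ℕ) : ℤ) := by
  have hS := addr_lt (n := n) (i := i) (by omega) hi ha hc he hg
  refine Spec.seq ((solve_spec hB hn hV hs hlen hi ha hc he hg hvis hzero hok).mono ?_)
  rintro s₁ ⟨h31, β₁, β₂, G₁, G₂, h32, h33, hβ₁, hβ₂, hG₁, hG₂, hopt⟩ hf -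
  have hst : StateVals n len i a c e g s₁ := hs.congr fun v hv => hf v (by revert v; decide)
  have hhere := eval_hereE hst
  have hn1 : (1 : ℤ) ≤ (n : ℤ) ^ 8 := by
    have : 0 < n ^ 8 := Nat.pow_pos (by omega)
    exact_mod_cast this
  refine Spec.seq (Spec.set ?_ ?_ ?_)
  · rw [hhere, Nat.abs_cast]
    refine le_trans ?_ hB
    exact_mod_cast hS.le.trans (Nat.pow_le_pow_right (by omega) (by decide))
  · rw [IExp.eval_var, h31]
    refine le_trans ?_ hB
    by_cases ht : ext V i (i + len) a c e g (n - (i + len - i + 1)) = ⊤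
    · rw [ht]
      simpa using hn1
    · rw [(hopt ht).2, WithTop.untopD_coe]
      exact (hopt ht).1.1.abs_triCost_le hn hi (by omega)
  rw [hhere, IExp.eval_var]
  generalize hs₂ : s₁.setInt 3 (addr n i (i + len) a c e g : ℕ) (s₁.ints 31 0) = s₂
  have hf₂ : ∀ v, v ≠ 3 → s₂.ints v = s₁.ints v := by
    intro v hv
    rw [← hs₂, Memory.setInt_ints_ne _ _ _ hv]
  have hst₂ : StateVals n len i a c e g s₂ := hst.congr fun v hv => hf₂ v (by revert v; decide)
  have h4 : s₂.ints 4 = s.ints 4 := by rw [hf₂ 4 (by decide), hf 4 (by decide)]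
  refine (join_spec hB hst₂ hlen hS (by rw [hf₂ 32 (by decide), h32])
    (by rw [hf₂ 33 (by decide), h33]) hβ₁ hβ₂ (by rwa [h4]) (by rwa [h4])).mono ?_
  rintro s₃ ⟨hb, hb'⟩ hf₃ -
  have h3 : s₃.ints 3 = s₂.ints 3 := hf₃ 3 (by decide)
  refine ⟨⟨?_, fun ht => ⟨_, (hopt ht).1, (hopt ht).2, hb⟩⟩, fun β hβ => ?_, fun β hβ k hk l hl => ?_⟩
  · rw [h3, ← hs₂, Memory.setInt_ints_same, h31]
  · rw [h3, ← hs₂, Memory.setInt_ints, if_neg, hf 3 (by decide)]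
    rintro ⟨-, hc⟩
    exact hβ (by exact_mod_cast hc)
  · rw [hb' β hβ k hk l hl, h4]

end Entries

/-! ### The whole program -/

section Table

variable {V : ℕ → ℕ → Prop} {n len : ℕ} {s : Memory} {B : ℤ}

/-- The loops run through all numbers below `n`; the guard discards length 0 and subpolygons that
would extend beyond the last vertex. -/
def fillGuarded : SProg :=
  .ite (.and (.ile (.const 1) (.var 20)) (.ilt endE (.var 0))) fillEntry .skip

/-- The memory while the entries for the subpolygons with `len + 1` vertices are filled in, after
those in `X`. -/
structure TableInv (V : ℕ → ℕ → Prop) (n len : ℕ) (X : Set (ℕ × ℕ × ℕ × ℕ × ℕ)) (s : Memory) :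
    Prop where
  len_eq : s.ints 20 0 = len
  vis : HoldsVis V n (s.ints 5)
  zero : Block (s.ints 4) n 0 ⊥
  shorter : ShorterOk V n (s.ints 3) (s.ints 4) len
  entry : ∀ i a c e g, (i, a, c, e, g) ∈ X → 1 ≤ len → i + len < n → a < n → c < n → e < n → g < n →
    EntryOk V n (s.ints 3) (s.ints 4) i (i + len) a c e g

theorem fillGuarded_adds (hB : (n : ℤ) ^ 8 ≤ B) (hn : 3 ≤ n) (hV : ∀ k, k + 1 < n → V k (k + 1)) :
    Adds B n [25, 24, 23, 22, 21] fillGuarded (TableInv V n len)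
      fun ρ => {(ρ 21, ρ 22, ρ 23, ρ 24, ρ 25)} := by
  intro ρ X s hρ hX
  obtain ⟨h21, -⟩ := hρ.2 21 (by decide)
  obtain ⟨h22, ha⟩ := hρ.2 22 (by decide)
  obtain ⟨h23, hc⟩ := hρ.2 23 (by decide)
  obtain ⟨h24, he⟩ := hρ.2 24 (by decide)
  obtain ⟨h25, hg⟩ := hρ.2 25 (by decide)
  change Spec B n fillGuarded s (TableInv V n len (X ∪ {(ρ 21, ρ 22, ρ 23, ρ 24, ρ 25)}))
  generalize ρ 21 = i at *
  generalize ρ 22 = a at *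
  generalize ρ 23 = c at *
  generalize ρ 24 = e at *
  generalize ρ 25 = g at *
  have hs : StateVals n len i a c e g s := ⟨hρ.1, hX.len_eq, h21, h22, h23, h24, h25⟩
  have hb' : (BExp.and (.ile (.const 1) (.var 20)) (.ilt endE (.var 0))).Holds s ↔
      1 ≤ len ∧ i + len < n := by
    simp only [BExp.Holds, BExp.holds_ile, endE, IExp.eval, IExp.eval_var, hs.size, hs.len_eq, hs.i_eq]
    omega
  refine Spec.ite (fun hb => ?_) fun hb => Spec.skip ?_
  · obtain ⟨hlen, hi⟩ := hb'.1 hb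
    refine (fillEntry_spec hB hn hV hs hlen hi ha hc he hg hX.vis hX.zero hX.shorter).mono ?_
    rintro s' ⟨hE, h3, h4⟩ hf -
    have hkeep : ∀ i' j' a' c' e' g', EntryOk V n (s.ints 3) (s.ints 4) i' j' a' c' e' g' →
        addr n i' j' a' c' e' g' ≠ addr n i (i + len) a c e g →
        EntryOk V n (s'.ints 3) (s'.ints 4) i' j' a' c' e' g' :=
      fun i' j' a' c' e' g' h hne => h.congr (h3 _ hne) (h4 _ hne)
    refine ⟨by rw [hf 20 (by decide), hX.len_eq], by rw [hf 5 (by decide)]; exact hX.vis,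
      hX.zero.congr (h4 0 fun h0 => ?_), ?_, ?_⟩
    · have : addr n 0 0 0 0 0 0 = addr n i (i + len) a c e g := by rw [← h0]; simp [addr]
      have := (addr_inj (by omega) (by omega) (by omega) (by omega) (by omega) hi ha hc he hg this).2.1
      omega
    · intro i' j' a' c' e' g' h₁ h₂ h₃ ha' hc' he' hg'
      refine hkeep _ _ _ _ _ _ (hX.shorter i' j' a' c' e' g' h₁ h₂ h₃ ha' hc' he' hg') fun h => ?_
      obtain ⟨rfl, rfl, -⟩ := addr_inj h₂ ha' hc' he' hg' hi ha hc he hg h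
      omega
    · intro i' a' c' e' g' hm h₁ h₂ ha' hc' he' hg'
      by_cases hq : addr n i' (i' + len) a' c' e' g' = addr n i (i + len) a c e g
      · obtain ⟨rfl, -, rfl, rfl, rfl, rfl⟩ := addr_inj h₂ ha' hc' he' hg' hi ha hc he hg hq
        exact hE
      · rcases hm with hm | hm
        · exact hkeep _ _ _ _ _ _ (hX.entry i' a' c' e' g' hm h₁ h₂ ha' hc' he' hg') hq
        · simp only [Set.mem_singleton_iff, Prod.mk.injEq] at hm
          obtain ⟨rfl, rfl, rfl, rfl, rfl⟩ := hm
          exact (hq rfl).elim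
  · refine { hX with entry := ?_ }
    rintro i' a' c' e' g' (hm | hm) h₁ h₂ ha' hc' he' hg'
    · exact hX.entry i' a' c' e' g' hm h₁ h₂ ha' hc' he' hg'
    · simp only [Set.mem_singleton_iff, Prod.mk.injEq] at hm
      obtain ⟨rfl, rfl, rfl, rfl, rfl⟩ := hm
      exact (hb (hb'.2 ⟨h₁, h₂⟩)).elim

/-- The length is the outermost variable, so that all shorter subpolygons are complete when an entry
is computed. -/
def fillTable : SProg :=
  .forN 20 (.forN 21 (.forN 22 (.forN 23 (.forN 24 (.forN 25 fillGuarded)))))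

theorem fillTable_spec (hB : (n : ℤ) ^ 8 ≤ B) (hn : 3 ≤ n) (hV : ∀ k, k + 1 < n → V k (k + 1))
    (hs : s.ints 0 0 = n) (hvis : HoldsVis V n (s.ints 5)) (hzero : Block (s.ints 4) n 0 ⊥) :
    Spec B n fillTable s fun s' => ShorterOk V n (s'.ints 3) (s'.ints 4) n := by
  have hnB : (n : ℤ) ≤ B := le_trans (by exact_mod_cast Nat.le_self_pow (by decide) n) hB
  have hA : ∀ v, v ∉ [3, 4, 5, 20] → ∀ len X s' x,
      TableInv V n len X s' → TableInv V n len X (s'.setInt v 0 x) := by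
    intro v hv len X s' x hX
    simp only [List.mem_cons, List.not_mem_nil, or_false, not_or] at hv
    have e₃ := s'.setInt_ints_ne 0 x (Ne.symm hv.1)
    have e₄ := s'.setInt_ints_ne 0 x (Ne.symm hv.2.1)
    have e₅ := s'.setInt_ints_ne 0 x (Ne.symm hv.2.2.1)
    have e₂₀ := s'.setInt_ints_ne 0 x (Ne.symm hv.2.2.2)
    exact ⟨by rw [e₂₀, hX.len_eq], by rw [e₅]; exact hX.vis, by rw [e₄]; exact hX.zero,
      by rw [e₃, e₄]; exact hX.shorter, by rw [e₃, e₄]; exact hX.entry⟩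
  have := Spec.forN (B := B) (v := 20)
    (P := .forN 21 (.forN 22 (.forN 23 (.forN 24 (.forN 25 fillGuarded))))) hs hnB (by decide)
    (by decide) (fun len s' => HoldsVis V n (s'.ints 5) ∧ Block (s'.ints 4) n 0 ⊥ ∧
      ShorterOk V n (s'.ints 3) (s'.ints 4) len)
    (fun len s' x h => by
      rw [Memory.setInt_ints_ne _ _ _ (by decide), Memory.setInt_ints_ne _ _ _ (by decide),
        Memory.setInt_ints_ne _ _ _ (by decide)]
      exact h)
    ⟨hvis, hzero, fun _ _ _ _ _ _ _ _ h => by omega⟩ ?_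
  · exact this.mono fun s' h _ _ => h.2.2
  · rintro len hlen s' ⟨h₁, h₂, h₃⟩ h20 hf -
    have h := ((((((fillGuarded_adds (len := len) hB hn hV).forN hnB (by decide) (by decide)
      (hA 25 (by decide) len)).forN hnB (by decide) (by decide) (hA 24 (by decide) len)).forN hnB
      (by decide) (by decide) (hA 23 (by decide) len)).forN hnB (by decide) (by decide)
      (hA 22 (by decide) len)).forN hnB (by decide) (by decide) (hA 21 (by decide) len)) (fun _ => 0) ∅
      s' ⟨by rw [hf 0 (by decide), hs], by simp⟩ ⟨h20, h₁, h₂, h₃, by simp⟩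
    refine h.mono fun s'' h'' _ _ => ⟨h''.vis, h''.zero, ?_⟩
    intro i j a c e g hij hj hl ha hc he hg
    by_cases hl' : j - i < len
    · exact h''.shorter i j a c e g hij hj hl' ha hc he hg
    · obtain rfl : j = i + len := by omega
      refine h''.entry i a c e g (.inr ⟨i, by omega, a, ha, c, hc, e, he, g, hg, ?_⟩) (by omega) hj ha hc
        he hg
      simp

def rootE : IExp :=
  addrE (.const 0) (.sub (.var 0) (.const 1)) (.var 22) (.var 23) (.var 24) (.var 25)

def pickStep : SProg :=
  .ite (.ile (.const 0) (.get 3 rootE)) (improve (.get 3 rootE) rootE (.const 0)) .skip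

/-- The value of EXT on the whole polygon, for given special vertices. -/
noncomputable def rootVal (V : ℕ → ℕ → Prop) (n : ℕ) (t : ℕ × ℕ × ℕ × ℕ) : WithTop ℤ :=
  ext V 0 (n - 1) t.1 t.2.1 t.2.2.1 t.2.2.2 0

def rootAddr (n : ℕ) (t : ℕ × ℕ × ℕ × ℕ) : ℕ := addr n 0 (n - 1) t.1 t.2.1 t.2.2.1 t.2.2.2

/-- The memory during the search for the best special vertices, after the choices in `X`. -/
def PickInv (V : ℕ → ℕ → Prop) (n : ℕ) (s₀ : Memory) (X : Set (ℕ × ℕ × ℕ × ℕ)) (s : Memory) : Prop :=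
  s.ints 3 = s₀.ints 3 ∧ BestInv (rootVal V n) (fun t => rootAddr n t) (fun _ => 0) X
    (s.ints 31 0) (s.ints 32 0) (s.ints 33 0)

theorem pickStep_adds {s₀ : Memory} (hB : (n : ℤ) ^ 8 ≤ B) (hn : 3 ≤ n)
    (hok : ShorterOk V n (s₀.ints 3) (s₀.ints 4) n) :
    Adds B n [25, 24, 23, 22] pickStep (PickInv V n s₀) fun ρ => {(ρ 22, ρ 23, ρ 24, ρ 25)} := by
  intro ρ X s hρ hX
  obtain ⟨h22, ha⟩ := hρ.2 22 (by decide)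
  obtain ⟨h23, hc⟩ := hρ.2 23 (by decide)
  obtain ⟨h24, he⟩ := hρ.2 24 (by decide)
  obtain ⟨h25, hg⟩ := hρ.2 25 (by decide)
  change Spec B n pickStep s (PickInv V n s₀ (X ∪ {(ρ 22, ρ 23, ρ 24, ρ 25)}))
  generalize ρ 22 = a at *
  generalize ρ 23 = c at *
  generalize ρ 24 = e at *
  generalize ρ 25 = g at *
  obtain ⟨h3, hbest⟩ := hX
  have heval : ∀ s' : Memory, (∀ v, v ∉ [31, 32, 33] → s'.ints v = s.ints v) →
      rootE.eval s' = (rootAddr n (a, c, e, g) : ℕ) := by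
    intro s' hs'
    have h0 : s'.ints 0 0 = n := by rw [hs' 0 (by decide), hρ.1]
    refine eval_addrE h0 rfl ?_ ?_ ?_ ?_ ?_
    · simp only [IExp.eval, IExp.eval_var, h0]
      omega
    · rw [IExp.eval_var, hs' 22 (by decide), h22]
    · rw [IExp.eval_var, hs' 23 (by decide), h23]
    · rw [IExp.eval_var, hs' 24 (by decide), h24]
    · rw [IExp.eval_var, hs' 25 (by decide), h25]
  have hE := hok 0 (n - 1) a c e g (by omega) (by omega) (by omega) ha hc he hg
  -- For the whole polygon the tabulated coefficient is 0, so the entry is the plain total distance.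
  have hα : n - (n - 1 - 0 + 1) = 0 := by omega
  have hnn := hE.nonneg_iff
  rw [EntryOk, hα] at hE
  rw [hα] at hnn
  have hmain : Spec B n pickStep s fun s' => BestInv (rootVal V n) (fun t => rootAddr n t) (fun _ => 0)
      (X ∪ {(a, c, e, g)}) (s'.ints 31 0) (s'.ints 32 0) (s'.ints 33 0) := by
    refine Spec.ite (fun hb => ?_) fun hb => Spec.skip ?_
    · simp only [BExp.holds_ile, IExp.eval, heval s fun _ _ => rfl, h3] at hb
      obtain ⟨G, hG, hGe, -⟩ := hE.2 (hnn.1 hb)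
      have hx : s₀.ints 3 (rootAddr n (a, c, e, g) : ℕ) = triCost G 0 (n - 1) 0 := by
        rw [rootAddr, hE.1, hGe]
        rfl
      refine improve_spec (x := triCost G 0 (n - 1) 0) (fun s' hs' => ⟨?_, heval s' hs', rfl⟩) hGe
        (triCost_nonneg _ _ _ _)
        ((le_abs_self _).trans ((hG.1.abs_triCost_le hn (by omega) (by omega)).trans hB)) ?_ ?_ hbest
      · simp only [IExp.eval, heval s' hs', hs' 3 (by decide), h3, hx]
      · rw [Nat.abs_cast]
        refine le_trans ?_ hB
        exact_mod_cast (addr_lt (by omega) (by omega) ha hc he hg).le.trans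
          (Nat.pow_le_pow_right (by omega) (by decide))
      · rw [abs_zero]
        exact le_trans (by positivity) hB
    · simp only [BExp.holds_ile, IExp.eval, heval s fun _ _ => rfl, h3] at hb
      refine hbest.add_of_top ?_
      by_contra ht
      exact hb (hnn.2 ht)
  refine hmain.mono fun s' h' hfr _ => ⟨?_, h'⟩
  rw [hfr 3 (by decide), h3]

def pick : SProg :=
  .seq (.assign 31 (.const (-1))) (.seq (.assign 32 (.const 0)) (.seq (.assign 33 (.const 0))
    (.forN 22 (.forN 23 (.forN 24 (.forN 25 pickStep))))))

theorem pick_spec (hB : (n : ℤ) ^ 8 ≤ B) (hn : 3 ≤ n) (hs : s.ints 0 0 = n)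
    (hok : ShorterOk V n (s.ints 3) (s.ints 4) n) :
    Spec B n pick s fun s' => BestInv (rootVal V n) (fun t => rootAddr n t) (fun _ => 0)
      {t | t.1 < n ∧ t.2.1 < n ∧ t.2.2.1 < n ∧ t.2.2.2 < n}
      (s'.ints 31 0) (s'.ints 32 0) (s'.ints 33 0) := by
  have hnB : (n : ℤ) ≤ B := le_trans (by exact_mod_cast Nat.le_self_pow (by decide) n) hB
  refine Spec.seq (Spec.assign (x := -1) rfl (by simp; omega) (Spec.seq (Spec.assign (x := 0) rfl
    (by simp; omega) (Spec.seq (Spec.assign (x := 0) rfl (by simp; omega) ?_)))))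
  generalize hs₁ : ((s.setInt 31 0 (-1)).setInt 32 0 0).setInt 33 0 0 = s₁
  have hA : ∀ v, v ∉ [3, 31, 32, 33] → ∀ X s' x, PickInv V n s₁ X s' →
      PickInv V n s₁ X (s'.setInt v 0 x) := by
    intro v hv X s' x hX
    simp only [List.mem_cons, List.not_mem_nil, or_false, not_or] at hv
    rw [PickInv, Memory.setInt_ints_ne _ _ _ (Ne.symm hv.1),
      Memory.setInt_ints_ne _ _ _ (Ne.symm hv.2.1), Memory.setInt_ints_ne _ _ _ (Ne.symm hv.2.2.1),
      Memory.setInt_ints_ne _ _ _ (Ne.symm hv.2.2.2)]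
    exact hX
  have h := ((((pickStep_adds (V := V) (s₀ := s₁) hB hn (by
      rw [← hs₁]
      exact hok)).forN hnB (by decide) (by decide) (hA 25 (by decide))).forN
    hnB (by decide) (by decide) (hA 24 (by decide))).forN hnB (by decide) (by decide)
    (hA 23 (by decide))).forN hnB (by decide) (by decide) (hA 22 (by decide)) (fun _ => 0) ∅ s₁
    ⟨by rw [← hs₁]; exact hs, by simp⟩
    ⟨rfl, .inl ⟨by simp [← hs₁, Memory.setInt_ints], by simp [← hs₁, Memory.setInt_ints],
      by simp [← hs₁, Memory.setInt_ints], by simp⟩⟩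
  refine h.mono fun s' hs' _ _ => ?_
  convert hs'.2 using 1
  ext ⟨a, c, e, g⟩
  simp only [Set.mem_ofPred_eq, Set.empty_union, Set.mem_singleton_iff, Prod.mk.injEq,
    Function.update_apply]
  constructor
  · rintro ⟨h₁, h₂, h₃, h₄⟩
    exact ⟨a, h₁, c, h₂, e, h₃, g, h₄, by simp⟩
  · rintro ⟨d', h₁, a₁, h₂, g₁, h₃, a₂, h₄, h⟩
    simp at h
    omega

/-- Writes the adjacency matrix with number in variable `32` and the value in variable `31` to the
output arrays. -/
def output : SProg :=
  .seq (.assign 2 (.var 31)) (.forN 34 (.forN 35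
    (.set 1 (.add (.mul (.var 34) (.var 0)) (.var 35)) (.get 4 (cellE (.var 32))))))

open Classical in
theorem output_spec {β : ℕ} {G : SimpleGraph ℕ} (hB : (n : ℤ) ^ 8 ≤ B) (hn : 3 ≤ n)
    (hs : s.ints 0 0 = n) (h31 : |s.ints 31 0| ≤ B) (h32 : s.ints 32 0 = β)
    (hG : Block (s.ints 4) n β G) :
    Spec B n output s fun s' => s'.ints 2 0 = s.ints 31 0 ∧
      ∀ k < n, ∀ l < n, s'.ints 1 ((k * n + l : ℕ) : ℤ) = if G.Adj k l then 1 else 0 := by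
  have hnB : (n : ℤ) ≤ B := le_trans (by exact_mod_cast Nat.le_self_pow (by decide) n) hB
  refine Spec.seq (Spec.assign rfl h31 ?_)
  rw [IExp.eval_var]
  generalize hs₁ : s.setInt 2 0 (s.ints 31 0) = s₁
  let A : Set (ℕ × ℕ) → Memory → Prop := fun X s' =>
    s'.ints 2 0 = s.ints 31 0 ∧ s'.ints 32 = s.ints 32 ∧ s'.ints 4 = s.ints 4 ∧
      ∀ k < n, ∀ l < n, (k, l) ∈ X → s'.ints 1 ((k * n + l : ℕ) : ℤ) = if G.Adj k l then 1 else 0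
  have hA : ∀ v, v ∉ [1, 2, 4, 32] → ∀ X s' x, A X s' → A X (s'.setInt v 0 x) := by
    intro v hv X s' x hX
    simp only [List.mem_cons, List.not_mem_nil, or_false, not_or] at hv
    simp only [A]
    rw [Memory.setInt_ints_ne _ _ _ (Ne.symm hv.1), Memory.setInt_ints_ne _ _ _ (Ne.symm hv.2.1),
      Memory.setInt_ints_ne _ _ _ (Ne.symm hv.2.2.1), Memory.setInt_ints_ne _ _ _ (Ne.symm hv.2.2.2)]
    exact hX
  have hstep : Adds B n [35, 34]
      (.set 1 (.add (.mul (.var 34) (.var 0)) (.var 35)) (.get 4 (cellE (.var 32)))) A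
      fun ρ => {(ρ 34, ρ 35)} := by
    intro ρ X s' hρ hX
    obtain ⟨h34, hk⟩ := hρ.2 34 (by decide)
    obtain ⟨h35, hl⟩ := hρ.2 35 (by decide)
    obtain ⟨h2, h32', h4, hX⟩ := hX
    have he := eval_cellE (b := .var 32) (β := β) hρ.1 (by rw [IExp.eval_var, h32', h32]) h34 h35
    have hi : (IExp.add (.mul (.var 34) (.var 0)) (.var 35)).eval s' = ((ρ 34 * n + ρ 35 : ℕ) : ℤ) := by
      simp [IExp.eval, IExp.eval_var, h34, h35, hρ.1]
    have hval : (IExp.get 4 (cellE (.var 32))).eval s' = if G.Adj (ρ 34) (ρ 35) then 1 else 0 := by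
      rw [IExp.eval, he, h4, hG _ hk _ hl]
    refine Spec.set ?_ ?_ ?_
    · rw [hi, Nat.abs_cast]
      refine le_trans ?_ hB
      exact_mod_cast (mul_add_lt_pow (m := 1) (by simpa using hk) hl).le.trans
        (Nat.pow_le_pow_right (by omega) (by decide))
    · rw [hval]
      split_ifs <;> simp <;> omega
    · rw [hi, hval]
      refine ⟨by rwa [Memory.setInt_ints_ne _ _ _ (by decide)],
        by rwa [Memory.setInt_ints_ne _ _ _ (by decide)],
        by rwa [Memory.setInt_ints_ne _ _ _ (by decide)], fun k hk' l hl' hm => ?_⟩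
      rw [Memory.setInt_ints]
      by_cases hc : 1 = 1 ∧ ((k * n + l : ℕ) : ℤ) = ((ρ 34 * n + ρ 35 : ℕ) : ℤ)
      · rw [if_pos hc]
        obtain ⟨rfl, rfl⟩ := mul_add_inj hl' hl (by exact_mod_cast hc.2)
        rfl
      · rw [if_neg hc]
        rcases hm with hm | hm
        · exact hX k hk' l hl' hm
        · obtain ⟨rfl, rfl⟩ := Prod.mk.inj hm
          exact (hc ⟨rfl, rfl⟩).elim
  have h := (hstep.forN hnB (by decide) (by decide) (hA 35 (by decide))).forN hnB (by decide)
    (by decide) (hA 34 (by decide)) (fun _ => 0) ∅ s₁ ⟨by rw [← hs₁]; exact hs, by simp⟩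
    (by
      rw [← hs₁]
      exact ⟨Memory.setInt_ints_same _ _ _ _, Memory.setInt_ints_ne _ _ _ (by decide),
        Memory.setInt_ints_ne _ _ _ (by decide), by simp⟩)
  refine h.mono fun s' hs' _ _ => ⟨hs'.1, fun k hk l hl => hs'.2.2.2 k hk l hl
    (.inr ⟨k, hk, l, hl, ?_⟩)⟩
  simp

end Table

section Main

variable {n : ℕ} [NeZero n] {p : Fin n → ℝ × ℝ} {B : ℤ}

/-- The dynamic program. -/
def mainProg : SProg := .seq visProg (.seq fillTable (.seq pick output))

/-- The deepest nesting consists of the six loops of `fillTable` around the five of `search`. -/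
theorem mainProg_depth : mainProg.depth ≤ 11 := by decide

theorem mainProg_spec (h : IsSimplePolygon p) (hB : (n : ℤ) ^ 8 ≤ B) :
    Spec B n mainProg (inputMemory p) fun s => HoldsExtTable s p ∧
      ∃ T : SimpleGraph (Fin n), IsTriangulation p T ∧ HoldsGraph s T ∧
        s.ints 2 0 = totalDist T ∧ ((totalDist T : ℤ) : WithTop ℤ) = extMin p 0 := by
  have hn := h.three_le
  have hsize : (inputMemory p).ints 0 0 = n := by simp [inputMemory]
  have hB2 : (n : ℤ) ^ 2 ≤ B := le_trans (pow_le_pow_right₀ (by omega) (by decide)) hB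
  refine Spec.seq ((visProg_spec h hB2 hsize rfl).mono fun s₁ h₁ hf₁ _ => ?_)
  have hsize₁ : s₁.ints 0 0 = n := by rw [hf₁ 0 (by decide), hsize]
  have hzero : Block (s₁.ints 4) n 0 ⊥ := by
    rw [hf₁ 4 (by decide)]
    intro k _ l _
    simp [inputMemory]
  refine Spec.seq ((fillTable_spec hB hn (fun k hk => sees_succ hk) hsize₁
    (fun k l hkl hl => h₁.2 k l ⟨hkl.trans hl, hl⟩ hkl hl) hzero).mono fun s₂ hok hf₂ _ => ?_)
  have hsize₂ : s₂.ints 0 0 = n := by rw [hf₂ 0 (by decide), hsize₁]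
  refine Spec.seq ((pick_spec hB hn hsize₂ hok).mono fun s₃ hbest hf₃ _ => ?_)
  have hsize₃ : s₃.ints 0 0 = n := by rw [hf₃ 0 (by decide), hsize₂]
  obtain ⟨T₀, -, hT₀⟩ := (isLeast_extMin h 0).1
  -- The search cannot come out empty, since a triangulation exists and hence the minimum is finite.
  rcases hbest with ⟨-, -, -, htop⟩ | ⟨h0, hle, ⟨a, c, e, g⟩, ⟨ha, hc, he, hg⟩, hval, h32, -⟩
  · have : extMin p 0 = ⊤ := by
      rw [extMin, Finset.inf_eq_top_iff]
      exact fun q _ => htop (q.1, q.2.1, q.2.2.1, q.2.2.2)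
        ⟨q.1.2, q.2.1.2, q.2.2.1.2, q.2.2.2.2⟩
    rw [this] at hT₀
    exact (WithTop.top_ne_coe hT₀).elim
  · have hmin : extMin p 0 = (s₃.ints 31 0 : WithTop ℤ) := by
      refine le_antisymm ?_ (Finset.le_inf fun q _ => ?_)
      · rw [← hval]
        exact Finset.inf_le (f := fun q : Fin n × Fin n × Fin n × Fin n =>
          ext (Sees p) 0 (n - 1) q.1 q.2.1 q.2.2.1 q.2.2.2 0)
          (Finset.mem_univ (⟨a, ha⟩, ⟨c, hc⟩, ⟨e, he⟩, ⟨g, hg⟩))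
      · exact hle (q.1, q.2.1, q.2.2.1, q.2.2.2) ⟨q.1.2, q.2.1.2, q.2.2.1.2, q.2.2.2.2⟩
    have hE := (hok 0 (n - 1) a c e g (by omega) (by omega) (by omega) ha hc he hg).2
    rw [show n - (n - 1 - 0 + 1) = 0 by omega] at hE
    obtain ⟨G, hG, hGe, hGb⟩ := hE (by
      change rootVal (Sees p) n (a, c, e, g) ≠ ⊤
      rw [hval]
      exact WithTop.coe_ne_top)
    have h31 : s₃.ints 31 0 = triCost G 0 (n - 1) 0 :=
      WithTop.coe_injective (hval.symm.trans hGe)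
    refine (output_spec hB hn hsize₃ ?_ h32 (by rwa [hf₃ 4 (by decide)])).mono
      fun s₄ h₄ hf₄ _ => ⟨?_, G.comap Fin.val, hG.1.isTriangulation h, ?_, ?_, ?_⟩
    · rw [h31]
      exact (hG.1.abs_triCost_le hn (by omega) (by omega)).trans hB
    · intro i j a c e g hij
      rw [hf₄ 3 (by decide), hf₃ 3 (by decide)]
      have := (hok i j a c e g hij j.2 (by omega) a.2 c.2 e.2 g.2).1
      rw [← this, addr]
      push_cast
      rfl
    · intro k l
      have := h₄.2 k k.2 l l.2
      push_cast at this
      exact this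
    · rw [h₄.1, h31, ← hG.1.extCost_comap, extCost, zero_mul, add_zero]
    · rw [hmin, h31, ← hG.1.extCost_comap, extCost, zero_mul, add_zero]

end Main

theorem theorem2 :
    -- correctness of the procedure
    (∀ (n : ℕ) [NeZero n] (p : Fin n → ℝ × ℝ), IsSimplePolygon p → ∀ α : ℕ,
      (∀ a c e g : Fin n,
        IsGLB {w : WithTop ℤ | ∃ T : SimpleGraph (Fin n), IsTriangulation p T ∧
            HasSpecialVertices T a c e g ∧ w = ((extCost T α : ℤ) : WithTop ℤ)}
          (ext (Sees p) 0 (n - 1) a c e g α)) ∧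
      IsLeast {w : WithTop ℤ | ∃ T : SimpleGraph (Fin n), IsTriangulation p T ∧
          w = ((extCost T α : ℤ) : WithTop ℤ)}
        (extMin p α)) ∧
    -- its running time, including the output of an optimal triangulation
    ∃ (P : Prog) (C : ℕ), ∀ (n : ℕ) [NeZero n] (p : Fin n → ℝ × ℝ), IsSimplePolygon p →
      ∃ (t : ℕ) (s : Memory), Runs ((n : ℤ) ^ C) P (inputMemory p) t s ∧ t ≤ C * n ^ 11 ∧
        HoldsExtTable s p ∧
        ∃ T : SimpleGraph (Fin n), IsTriangulation p T ∧
          (∀ T' : SimpleGraph (Fin n), IsTriangulation p T' → totalDist T ≤ totalDist T') ∧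
          HoldsGraph s T ∧
          s.ints 2 0 = totalDist T ∧ ((totalDist T : ℤ) : WithTop ℤ) = extMin p 0 := by
  refine ⟨fun n _ p h α => ⟨isGLB_ext h α, isLeast_extMin h α⟩, mainProg.compile,
    -- One constant serves both as the factor of `n ^ 11`, for which `coeff` suffices, and as the
    -- exponent of the word bound, for which 8 suffices.
    mainProg.coeff + 8, fun n _ p h => ?_⟩
  have hn := h.three_le
  obtain ⟨t, s, hrun, ht, ⟨htable, T, hT, hgraph, hcost, hmin⟩, -⟩ :=
    mainProg_spec (B := (n : ℤ) ^ (mainProg.coeff + 8)) h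
      (pow_le_pow_right₀ (by omega) (Nat.le_add_left _ _))
  refine ⟨t, s, hrun, ?_, htable, T, hT, fun T' hT' => ?_, hgraph, hcost, hmin⟩
  · exact ht.trans ((mainProg.time_le (by omega) mainProg_depth).trans
      (Nat.mul_le_mul_right _ (Nat.le_add_right _ _)))
  · have h' := extMin_le_extCost h hT' 0
    rw [← hmin, extCost, zero_mul, add_zero, WithTop.coe_le_coe] at h'
    exact_mod_cast h'
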